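/- Let $m\ge \ell\ge 3$ be integers, $\alpha=\ell/m$, and let $h_2$ be the binary entropy function (in bits). Let $\mathbb A(\ell,m)$ be the ensemble of binary codes of length $n$ given by equiprobable binary $r\times n$ parity-check matrices $H$, $r=\ell n/m$, with all column weights $\ell$ and all row weights $m$. Let $\mathbb B(\ell,m)$ be Gallager's ensemble of length $n=ms$: $H$ consists of $\ell$ horizontal $s\times n$ blocks, and each block is obtained from the row $(I_s|\cdots|I_s)$ of $m$ unit matrices by an independent uniformly random permutation of its $n$ columns. For $0<\beta<1$ (and $\beta<1-1/m$ if $m$ is odd) let $t>0$ be the unique positive root of $$\frac{(1+t)^{m-1}+(1-t)^{m-1}}{(1+t)^m+(1-t)^m}=1-\beta ,$$ and let $$q(\alpha,\beta)=\alpha\log_2\frac{(1+t)^m+(1-t)^m}{2t^{\beta m}}-\alpha m\,h_2(\beta),$$ with $q(\alpha,\beta)=-\infty$ if $m$ is odd and $\beta\ge 1-1/m$. Let $\delta_*\in(0,1)$ be the least positive root of $h_2(\delta)+q(\alpha,\delta)=0$, and let $\theta_*\in(0,1]$ be the root of $f(\theta)=0$, $f(\theta)=\max_{0<\beta<1}\{q(\alpha,\beta\theta)+\theta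 h_2(\beta)\}$, that is, the unique $\theta\in(0,1]$ for which this maximum is attained in $(0,1)$ and equals $0$. Both $\delta_*$ and $\theta_*$ exist and are unique. Then, for most codes in the ensembles $\mathbb A(\ell,m)$ and $\mathbb B(\ell,m)$, distance verification up to the ensemble's relative distance $\delta_*$ can be performed with complexity exponent $$F=\min\{(1-\theta_*)h_2(\delta_*),\ h_2(\delta_*)/2\}.$$ Precisely, there is a deterministic algorithm (a random access machine program with logarithmic cost) that, for every binary matrix $H$ with $n$ columns and every integer $w\ge0$, finds a nonzero codeword of minimum weight of the code $C=\{c: Hc=0\}$ if its minimum distance $d(C)$ is at most $w$, and otherwise reports that there is no nonzero codeword of weight at most $w$. For each $\varepsilon>0$ there is $\eta>0$ such that, for all matrices $H$ of either ensemble except for a fraction that tends to $0$ as $n\to\infty$, it takes time at most $2^{(F+\varepsilon)n}$ for all $w\le n$ such that $w\le(\delta_*+\eta)n$ or $d(C)\le(\delta_*+\eta)n$. -/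

import Mathlib

open Matrix

namespace LDPC

noncomputable section

/-! ### Entropy, the spectrum exponent, and the two parameters -/

/-- Binary entropy in bits. -/
def h2 (x : ℝ) : ℝ := Real.binEntropy x / Real.log 2

/-- The unique positive solution `t` of
`((1+t)^(m-1) + (1-t)^(m-1)) / ((1+t)^m + (1-t)^m) = 1 - β`
(it exists for `0 < β < 1` if `m` is even, and for `0 < β < 1 - 1/m` if `m` is odd). -/
def tRoot (m : ℕ) (β : ℝ) : ℝ :=
  sInf {t : ℝ | 0 < t ∧
    ((1 + t) ^ (m - 1) + (1 - t) ^ (m - 1)) / ((1 + t) ^ m + (1 - t) ^ m) = 1 - β}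

open scoped Classical in
/-- The exponent `q(α, β)`, `α = ℓ / m`, of the probability that a given word of weight `β n`
belongs to a random code; it is `-∞` if `m` is odd and `β ≥ 1 - 1/m`. -/
def qExp (ℓ m : ℕ) (β : ℝ) : EReal :=
  if Odd m ∧ 1 - 1 / (m : ℝ) ≤ β then ⊥
  else (((ℓ / m : ℝ) *
      Real.logb 2 (((1 + tRoot m β) ^ m + (1 - tRoot m β) ^ m) / (2 * tRoot m β ^ (β * m)))
        - (ℓ / m : ℝ) * m * h2 β : ℝ) : EReal)

/-- `δ` is the relative distance `δ_*` of the ensembles: the least positive root of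
`h₂(δ) + q(α, δ) = 0`. -/
def IsRelativeDistance (ℓ m : ℕ) (δ : ℝ) : Prop :=
  IsLeast {x : ℝ | 0 < x ∧ x < 1 ∧ (h2 x : EReal) + qExp ℓ m x = 0} δ

/-- `θ ∈ (0, 1]` is the root `θ_*` of `f(θ) = 0`, where
`f(θ) = max_{0 < β < 1} {q(α, βθ) + θ h₂(β)}`. The maximum has to be attained in `(0, 1)`: as
`β → 0` the expression tends to `0` for each `θ`, so that the supremum is never negative. -/
def IsErasureRoot (ℓ m : ℕ) (θ : ℝ) : Prop :=
  0 < θ ∧ θ ≤ 1 ∧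
    IsGreatest ((fun β : ℝ => qExp ℓ m (β * θ) + ((θ * h2 β : ℝ) : EReal)) '' Set.Ioo 0 1) 0

/-! ### Codes and the two ensembles -/

/-- The binary linear code with parity-check matrix `H`. -/
def code {r n : ℕ} (H : Matrix (Fin r) (Fin n) (ZMod 2)) : Submodule (ZMod 2) (Fin n → ZMod 2) :=
  LinearMap.ker H.mulVecLin

/-- The code of `H` has minimum distance at most `b`. -/
def DistLE {r n : ℕ} (H : Matrix (Fin r) (Fin n) (ZMod 2)) (b : ℝ) : Prop :=
  ∃ c ∈ code H, c ≠ 0 ∧ (hammingNorm c : ℝ) ≤ b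

/-- `c` is a nonzero codeword of minimum weight in the code of `H`. -/
def IsMinWeightWord {r n : ℕ} (H : Matrix (Fin r) (Fin n) (ZMod 2)) (c : Fin n → ZMod 2) : Prop :=
  c ∈ code H ∧ c ≠ 0 ∧ ∀ x ∈ code H, x ≠ 0 → hammingNorm c ≤ hammingNorm x

/-- Ensemble `A(ℓ, m)`: all binary `r × n` matrices with column weights `ℓ` and row weights `m`. -/
def ensembleA (ℓ m r n : ℕ) : Set (Matrix (Fin r) (Fin n) (ZMod 2)) :=
  {H | (∀ j, hammingNorm (fun i => H i j) = ℓ) ∧ ∀ i, hammingNorm (H i) = m}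

/-- A matrix of ensemble `B(ℓ, m)` of length `n = m s`: it has `ℓ` horizontal blocks of size
`s × n`, and block `i` is the row `(I_s | ⋯ | I_s)` of `m` unit matrices with its columns permuted
by `π i`. -/
def gallagerMatrix (ℓ m s : ℕ) (π : Fin ℓ → Equiv.Perm (Fin (m * s))) :
    Matrix (Fin (ℓ * s)) (Fin (m * s)) (ZMod 2) :=
  Matrix.of fun i j => if (π i.divNat j).modNat = i.modNat then 1 else 0

/-- Most codes of ensemble `A(ℓ, m)`, given by equiprobable matrices, have the property `Good`:
the fraction of exceptions vanishes as `n → ∞`, where `r = ℓ n / m` is an integer. -/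
def MostA (ℓ m : ℕ) (Good : ∀ r n : ℕ, Matrix (Fin r) (Fin n) (ZMod 2) → Prop) : Prop :=
  ∀ κ : ℝ, 0 < κ → ∃ N : ℕ, ∀ n r : ℕ, N ≤ n → r * m = ℓ * n →
    (1 - κ) * (ensembleA ℓ m r n).ncard ≤ ({H ∈ ensembleA ℓ m r n | Good r n H}.ncard : ℝ)

/-- Most codes of ensemble `B(ℓ, m)`, given by independent uniform permutations, have the property
`Good`: the fraction of exceptions vanishes as `n = m s → ∞`. -/
def MostB (ℓ m : ℕ) (Good : ∀ r n : ℕ, Matrix (Fin r) (Fin n) (ZMod 2) → Prop) : Prop :=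
  ∀ κ : ℝ, 0 < κ → ∃ N : ℕ, ∀ s : ℕ, N ≤ s →
    (1 - κ) * Nat.card (Fin ℓ → Equiv.Perm (Fin (m * s))) ≤
      ({π : Fin ℓ → Equiv.Perm (Fin (m * s)) | Good _ _ (gallagerMatrix ℓ m s π)}.ncard : ℝ)

/-! ### Random access machines with logarithmic cost -/

/-- A state: registers (a program uses finitely many of them) and a memory that is addressed
indirectly. All cells hold natural numbers. -/
structure State where
  reg : ℕ → ℕ
  mem : ℕ → ℕ

/-- Assignment of `v` to register `a`. -/
def State.setReg (σ : State) (a v : ℕ) : State := ⟨Function.update σ.reg a v, σ.mem⟩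

/-- Assignment of `v` to memory cell `p`. -/
def State.setMem (σ : State) (p v : ℕ) : State := ⟨σ.reg, Function.update σ.mem p v⟩

/-- Structured programs of a deterministic random access machine. Arguments are register indices,
except for the constant of `const`. -/
inductive Prog where
  | skip : Prog
  /-- `R_a := k` -/
  | const (a k : ℕ) : Prog
  /-- `R_a := R_b + R_c` -/
  | add (a b c : ℕ) : Prog
  /-- `R_a := max (R_b - R_c) 0` -/
  | sub (a b c : ℕ) : Prog
  /-- `R_a := M[R_b]` -/
  | load (a b : ℕ) : Prog
  /-- `M[R_a] := R_b` -/
  | store (a b : ℕ) : Prog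
  | seq (P Q : Prog) : Prog
  /-- `if R_a < R_b then P else Q` -/
  | ifLt (a b : ℕ) (P Q : Prog) : Prog
  /-- `while R_a < R_b do P` -/
  | whileLt (a b : ℕ) (P : Prog) : Prog

/-- `Runs P σ T σ'`: started in the state `σ`, the program `P` halts in the state `σ'` after time
`T`. An operation or a test costs one plus the bit lengths of the numbers and addresses that it
handles. -/
inductive Runs : Prog → State → ℕ → State → Prop where
  | skip (σ) : Runs .skip σ 1 σ
  | const (a k σ) : Runs (.const a k) σ (1 + k.size) (σ.setReg a k)
  | add (a b c σ) : Runs (.add a b c) σ (1 + (σ.reg b).size + (σ.reg c).size)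
      (σ.setReg a (σ.reg b + σ.reg c))
  | sub (a b c σ) : Runs (.sub a b c) σ (1 + (σ.reg b).size + (σ.reg c).size)
      (σ.setReg a (σ.reg b - σ.reg c))
  | load (a b σ) : Runs (.load a b) σ (1 + (σ.reg b).size + (σ.mem (σ.reg b)).size)
      (σ.setReg a (σ.mem (σ.reg b)))
  | store (a b σ) : Runs (.store a b) σ (1 + (σ.reg a).size + (σ.reg b).size)
      (σ.setMem (σ.reg a) (σ.reg b))
  | seq {P Q σ σ' σ'' T T'} : Runs P σ T σ' → Runs Q σ' T' σ'' → Runs (.seq P Q) σ (T + T') σ''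
  | ifTrue {a b P Q σ σ' T} : σ.reg a < σ.reg b → Runs P σ T σ' →
      Runs (.ifLt a b P Q) σ (1 + (σ.reg a).size + (σ.reg b).size + T) σ'
  | ifFalse {a b P Q σ σ' T} : ¬ σ.reg a < σ.reg b → Runs Q σ T σ' →
      Runs (.ifLt a b P Q) σ (1 + (σ.reg a).size + (σ.reg b).size + T) σ'
  | whileTrue {a b P σ σ' σ'' T T'} : σ.reg a < σ.reg b → Runs P σ T σ' →
      Runs (.whileLt a b P) σ' T' σ'' →
      Runs (.whileLt a b P) σ (1 + (σ.reg a).size + (σ.reg b).size + T + T') σ''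
  | whileFalse {a b P σ} : ¬ σ.reg a < σ.reg b →
      Runs (.whileLt a b P) σ (1 + (σ.reg a).size + (σ.reg b).size) σ

/-! ### Distance verification -/

/-- The input `(H, w)`: registers `0, 1, 2` hold `n, r, w`, the first `r n` memory cells hold `H`
row by row, and everything else is zero. -/
def input {r n : ℕ} (H : Matrix (Fin r) (Fin n) (ZMod 2)) (w : ℕ) : State where
  reg a := if a = 0 then n else if a = 1 then r else if a = 2 then w else 0
  mem p := if h : p < r * n then
      (H (Fin.divNat (⟨p, h⟩ : Fin (r * n))) (Fin.modNat (⟨p, h⟩ : Fin (r * n)))).val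
    else 0

/-- `P` verifies code distances, without failures: on each parity-check matrix `H` and each weight
`w` it halts, and the first `n` memory cells then hold a nonzero codeword of minimum weight if the
code has distance at most `w`, and the zero word if it has not. -/
def VerifiesDistance (P : Prog) : Prop :=
  ∀ (r n : ℕ) (H : Matrix (Fin r) (Fin n) (ZMod 2)) (w : ℕ),
    ∃ (T : ℕ) (σ : State) (c : Fin n → ZMod 2), Runs P (input H w) T σ ∧
      (∀ j : Fin n, σ.mem j = (c j).val) ∧
      (DistLE H w → IsMinWeightWord H c) ∧ (¬ DistLE H w → c = 0)

/-- On the matrix `H` of length `n`, the program `P` halts within time `2 ^ (E n)`, for each input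
weight `w ≤ n` such that `w` or the distance of the code is at most `x n`. -/
def FastUpTo (P : Prog) (E x : ℝ) (r n : ℕ) (H : Matrix (Fin r) (Fin n) (ZMod 2)) : Prop :=
  ∀ w : ℕ, w ≤ n → ((w : ℝ) ≤ x * n ∨ DistLE H (x * n)) →
    ∃ (T : ℕ) (σ : State), Runs P (input H w) T σ ∧ (T : ℝ) ≤ (2 : ℝ) ^ (E * n)

end

end LDPC

namespace LDPC

/-! ### The generating polynomial of even-weight words -/

/-! Exponents. Let `P(t) = ((1+t)^m + (1-t)^m)/2` be the weight enumerator of the even-weight words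
of length `m`. A word satisfies a family of disjoint checks of size `m` if and only if its support
meets each of them evenly. Extracting a coefficient from a power of `P` bounds the probability of
this for weight `xn` by a polynomial times an exponential, for every tilt `s > 0`. The equation for
`t` says that the tilted distribution has mean `xm`, so a root minimises the bound
(`IsTRoot.lam_le`), and `q` is the best exponent. Uniqueness of the root is never needed. Up to the
entropy term, `q` is a minimum of affine functions of `x`, so it is continuous up to `1/2` and
beyond. The sum `h + q` is negative near `0` because `ℓ ≥ 3`, and nonnegative at `1/2` because `ℓ ≤
m`. This yields `δ_* ≤ 1/2`. With `x = βθ` the function under the maximum becomes `q(x) + θ h(x/θ)`,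
which strictly increases with `θ`. Compactness yields the root `θ_*`, monotonicity its uniqueness,
and weights above `1/2` are compared with their reflections `1 - x`.

Random codes. At `θ_*` the expected number of codewords supported on a given set of at most `θ_* n`
positions is polynomial. Markov's inequality and a union bound over the `n` cyclic windows show that
for most matrices at most `2^√n` codewords vanish on any window of length about `(1-θ_*)n`
(`Sparse`). In ensemble `B` the blocks are independent. In ensemble `A` the matrices correspond to
the simple configurations, equally many for each matrix, and switchings show that these make up at
least an inverse polynomial fraction of all configurations (`Config.card_le_card_simple`).

Window search, for the exponent `(1-θ_*)h₂(δ_*)`. A word of weight `D` has at most its share `Da/n`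
in some cyclic window of length `a`. Elimination that removes positions outside the window first
leaves an information set that consists of window positions and of `z` other positions, where the
`z` basis vectors at the latter generate codewords that vanish on the window (`Elim`). Hence `z ≤
√n` for typical matrices. All choices on the `z` positions combined with at most `Da/n` ones in the
window number at most `2^√n` times the volume of a ball, and the word sought is among their
encodings. The program tries `a = 0, 1, ...` until `z² ≤ n` for each window, so that `θ_*` does not
enter it. At `a = n` this always holds, so the search is correct for every matrix.

Collision search, for the exponent `h₂(δ_*)/2`. Some interval of length `⌈n/2⌉` contains exactly
`⌊D/2⌋` ones of a word of weight `D` (`exists_half_window`). Its two parts have equal syndromes, and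
a table addressed by syndromes finds such pairs. Stamps spare the clearing of the table.

Both searches run for the weights `1, 2, ...` and stop at the first hit, which is a word of minimum
weight (`verifier_spec`). A small calculus of operation counts (`HT`) handles the machine: with
cells of `W` bits an operation costs at most `2W + 1`, and for the time bounds `W = n + 6` suffices.
Ball volumes are bounded by a function that is exponential in a linear function of the radius
(`ballVol_le_rpow`), so that enlarging `δ_*` by a small `η` costs only `ε`. -/

/-- The weight enumerator of the even-weight binary words of length `m`. -/
noncomputable def evenPoly (m : ℕ) (t : ℝ) : ℝ := ((1 + t) ^ m + (1 - t) ^ m) / 2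

theorem evenPoly_eq_sum (m : ℕ) (t : ℝ) :
    evenPoly m t = ∑ k ∈ Finset.range (m + 1), (if Even k then (m.choose k : ℝ) else 0) * t ^ k := by
  unfold evenPoly
  rw [add_comm 1 t, show (1 : ℝ) - t = -t + 1 by ring, add_pow, add_pow, ← Finset.sum_add_distrib,
    Finset.sum_div]
  refine Finset.sum_congr rfl fun k _ => ?_
  rcases Nat.even_or_odd k with h | h
  · rw [if_pos h, h.neg_pow]; simp; ring
  · rw [if_neg (Nat.not_even_iff_odd.2 h), h.neg_pow]; simp

theorem evenPoly_pos (m : ℕ) {t : ℝ} (ht : 0 ≤ t) : 0 < evenPoly m t := by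
  rw [evenPoly_eq_sum]
  refine lt_of_lt_of_le zero_lt_one ?_
  refine le_trans ?_ (Finset.single_le_sum (f := fun k => (if Even k then (m.choose k : ℝ) else 0) * t ^ k)
    (fun k _ => by positivity) (Finset.mem_range.2 (Nat.succ_pos m)))
  simp

theorem evenPoly_lt {m : ℕ} (hm : 1 ≤ m) {t : ℝ} (ht : 0 < t) : evenPoly m t < (1 + t) ^ m := by
  have : |1 - t| < 1 + t := abs_lt.2 ⟨by linarith, by linarith⟩
  have h := pow_lt_pow_left₀ this (abs_nonneg _) (by omega : m ≠ 0)
  have h2 := le_abs_self ((1 - t) ^ m)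
  rw [abs_pow] at h2
  unfold evenPoly; linarith

theorem hasDerivAt_evenPoly (m : ℕ) (t : ℝ) :
    HasDerivAt (evenPoly m) (m * ((1 + t) ^ (m - 1) - (1 - t) ^ (m - 1)) / 2) t := by
  have h1 : HasDerivAt (fun t : ℝ => (1 + t) ^ m) (m * (1 + t) ^ (m - 1) * 1) t :=
    ((hasDerivAt_id t).const_add 1).pow m
  have h2 : HasDerivAt (fun t : ℝ => (1 - t) ^ m) (m * (1 - t) ^ (m - 1) * (-1)) t :=
    ((hasDerivAt_id t).const_sub 1).pow m
  exact ((h1.add h2).div_const 2).congr_deriv (by ring)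

/-- Both sides are `t P'(t)`, differentiated term by term and in closed form. Divided by `P(t)`,
this is the mean weight of an even word under the tilt `t`. -/
theorem sum_mul_evenPoly_coeff (m : ℕ) (t : ℝ) :
    ∑ k ∈ Finset.range (m + 1), (k : ℝ) * ((if Even k then (m.choose k : ℝ) else 0) * t ^ k) =
      t * (m * ((1 + t) ^ (m - 1) - (1 - t) ^ (m - 1)) / 2) := by
  have h1 : HasDerivAt (evenPoly m) (∑ k ∈ Finset.range (m + 1),
      (if Even k then (m.choose k : ℝ) else 0) * (k * t ^ (k - 1))) t := by
    have : evenPoly m = fun t => ∑ k ∈ Finset.range (m + 1),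
        (if Even k then (m.choose k : ℝ) else 0) * t ^ k := funext (evenPoly_eq_sum m)
    rw [this]
    exact HasDerivAt.fun_sum fun k _ => (hasDerivAt_pow k t).const_mul _
  rw [← h1.unique (hasDerivAt_evenPoly m t), Finset.mul_sum]
  refine Finset.sum_congr rfl fun k _ => ?_
  rcases k with _ | k
  · simp
  · simp only [Nat.add_sub_cancel]; ring

/-! ### The root as a saddle point -/

/-- `t` solves the equation that defines `tRoot m x`. -/
def IsTRoot (m : ℕ) (x t : ℝ) : Prop :=
  0 < t ∧ ((1 + t) ^ (m - 1) + (1 - t) ^ (m - 1)) / ((1 + t) ^ m + (1 - t) ^ m) = 1 - x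

/-- The exponent `log (P(s) / s^(x m))` of the even words of relative weight `x`. -/
noncomputable def lam (m : ℕ) (s x : ℝ) : ℝ := Real.log (evenPoly m s) - x * m * Real.log s

/-- Jensen's inequality: with `L = log s - log t`, the bound `e^((k-xm)L) ≥ 1 + (k-xm)L` is averaged
over the weights `k` tilted by `t`. Their mean is `xm`, so the linear term disappears. Consequently
all roots give the same value, and any `s` gives an upper bound for it. -/
theorem IsTRoot.lam_le {m : ℕ} (hm : 1 ≤ m) {x t s : ℝ} (h : IsTRoot m x t) (hs : 0 < s) :
    lam m t x ≤ lam m s x := by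
  obtain ⟨ht, heq⟩ := h
  have hP := evenPoly_pos m ht.le
  have hPs := evenPoly_pos m hs.le
  have hden : (1 + t) ^ m + (1 - t) ^ m ≠ 0 := by unfold evenPoly at hP; linarith
  rw [div_eq_iff hden] at heq
  -- The equation for `t` says precisely that the tilted mean weight is `x m`.
  have hmean : ∑ k ∈ Finset.range (m + 1), (k : ℝ) *
      ((if Even k then (m.choose k : ℝ) else 0) * t ^ k) = x * m * evenPoly m t := by
    rw [sum_mul_evenPoly_coeff]
    obtain ⟨M, rfl⟩ : ∃ M, m = M + 1 := ⟨m - 1, by omega⟩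
    simp only [Nat.add_sub_cancel] at *
    unfold evenPoly
    rw [pow_succ, pow_succ] at *
    linear_combination ((M + 1 : ℕ) : ℝ) / 2 * (-heq)
  set L := Real.log s - Real.log t with hL
  have key : evenPoly m t * Real.exp (x * m * L) ≤ evenPoly m s := by
    have hterm : ∀ k ∈ Finset.range (m + 1),
        (if Even k then (m.choose k : ℝ) else 0) * t ^ k * (1 + ((k : ℝ) - x * m) * L)
          * Real.exp (x * m * L) ≤ (if Even k then (m.choose k : ℝ) else 0) * s ^ k := by
      intro k _
      have hsk : s ^ k = t ^ k * Real.exp ((k : ℝ) * L) := by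
        rw [hL, mul_sub, Real.exp_sub, ← Real.log_pow, ← Real.log_pow, Real.exp_log (by positivity),
          Real.exp_log (by positivity)]
        field_simp
      have h1 := Real.add_one_le_exp (((k : ℝ) - x * m) * L)
      have h2 : Real.exp ((k : ℝ) * L) = Real.exp (((k : ℝ) - x * m) * L) * Real.exp (x * m * L) := by
        rw [← Real.exp_add]; ring_nf
      rw [hsk, h2, ← mul_assoc, ← mul_assoc]
      refine mul_le_mul_of_nonneg_right ?_ (Real.exp_pos _).le
      refine mul_le_mul_of_nonneg_left (by linarith) ?_
      split_ifs <;> positivity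
    have hsum := Finset.sum_le_sum hterm
    rw [← evenPoly_eq_sum, ← Finset.sum_mul] at hsum
    refine le_trans (le_of_eq ?_) hsum
    congr 1
    have : ∀ k ∈ Finset.range (m + 1), (if Even k then (m.choose k : ℝ) else 0) * t ^ k *
        (1 + ((k : ℝ) - x * m) * L) = (1 - x * m * L) * ((if Even k then (m.choose k : ℝ) else 0) * t ^ k)
        + L * ((k : ℝ) * ((if Even k then (m.choose k : ℝ) else 0) * t ^ k)) := fun k _ => by ring
    rw [Finset.sum_congr rfl this, Finset.sum_add_distrib, ← Finset.mul_sum, ← Finset.mul_sum, hmean,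
      ← evenPoly_eq_sum]
    ring
  have := Real.log_le_log (by positivity) key
  rw [Real.log_mul hP.ne' (Real.exp_pos _).ne', Real.log_exp] at this
  unfold lam
  rw [hL] at this
  nlinarith

/-- The infimum is attained: after clearing denominators the condition is closed on `[0, ∞)`, and
`0` is no solution, since the ratio there is `1`. -/
theorem tRoot_isTRoot {m : ℕ} {x : ℝ} (hx : 0 < x) (h : ∃ t, IsTRoot m x t) :
    IsTRoot m x (tRoot m x) := by
  have heq : {t : ℝ | 0 < t ∧
      ((1 + t) ^ (m - 1) + (1 - t) ^ (m - 1)) / ((1 + t) ^ m + (1 - t) ^ m) = 1 - x} =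
      Set.Ici 0 ∩ {t : ℝ | (1 + t) ^ (m - 1) + (1 - t) ^ (m - 1) =
        (1 - x) * ((1 + t) ^ m + (1 - t) ^ m)} := by
    ext t
    simp only [Set.mem_ofPred_eq, Set.mem_inter_iff, Set.mem_Ici]
    constructor
    · rintro ⟨h0, h1⟩
      have hP := evenPoly_pos m h0.le
      have hden : (1 + t) ^ m + (1 - t) ^ m ≠ 0 := by unfold evenPoly at hP; linarith
      exact ⟨h0.le, (div_eq_iff hden).1 h1⟩
    · rintro ⟨h0, h1⟩
      have hP := evenPoly_pos m h0
      have hden : (1 + t) ^ m + (1 - t) ^ m ≠ 0 := by unfold evenPoly at hP; linarith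
      refine ⟨lt_of_le_of_ne h0 ?_, (div_eq_iff hden).2 h1⟩
      rintro rfl
      simp at h1
      linarith
  have hcl : IsClosed {t : ℝ | 0 < t ∧
      ((1 + t) ^ (m - 1) + (1 - t) ^ (m - 1)) / ((1 + t) ^ m + (1 - t) ^ m) = 1 - x} := by
    rw [heq]
    exact isClosed_Ici.inter (isClosed_eq (by fun_prop) (by fun_prop))
  exact hcl.csInf_mem h ⟨0, fun t ht => ht.1.le⟩

/-- The ratio goes continuously from `1` at `t = 0` to a value below `1/2` at `t = 2`. Reaching
beyond `x = 1/2` makes `1/2` an interior point, where concavity will imply continuity. -/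
theorem exists_isTRoot {m : ℕ} (hm : 3 ≤ m) :
    ∃ b : ℝ, 1 / 2 < b ∧ b ≤ 2 / 3 ∧ ∀ x, 0 < x → x < b → ∃ t, IsTRoot m x t := by
  set ρ : ℝ → ℝ := fun t => ((1 + t) ^ (m - 1) + (1 - t) ^ (m - 1)) / ((1 + t) ^ m + (1 - t) ^ m)
    with hρ
  have hcont : ContinuousOn ρ (Set.Icc 0 2) := by
    refine ContinuousOn.div (by fun_prop) (by fun_prop) fun t ht => ?_
    have hP := evenPoly_pos m ht.1
    unfold evenPoly at hP; linarith
  have h0 : ρ 0 = 1 := by simp [hρ]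
  have h2 : ρ 2 < 1 / 2 := by
    have hP := evenPoly_pos m (zero_le_two (α := ℝ))
    have hden : (0 : ℝ) < (1 + 2) ^ m + (1 - 2) ^ m := by
      unfold evenPoly at hP; exact (div_pos_iff_of_pos_right two_pos).1 hP
    simp only [hρ]
    rw [div_lt_iff₀ hden]
    obtain ⟨M, rfl⟩ : ∃ M, m = M + 1 := ⟨m - 1, by omega⟩
    simp only [Nat.add_sub_cancel]
    -- With `M = m - 1` the claim reduces to `3 (-1)^M < 3^M`.
    have h9 : (9 : ℝ) ≤ 3 ^ M := by
      calc (9 : ℝ) = 3 ^ 2 := by norm_num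
        _ ≤ 3 ^ M := pow_le_pow_right₀ (by norm_num) (by omega)
    rw [pow_succ, pow_succ]
    norm_num
    rcases neg_one_pow_eq_or ℝ M with h | h <;> rw [h] <;> linarith
  refine ⟨min (1 - ρ 2) (2 / 3), lt_min (by linarith) (by norm_num), min_le_right _ _,
    fun x hx hxb => ?_⟩
  have hxb' := lt_of_lt_of_le hxb (min_le_left _ _)
  have := intermediate_value_Icc' (by norm_num : (0 : ℝ) ≤ 2) hcont
    (show 1 - x ∈ Set.Icc (ρ 2) (ρ 0) from ⟨by linarith, by rw [h0]; linarith⟩)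
  obtain ⟨t, ht, hte⟩ := this
  refine ⟨t, lt_of_le_of_ne ht.1 ?_, hte⟩
  rintro rfl
  rw [h0] at hte
  linarith

/-! ### The exponent in natural units -/

/-- The exponent `q` in natural units, at a parameter `s` in place of the root `t`. -/
noncomputable def qNat (ℓ m : ℕ) (s x : ℝ) : ℝ := (ℓ / m : ℝ) * lam m s x - ℓ * Real.binEntropy x

theorem qExp_eq {ℓ m : ℕ} (hm : 1 ≤ m) {x : ℝ} (h : ¬(Odd m ∧ 1 - 1 / (m : ℝ) ≤ x))
    (ht : 0 < tRoot m x) :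
    qExp ℓ m x = ((qNat ℓ m (tRoot m x) x / Real.log 2 : ℝ) : EReal) := by
  unfold qExp
  rw [if_neg h]
  congr 1
  have hP := evenPoly_pos m ht.le
  have hm' : (m : ℝ) ≠ 0 := by positivity
  have : ((1 + tRoot m x) ^ m + (1 - tRoot m x) ^ m) / (2 * tRoot m x ^ (x * m)) =
      evenPoly m (tRoot m x) / tRoot m x ^ (x * m) := by
    unfold evenPoly; field_simp
  rw [this, Real.logb, Real.log_div hP.ne' (by positivity), Real.log_rpow ht, h2, qNat, lam]
  field_simp

/-- Without a root, `tRoot` is `sInf ∅ = 0`. The logarithm is then that of a quotient by zero and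
vanishes, which leaves the entropy term. This makes it unnecessary to decide for which `x > 1/2`
there is a root. -/
theorem qExp_junk {ℓ m : ℕ} (hm : 1 ≤ m) {x : ℝ} (hx : 0 < x) (h : ¬(Odd m ∧ 1 - 1 / (m : ℝ) ≤ x))
    (ht : ¬ ∃ t, IsTRoot m x t) :
    qExp ℓ m x = ((- (ℓ * Real.binEntropy x) / Real.log 2 : ℝ) : EReal) := by
  have h0 : tRoot m x = 0 := by
    unfold tRoot
    convert Real.sInf_empty
    rw [Set.eq_empty_iff_forall_notMem]
    exact fun t h => ht ⟨t, h⟩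
  unfold qExp
  rw [if_neg h, h0]
  congr 1
  have hm' : (m : ℝ) ≠ 0 := by positivity
  rw [Real.zero_rpow (by positivity), h2]
  simp
  field_simp

/-- The tilt `x/(1-x)` is optimal for the enumerator `(1+s)^m` of all words, for which it gives the
exponent `m h(x)`. Restricting to even words loses something. -/
theorem lam_lt_entropy {m : ℕ} (hm : 1 ≤ m) {x : ℝ} (hx : 0 < x) (hx1 : x < 1) :
    lam m (x / (1 - x)) x < m * Real.binEntropy x := by
  have h1 : 0 < 1 - x := by linarith
  have hs : 0 < x / (1 - x) := by positivity
  have := Real.log_lt_log (evenPoly_pos m hs.le) (evenPoly_lt hm hs)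
  rw [Real.log_pow, show 1 + x / (1 - x) = (1 - x)⁻¹ by field_simp; ring, Real.log_inv] at this
  unfold lam
  rw [Real.binEntropy_eq_negMulLog_add_negMulLog_one_sub, Real.negMulLog, Real.negMulLog,
    Real.log_div hx.ne' h1.ne']
  nlinarith

theorem qNat_neg_of_isTRoot {ℓ m : ℕ} (hℓ : 1 ≤ ℓ) (hm : 1 ≤ m) {x t : ℝ} (hx : 0 < x)
    (hx1 : x < 1) (h : IsTRoot m x t) : qNat ℓ m t x < 0 := by
  have h1 := (h.lam_le hm (s := x / (1 - x)) (div_pos hx (by linarith))).trans_lt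
    (lam_lt_entropy hm hx hx1)
  unfold qNat
  have hm' : (0 : ℝ) < m := by positivity
  have : (ℓ / m : ℝ) * lam m t x < (ℓ / m : ℝ) * (m * Real.binEntropy x) :=
    mul_lt_mul_of_pos_left h1 (by positivity)
  have h3 : (ℓ / m : ℝ) * (m * Real.binEntropy x) = ℓ * Real.binEntropy x := by field_simp
  linarith

/-- Reflection of the generating polynomial. -/
theorem lam_inv_le {m : ℕ} {x t : ℝ} (ht : 0 < t) (ht1 : t ≤ 1) :
    lam m t⁻¹ x ≤ lam m t (1 - x) := by
  have hP := evenPoly_pos m ht.le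
  have hPi := evenPoly_pos m (inv_pos.2 ht).le
  -- Multiplication by `t^m` reverses the coefficients. For odd `m` this turns `(1-t)^m` into its
  -- negative, hence an inequality only.
  have key : t ^ m * evenPoly m t⁻¹ ≤ evenPoly m t := by
    unfold evenPoly
    have e1 : t ^ m * ((1 + t⁻¹) ^ m + (1 - t⁻¹) ^ m) = (1 + t) ^ m + (t - 1) ^ m := by
      rw [mul_add, ← mul_pow, ← mul_pow]
      congr 2 <;> field_simp
      ring
    have e2 : (t - 1) ^ m ≤ (1 - t) ^ m := by
      refine (le_abs_self _).trans ?_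
      rw [abs_pow, abs_sub_comm, abs_of_nonneg (by linarith)]
    calc t ^ m * (((1 + t⁻¹) ^ m + (1 - t⁻¹) ^ m) / 2) = ((1 + t) ^ m + (t - 1) ^ m) / 2 := by
          rw [← e1]; ring
      _ ≤ _ := by linarith
  have := Real.log_le_log (by positivity) key
  rw [Real.log_mul (by positivity) hPi.ne', Real.log_pow] at this
  unfold lam
  rw [Real.log_inv]
  nlinarith

theorem isTRoot_one {m : ℕ} (hm : 2 ≤ m) : IsTRoot m (1 / 2) 1 := by
  refine ⟨one_pos, ?_⟩
  obtain ⟨M, rfl⟩ : ∃ M, m = M + 2 := ⟨m - 2, by omega⟩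
  simp [pow_succ]
  field_simp
  norm_num

/-- For `x ≤ 1 / 2` there is a root that is at most one. -/
theorem exists_isTRoot_le_one {m : ℕ} (hm : 3 ≤ m) {x : ℝ} (hx : 0 < x) (hx2 : x ≤ 1 / 2) :
    ∃ t, IsTRoot m x t ∧ t ≤ 1 := by
  set ρ : ℝ → ℝ := fun t => ((1 + t) ^ (m - 1) + (1 - t) ^ (m - 1)) / ((1 + t) ^ m + (1 - t) ^ m)
    with hρ
  have hcont : ContinuousOn ρ (Set.Icc 0 1) := by
    refine ContinuousOn.div (by fun_prop) (by fun_prop) fun t ht => ?_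
    have hP := evenPoly_pos m ht.1
    unfold evenPoly at hP; linarith
  have h0 : ρ 0 = 1 := by simp [hρ]
  have h1 : ρ 1 = 1 - 1 / 2 := (isTRoot_one (by omega)).2
  have := intermediate_value_Icc' (by norm_num : (0 : ℝ) ≤ 1) hcont
    (show 1 - x ∈ Set.Icc (ρ 1) (ρ 0) from ⟨by linarith, by rw [h0]; linarith⟩)
  obtain ⟨t, ht, hte⟩ := this
  refine ⟨t, ⟨lt_of_le_of_ne ht.1 ?_, hte⟩, ht.2⟩
  rintro rfl
  rw [h0] at hte
  linarith

/-! ### Existence and uniqueness of the two parameters -/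

/-- The exponent `q` in natural units. -/
noncomputable def qReal (ℓ m : ℕ) (x : ℝ) : ℝ := qNat ℓ m (tRoot m x) x

theorem not_odd_and_le {m : ℕ} (hm : 3 ≤ m) {x : ℝ} (hx : x < 2 / 3) :
    ¬(Odd m ∧ 1 - 1 / (m : ℝ) ≤ x) := by
  rintro ⟨_, h⟩
  have h3 : (3 : ℝ) ≤ m := by exact_mod_cast hm
  have : 1 / (m : ℝ) ≤ 1 / 3 := one_div_le_one_div_of_le (by norm_num) h3
  linarith

theorem qExp_eq_qReal {ℓ m : ℕ} (hm : 3 ≤ m) {x : ℝ} (hx : 0 < x) (hx2 : x ≤ 1 / 2) :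
    qExp ℓ m x = ((qReal ℓ m x / Real.log 2 : ℝ) : EReal) := by
  obtain ⟨t, ht, _⟩ := exists_isTRoot_le_one hm hx hx2
  exact qExp_eq (by omega) (not_odd_and_le hm (by linarith)) (tRoot_isTRoot hx ⟨t, ht⟩).1

theorem qReal_le_qNat {ℓ m : ℕ} (hm : 3 ≤ m) {x s : ℝ} (hs : 0 < s) (h : ∃ t, IsTRoot m x t)
    (hx : 0 < x) : qReal ℓ m x ≤ qNat ℓ m s x := by
  have := (tRoot_isTRoot hx h).lam_le (by omega) hs
  unfold qReal qNat
  have := mul_le_mul_of_nonneg_left this (show 0 ≤ (ℓ / m : ℝ) by positivity)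
  linarith

theorem IsTRoot.qReal_eq {ℓ m : ℕ} (hm : 3 ≤ m) {x t : ℝ} (hx : 0 < x) (h : IsTRoot m x t) :
    qReal ℓ m x = qNat ℓ m t x := by
  refine le_antisymm (qReal_le_qNat hm h.1 ⟨t, h⟩ hx) ?_
  have := h.lam_le (by omega) (tRoot_isTRoot hx ⟨t, h⟩).1
  unfold qReal qNat
  have := mul_le_mul_of_nonneg_left this (show 0 ≤ (ℓ / m : ℝ) by positivity)
  linarith

/-- For fixed `s` the exponent `lam` is affine in `x`. Its minimum over `s` is therefore concave,
and concave functions are continuous on open intervals. -/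
theorem continuousOn_qReal (ℓ : ℕ) {m : ℕ} (hm : 3 ≤ m) :
    ContinuousOn (qReal ℓ m) (Set.Ioc 0 (1 / 2)) := by
  obtain ⟨b, hb, hb2, hroot⟩ := exists_isTRoot hm
  have hconc : ConcaveOn ℝ (Set.Ioo 0 b) fun x => lam m (tRoot m x) x := by
    refine ⟨convex_Ioo 0 b, fun x hx y hy u v hu hv huv => ?_⟩
    have hz : u • x + v • y ∈ Set.Ioo 0 b := convex_Ioo 0 b hx hy hu hv huv
    set z := u • x + v • y with hzdef
    have ht := (tRoot_isTRoot hz.1 (hroot z hz.1 hz.2)).1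
    have h1 := (tRoot_isTRoot hx.1 (hroot x hx.1 hx.2)).lam_le (by omega) ht
    have h2 := (tRoot_isTRoot hy.1 (hroot y hy.1 hy.2)).lam_le (by omega) ht
    simp only [smul_eq_mul] at *
    have h1' := mul_le_mul_of_nonneg_left h1 hu
    have h2' := mul_le_mul_of_nonneg_left h2 hv
    have : lam m (tRoot m z) z = u * lam m (tRoot m z) x + v * lam m (tRoot m z) y := by
      unfold lam
      linear_combination (-(m : ℝ) * Real.log (tRoot m z)) * hzdef -
        Real.log (evenPoly m (tRoot m z)) * huv
    linarith
  have hc := hconc.continuousOn isOpen_Ioo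
  have hc2 : ContinuousOn (qReal ℓ m) (Set.Ioo 0 b) := by
    unfold qReal qNat
    exact (hc.const_mul _).sub (Real.binEntropy_continuous.continuousOn.const_mul _)
  exact hc2.mono fun x hx => ⟨hx.1, lt_of_le_of_lt hx.2 hb⟩

theorem qReal_neg {ℓ m : ℕ} (hℓ : 1 ≤ ℓ) (hm : 3 ≤ m) {x : ℝ} (hx : 0 < x) (hx2 : x ≤ 1 / 2) :
    qReal ℓ m x < 0 := by
  obtain ⟨t, ht, _⟩ := exists_isTRoot_le_one hm hx hx2
  exact qNat_neg_of_isTRoot hℓ (by omega) hx (by linarith) (tRoot_isTRoot hx ⟨t, ht⟩)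

/-- There is no linear term, so each nonconstant power of `s ≤ 1` is at most `s^2`. -/
theorem evenPoly_le_one_add {m : ℕ} {s : ℝ} (hs : 0 ≤ s) (hs1 : s ≤ 1) :
    evenPoly m s ≤ 1 + 2 ^ m * s ^ 2 := by
  have h2 : (2 : ℝ) ^ m = ∑ k ∈ Finset.range (m + 1), (m.choose k : ℝ) := by
    exact_mod_cast (Nat.sum_range_choose m).symm
  rw [evenPoly_eq_sum, h2, Finset.sum_range_succ', Finset.sum_range_succ' _ m, add_mul, Finset.sum_mul]
  have : ∑ k ∈ Finset.range m, (if Even (k + 1) then (m.choose (k + 1) : ℝ) else 0) * s ^ (k + 1) ≤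
      ∑ k ∈ Finset.range m, (m.choose (k + 1) : ℝ) * s ^ 2 := by
    refine Finset.sum_le_sum fun k _ => ?_
    split_ifs with h
    · refine mul_le_mul_of_nonneg_left ?_ (by positivity)
      refine pow_le_pow_of_le_one hs hs1 ?_
      rcases k with _ | k
      · simp at h
      · omega
    · rw [zero_mul]; positivity
  have e0 : (if Even 0 then (m.choose 0 : ℝ) else 0) * s ^ 0 = 1 := by simp
  rw [e0]
  simp only [Nat.choose_zero_right, Nat.cast_one, one_mul]
  nlinarith [sq_nonneg s]

/-- For small weights the expected number of codewords is exponentially small. -/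
theorem exists_entropy_add_qReal_neg {ℓ m : ℕ} (hℓ : 3 ≤ ℓ) (hm : ℓ ≤ m) :
    ∃ x₀ : ℝ, 0 < x₀ ∧ x₀ ≤ 1 / 2 ∧
      ∀ x, 0 < x → x < x₀ → Real.binEntropy x + qReal ℓ m x < 0 := by
  -- The tilt is `s = √x`, for which `log P(s) ≤ 2^m x`. With `u = -x log x ≤ h(x)` the sum is at
  -- most `2^m x + ℓu/2 - (ℓ-1)u ≤ 2^m x - u/2`, as `ℓ ≥ 3`. The bound on `x` makes `u > 2 · 2^m x`.
  refine ⟨min (1 / 2) (Real.exp (-(2 * 2 ^ m))), by positivity, min_le_left _ _, fun x hx hlt => ?_⟩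
  have hx2 : x < 1 / 2 := lt_of_lt_of_le hlt (min_le_left _ _)
  have hxe : x < Real.exp (-(2 * 2 ^ m)) := lt_of_lt_of_le hlt (min_le_right _ _)
  have hlog : Real.log x < -(2 * 2 ^ m) := by
    rw [← Real.log_exp (-(2 * 2 ^ m))]; exact Real.log_lt_log hx hxe
  have hs : 0 < √x := Real.sqrt_pos.2 hx
  have hs1 : √x ≤ 1 := Real.sqrt_le_one.2 (by linarith)
  obtain ⟨t, ht, _⟩ := exists_isTRoot_le_one (by omega : 3 ≤ m) hx hx2.le
  have h1 := qReal_le_qNat (ℓ := ℓ) (by omega : 3 ≤ m) hs ⟨t, ht⟩ hx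
  have h2 : Real.log (evenPoly m √x) ≤ 2 ^ m * x := by
    have := evenPoly_le_one_add (m := m) hs.le hs1
    rw [Real.sq_sqrt hx.le] at this
    have h3 := Real.log_le_sub_one_of_pos (evenPoly_pos m hs.le)
    linarith
  have hH : -(x * Real.log x) ≤ Real.binEntropy x := by
    rw [Real.binEntropy_eq_negMulLog_add_negMulLog_one_sub]
    have := Real.negMulLog_nonneg (x := 1 - x) (by linarith) (by linarith)
    unfold Real.negMulLog at *
    linarith
  have hmR : (0 : ℝ) < m := by exact_mod_cast (by omega : 0 < m)
  have hℓR : (3 : ℝ) ≤ ℓ := by exact_mod_cast hℓ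
  have hα : (ℓ / m : ℝ) ≤ 1 := by rw [div_le_one hmR]; exact_mod_cast hm
  have hα0 : (0 : ℝ) ≤ (ℓ / m : ℝ) := by positivity
  unfold qNat lam at h1
  rw [Real.log_sqrt hx.le] at h1
  have h4 : (ℓ / m : ℝ) * (Real.log (evenPoly m √x) - x * m * (Real.log x / 2)) =
      (ℓ / m : ℝ) * Real.log (evenPoly m √x) - ℓ * (x * Real.log x) / 2 := by field_simp
  have h5 : (ℓ / m : ℝ) * Real.log (evenPoly m √x) ≤ 2 ^ m * x :=
    (mul_le_mul_of_nonneg_left h2 hα0).trans (mul_le_of_le_one_left (by positivity) hα)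
  have h6 : ((ℓ : ℝ) - 1) * -(x * Real.log x) ≤ (ℓ - 1) * Real.binEntropy x :=
    mul_le_mul_of_nonneg_left hH (by linarith)
  have h7 : x * Real.log x < x * -(2 * 2 ^ m) := mul_lt_mul_of_pos_left hlog hx
  have h8 : 0 < x * 2 ^ m := by positivity
  nlinarith

/-- At `x = 1/2` the root is `t = 1` and `P(1) = 2^(m-1)`, so that the sum is `(1 - ℓ/m) log 2`, the
design rate in natural units. -/
theorem entropy_add_qReal_half {ℓ m : ℕ} (hm : 3 ≤ m) (hℓ : ℓ ≤ m) :
    0 ≤ Real.binEntropy (1 / 2) + qReal ℓ m (1 / 2) := by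
  rw [(isTRoot_one (by omega)).qReal_eq hm (by norm_num), qNat, lam, evenPoly]
  have hmR : (0 : ℝ) < m := by exact_mod_cast (by omega : 0 < m)
  have hα : (ℓ / m : ℝ) ≤ 1 := by rw [div_le_one hmR]; exact_mod_cast hℓ
  have h2 : 0 < Real.log 2 := Real.log_pos (by norm_num)
  have : ((1 : ℝ) + 1) ^ m + (1 - 1) ^ m = 2 ^ m := by
    rw [sub_self, zero_pow (by omega)]; norm_num
  rw [this, Real.log_div (by positivity) (by norm_num), Real.log_pow, Real.log_one,
    show (1 / 2 : ℝ) = 2⁻¹ by norm_num, Real.binEntropy_two_inv]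
  have e : (ℓ / m : ℝ) * (m * Real.log 2 - Real.log 2 - 2⁻¹ * m * 0) =
    ℓ * Real.log 2 - (ℓ / m : ℝ) * Real.log 2 := by field_simp; ring
  rw [e]
  nlinarith

theorem h2_add_qExp_eq_zero_iff {ℓ m : ℕ} (hm : 3 ≤ m) {x : ℝ} (hx : 0 < x) (hx2 : x ≤ 1 / 2) :
    (h2 x : EReal) + qExp ℓ m x = 0 ↔ Real.binEntropy x + qReal ℓ m x = 0 := by
  rw [qExp_eq_qReal hm hx hx2, h2, ← EReal.coe_add, ← add_div, EReal.coe_eq_zero, div_eq_zero_iff]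
  have : Real.log 2 ≠ 0 := (Real.log_pos (by norm_num)).ne'
  tauto

/-- The sum changes sign on `[x₀/2, 1/2]`, and its zeros there form a compact set. No zero lies
below `x₀`, and whatever happens above `1/2` cannot affect the least one. -/
theorem exists_isRelativeDistance {ℓ m : ℕ} (hℓ : 3 ≤ ℓ) (hm : ℓ ≤ m) :
    ∃ δ, IsRelativeDistance ℓ m δ ∧ δ ≤ 1 / 2 := by
  have hm3 : 3 ≤ m := hℓ.trans hm
  obtain ⟨x₀, hx₀, hx₀2, hneg⟩ := exists_entropy_add_qReal_neg hℓ hm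
  have hpos := entropy_add_qReal_half hm3 hm
  have hcont : ContinuousOn (fun x => Real.binEntropy x + qReal ℓ m x) (Set.Icc (x₀ / 2) (1 / 2)) :=
    Real.binEntropy_continuous.continuousOn.add ((continuousOn_qReal ℓ hm3).mono
      fun x hx => ⟨by linarith [hx.1], hx.2⟩)
  have hlow := hneg (x₀ / 2) (by linarith) (by linarith)
  have hne := intermediate_value_Icc (by linarith : x₀ / 2 ≤ 1 / 2) hcont
    (show (0 : ℝ) ∈ Set.Icc _ _ from ⟨hlow.le, hpos⟩)
  obtain ⟨y, hy, hy0⟩ := hne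
  have hcomp : IsCompact (Set.Icc (x₀ / 2) (1 / 2) ∩
      (fun x => Real.binEntropy x + qReal ℓ m x) ⁻¹' {0}) :=
    isCompact_Icc.of_isClosed_subset (hcont.preimage_isClosed_of_isClosed isClosed_Icc
      isClosed_singleton) Set.inter_subset_left
  obtain ⟨δ, hδ, hmin⟩ := hcomp.exists_isLeast ⟨y, hy, hy0⟩
  have hδ0 : 0 < δ := by linarith [hδ.1.1]
  refine ⟨δ, ⟨⟨hδ0, by linarith [hδ.1.2], (h2_add_qExp_eq_zero_iff hm3 hδ0 hδ.1.2).2 hδ.2⟩, ?_⟩,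
    hδ.1.2⟩
  rintro z ⟨hz0, hz1, hz⟩
  by_cases hz2 : z ≤ 1 / 2
  · have hz' := (h2_add_qExp_eq_zero_iff hm3 hz0 hz2).1 hz
    refine hmin ⟨⟨?_, hz2⟩, hz'⟩
    by_contra hlt
    have := hneg z hz0 (by linarith)
    linarith
  · linarith [hδ.1.2]

theorem existsUnique_isRelativeDistance {ℓ m : ℕ} (hℓ : 3 ≤ ℓ) (hm : ℓ ≤ m) :
    ∃! δ, IsRelativeDistance ℓ m δ := by
  obtain ⟨δ, h, _⟩ := exists_isRelativeDistance hℓ hm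
  exact ⟨δ, h, fun y hy => IsLeast.unique hy h⟩

theorem IsRelativeDistance.le_half {ℓ m : ℕ} (hℓ : 3 ≤ ℓ) (hm : ℓ ≤ m) {δ : ℝ}
    (h : IsRelativeDistance ℓ m δ) : δ ≤ 1 / 2 := by
  obtain ⟨δ', h', h2⟩ := exists_isRelativeDistance hℓ hm
  rwa [IsLeast.unique h h']

/-! ### The perspective of the entropy function -/

/-- Strict concavity: `x/θ'` is a convex combination of `x/θ` and `0`, where the entropy vanishes.
-/
theorem persp_lt {x θ θ' : ℝ} (hx : 0 < x) (hxθ : x ≤ θ) (hθ : θ < θ') :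
    θ * Real.binEntropy (x / θ) < θ' * Real.binEntropy (x / θ') := by
  have hθ0 : 0 < θ := hx.trans_le hxθ
  have hθ'0 : 0 < θ' := hθ0.trans hθ
  have := Real.strictConcave_binEntropy.2
    (show x / θ ∈ Set.Icc 0 1 from ⟨by positivity, (div_le_one hθ0).2 hxθ⟩)
    (show (0 : ℝ) ∈ Set.Icc 0 1 from ⟨le_rfl, zero_le_one⟩) (by positivity)
    (show 0 < θ / θ' by positivity)
    (show 0 < 1 - θ / θ' by rw [sub_pos, div_lt_one hθ'0]; exact hθ) (by ring)
  simp only [smul_eq_mul, Real.binEntropy_zero, mul_zero, add_zero] at this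
  rw [show θ / θ' * (x / θ) = x / θ' by field_simp] at this
  have := mul_lt_mul_of_pos_left this hθ'0
  rwa [← mul_assoc, mul_div_cancel₀ _ hθ'0.ne'] at this

theorem persp_le {x θ θ' : ℝ} (hx : 0 < x) (hxθ : x ≤ θ) (hθ : θ ≤ θ') :
    θ * Real.binEntropy (x / θ) ≤ θ' * Real.binEntropy (x / θ') := by
  rcases hθ.eq_or_lt with rfl | h
  · exact le_rfl
  · exact (persp_lt hx hxθ h).le

/-- The entropy is symmetric about `1/2` and monotone on either side, and `y` lies between `1 - x`
and `x`. -/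
theorem binEntropy_le_of_le_of_one_sub_le {x y : ℝ} (hx : x ≤ 1) (hyx : y ≤ x) (h1 : 1 - x ≤ y) :
    Real.binEntropy x ≤ Real.binEntropy y := by
  by_cases hy : 2⁻¹ ≤ y
  · exact (Real.binEntropy_strictAntiOn.le_iff_ge ⟨hy.trans hyx, hx⟩
      ⟨hy, hyx.trans hx⟩).2 hyx
  · push Not at hy
    rw [← Real.binEntropy_one_sub x]
    exact (Real.binEntropy_strictMonoOn.le_iff_le ⟨by linarith, by linarith⟩
      ⟨by linarith, hy.le⟩).2 h1

/-- The comparison of the weights `x > 1/2` and `1 - x`. -/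
theorem persp_reflect {x θ : ℝ} (hx : 1 / 2 ≤ x) (hxθ : x ≤ θ) (hθ : θ ≤ 1) :
    θ * Real.binEntropy (x / θ) ≤ θ * Real.binEntropy ((1 - x) / θ) := by
  have hθ0 : 0 < θ := by linarith
  refine mul_le_mul_of_nonneg_left ?_ hθ0.le
  refine binEntropy_le_of_le_of_one_sub_le ((div_le_one hθ0).2 hxθ)
    (div_le_div_of_nonneg_right (by linarith) hθ0.le) ?_
  rw [show 1 - x / θ = (θ - x) / θ by field_simp]
  exact div_le_div_of_nonneg_right (by linarith) hθ0.le

/-- If there is a root for `x`, it does at least as well as `t⁻¹`, where `t` is the root for `1 -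
x`. If there is none, the default value of `tRoot` yields the second term of the maximum. -/
theorem qExp_reflect {ℓ m : ℕ} (hm : 3 ≤ m) {x : ℝ} (hx : 1 / 2 < x) (hx1 : x < 1) :
    qExp ℓ m x ≤ ((max (qReal ℓ m (1 - x)) (- (ℓ * Real.binEntropy x)) / Real.log 2 : ℝ) : EReal) := by
  have hl : 0 < Real.log 2 := Real.log_pos (by norm_num)
  by_cases hodd : Odd m ∧ 1 - 1 / (m : ℝ) ≤ x
  · unfold qExp; rw [if_pos hodd]; exact bot_le
  by_cases ht : ∃ t, IsTRoot m x t
  · have htr := tRoot_isTRoot (by linarith) ht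
    rw [qExp_eq (by omega) hodd htr.1, EReal.coe_le_coe_iff]
    refine div_le_div_of_nonneg_right (le_trans ?_ (le_max_left _ _)) hl.le
    obtain ⟨t, htt, ht1⟩ := exists_isTRoot_le_one hm (x := 1 - x) (by linarith) (by linarith)
    rw [htt.qReal_eq hm (by linarith)]
    have h1 := htr.lam_le (by omega) (inv_pos.2 htt.1)
    have h2 := lam_inv_le (m := m) (x := x) htt.1 ht1
    unfold qNat
    rw [Real.binEntropy_one_sub]
    have := mul_le_mul_of_nonneg_left (h1.trans h2) (show 0 ≤ (ℓ / m : ℝ) by positivity)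
    linarith
  · rw [qExp_junk (by omega) (by linarith) hodd ht, EReal.coe_le_coe_iff]
    exact div_le_div_of_nonneg_right (le_max_right _ _) hl.le

theorem erasure_value_eq {ℓ m : ℕ} (hm : 3 ≤ m) {θ β : ℝ} (hθ : 0 < θ) (hβ : 0 < β)
    (h : β * θ ≤ 1 / 2) :
    qExp ℓ m (β * θ) + ((θ * h2 β : ℝ) : EReal) =
      (((qReal ℓ m (β * θ) + θ * Real.binEntropy (β * θ / θ)) / Real.log 2 : ℝ) : EReal) := by
  rw [qExp_eq_qReal hm (by positivity) h, ← EReal.coe_add, h2, mul_div_cancel_right₀ _ hθ.ne']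
  congr 1
  ring

theorem IsErasureRoot.exponent_nonpos {ℓ m : ℕ} (hm : 3 ≤ m) {θ x : ℝ} (h : IsErasureRoot ℓ m θ)
    (hx : 0 < x) (hx2 : x ≤ 1 / 2) (hxθ : x < θ) :
    qReal ℓ m x + θ * Real.binEntropy (x / θ) ≤ 0 := by
  obtain ⟨h0, h1, h2⟩ := h
  have hl : 0 < Real.log 2 := Real.log_pos (by norm_num)
  have e : x / θ * θ = x := by field_simp
  have hle := h2.2 ⟨x / θ, ⟨by positivity, (div_lt_one h0).2 hxθ⟩, rfl⟩
  simp only at hle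
  rw [erasure_value_eq hm h0 (by positivity) (by rw [e]; exact hx2), e, ← EReal.coe_zero,
    EReal.coe_le_coe_iff] at hle
  by_contra hc
  push Not at hc
  have := div_pos hc hl
  linarith

/-- In the variable `x = βθ` the value is `q(x) + θ h(x/θ)`. By compactness there is a least `θ` for
which it is nonnegative at some `x` in `[x₀, 1/2]`. A positive value at this `θ` would persist for
slightly smaller `θ`, so the maximum is exactly `0`. For `x < x₀` the value is at most `h(x) + q(x)
< 0`. -/
theorem exists_isErasureRoot {ℓ m : ℕ} (hℓ : 3 ≤ ℓ) (hm : ℓ ≤ m) : ∃ θ, IsErasureRoot ℓ m θ := by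
  have hm3 : 3 ≤ m := hℓ.trans hm
  have hl : 0 < Real.log 2 := Real.log_pos (by norm_num)
  obtain ⟨x₀, hx₀, hx₀2, hneg⟩ := exists_entropy_add_qReal_neg hℓ hm
  set V : ℝ × ℝ → ℝ := fun p => qReal ℓ m p.1 + p.2 * Real.binEntropy (p.1 / p.2) with hV
  set D : Set (ℝ × ℝ) := {p | x₀ ≤ p.1 ∧ p.1 ≤ 1 / 2 ∧ p.1 ≤ p.2 ∧ p.2 ≤ 1} with hD
  have hDc : IsCompact D := by
    refine (isCompact_Icc (a := ((x₀, x₀) : ℝ × ℝ)) (b := (1 / 2, 1))).of_isClosed_subset ?_ ?_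
    · refine IsClosed.inter (isClosed_le continuous_const continuous_fst) ?_
      refine IsClosed.inter (isClosed_le continuous_fst continuous_const) ?_
      exact IsClosed.inter (isClosed_le continuous_fst continuous_snd)
        (isClosed_le continuous_snd continuous_const)
    · rintro ⟨x, θ⟩ ⟨h1, h2, h3, h4⟩
      exact ⟨⟨h1, h1.trans h3⟩, ⟨h2, h4⟩⟩
  have hVc : ContinuousOn V D := by
    refine ContinuousOn.add ?_ ?_
    · exact (continuousOn_qReal ℓ hm3).comp continuousOn_fst
        fun p hp => ⟨hx₀.trans_le hp.1, hp.2.1⟩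
    · refine continuousOn_snd.mul (Real.binEntropy_continuous.comp_continuousOn ?_)
      exact continuousOn_fst.div continuousOn_snd fun p hp =>
        ((hx₀.trans_le hp.1).trans_le hp.2.2.1).ne'
  have hcomp : IsCompact (D ∩ V ⁻¹' Set.Ici 0) :=
    hDc.of_isClosed_subset (hVc.preimage_isClosed_of_isClosed hDc.isClosed isClosed_Ici)
      Set.inter_subset_left
  have hne : (D ∩ V ⁻¹' Set.Ici 0).Nonempty := by
    refine ⟨(1 / 2, 1), ⟨hx₀2, le_rfl, by norm_num, le_rfl⟩, ?_⟩
    have := entropy_add_qReal_half hm3 hm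
    simp only [hV, Set.mem_preimage, Set.mem_Ici, one_mul, div_one]
    linarith
  obtain ⟨⟨x', θ⟩, ⟨hmem, hval⟩, hmin⟩ := hcomp.exists_isMinOn hne continuousOn_snd
  obtain ⟨h1, hhalf, h3, h4⟩ := hmem
  simp only [hV, Set.mem_preimage, Set.mem_Ici] at h1 hhalf h3 h4 hval
  have hx' : 0 < x' := hx₀.trans_le h1
  have hθ : 0 < θ := hx'.trans_le h3
  -- At `x' = θ` the entropy term is `h(1) = 0` and the negative `q` remains. So the maximum is
  -- attained at some `β < 1`.
  have hlt : x' < θ := by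
    refine lt_of_le_of_ne h3 ?_
    rintro rfl
    rw [div_self hx'.ne', Real.binEntropy_one, mul_zero, add_zero] at hval
    linarith [qReal_neg (ℓ := ℓ) (by omega) hm3 hx' hhalf]
  -- at `θ` all values are nonpositive
  have hall : ∀ x, 0 < x → x ≤ 1 / 2 → x < θ → qReal ℓ m x + θ * Real.binEntropy (x / θ) ≤ 0 := by
    intro x hx hx2 hxθ
    by_contra hc
    push Not at hc
    have hxx : x₀ ≤ x := by
      by_contra hxx
      have := hneg x hx (by linarith)
      have h5 := persp_le hx hxθ.le h4
      rw [one_mul, div_one] at h5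
      linarith
    have hcont : ContinuousAt (fun θ : ℝ => qReal ℓ m x + θ * Real.binEntropy (x / θ)) θ := by
      refine continuousAt_const.add (continuousAt_id.mul ?_)
      exact Real.binEntropy_continuous.continuousAt.comp
        (continuousAt_const.div continuousAt_id hθ.ne')
    have hev := (hcont.eventually (lt_mem_nhds hc)).and (lt_mem_nhds hxθ)
    obtain ⟨θ', ⟨hpos, hxθ'⟩, hθ'⟩ := ((hev.filter_mono
      (nhdsWithin_le_nhds (s := Set.Iio θ))).and self_mem_nhdsWithin).exists
    have hθ'' : θ' < θ := hθ'
    have hm' := isMinOn_iff.1 hmin (x, θ') ⟨⟨hxx, hx2, le_of_lt hxθ', by linarith⟩, le_of_lt hpos⟩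
    simp only at hm'
    linarith
  refine ⟨θ, hθ, h4, ⟨x' / θ, ⟨by positivity, (div_lt_one hθ).2 hlt⟩, ?_⟩, ?_⟩
  · have e : x' / θ * θ = x' := by field_simp
    simp only
    rw [erasure_value_eq hm3 hθ (by positivity) (by rw [e]; exact hhalf), e,
      le_antisymm (hall x' hx' hhalf hlt) hval, zero_div, EReal.coe_zero]
  · rintro _ ⟨β, ⟨hβ0, hβ1⟩, rfl⟩
    have hx : 0 < β * θ := by positivity
    have hxθ : β * θ < θ := by nlinarith
    have e : β * θ / θ = β := by field_simp
    simp only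
    rcases le_or_gt (β * θ) (1 / 2) with h | h
    · rw [erasure_value_eq hm3 hθ hβ0 h, ← EReal.coe_zero, EReal.coe_le_coe_iff]
      exact div_nonpos_of_nonpos_of_nonneg (hall _ hx h hxθ) hl.le
    -- The first bound of `qExp_reflect` is settled by the value at `1 - βθ`, and the second by `θ
    -- h(β) ≤ h(βθ) ≤ ℓ h(βθ)`.
    · refine (add_le_add_left (qExp_reflect hm3 h (hxθ.trans_le h4)) _).trans ?_
      rw [← EReal.coe_add, ← EReal.coe_zero, EReal.coe_le_coe_iff, h2, mul_div_assoc', ← add_div]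
      refine div_nonpos_of_nonpos_of_nonneg ?_ hl.le
      have h5 := hall (1 - β * θ) (by linarith) (by linarith) (by linarith)
      have h6 := persp_reflect h.le hxθ.le h4
      have h7 := persp_le hx hxθ.le h4
      have h8 := Real.binEntropy_nonneg hx.le (hxθ.le.trans h4)
      rw [one_mul, div_one] at h7
      rw [e] at h6 h7
      have h9 : (1 : ℝ) ≤ ℓ := by exact_mod_cast (by omega : 1 ≤ ℓ)
      rcases max_choice (qReal ℓ m (1 - β * θ)) (-(ℓ * Real.binEntropy (β * θ))) with hc | hc <;>
        rw [hc] <;> nlinarith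

/-- If `θ < θ'`, the weight `x = βθ` that attains `0` at `θ` has a positive value at `θ'`, because
the perspective of the entropy is strictly increasing in `θ`. -/
theorem existsUnique_isErasureRoot {ℓ m : ℕ} (hℓ : 3 ≤ ℓ) (hm : ℓ ≤ m) :
    ∃! θ, IsErasureRoot ℓ m θ := by
  have hm3 : 3 ≤ m := hℓ.trans hm
  have key : ∀ θ θ', IsErasureRoot ℓ m θ → IsErasureRoot ℓ m θ' → ¬ θ < θ' := by
    rintro θ θ' ⟨h0, h1, ⟨β, ⟨hβ0, hβ1⟩, hβ⟩, -⟩ ⟨h0', h1', -, hup⟩ hlt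
    have hx : 0 < β * θ := by positivity
    have hxθ : β * θ < θ := by nlinarith
    have hle := hup ⟨β * θ / θ', ⟨by positivity, (div_lt_one h0').2 (hxθ.trans hlt)⟩, rfl⟩
    simp only at hβ hle
    rw [div_mul_cancel₀ _ h0'.ne'] at hle
    have hq := persp_lt hx hxθ.le hlt
    rw [mul_div_cancel_right₀ _ h0.ne'] at hq
    have hl : 0 < Real.log 2 := Real.log_pos (by norm_num)
    have hq' : θ * h2 β < θ' * h2 (β * θ / θ') := by
      unfold h2
      rw [mul_div_assoc', mul_div_assoc']
      exact div_lt_div_of_pos_right hq hl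
    generalize qExp ℓ m (β * θ) = q at hβ hle
    induction q using EReal.rec with
    | bot => rw [EReal.bot_add] at hβ; exact EReal.bot_ne_zero hβ
    | coe q =>
      have e1 : q + θ * h2 β = 0 := by exact_mod_cast hβ
      have e2 : q + θ' * h2 (β * θ / θ') ≤ 0 := by exact_mod_cast hle
      linarith
    | top => rw [EReal.top_add_coe] at hβ; exact EReal.top_ne_zero hβ
  obtain ⟨θ, h⟩ := exists_isErasureRoot hℓ hm
  exact ⟨θ, h, fun y hy => le_antisymm (not_lt.1 (key _ _ h hy)) (not_lt.1 (key _ _ hy h))⟩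

/-! ### Binomial coefficients and entropy -/

/-- The binomial distribution with success probability `k/N` has its mode at `k`. In terms of
factorials, `k!/i!` and `(N-i)!/(N-k)!` (for `i ≤ k`, and symmetrically otherwise) are compared with
powers of `k` and `N - k`. -/
theorem choose_mul_pow_le {N k i : ℕ} (hk : k ≤ N) (hi : i ≤ N) :
    N.choose i * (k ^ i * (N - k) ^ (N - i)) ≤ N.choose k * (k ^ k * (N - k) ^ (N - k)) := by
  have hfac : k.factorial * (N - k).factorial * (k ^ i * (N - k) ^ (N - i)) ≤
      i.factorial * (N - i).factorial * (k ^ k * (N - k) ^ (N - k)) := by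
    rcases le_total i k with h | h
    · obtain ⟨d, rfl⟩ := Nat.exists_eq_add_of_le h
      obtain ⟨e, rfl⟩ := Nat.exists_eq_add_of_le hk
      have h1 : (i + d).factorial ≤ i.factorial * (i + d) ^ d := by
        rw [← Nat.factorial_mul_ascFactorial]
        refine Nat.mul_le_mul_left _ ?_
        have := Nat.ascFactorial_le_pow_add i d
        simpa using this
      have h2 : e.factorial * e ^ d ≤ (e + d).factorial :=
        (Nat.mul_le_mul_left _ (Nat.pow_le_pow_left (Nat.le_succ e) d)).trans
          (Nat.factorial_mul_pow_le_factorial)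
      rw [show i + d + e - (i + d) = e by omega, show i + d + e - i = e + d by omega]
      calc (i + d).factorial * e.factorial * ((i + d) ^ i * e ^ (e + d))
          = (i + d).factorial * (e.factorial * e ^ d) * ((i + d) ^ i * e ^ e) := by rw [pow_add]; ring
        _ ≤ (i.factorial * (i + d) ^ d) * (e + d).factorial * ((i + d) ^ i * e ^ e) := by gcongr
        _ = _ := by rw [pow_add (i + d)]; ring
    · obtain ⟨d, rfl⟩ := Nat.exists_eq_add_of_le h
      obtain ⟨e, rfl⟩ := Nat.exists_eq_add_of_le hi
      have h1 : (e + d).factorial ≤ e.factorial * (e + d) ^ d := by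
        rw [← Nat.factorial_mul_ascFactorial]
        refine Nat.mul_le_mul_left _ ?_
        have := Nat.ascFactorial_le_pow_add e d
        simpa using this
      have h2 : k.factorial * k ^ d ≤ (k + d).factorial :=
        (Nat.mul_le_mul_left _ (Nat.pow_le_pow_left (Nat.le_succ k) d)).trans
          (Nat.factorial_mul_pow_le_factorial)
      rw [show k + d + e - k = e + d by omega, show k + d + e - (k + d) = e by omega]
      calc k.factorial * (e + d).factorial * (k ^ (k + d) * (e + d) ^ e)
          = (k.factorial * k ^ d) * (e + d).factorial * (k ^ k * (e + d) ^ e) := by rw [pow_add]; ring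
        _ ≤ (k + d).factorial * (e.factorial * (e + d) ^ d) * (k ^ k * (e + d) ^ e) := by gcongr
        _ = _ := by rw [pow_add (e + d)]; ring
  have e1 := Nat.choose_mul_factorial_mul_factorial hk
  have e2 := Nat.choose_mul_factorial_mul_factorial hi
  have hpos : 0 < k.factorial * (N - k).factorial * (i.factorial * (N - i).factorial) := by positivity
  refine Nat.le_of_mul_le_mul_left ?_ hpos
  calc k.factorial * (N - k).factorial * (i.factorial * (N - i).factorial) *
        (N.choose i * (k ^ i * (N - k) ^ (N - i)))
      = (N.choose i * i.factorial * (N - i).factorial) *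
        (k.factorial * (N - k).factorial * (k ^ i * (N - k) ^ (N - i))) := by ring
    _ ≤ (N.choose i * i.factorial * (N - i).factorial) *
        (i.factorial * (N - i).factorial * (k ^ k * (N - k) ^ (N - k))) := by gcongr
    _ = (N.choose k * k.factorial * (N - k).factorial) *
        (i.factorial * (N - i).factorial * (k ^ k * (N - k) ^ (N - k))) := by rw [e1, e2]
    _ = _ := by ring

/-- The expansion of `(k + (N-k))^N` has `N + 1` terms, of which number `k` is the largest. -/
theorem pow_self_le_choose {N k : ℕ} (hk : k ≤ N) :
    N ^ N ≤ (N + 1) * (N.choose k * (k ^ k * (N - k) ^ (N - k))) := by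
  have h : N ^ N = ∑ i ∈ Finset.range (N + 1), N.choose i * (k ^ i * (N - k) ^ (N - i)) := by
    conv_lhs => rw [← Nat.add_sub_of_le hk]
    rw [add_pow, Nat.add_sub_of_le hk]
    exact Finset.sum_congr rfl fun i _ => by simp; ring
  rw [h]
  refine (Finset.sum_le_card_nsmul _ _ _ fun i hi =>
    choose_mul_pow_le hk (Nat.lt_succ_iff.1 (Finset.mem_range.1 hi))).trans ?_
  simp

theorem exp_mul_entropy {N k : ℕ} (hk : 0 < k) (hkN : k < N) :
    Real.exp (N * Real.binEntropy (k / N)) = (N : ℝ) ^ N / ((k : ℝ) ^ k * ((N - k : ℕ) : ℝ) ^ (N - k)) := by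
  have hN : (0 : ℝ) < N := by exact_mod_cast hk.trans hkN
  have hk' : (0 : ℝ) < k := by exact_mod_cast hk
  have hd : (0 : ℝ) < ((N - k : ℕ) : ℝ) := by exact_mod_cast Nat.sub_pos_of_lt hkN
  rw [← Real.exp_log (show 0 < (N : ℝ) ^ N / ((k : ℝ) ^ k * ((N - k : ℕ) : ℝ) ^ (N - k)) by positivity)]
  congr 1
  rw [Real.log_div (by positivity) (by positivity), Real.log_mul (by positivity) (by positivity),
    Real.log_pow, Real.log_pow, Real.log_pow, Real.binEntropy_eq_negMulLog_add_negMulLog_one_sub,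
    Real.negMulLog, Real.negMulLog]
  have e : 1 - (k : ℝ) / N = ((N - k : ℕ) : ℝ) / N := by
    rw [Nat.cast_sub hkN.le]; field_simp
  rw [e, Real.log_div hk'.ne' hN.ne', Real.log_div hd.ne' hN.ne', Nat.cast_sub hkN.le]
  field_simp
  ring

theorem exp_entropy_le_choose {N k : ℕ} (hk : 0 < k) (hkN : k < N) :
    Real.exp (N * Real.binEntropy (k / N)) ≤ (N + 1) * N.choose k := by
  have hk' : (0 : ℝ) < k := by exact_mod_cast hk
  have hd : (0 : ℝ) < ((N - k : ℕ) : ℝ) := by exact_mod_cast Nat.sub_pos_of_lt hkN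
  rw [exp_mul_entropy hk hkN, div_le_iff₀ (by positivity)]
  have := pow_self_le_choose hkN.le
  calc (N : ℝ) ^ N ≤ ((N + 1) * (N.choose k * (k ^ k * (N - k) ^ (N - k))) : ℕ) := by exact_mod_cast this
    _ = _ := by push_cast; ring

theorem choose_le_exp_entropy {N k : ℕ} (hk : 0 < k) (hkN : k < N) :
    (N.choose k : ℝ) ≤ Real.exp (N * Real.binEntropy (k / N)) := by
  have hk' : (0 : ℝ) < k := by exact_mod_cast hk
  have hd : (0 : ℝ) < ((N - k : ℕ) : ℝ) := by exact_mod_cast Nat.sub_pos_of_lt hkN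
  rw [exp_mul_entropy hk hkN, le_div_iff₀ (by positivity)]
  have : N.choose k * (k ^ k * (N - k) ^ (N - k)) ≤ N ^ N := by
    conv_rhs => rw [← Nat.add_sub_of_le hkN.le]
    rw [add_pow, Nat.add_sub_of_le hkN.le]
    refine le_trans (le_of_eq ?_) (Finset.single_le_sum
      (f := fun i => k ^ i * (N - k) ^ (N - i) * N.choose i) (fun i _ => Nat.zero_le _)
      (Finset.mem_range.2 (Nat.lt_succ_of_lt hkN)))
    ring
  exact_mod_cast this

/-! ### Sets that meet each class evenly -/

theorem sum_even_powerset {β : Type*} (F : Finset β) (s : ℝ) :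
    ∑ T ∈ F.powerset with Even T.card, s ^ T.card = evenPoly F.card s := by
  rw [Finset.sum_filter, Finset.sum_powerset_apply_card (fun j => if Even j then s ^ j else 0),
    evenPoly_eq_sum]
  refine Finset.sum_congr rfl fun k _ => ?_
  split_ifs <;> simp

section Even

variable {α β ρ : Type*} [Fintype α] [DecidableEq α] [Fintype β] [DecidableEq β] [Fintype ρ]
  [DecidableEq ρ]

/-- The sets of `k` elements that meet each class of `cls` in an even number of elements. -/
def evenSets (cls : β → ρ) (k : ℕ) : Finset (Finset β) :=
  {S ∈ Finset.powersetCard k Finset.univ | ∀ i, Even ({x ∈ S | cls x = i}.card)}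

/-- A set is determined by its traces on the classes, so the enumerator of all sets that meet each
class evenly is a product of copies of `P`. Its coefficients are nonnegative, so a single term is at
most the whole value. -/
theorem card_evenSets_mul_le (cls : β → ρ) {m : ℕ} (hm : ∀ i, (Finset.univ.filter fun x => cls x = i).card = m) (k : ℕ)
    {s : ℝ} (hs : 0 < s) :
    ((evenSets cls k).card : ℝ) * s ^ k ≤ evenPoly m s ^ Fintype.card ρ := by
  have h1 : evenPoly m s ^ Fintype.card ρ = ∑ f ∈ Fintype.piFinset (fun i : ρ =>
      {T ∈ ({x | cls x = i} : Finset β).powerset | Even T.card}), ∏ i, s ^ (f i).card := by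
    rw [← Finset.prod_univ_sum _ (fun (_ : ρ) (T : Finset β) => s ^ T.card)]
    simp_rw [sum_even_powerset, hm]
    simp [Finset.card_univ]
  set φ : Finset β → ρ → Finset β := fun S i => {x ∈ S | cls x = i} with hφ
  have hinj : Set.InjOn φ (evenSets cls k) := by
    intro S _ S' _ h
    ext x
    have := congrFun h (cls x)
    have h2 := Finset.ext_iff.1 this x
    simpa [hφ] using h2
  rw [h1, ← nsmul_eq_mul, ← Finset.sum_const]
  calc ∑ _S ∈ evenSets cls k, s ^ k = ∑ S ∈ evenSets cls k, ∏ i, s ^ (φ S i).card := by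
        refine Finset.sum_congr rfl fun S hS => ?_
        rw [Finset.prod_pow_eq_pow_sum]
        congr 1
        simp only [evenSets, Finset.mem_filter, Finset.mem_powersetCard] at hS
        rw [← hS.1.2]
        exact Finset.card_eq_sum_card_fiberwise (fun x _ => Finset.mem_coe.2 (Finset.mem_univ _))
    _ = ∑ f ∈ (evenSets cls k).image φ, ∏ i, s ^ (f i).card :=
        (Finset.sum_image (f := fun f : ρ → Finset β => ∏ i, s ^ (f i).card) hinj).symm
    _ ≤ _ := by
        refine Finset.sum_le_sum_of_subset_of_nonneg ?_ fun f _ _ => by positivity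
        intro f hf
        obtain ⟨S, hS, rfl⟩ := Finset.mem_image.1 hf
        simp only [evenSets, Finset.mem_filter, Finset.mem_powersetCard] at hS
        rw [Fintype.mem_piFinset]
        intro i
        rw [Finset.mem_filter, Finset.mem_powerset]
        refine ⟨fun x hx => ?_, hS.2 i⟩
        simp only [hφ, Finset.mem_filter] at hx
        simp [hx.2]

/-- Under uniform bijections, the image of a `k`-set is a uniform `k`-set. -/
theorem card_equiv_map_mem (T : Finset α) (E : Finset (Finset β)) (hE : ∀ S ∈ E, S.card = T.card) :
    Fintype.card {φ : α ≃ β // T.map φ.toEmbedding ∈ E} * (Fintype.card β).choose T.card =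
      E.card * Fintype.card (α ≃ β) := by
  classical
  set c : Finset β → ℕ := fun S => (Finset.univ.filter fun φ : α ≃ β => T.map φ.toEmbedding = S).card
    with hc
  -- A permutation of `β` that carries `S` to `S'` maps the bijections over `S` injectively to those
  -- over `S'`. So all fibres have the same size.
  have hle : ∀ S S' : Finset β, S.card = S'.card → c S ≤ c S' := by
    intro S S' h
    obtain ⟨e⟩ : Nonempty ({x // x ∈ S} ≃ {x // x ∈ S'}) := ⟨Finset.equivOfCardEq h⟩
    set σ : Equiv.Perm β := e.extendSubtype with hσ
    refine Finset.card_le_card_of_injOn (fun φ => φ.trans σ) ?_ ?_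
    · intro φ hφ
      simp only [Finset.coe_filter, Finset.mem_univ, true_and, Set.mem_ofPred_eq] at hφ ⊢
      have hcomp : T.map (φ.trans σ).toEmbedding = S.map σ.toEmbedding := by
        rw [← hφ, Finset.map_map]; rfl
      rw [hcomp]
      refine Finset.eq_of_subset_of_card_le ?_ (by rw [Finset.card_map, h])
      intro y hy
      obtain ⟨x, hx, rfl⟩ := Finset.mem_map.1 hy
      have := e.extendSubtype_mem x hx
      exact this
    · intro φ _ φ' _ h
      ext x
      have := congrArg (fun ψ : α ≃ β => ψ x) h
      simpa using this
  have hsum : ∀ E' : Finset (Finset β), (∀ S ∈ E', S.card = T.card) →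
      Fintype.card {φ : α ≃ β // T.map φ.toEmbedding ∈ E'} = ∑ S ∈ E', c S := by
    intro E' _
    rw [Fintype.card_subtype]
    rw [Finset.card_eq_sum_card_fiberwise (f := fun φ : α ≃ β => T.map φ.toEmbedding) (t := E')
      (fun φ hφ => by simpa using hφ)]
    refine Finset.sum_congr rfl fun S hS => ?_
    congr 1
    ext φ
    simp only [Finset.mem_filter, Finset.mem_univ, true_and, and_iff_right_iff_imp]
    rintro rfl; exact hS
  rcases E.eq_empty_or_nonempty with rfl | ⟨S₀, hS₀⟩
  · simp
  have hconst : ∀ E' : Finset (Finset β), (∀ S ∈ E', S.card = T.card) →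
      ∑ S ∈ E', c S = E'.card * c S₀ := by
    intro E' hE'
    rw [← smul_eq_mul, ← Finset.sum_const]
    refine Finset.sum_congr rfl fun S hS => ?_
    have : S.card = S₀.card := by rw [hE' S hS, hE S₀ hS₀]
    exact le_antisymm (hle _ _ this) (hle _ _ this.symm)
  have htot : Fintype.card (α ≃ β) = (Fintype.card β).choose T.card * c S₀ := by
    have h1 := hsum (Finset.powersetCard T.card Finset.univ) (fun S hS => (Finset.mem_powersetCard.1 hS).2)
    rw [hconst _ (fun S hS => (Finset.mem_powersetCard.1 hS).2), Finset.card_powersetCard,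
      Finset.card_univ] at h1
    rw [← h1]
    refine (Fintype.card_congr (Equiv.subtypeUnivEquiv fun φ => ?_)).symm
    simp [Finset.mem_powersetCard]
  rw [hsum E hE, hconst E hE, htot]
  ring

/-- The probability that a set is mapped to a set that meets each class evenly. -/
theorem card_equiv_even_le (cls : β → ρ) {m : ℕ} (hm : ∀ i, (Finset.univ.filter fun x => cls x = i).card = m) {N : ℕ}
    (hN : Fintype.card β = N) (hNR : N = Fintype.card ρ * m) (T : Finset α)
    (hT : 0 < T.card) (hTN : T.card < N) {s : ℝ} (hs : 0 < s) :
    (Fintype.card {φ : α ≃ β // ∀ i, Even ({a ∈ T | cls (φ a) = i}.card)} : ℝ) ≤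
      (N + 1) * Real.exp (Fintype.card ρ * lam m s (T.card / N) - N * Real.binEntropy (T.card / N)) *
        Fintype.card (α ≃ β) := by
  set k := T.card with hk
  have h1 : Fintype.card {φ : α ≃ β // ∀ i, Even ({a ∈ T | cls (φ a) = i}.card)} =
      Fintype.card {φ : α ≃ β // T.map φ.toEmbedding ∈ evenSets cls k} := by
    refine Fintype.card_congr (Equiv.subtypeEquivRight fun φ => ?_)
    simp only [evenSets, Finset.mem_filter, Finset.mem_powersetCard, Finset.subset_univ,
      Finset.card_map, true_and, hk]
    refine forall_congr' fun i => ?_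
    rw [Finset.filter_map, Finset.card_map]
    rfl
  have h2 := card_equiv_map_mem T (evenSets cls k) (fun S hS => by
    simp only [evenSets, Finset.mem_filter, Finset.mem_powersetCard] at hS; exact hS.1.2)
  rw [hN, ← hk] at h2
  have h3 := card_evenSets_mul_le cls hm k hs
  have h4 := exp_entropy_le_choose hT hTN
  have hP := evenPoly_pos m hs.le
  have hN0 : (0 : ℝ) < N := by exact_mod_cast hT.trans hTN
  have h5 : Real.exp (Fintype.card ρ * lam m s (k / N)) = evenPoly m s ^ Fintype.card ρ / s ^ k := by
    unfold lam
    have : (Fintype.card ρ : ℝ) * (k / N * m * Real.log s) = k * Real.log s := by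
      have : (N : ℝ) = Fintype.card ρ * m := by exact_mod_cast hNR
      rw [show (Fintype.card ρ : ℝ) * (k / N * m * Real.log s) =
        (Fintype.card ρ * m) * (k / N * Real.log s) by ring, ← this]
      field_simp
    rw [mul_sub, this, Real.exp_sub, ← Real.log_pow, ← Real.log_pow, Real.exp_log (by positivity),
      Real.exp_log (by positivity)]
  rw [h1, Real.exp_sub, h5]
  set X : ℝ := (Fintype.card {φ : α ≃ β // T.map φ.toEmbedding ∈ evenSets cls k} : ℝ)
  have h2' : X * (N.choose k : ℝ) = (evenSets cls k).card * Fintype.card (α ≃ β) := by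
    have := congrArg (Nat.cast : ℕ → ℝ) h2
    push_cast at this
    exact this
  set EE := Real.exp (N * Real.binEntropy (k / N)) with hEE
  have hEpos : 0 < EE := Real.exp_pos _
  have hsk : 0 < s ^ k := by positivity
  have h6 : X * EE * s ^ k ≤ (N + 1) * evenPoly m s ^ Fintype.card ρ * Fintype.card (α ≃ β) := by
    have hX : 0 ≤ X := Nat.cast_nonneg _
    calc X * EE * s ^ k ≤ X * ((N + 1) * N.choose k) * s ^ k := by gcongr
      _ = (N + 1) * (((evenSets cls k).card : ℝ) * s ^ k) * Fintype.card (α ≃ β) := by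
          linear_combination (N + 1) * s ^ k * h2'
      _ ≤ _ := by gcongr
  rw [show (N + 1) * (evenPoly m s ^ Fintype.card ρ / s ^ k / EE) * (Fintype.card (α ≃ β) : ℝ) =
    ((N + 1) * evenPoly m s ^ Fintype.card ρ * Fintype.card (α ≃ β)) / (EE * s ^ k) by field_simp,
    le_div_iff₀ (by positivity)]
  linarith

end Even

/-- The expected number of codewords of weight `w` on `j ≤ θ n` positions is subexponential. -/
theorem IsErasureRoot.exists_choose_mul_exp_le_one {ℓ m : ℕ} (hm : 3 ≤ m) {θ : ℝ}
    (h : IsErasureRoot ℓ m θ) {n j w : ℕ} (hw : 0 < w) (hwj : w < j) (hj : (j : ℝ) ≤ θ * n) :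
    ∃ s : ℝ, 0 < s ∧ (j.choose w : ℝ) * Real.exp (n * qNat ℓ m s (w / n)) ≤ 1 := by
  have hj0 : (0 : ℝ) < j := by exact_mod_cast hw.trans hwj
  have hw0 : (0 : ℝ) < w := by exact_mod_cast hw
  have hwj' : (w : ℝ) < j := by exact_mod_cast hwj
  have hn0 : (0 : ℝ) < n := by
    rcases (Nat.cast_nonneg n : (0 : ℝ) ≤ n).eq_or_lt with h0 | h0
    · rw [← h0, mul_zero] at hj; linarith
    · exact h0
  set x : ℝ := w / n with hxdef
  have hx : 0 < x := by positivity
  have hjn : (j : ℝ) / n ≤ θ := by rw [div_le_iff₀ hn0]; exact hj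
  have hxj : x < j / n := by rw [hxdef]; gcongr
  have hxθ : x < θ := hxj.trans_le hjn
  have hC : (j.choose w : ℝ) ≤ Real.exp (n * (θ * Real.binEntropy (x / θ))) := by
    refine (choose_le_exp_entropy hw hwj).trans (Real.exp_le_exp.2 ?_)
    have := persp_le hx hxj.le hjn
    have e : x / (j / n) = w / j := by rw [hxdef]; field_simp
    rw [e] at this
    calc (j : ℝ) * Real.binEntropy (w / j) = n * (j / n * Real.binEntropy (w / j)) := by field_simp
      _ ≤ _ := by gcongr
  obtain ⟨s, hs, hval⟩ : ∃ s : ℝ, 0 < s ∧ θ * Real.binEntropy (x / θ) + qNat ℓ m s x ≤ 0 := by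
    rcases le_or_gt x (1 / 2) with h2 | h2
    · obtain ⟨t, ht, _⟩ := exists_isTRoot_le_one hm hx h2
      refine ⟨t, ht.1, ?_⟩
      rw [← ht.qReal_eq hm hx]
      linarith [h.exponent_nonpos hm hx h2 hxθ]
    -- Above `1/2`, the inverse of the root for `1 - x` serves as tilt.
    · have hθ1 := h.2.1
      obtain ⟨t, ht, ht1⟩ := exists_isTRoot_le_one hm (x := 1 - x) (by linarith) (by linarith)
      refine ⟨t⁻¹, inv_pos.2 ht.1, ?_⟩
      have h3 := lam_inv_le (m := m) (x := x) ht.1 ht1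
      have h4 := h.exponent_nonpos hm (x := 1 - x) (by linarith) (by linarith) (by linarith)
      have h5 := persp_reflect h2.le hxθ.le hθ1
      rw [ht.qReal_eq hm (by linarith)] at h4
      unfold qNat at *
      rw [Real.binEntropy_one_sub] at h4
      have := mul_le_mul_of_nonneg_left h3 (show 0 ≤ (ℓ / m : ℝ) by positivity)
      linarith
  refine ⟨s, hs, ?_⟩
  calc (j.choose w : ℝ) * Real.exp (n * qNat ℓ m s x)
      ≤ Real.exp (n * (θ * Real.binEntropy (x / θ))) * Real.exp (n * qNat ℓ m s x) := by gcongr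
    _ = Real.exp (n * (θ * Real.binEntropy (x / θ) + qNat ℓ m s x)) := by rw [← Real.exp_add]; ring_nf
    _ ≤ 1 := Real.exp_le_one_iff.2 (mul_nonpos_of_nonneg_of_nonpos hn0.le hval)

/-! ### Cyclic windows and the codewords outside of them -/

/-- Position `j` belongs to the cyclic window of length `a` that starts at `s`. -/
def InWindow (n a s j : ℕ) : Prop := (s ≤ j ∧ j < s + a) ∨ j + n < s + a

instance (n a s j : ℕ) : Decidable (InWindow n a s j) := by unfold InWindow; infer_instance

/-- The positions outside of a cyclic window. -/
def offWindow (n a s : ℕ) : Finset (Fin n) := {j | ¬ InWindow n a s j}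

theorem card_offWindow_le {n a s : ℕ} (ha : a ≤ n) :
    (offWindow n a s).card ≤ n - a := by
  have h1 : (offWindow n a s).card =
      ((Finset.range n).filter fun j => ¬ InWindow n a s j).card := by
    refine Finset.card_bij (fun j _ => (j : ℕ)) ?_ ?_ ?_
    · intro j hj; simpa [offWindow] using hj
    · intro j _ j' _ h; exact Fin.ext h
    · intro b hb
      rw [Finset.mem_filter, Finset.mem_range] at hb
      exact ⟨⟨b, hb.1⟩, by simpa [offWindow] using hb.2, rfl⟩
  rw [h1]
  rcases le_or_gt (s + a) n with h | h
  · have : (Finset.range n).filter (fun j => ¬ InWindow n a s j) ⊆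
        Finset.range s ∪ Finset.Ico (s + a) n := by
      intro j hj
      rw [Finset.mem_filter, Finset.mem_range] at hj
      rw [Finset.mem_union, Finset.mem_range, Finset.mem_Ico]
      unfold InWindow at hj
      omega
    refine (Finset.card_le_card this).trans ((Finset.card_union_le _ _).trans ?_)
    simp; omega
  · have : (Finset.range n).filter (fun j => ¬ InWindow n a s j) ⊆ Finset.Ico (s + a - n) s := by
      intro j hj
      rw [Finset.mem_filter, Finset.mem_range] at hj
      rw [Finset.mem_Ico]
      unfold InWindow at hj
      omega
    refine (Finset.card_le_card this).trans ?_
    simp; omega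

/-- The supports of the codewords that vanish outside of `J`. -/
def wordsIn {r n : ℕ} (H : Matrix (Fin r) (Fin n) (ZMod 2)) (J : Finset (Fin n)) :
    Finset (Finset (Fin n)) :=
  {T ∈ J.powerset | ∀ i, ∑ j ∈ T, H i j = 0}

/-- Few codewords vanish on any cyclic window of length `a`. -/
def Sparse {r n : ℕ} (H : Matrix (Fin r) (Fin n) (ZMod 2)) (a : ℕ) : Prop :=
  ∀ s < n, (wordsIn H (offWindow n a s)).card ≤ 2 ^ Nat.sqrt n

/-! ### First moments and Markov's inequality over all windows -/

section Markov

variable {Ω : Type*} [Fintype Ω] {r n : ℕ}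

-- The expectation is summed by weights. By the choice of `θ` each weight strictly between `0` and
-- `|J|` contributes at most `K`. The two extreme weights belong to one set each and are bounded by
-- probability one, which explains the `2`.
open scoped Classical in
theorem sum_card_wordsIn_le {ℓ m : ℕ} (hm : 3 ≤ m) {θ : ℝ} (hθ : IsErasureRoot ℓ m θ)
    (M : Ω → Matrix (Fin r) (Fin n) (ZMod 2)) {K : ℝ} (hK : 0 ≤ K)
    (hM : ∀ T : Finset (Fin n), 0 < T.card → T.card < n → ∀ s : ℝ, 0 < s →
      ((Finset.univ.filter fun ω => ∀ i, ∑ j ∈ T, M ω i j = 0).card : ℝ) ≤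
        K * Real.exp (n * qNat ℓ m s (T.card / n)) * Fintype.card Ω)
    (J : Finset (Fin n)) (hJ : (J.card : ℝ) ≤ θ * n) :
    (∑ ω, ((wordsIn (M ω) J).card : ℝ)) ≤ (2 + n * K) * Fintype.card Ω := by
  set c : Finset (Fin n) → ℝ := fun T =>
    ((Finset.univ.filter fun ω => ∀ i, ∑ j ∈ T, M ω i j = 0).card : ℝ) with hc
  have htriv : ∀ T, c T ≤ Fintype.card Ω := fun T => by
    simp only [hc]; exact_mod_cast Finset.card_le_univ _
  have h1 : (∑ ω, ((wordsIn (M ω) J).card : ℝ)) = ∑ T ∈ J.powerset, c T := by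
    have := Finset.sum_card_bipartiteAbove_eq_sum_card_bipartiteBelow
      (s := (Finset.univ : Finset Ω)) (t := J.powerset) fun ω T => ∀ i, ∑ j ∈ T, M ω i j = 0
    simp only [hc]
    exact_mod_cast this
  rw [h1, Finset.sum_powerset]
  have hjn : J.card ≤ n := by simpa using Finset.card_le_univ J
  have hlayer : ∀ w ∈ Finset.range (J.card + 1), ∑ T ∈ J.powersetCard w, c T ≤
      ((if w = 0 then 1 else 0) + (if w = J.card then 1 else 0) + (if w = 0 then 0 else K)) *
        Fintype.card Ω := by
    intro w hw
    have hw' : w ≤ J.card := Nat.lt_succ_iff.1 (Finset.mem_range.1 hw)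
    by_cases h0 : w = 0 ∨ w = J.card
    · have : (∑ T ∈ J.powersetCard w, c T) ≤ Fintype.card Ω := by
        have hcard : (J.powersetCard w).card = 1 := by
          rw [Finset.card_powersetCard]; rcases h0 with rfl | rfl <;> simp
        refine (Finset.sum_le_card_nsmul _ _ _ fun T _ => htriv T).trans ?_
        rw [hcard, one_smul]
      refine this.trans (le_mul_of_one_le_left (Nat.cast_nonneg _) ?_)
      rcases h0 with h0 | h0
      · rw [if_pos h0, if_pos h0]; split_ifs <;> norm_num
      · rw [if_pos h0]; split_ifs <;> linarith
    · push Not at h0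
      rw [if_neg h0.1, if_neg h0.2, if_neg h0.1]
      have hwj : w < J.card := lt_of_le_of_ne hw' h0.2
      obtain ⟨s, hs, hle⟩ := hθ.exists_choose_mul_exp_le_one hm (Nat.pos_of_ne_zero h0.1) hwj hJ
      have : ∀ T ∈ J.powersetCard w, c T ≤ K * Real.exp (n * qNat ℓ m s (w / n)) * Fintype.card Ω := by
        intro T hT
        have hTc := (Finset.mem_powersetCard.1 hT).2
        have := hM T (by omega) (by omega) s hs
        rwa [hTc] at this
      refine (Finset.sum_le_card_nsmul _ _ _ this).trans ?_
      rw [Finset.card_powersetCard, nsmul_eq_mul]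
      calc (J.card.choose w : ℝ) * (K * Real.exp (n * qNat ℓ m s (w / n)) * Fintype.card Ω)
          = ((J.card.choose w : ℝ) * Real.exp (n * qNat ℓ m s (w / n))) * (K * Fintype.card Ω) := by
            ring
        _ ≤ 1 * (K * Fintype.card Ω) := by gcongr
        _ = _ := by ring
  refine (Finset.sum_le_sum hlayer).trans ?_
  rw [← Finset.sum_mul]
  refine mul_le_mul_of_nonneg_right ?_ (Nat.cast_nonneg _)
  rw [Finset.sum_add_distrib, Finset.sum_add_distrib, Finset.sum_ite_eq', Finset.sum_ite_eq',
    Finset.sum_range_succ']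
  simp only [Finset.mem_range, Nat.succ_ne_zero, if_true, if_false]
  rw [if_pos (by omega), if_pos (by omega), Finset.sum_const, Finset.card_range, nsmul_eq_mul]
  have : (J.card : ℝ) * K ≤ n * K := by gcongr
  linarith

-- A matrix that is not sparse has more than `2^√n` words off some window, so Markov's inequality
-- applies to the sum over all `n` windows.
open scoped Classical in
theorem card_not_sparse_le {ℓ m : ℕ} (hm : 3 ≤ m) {θ : ℝ} (hθ : IsErasureRoot ℓ m θ)
    (M : Ω → Matrix (Fin r) (Fin n) (ZMod 2)) {K : ℝ} (hK : 0 ≤ K)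
    (hM : ∀ T : Finset (Fin n), 0 < T.card → T.card < n → ∀ s : ℝ, 0 < s →
      ((Finset.univ.filter fun ω => ∀ i, ∑ j ∈ T, M ω i j = 0).card : ℝ) ≤
        K * Real.exp (n * qNat ℓ m s (T.card / n)) * Fintype.card Ω)
    {a : ℕ} (han : a ≤ n) (ha : ((n - a : ℕ) : ℝ) ≤ θ * n) :
    ((Finset.univ.filter fun ω => ¬ Sparse (M ω) a).card : ℝ) * 2 ^ Nat.sqrt n ≤
      n * (2 + n * K) * Fintype.card Ω := by
  have h1 : ∀ ω ∈ Finset.univ.filter (fun ω => ¬ Sparse (M ω) a), (2 : ℝ) ^ Nat.sqrt n ≤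
      ∑ s ∈ Finset.range n, ((wordsIn (M ω) (offWindow n a s)).card : ℝ) := by
    intro ω hω
    rw [Finset.mem_filter] at hω
    have := hω.2
    unfold Sparse at this
    push Not at this
    obtain ⟨s, hs, hlt⟩ := this
    refine le_trans ?_ (Finset.single_le_sum
      (f := fun s => ((wordsIn (M ω) (offWindow n a s)).card : ℝ))
      (fun _ _ => Nat.cast_nonneg _) (Finset.mem_range.2 hs))
    exact_mod_cast hlt.le
  rw [← nsmul_eq_mul, ← Finset.sum_const]
  refine (Finset.sum_le_sum h1).trans ?_
  refine (Finset.sum_le_sum_of_subset_of_nonneg (Finset.filter_subset _ _)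
    fun _ _ _ => Finset.sum_nonneg fun _ _ => Nat.cast_nonneg _).trans ?_
  rw [Finset.sum_comm]
  refine (Finset.sum_le_card_nsmul _ _ ((2 + n * K) * Fintype.card Ω) fun s _ => ?_).trans ?_
  · refine sum_card_wordsIn_le hm hθ M hK hM _ (le_trans ?_ ha)
    exact_mod_cast card_offWindow_le (s := s) han
  · rw [Finset.card_range, nsmul_eq_mul, mul_assoc]

end Markov

/-- With `q = ⌊√n⌋` one has `n + 1 ≤ (q+1)² ≤ (2q)²`, and a polynomial in `q` is eventually below
`2^q`. -/
theorem exists_poly_le_two_pow_sqrt (K : ℝ) (hK : 0 ≤ K) (e : ℕ) (κ : ℝ) (hκ : 0 < κ) :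
    ∃ N : ℕ, ∀ n : ℕ, N ≤ n →
      (n : ℝ) * (2 + n * (K * (n + 1 : ℝ) ^ e)) ≤ κ * 2 ^ Nat.sqrt n := by
  have ht := tendsto_pow_const_div_const_pow_of_one_lt (2 * (e + 2)) (one_lt_two (α := ℝ))
  have hpos : 0 < κ / ((2 + K) * 2 ^ (2 * (e + 2))) := by positivity
  obtain ⟨N, hN⟩ := Filter.eventually_atTop.1 (ht.eventually (gt_mem_nhds hpos))
  refine ⟨(N + 1) ^ 2, fun n hn => ?_⟩
  set q := Nat.sqrt n with hq
  have hqN : N + 1 ≤ q := by rw [hq, Nat.le_sqrt]; nlinarith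
  have hnq : n + 1 ≤ (q + 1) ^ 2 := by
    have := Nat.lt_succ_sqrt n
    rw [← hq] at this
    simp only [Nat.succ_eq_add_one] at this
    nlinarith
  have hq1 : (1 : ℝ) ≤ q := by exact_mod_cast (by omega : 1 ≤ q)
  have h := hN q (by omega)
  rw [div_lt_div_iff₀ (by positivity) (by positivity)] at h
  have hn1 : ((n : ℝ) + 1) ≤ (2 * q) ^ 2 := by
    have : ((n : ℝ) + 1) ≤ (q + 1) ^ 2 := by exact_mod_cast hnq
    nlinarith
  have hn0 : (0 : ℝ) ≤ n := Nat.cast_nonneg n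
  have h1 : (1 : ℝ) ≤ (n + 1 : ℝ) ^ e := one_le_pow₀ (by linarith)
  calc (n : ℝ) * (2 + n * (K * (n + 1 : ℝ) ^ e))
      ≤ (n + 1) * (2 * ((n + 1) * (n + 1) ^ e) + (n + 1) * (K * (n + 1 : ℝ) ^ e)) := by
        gcongr
        · linarith
        · nlinarith
        · linarith
    _ = (2 + K) * (n + 1 : ℝ) ^ (e + 2) := by ring
    _ ≤ (2 + K) * ((2 * q) ^ 2) ^ (e + 2) := by gcongr
    _ = ((q : ℝ) ^ (2 * (e + 2))) * ((2 + K) * 2 ^ (2 * (e + 2))) := by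
        rw [← pow_mul, mul_pow]; ring
    _ ≤ _ := h.le

/-! ### Gallager's ensemble -/

theorem sum_ite_eq_zero_iff_even {α : Type*} (T : Finset α) (p : α → Prop) [DecidablePred p] :
    ∑ j ∈ T, (if p j then (1 : ZMod 2) else 0) = 0 ↔ Even ({j ∈ T | p j}.card) := by
  rw [Finset.sum_boole, ZMod.natCast_eq_zero_iff_even]

theorem card_modNat_fiber (m s : ℕ) (i : Fin s) :
    (Finset.univ.filter fun x : Fin (m * s) => x.modNat = i).card = m := by
  rw [← Finset.card_map finProdFinEquiv.symm.toEmbedding]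
  have : (Finset.univ.filter fun x : Fin (m * s) => x.modNat = i).map
      finProdFinEquiv.symm.toEmbedding = Finset.univ ×ˢ {i} := by
    ext ⟨a, b⟩
    simp only [Finset.mem_map, Finset.mem_filter, Finset.mem_univ, true_and, Finset.mem_product,
      Finset.mem_singleton]
    constructor
    · rintro ⟨x, hx, hxe⟩
      rw [← hx]
      exact (congrArg Prod.snd hxe).symm
    · rintro rfl
      refine ⟨finProdFinEquiv (a, b), ?_, by simp⟩
      have := finProdFinEquiv.symm_apply_apply (a, b)
      exact congrArg Prod.snd this
  rw [this]
  simp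

/-- The blocks are permuted independently, so the probability is the `ℓ`-th power of that for one
block, whose checks are the classes of `modNat`. The exponents add up to `n` times `qNat`. -/
theorem gallager_even_le {ℓ m s : ℕ} (hm : 1 ≤ m) (T : Finset (Fin (m * s))) (hT : 0 < T.card)
    (hTn : T.card < m * s) {u : ℝ} (hu : 0 < u) :
    ((Finset.univ.filter fun π : Fin ℓ → Equiv.Perm (Fin (m * s)) =>
        ∀ i, ∑ j ∈ T, gallagerMatrix ℓ m s π i j = 0).card : ℝ) ≤
      ((m * s : ℕ) + 1 : ℝ) ^ ℓ * Real.exp ((m * s : ℕ) * qNat ℓ m u (T.card / (m * s : ℕ))) *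
        Fintype.card (Fin ℓ → Equiv.Perm (Fin (m * s))) := by
  have h1 : (Finset.univ.filter fun π : Fin ℓ → Equiv.Perm (Fin (m * s)) =>
        ∀ i, ∑ j ∈ T, gallagerMatrix ℓ m s π i j = 0).card =
      (Fintype.card {φ : Equiv.Perm (Fin (m * s)) //
        ∀ i : Fin s, Even ({a ∈ T | (φ a).modNat = i}.card)}) ^ ℓ := by
    rw [← Fintype.card_subtype]
    conv_rhs => rw [← Fintype.card_fin ℓ, ← Fintype.card_fun]
    refine Fintype.card_congr ((Equiv.subtypeEquivRight fun π => ?_).trans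
      (Equiv.subtypePiEquivPi (p := fun _ (φ : Equiv.Perm (Fin (m * s))) =>
        ∀ i : Fin s, Even ({a ∈ T | (φ a).modNat = i}.card))))
    constructor
    · intro h b i
      have := h (finProdFinEquiv (b, i))
      have e := finProdFinEquiv.symm_apply_apply (b, i)
      have e1 : (finProdFinEquiv (b, i)).divNat = b := congrArg Prod.fst e
      have e2 : (finProdFinEquiv (b, i)).modNat = i := congrArg Prod.snd e
      simp only [gallagerMatrix, Matrix.of_apply, e1, e2] at this
      exact (sum_ite_eq_zero_iff_even T _).1 this
    · intro h i
      simp only [gallagerMatrix, Matrix.of_apply]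
      exact (sum_ite_eq_zero_iff_even T _).2 (h _ _)
  have h2 := card_equiv_even_le (α := Fin (m * s)) (fun x : Fin (m * s) => x.modNat) (card_modNat_fiber m s)
    (N := m * s) (by simp) (by simp [mul_comm]) T hT hTn hu
  rw [h1, Nat.cast_pow]
  refine (pow_le_pow_left₀ (Nat.cast_nonneg _) (le_trans (le_of_eq (by congr!)) h2) ℓ).trans (le_of_eq ?_)
  rw [mul_pow, mul_pow, ← Real.exp_nat_mul, Fintype.card_fun, Fintype.card_fin, Fintype.card_fin,
    Nat.cast_pow]
  congr 3
  unfold qNat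
  have hm' : (m : ℝ) ≠ 0 := by positivity
  push_cast
  field_simp

/-- The window length `n - ⌊θ n⌋`. -/
noncomputable def winLen (θ : ℝ) (n : ℕ) : ℕ := n - ⌊θ * n⌋₊

theorem winLen_spec {θ : ℝ} (h0 : 0 < θ) (h1 : θ ≤ 1) (n : ℕ) :
    winLen θ n ≤ n ∧ ((n - winLen θ n : ℕ) : ℝ) ≤ θ * n ∧ (winLen θ n : ℝ) ≤ (1 - θ) * n + 1 := by
  have hn : (0 : ℝ) ≤ n := Nat.cast_nonneg n
  have hf : ⌊θ * n⌋₊ ≤ n := by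
    refine Nat.floor_le_of_le ?_
    nlinarith
  refine ⟨Nat.sub_le _ _, ?_, ?_⟩
  · rw [winLen, Nat.sub_sub_self hf]; exact Nat.floor_le (by positivity)
  · rw [winLen, Nat.cast_sub hf]
    have := Nat.lt_floor_add_one (θ * n)
    linarith

theorem mostB_sparse {ℓ m : ℕ} (hm : 3 ≤ m) {θ : ℝ} (hθ : IsErasureRoot ℓ m θ) :
    MostB ℓ m fun _ n H => Sparse H (winLen θ n) := by
  intro κ hκ
  obtain ⟨N, hN⟩ := exists_poly_le_two_pow_sqrt 1 zero_le_one ℓ κ hκ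
  refine ⟨N, fun s hs => ?_⟩
  classical
  set n := m * s with hn
  have hw := winLen_spec hθ.1 hθ.2.1 n
  have h1 := card_not_sparse_le hm hθ (fun π : Fin ℓ → Equiv.Perm (Fin n) => gallagerMatrix ℓ m s π)
    (K := (n + 1 : ℝ) ^ ℓ) (by positivity)
    (fun T hT hTn u hu => gallager_even_le (by omega) T hT hTn hu) hw.1 hw.2.1
  have h2 := hN n (hs.trans (by rw [hn]; nlinarith))
  rw [one_mul] at h2
  have h3 : ((Finset.univ.filter fun π : Fin ℓ → Equiv.Perm (Fin n) =>
      ¬ Sparse (gallagerMatrix ℓ m s π) (winLen θ n)).card : ℝ) ≤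
      κ * Fintype.card (Fin ℓ → Equiv.Perm (Fin n)) := by
    have hp : (0 : ℝ) < 2 ^ Nat.sqrt n := by positivity
    refine le_of_mul_le_mul_right (h1.trans ?_) hp
    have := mul_le_mul_of_nonneg_right h2
      (Nat.cast_nonneg (α := ℝ) (Fintype.card (Fin ℓ → Equiv.Perm (Fin n))))
    linarith
  have h4 := Finset.card_filter_add_card_filter_not (s := Finset.univ)
    (fun π : Fin ℓ → Equiv.Perm (Fin n) => Sparse (gallagerMatrix ℓ m s π) (winLen θ n))
  have h5 : {π : Fin ℓ → Equiv.Perm (Fin n) | Sparse (gallagerMatrix ℓ m s π) (winLen θ n)}.ncard =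
      (Finset.univ.filter fun π : Fin ℓ → Equiv.Perm (Fin n) =>
        Sparse (gallagerMatrix ℓ m s π) (winLen θ n)).card := by
    rw [← Set.ncard_coe_finset]; congr 1; ext; simp
  rw [h5, Nat.card_eq_fintype_card]
  rw [Finset.card_univ] at h4
  have h6 : ((Finset.univ.filter fun π : Fin ℓ → Equiv.Perm (Fin n) =>
      Sparse (gallagerMatrix ℓ m s π) (winLen θ n)).card : ℝ) +
      (Finset.univ.filter fun π : Fin ℓ → Equiv.Perm (Fin n) =>
      ¬ Sparse (gallagerMatrix ℓ m s π) (winLen θ n)).card =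
      Fintype.card (Fin ℓ → Equiv.Perm (Fin n)) := by exact_mod_cast h4
  linarith

/-! ### The configuration model of ensemble `A` -/

/-- A configuration matches the sockets of the columns with the sockets of the rows. -/
abbrev Config (ℓ m r n : ℕ) : Type := (Fin n × Fin ℓ) ≃ (Fin r × Fin m)

namespace Config

variable {ℓ m r n : ℕ}

/-- The sockets of a column are matched with different rows. -/
def Simple (φ : Config ℓ m r n) : Prop :=
  ∀ p q : Fin n × Fin ℓ, p.1 = q.1 → (φ p).1 = (φ q).1 → p = q

instance (φ : Config ℓ m r n) : Decidable φ.Simple := by unfold Simple; infer_instance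

/-- The matrix of a configuration. -/
def mat (φ : Config ℓ m r n) : Matrix (Fin r) (Fin n) (ZMod 2) :=
  Matrix.of fun i j => if ∃ a, (φ (j, a)).1 = i then 1 else 0

theorem mat_apply (φ : Config ℓ m r n) (i : Fin r) (j : Fin n) :
    φ.mat i j = if ∃ a, (φ (j, a)).1 = i then 1 else 0 := rfl

theorem mat_ne_zero_iff (φ : Config ℓ m r n) (i : Fin r) (j : Fin n) :
    φ.mat i j ≠ 0 ↔ ∃ a, (φ (j, a)).1 = i := by
  rw [mat_apply]; split_ifs with h <;> simp [h]

theorem Simple.mat_mem {φ : Config ℓ m r n} (h : φ.Simple) : φ.mat ∈ ensembleA ℓ m r n := by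
  constructor
  · intro j
    unfold hammingNorm
    simp_rw [mat_ne_zero_iff]
    have : (Finset.univ.filter fun i => ∃ a, (φ (j, a)).1 = i) =
        Finset.univ.image fun a => (φ (j, a)).1 := by ext; simp
    rw [this, Finset.card_image_of_injective, Finset.card_univ, Fintype.card_fin]
    intro a b hab
    exact congrArg Prod.snd (h (j, a) (j, b) rfl hab)
  · intro i
    unfold hammingNorm
    simp_rw [mat_ne_zero_iff]
    have : (Finset.univ.filter fun j => ∃ a, (φ (j, a)).1 = i) =
        Finset.univ.image fun b => (φ.symm (i, b)).1 := by
      ext j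
      simp only [Finset.mem_filter, Finset.mem_univ, true_and, Finset.mem_image]
      constructor
      · rintro ⟨a, rfl⟩
        exact ⟨(φ (j, a)).2, by simp⟩
      · rintro ⟨b, rfl⟩
        exact ⟨(φ.symm (i, b)).2, by simp⟩
    rw [this, Finset.card_image_of_injective, Finset.card_univ, Fintype.card_fin]
    intro b b' hb
    have := h (φ.symm (i, b)) (φ.symm (i, b')) hb (by simp)
    simpa using this

/-- `mat` records a multiple edge only once. Simplicity makes the projection from sockets to columns
injective within each row, so that a matrix row sum becomes a number of sockets. -/
theorem Simple.even_iff {φ : Config ℓ m r n} (h : φ.Simple) (T : Finset (Fin n)) (i : Fin r) :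
    ∑ j ∈ T, φ.mat i j = 0 ↔
      Even ({p ∈ T ×ˢ (Finset.univ : Finset (Fin ℓ)) | (φ p).1 = i}.card) := by
  simp_rw [mat_apply]
  rw [sum_ite_eq_zero_iff_even]
  have : ({j ∈ T | ∃ a, (φ (j, a)).1 = i}) =
      ({p ∈ T ×ˢ (Finset.univ : Finset (Fin ℓ)) | (φ p).1 = i}).image Prod.fst := by
    ext j
    simp
  rw [this, Finset.card_image_of_injOn]
  intro p hp q hq hpq
  simp only [Finset.coe_filter, Set.mem_ofPred_eq] at hp hq
  exact h p q hpq (hp.2.trans hq.2.symm)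

theorem exists_simple_mat_eq (hrm : r * m = ℓ * n) {H : Matrix (Fin r) (Fin n) (ZMod 2)}
    (hH : H ∈ ensembleA ℓ m r n) : ∃ φ : Config ℓ m r n, φ.Simple ∧ φ.mat = H := by
  obtain ⟨hc, hr⟩ := hH
  have ec : ∀ j, Nonempty (Fin ℓ ≃ {i // H i j ≠ 0}) := fun j => by
    refine ⟨Fintype.equivOfCardEq ?_⟩
    rw [Fintype.card_fin, Fintype.card_subtype, ← hc j]; rfl
  have er : ∀ i, Nonempty ({j // H i j ≠ 0} ≃ Fin m) := fun i => by
    refine ⟨Fintype.equivOfCardEq ?_⟩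
    rw [Fintype.card_fin, Fintype.card_subtype, ← hr i]; rfl
  obtain ⟨e⟩ : Nonempty (∀ j, Fin ℓ ≃ {i // H i j ≠ 0}) := ⟨fun j => (ec j).some⟩
  obtain ⟨f⟩ : Nonempty (∀ i, {j // H i j ≠ 0} ≃ Fin m) := ⟨fun i => (er i).some⟩
  set F : Fin n × Fin ℓ → Fin r × Fin m := fun p =>
    ((e p.1 p.2).1, f (e p.1 p.2).1 ⟨p.1, (e p.1 p.2).2⟩) with hF
  have hinj : Function.Injective F := by
    rintro ⟨j, a⟩ ⟨j', a'⟩ h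
    simp only [hF, Prod.mk.injEq] at h
    obtain ⟨h1, h2⟩ := h
    have hj : j = j' := by
      have key : ∀ (i i' : Fin r) (hi : i = i') (x : {j // H i j ≠ 0}) (y : {j // H i' j ≠ 0}),
          f i x = f i' y → x.1 = y.1 := by
        rintro i _ rfl x y hxy
        rw [(f i).injective hxy]
      exact key _ _ h1 _ _ h2
    subst hj
    have := (e j).injective (Subtype.ext h1)
    rw [this]
  have hbij : Function.Bijective F := by
    rw [Fintype.bijective_iff_injective_and_card]
    refine ⟨hinj, ?_⟩
    simp [hrm, mul_comm]
  have hφ : ∀ j a, (Equiv.ofBijective F hbij (j, a)).1 = (e j a).1 := fun j a => rfl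
  refine ⟨Equiv.ofBijective F hbij, ?_, ?_⟩
  · rintro ⟨j, a⟩ ⟨j', b⟩ hj hab
    simp only at hj
    subst hj
    rw [hφ, hφ] at hab
    rw [(e j).injective (Subtype.ext hab)]
  · ext i j
    rw [mat_apply]
    simp_rw [hφ]
    split_ifs with h
    · obtain ⟨a, rfl⟩ := h
      have := (e j a).2
      generalize H (↑(e j a)) j = x at this
      revert this; revert x; decide
    · by_contra hne
      refine h ⟨(e j).symm ⟨i, fun h0 => hne h0.symm⟩, by simp⟩

/-- Permutations of the sockets of each vertex. -/
abbrev FiberPerm (α β : Type*) : Type _ := {κ : Equiv.Perm (α × β) // ∀ p, (κ p).1 = p.1}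

/-- The permutations of sockets within columns and within rows act simply transitively on the simple
configurations of `H`. Their number thus does not depend on `H`, and a uniform simple configuration
gives a uniform matrix of the ensemble. -/
theorem card_fiber {H : Matrix (Fin r) (Fin n) (ZMod 2)} {φ₀ : Config ℓ m r n} (h0 : φ₀.Simple)
    (h0H : φ₀.mat = H) :
    Fintype.card {φ : Config ℓ m r n // φ.Simple ∧ φ.mat = H} =
      Fintype.card (FiberPerm (Fin n) (Fin ℓ) × FiberPerm (Fin r) (Fin m)) := by
  symm
  have hmem : ∀ (κ : FiberPerm (Fin n) (Fin ℓ)) (ρ : FiberPerm (Fin r) (Fin m)),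
      Simple (ℓ := ℓ) (m := m) (r := r) (n := n) (κ.1.trans (φ₀.trans ρ.1)) ∧
      mat (ℓ := ℓ) (m := m) (r := r) (n := n) (κ.1.trans (φ₀.trans ρ.1)) = H := by
    intro κ ρ
    constructor
    · intro p q hpq hrow
      simp only [Equiv.trans_apply, ρ.2] at hrow
      exact κ.1.injective (h0 _ _ (by rw [κ.2, κ.2, hpq]) hrow)
    · rw [← h0H]
      ext i j
      rw [mat_apply, mat_apply]
      congr 1
      simp only [Equiv.trans_apply, ρ.2, eq_iff_iff]
      constructor
      · rintro ⟨a, ha⟩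
        refine ⟨(κ.1 (j, a)).2, ?_⟩
        rwa [show (j, (κ.1 (j, a)).2) = κ.1 (j, a) from Prod.ext (κ.2 (j, a)).symm rfl]
      · rintro ⟨a, ha⟩
        have h1 : (κ.1.symm (j, a)).1 = j := by
          have := κ.2 (κ.1.symm (j, a))
          rw [Equiv.apply_symm_apply] at this
          exact this.symm
        refine ⟨(κ.1.symm (j, a)).2, ?_⟩
        rw [show (j, (κ.1.symm (j, a)).2) = κ.1.symm (j, a) from Prod.ext h1.symm rfl,
          Equiv.apply_symm_apply]
        exact ha
  refine Fintype.card_of_bijective (f := fun x => (⟨_, hmem x.1 x.2⟩ :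
    {φ : Config ℓ m r n // φ.Simple ∧ φ.mat = H})) ⟨?_, ?_⟩
  · rintro ⟨κ, ρ⟩ ⟨κ', ρ'⟩ h
    have h1 : ∀ p, ρ.1 (φ₀ (κ.1 p)) = ρ'.1 (φ₀ (κ'.1 p)) := fun p =>
      congrArg (fun ψ : Config ℓ m r n => ψ p) (congrArg Subtype.val h)
    have h2 : ∀ p, κ.1 p = κ'.1 p := fun p => by
      refine h0 _ _ (by rw [κ.2, κ'.2]) ?_
      have := congrArg Prod.fst (h1 p)
      rwa [ρ.2, ρ'.2] at this
    have hκ : κ = κ' := Subtype.ext (Equiv.ext h2)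
    subst hκ
    have hρ : ρ = ρ' := by
      refine Subtype.ext (Equiv.ext fun q => ?_)
      have := h1 (κ.1.symm (φ₀.symm q))
      simpa using this
    rw [hρ]
  · rintro ⟨φ, hs, hφ⟩
    have hex : ∀ p : Fin n × Fin ℓ, ∃ a, (φ₀ (p.1, a)).1 = (φ p).1 := fun p => by
      rw [← mat_ne_zero_iff, h0H, ← hφ, mat_ne_zero_iff]
      exact ⟨p.2, rfl⟩
    choose g hg using hex
    have hinj : Function.Injective fun p : Fin n × Fin ℓ => (p.1, g p) := by
      intro p q hpq
      simp only [Prod.mk.injEq] at hpq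
      refine hs p q hpq.1 ?_
      rw [← hg p, ← hg q, hpq.1, hpq.2]
    set κ : Equiv.Perm (Fin n × Fin ℓ) :=
      Equiv.ofBijective _ (Finite.injective_iff_bijective.1 hinj) with hκ
    have hκa : ∀ p, κ p = (p.1, g p) := fun p => rfl
    refine ⟨(⟨κ, fun p => by rw [hκa]⟩, ⟨φ₀.symm.trans (κ.symm.trans φ), fun q => ?_⟩), ?_⟩
    · obtain ⟨p, rfl⟩ : ∃ p, q = φ₀ (κ p) := ⟨κ.symm (φ₀.symm q), by simp⟩
      simp only [Equiv.trans_apply, Equiv.symm_apply_apply]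
      rw [← hg p, hκa]
    · refine Subtype.ext (Equiv.ext fun p => ?_)
      simp

/-! ### Switchings -/

/-- The pairs of sockets of the same column that are matched with the same row. -/
def bad (φ : Config ℓ m r n) : Finset ((Fin n × Fin ℓ) × (Fin n × Fin ℓ)) :=
  {x | x.1 ≠ x.2 ∧ x.1.1 = x.2.1 ∧ (φ x.1).1 = (φ x.2).1}

theorem mem_bad (φ : Config ℓ m r n) (p q : Fin n × Fin ℓ) :
    (p, q) ∈ φ.bad ↔ p ≠ q ∧ p.1 = q.1 ∧ (φ p).1 = (φ q).1 := by simp [bad]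

theorem simple_iff_card_bad (φ : Config ℓ m r n) : φ.Simple ↔ φ.bad.card ≤ 0 := by
  rw [Nat.le_zero, Finset.card_eq_zero, Finset.eq_empty_iff_forall_notMem]
  constructor
  · rintro h ⟨p, q⟩ hpq
    rw [mem_bad] at hpq
    exact hpq.1 (h p q hpq.2.1 hpq.2.2)
  · intro h p q h1 h2
    by_contra hne
    exact h (p, q) ((mem_bad φ p q).2 ⟨hne, h1, h2⟩)

theorem card_row_fiber (φ : Config ℓ m r n) (i : Fin r) :
    (Finset.univ.filter fun p => (φ p).1 = i).card = m := by
  rw [← Finset.card_map φ.toEmbedding]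
  have : (Finset.univ.filter fun p => (φ p).1 = i).map φ.toEmbedding =
      {i} ×ˢ (Finset.univ : Finset (Fin m)) := by
    ext q
    simp only [Finset.mem_map_equiv, Finset.mem_filter, Finset.mem_univ, true_and,
      Equiv.apply_symm_apply, Finset.mem_product, Finset.mem_singleton, and_true]
  rw [this]; simp

/-- A socket `p` of a bad pair exchanges its partner with a socket `p'` whose row does not meet the
column of `p` and whose column does not meet the row of `p`. After this neither of the two belongs
to a bad pair, and all other pairs are as before. Only `2ℓm` sockets are unsuitable. -/
theorem exists_switch (hN : 2 * (ℓ * m) < n * ℓ) (φ : Config ℓ m r n) (hφ : 0 < φ.bad.card) :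
    ∃ p q : Fin n × Fin ℓ, bad ((Equiv.swap p q).trans φ : Config ℓ m r n) ⊂ φ.bad := by
  obtain ⟨⟨p, q⟩, hpq⟩ := Finset.card_pos.1 hφ
  have hpq' := (mem_bad φ p q).1 hpq
  -- `B1` consists of the sockets matched with rows that meet the column of `p`, and `B2` of those
  -- in columns that meet the row of `p`.
  set B1 : Finset (Fin n × Fin ℓ) := Finset.univ.biUnion fun a : Fin ℓ =>
    Finset.univ.filter fun x => (φ x).1 = (φ (p.1, a)).1 with hB1
  set B2 : Finset (Fin n × Fin ℓ) := (Finset.univ.filter fun x => (φ x).1 = (φ p).1).biUnion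
    fun x => {x.1} ×ˢ Finset.univ with hB2
  have c1 : B1.card ≤ ℓ * m := by
    refine Finset.card_biUnion_le.trans ?_
    simp_rw [card_row_fiber]
    simp
  have c2 : B2.card ≤ ℓ * m := by
    refine Finset.card_biUnion_le.trans ?_
    simp [card_row_fiber, mul_comm]
  have : ∃ x, x ∉ B1 ∪ B2 := by
    by_contra hall
    push Not at hall
    have := Finset.card_le_card (fun x _ => hall x : (Finset.univ : Finset (Fin n × Fin ℓ)) ⊆ B1 ∪ B2)
    rw [Finset.card_univ, Fintype.card_prod, Fintype.card_fin, Fintype.card_fin] at this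
    have := Finset.card_union_le B1 B2
    omega
  obtain ⟨p', hp'⟩ := this
  rw [Finset.mem_union, not_or] at hp'
  have hi : ∀ v : Fin n × Fin ℓ, v.1 = p.1 → (φ v).1 ≠ (φ p').1 := by
    rintro ⟨j, a⟩ hv h
    simp only at hv
    subst hv
    refine hp'.1 (Finset.mem_biUnion.2 ⟨a, Finset.mem_univ _, ?_⟩)
    simp [h]
  have hii : ∀ v : Fin n × Fin ℓ, v.1 = p'.1 → (φ v).1 ≠ (φ p).1 := by
    intro v hv h
    refine hp'.2 (Finset.mem_biUnion.2 ⟨v, by simp [h], ?_⟩)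
    rw [Finset.mem_product, Finset.mem_singleton]
    exact ⟨hv.symm, Finset.mem_univ _⟩
  have hcol : p'.1 ≠ p.1 := fun h => hi p' h rfl
  have hne : p ≠ p' := fun h => hcol (by rw [h])
  have hswap : ∀ x, x ≠ p → x ≠ p' → Equiv.swap p p' x = x := fun x => Equiv.swap_apply_of_ne_of_ne
  have hnp : ∀ v, v ≠ p → v.1 = p.1 → (φ (Equiv.swap p p' v)).1 ≠ (φ (Equiv.swap p p' p)).1 := by
    intro v hv hc
    rw [Equiv.swap_apply_left, hswap v hv (fun h => hcol (by rw [← h, hc]))]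
    exact hi v hc
  have hnp' : ∀ v, v ≠ p' → v.1 = p'.1 →
      (φ (Equiv.swap p p' v)).1 ≠ (φ (Equiv.swap p p' p')).1 := by
    intro v hv hc
    rw [Equiv.swap_apply_right, hswap v (fun h => hcol (by rw [← h, hc])) hv]
    exact hii v hc
  refine ⟨p, p', (Finset.ssubset_iff_of_subset ?_).2 ⟨(p, q), hpq, ?_⟩⟩
  · rintro ⟨u, v⟩ huv
    rw [mem_bad] at huv ⊢
    simp only [Equiv.trans_apply] at huv
    obtain ⟨h1, h2, h3⟩ := huv
    have hu : u ≠ p := by rintro rfl; exact hnp v h1.symm h2.symm h3.symm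
    have hu' : u ≠ p' := by rintro rfl; exact hnp' v h1.symm h2.symm h3.symm
    have hv : v ≠ p := by rintro rfl; exact hnp u h1 h2 h3
    have hv' : v ≠ p' := by rintro rfl; exact hnp' u h1 h2 h3
    rw [hswap u hu hu', hswap v hv hv'] at h3
    exact ⟨h1, h2, h3⟩
  · rw [mem_bad]
    simp only [Equiv.trans_apply]
    rintro ⟨h1, h2, h3⟩
    exact hnp q h1.symm h2.symm h3.symm

/-- A configuration with `k + 1` bad pairs arises by one of `(nℓ)²` swaps from a configuration with
at most `k`. -/
theorem card_bad_le_mul (hN : 2 * (ℓ * m) < n * ℓ) (k : ℕ) :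
    (Finset.univ.filter fun φ : Config ℓ m r n => φ.bad.card ≤ k).card ≤
      ((n * ℓ) ^ 2 + 1) ^ k * (Finset.univ.filter fun φ : Config ℓ m r n => φ.bad.card ≤ 0).card := by
  induction k with
  | zero => simp
  | succ k ih =>
    have hsub : (Finset.univ.filter fun φ : Config ℓ m r n => φ.bad.card ≤ k + 1) ⊆
        (Finset.univ.filter fun φ : Config ℓ m r n => φ.bad.card ≤ k) ∪
        ((Finset.univ ×ˢ Finset.univ) ×ˢ
          (Finset.univ.filter fun φ : Config ℓ m r n => φ.bad.card ≤ k)).image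
          (fun x : ((Fin n × Fin ℓ) × (Fin n × Fin ℓ)) × Config ℓ m r n =>
            (Equiv.swap x.1.1 x.1.2).trans x.2) := by
      intro φ hφ
      rw [Finset.mem_filter] at hφ
      rw [Finset.mem_union]
      by_cases h : φ.bad.card ≤ k
      · exact Or.inl (Finset.mem_filter.2 ⟨Finset.mem_univ _, h⟩)
      · right
        obtain ⟨p, q, hlt⟩ := exists_switch hN φ (by omega)
        have := Finset.card_lt_card hlt
        refine Finset.mem_image.2 ⟨((p, q), (Equiv.swap p q).trans φ), ?_, ?_⟩
        · simp only [Finset.mem_product, Finset.mem_univ, true_and, Finset.mem_filter]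
          omega
        · ext x <;> simp
    refine (Finset.card_le_card hsub).trans ((Finset.card_union_le _ _).trans ?_)
    refine (Nat.add_le_add_left Finset.card_image_le _).trans ?_
    rw [Finset.card_product, Finset.card_product, Finset.card_univ, Fintype.card_prod,
      Fintype.card_fin, Fintype.card_fin, pow_succ]
    nlinarith

/-- By symmetry all `q ≠ p` share the row of `p` equally often, while that row has only `m` sockets.
-/
theorem card_row_eq_mul_le {p q : Fin n × Fin ℓ} (hpq : p ≠ q) :
    (Finset.univ.filter fun φ : Config ℓ m r n => (φ p).1 = (φ q).1).card * (n * ℓ - 1) ≤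
      m * Fintype.card (Config ℓ m r n) := by
  set c : Fin n × Fin ℓ → ℕ := fun q =>
    (Finset.univ.filter fun φ : Config ℓ m r n => (φ p).1 = (φ q).1).card with hc
  have hle : ∀ q', q' ≠ p → c q ≤ c q' := by
    intro q' hq'
    refine Finset.card_le_card_of_injOn (fun φ => (Equiv.swap q q').trans φ) ?_ ?_
    · intro φ hφ
      simp only [Finset.coe_filter, Finset.mem_univ, true_and, Set.mem_ofPred_eq] at hφ ⊢
      simp only [Equiv.trans_apply, Equiv.swap_apply_right]
      rw [Equiv.swap_apply_of_ne_of_ne hpq hq'.symm, hφ]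
    · intro φ _ φ' _ h
      ext x : 1
      have := congrArg (fun ψ : Config ℓ m r n => ψ (Equiv.swap q q' x)) h
      simpa using this
  have h1 : ∑ q' ∈ Finset.univ.erase p, c q' ≤ m * Fintype.card (Config ℓ m r n) := by
    have := Finset.sum_card_bipartiteAbove_eq_sum_card_bipartiteBelow
      (s := (Finset.univ.erase p)) (t := (Finset.univ : Finset (Config ℓ m r n)))
      fun q' φ => (φ p).1 = (φ q').1
    simp only [hc]
    refine (le_of_eq this).trans ?_
    refine (Finset.sum_le_card_nsmul _ _ m fun φ _ => ?_).trans ?_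
    · refine le_trans ?_ (le_of_eq (card_row_fiber φ (φ p).1))
      refine Finset.card_le_card fun x hx => ?_
      simp only [Finset.bipartiteBelow, Finset.mem_filter] at hx
      simp [hx.2]
    · rw [Finset.card_univ, smul_eq_mul, mul_comm]
  refine le_trans ?_ h1
  have h2 := Finset.card_nsmul_le_sum (Finset.univ.erase p) c (c q)
    fun q' hq' => hle q' (Finset.ne_of_mem_erase hq')
  rw [Finset.card_erase_of_mem (Finset.mem_univ _), Finset.card_univ, Fintype.card_prod,
    Fintype.card_fin, Fintype.card_fin, smul_eq_mul, mul_comm] at h2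
  exact h2

/-- There are at most `nℓ · ℓ` pairs of sockets in a common column, and each is bad with probability
at most `m/(nℓ - 1)`. -/
theorem sum_card_bad_le (hN : 2 ≤ n * ℓ) :
    ∑ φ : Config ℓ m r n, φ.bad.card ≤ 2 * (ℓ * m) * Fintype.card (Config ℓ m r n) := by
  set D : Finset ((Fin n × Fin ℓ) × (Fin n × Fin ℓ)) :=
    {x | x.1 ≠ x.2 ∧ x.1.1 = x.2.1} with hD
  have hDc : D.card ≤ n * ℓ * ℓ := by
    have : D ⊆ (Finset.univ : Finset ((Fin n × Fin ℓ) × Fin ℓ)).image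
        fun x => (x.1, (x.1.1, x.2)) := by
      rintro ⟨p, q⟩ hx
      simp only [hD, Finset.mem_filter, Finset.mem_univ, true_and] at hx
      exact Finset.mem_image.2 ⟨(p, q.2), Finset.mem_univ _, by
        simp only [Prod.mk.injEq, true_and]; exact Prod.ext hx.2 rfl⟩
    refine (Finset.card_le_card this).trans (Finset.card_image_le.trans ?_)
    simp
  have h1 : ∑ φ : Config ℓ m r n, φ.bad.card = ∑ x ∈ D,
      (Finset.univ.filter fun φ : Config ℓ m r n => (φ x.1).1 = (φ x.2).1).card := by
    have h0 := Finset.sum_card_bipartiteAbove_eq_sum_card_bipartiteBelow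
      (s := (Finset.univ : Finset (Config ℓ m r n))) (t := D) fun φ x => (φ x.1).1 = (φ x.2).1
    simp only [Finset.bipartiteBelow] at h0
    rw [← h0]
    refine Finset.sum_congr rfl fun φ _ => ?_
    congr 1
    ext ⟨p, q⟩
    simp only [mem_bad, Finset.bipartiteAbove, Finset.mem_filter, hD, Finset.mem_univ, true_and]
    tauto
  have h2 : (∑ φ : Config ℓ m r n, φ.bad.card) * (n * ℓ - 1) ≤
      n * ℓ * ℓ * (m * Fintype.card (Config ℓ m r n)) := by
    rw [h1, Finset.sum_mul]
    refine (Finset.sum_le_card_nsmul _ _ (m * Fintype.card (Config ℓ m r n)) fun x hx => ?_).trans ?_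
    · simp only [hD, Finset.mem_filter] at hx
      exact card_row_eq_mul_le hx.2.1
    · rw [smul_eq_mul]; exact Nat.mul_le_mul_right _ hDc
  refine Nat.le_of_mul_le_mul_right (h2.trans ?_) (by omega : 0 < n * ℓ - 1)
  have : n * ℓ ≤ 2 * (n * ℓ - 1) := by omega
  calc n * ℓ * ℓ * (m * Fintype.card (Config ℓ m r n))
      ≤ (2 * (n * ℓ - 1)) * ℓ * (m * Fintype.card (Config ℓ m r n)) := by gcongr
    _ = _ := by ring

/-- A polynomial fraction of the configurations is simple. -/
theorem card_le_card_simple (hℓm : 0 < ℓ * m) (hN : 2 * (ℓ * m) < n * ℓ) :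
    Fintype.card (Config ℓ m r n) ≤ 2 * ((n * ℓ) ^ 2 + 1) ^ (4 * (ℓ * m)) *
      (Finset.univ.filter fun φ : Config ℓ m r n => φ.Simple).card := by
  set K := 4 * (ℓ * m) with hK
  have h1 := sum_card_bad_le (m := m) (r := r) (by omega : 2 ≤ n * ℓ)
  have h2 : (Finset.univ.filter fun φ : Config ℓ m r n => ¬ φ.bad.card ≤ K).card * K ≤
      ∑ φ : Config ℓ m r n, φ.bad.card := by
    refine le_trans ?_ (Finset.sum_le_sum_of_subset
      (Finset.filter_subset (fun φ : Config ℓ m r n => ¬ φ.bad.card ≤ K) Finset.univ))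
    rw [← smul_eq_mul]
    refine Finset.card_nsmul_le_sum _ _ _ fun φ hφ => ?_
    rw [Finset.mem_filter] at hφ
    omega
  have h3 := Finset.card_filter_add_card_filter_not (s := Finset.univ)
    (fun φ : Config ℓ m r n => φ.bad.card ≤ K)
  rw [Finset.card_univ] at h3
  -- Markov's inequality: at least half of the configurations have at most twice the mean bound of
  -- bad pairs, and `K` switchings lead from these to simple ones.
  have h4 : 2 * (Finset.univ.filter fun φ : Config ℓ m r n => ¬ φ.bad.card ≤ K).card ≤
      Fintype.card (Config ℓ m r n) := by
    refine Nat.le_of_mul_le_mul_left ?_ (by omega : 0 < 2 * (ℓ * m))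
    calc _ = (Finset.univ.filter fun φ : Config ℓ m r n => ¬ φ.bad.card ≤ K).card * K := by
          rw [hK]; ring
      _ ≤ _ := h2.trans h1
  have h5 := card_bad_le_mul (r := r) hN K
  have h6 : (Finset.univ.filter fun φ : Config ℓ m r n => φ.bad.card ≤ 0) =
      Finset.univ.filter fun φ : Config ℓ m r n => φ.Simple := by
    ext φ; simp only [Finset.mem_filter, Finset.mem_univ, true_and, simple_iff_card_bad]
  rw [h6] at h5
  rw [mul_assoc]
  omega

end Config

/-! ### The probability of a codeword in ensemble `A` -/

-- For simple configurations a codeword supported on `T` means that the sockets of `T` meet each row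
-- evenly, and `T` has the same relative weight among sockets as among columns. Conditioning on
-- simplicity costs a polynomial factor.
open scoped Classical in
theorem ensembleA_even_le {ℓ m r n : ℕ} (hℓ : 1 ≤ ℓ) (hm : 1 ≤ m) (hrm : r * m = ℓ * n)
    (hN : 2 * (ℓ * m) < n * ℓ) (T : Finset (Fin n)) (hT : 0 < T.card) (hTn : T.card < n)
    {u : ℝ} (hu : 0 < u) :
    ((Finset.univ.filter fun H : ensembleA ℓ m r n => ∀ i, ∑ j ∈ T, H.1 i j = 0).card : ℝ) ≤
      2 * (ℓ * (n + 1 : ℝ)) ^ (8 * (ℓ * m) + 1) * Real.exp (n * qNat ℓ m u (T.card / n)) *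
        Fintype.card (ensembleA ℓ m r n) := by
  set F := Fintype.card (Config.FiberPerm (Fin n) (Fin ℓ) × Config.FiberPerm (Fin r) (Fin m)) with hF
  have hFpos : 0 < F := Fintype.card_pos_iff.2
    ⟨(⟨Equiv.refl _, fun _ => rfl⟩, ⟨Equiv.refl _, fun _ => rfl⟩)⟩
  -- Each matrix of the ensemble has the same number `F` of simple configurations, so counts of
  -- matrices and of configurations are proportional.
  have hcount : ∀ P : Matrix (Fin r) (Fin n) (ZMod 2) → Prop,
      (Finset.univ.filter fun φ : Config ℓ m r n => φ.Simple ∧ P φ.mat).card =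
        (Finset.univ.filter fun H : ensembleA ℓ m r n => P H.1).card * F := by
    intro P
    rw [Finset.card_eq_sum_card_fiberwise (f := fun φ : Config ℓ m r n => φ.mat)
      (t := (Finset.univ.filter fun H : ensembleA ℓ m r n => P H.1).map (Function.Embedding.subtype _)),
      Finset.sum_map, ← smul_eq_mul, ← Finset.sum_const]
    · refine Finset.sum_congr rfl fun H hH => ?_
      obtain ⟨φ₀, h0, h1⟩ := Config.exists_simple_mat_eq hrm H.2
      rw [hF, ← Config.card_fiber h0 h1, Fintype.card_subtype]
      congr 1
      ext φ
      rw [Finset.mem_filter] at hH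
      rw [Finset.mem_filter, Finset.mem_filter, Finset.mem_filter]
      constructor
      · rintro ⟨⟨_, h2, _⟩, h3⟩; exact ⟨Finset.mem_univ _, h2, h3⟩
      · rintro ⟨_, h2, h3⟩
        exact ⟨⟨Finset.mem_univ _, h2, by rw [h3]; exact hH.2⟩, h3⟩
    · intro φ hφ
      simp only [Finset.coe_filter, Finset.mem_univ, true_and, Set.mem_ofPred_eq] at hφ
      rw [Finset.mem_coe, Finset.mem_map]
      exact ⟨⟨φ.mat, hφ.1.mat_mem⟩, by simpa using hφ.2, rfl⟩
  have hall := hcount fun _ => True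
  have hT' := hcount fun H => ∀ i, ∑ j ∈ T, H i j = 0
  simp only [and_true, Finset.filter_true, Finset.card_univ] at hall
  have hsimple := Config.card_le_card_simple (r := r) (show 0 < ℓ * m by positivity) hN
  have heven : (((Finset.univ.filter fun H : ensembleA ℓ m r n =>
      ∀ i, ∑ j ∈ T, H.1 i j = 0).card * F : ℕ) : ℝ) ≤
      (n * ℓ + 1) * Real.exp (n * qNat ℓ m u (T.card / n)) * Fintype.card (Config ℓ m r n) := by
    have h2 := card_equiv_even_le (α := Fin n × Fin ℓ) (β := Fin r × Fin m) Prod.fst (m := m)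
      (fun i => by
        have : (Finset.univ.filter fun x : Fin r × Fin m => x.1 = i) = {i} ×ˢ Finset.univ := by
          ext x
          simp only [Finset.mem_filter, Finset.mem_univ, Finset.mem_product, Finset.mem_singleton,
            true_and, and_true]
        rw [this]; simp)
      (N := n * ℓ) (by simp [hrm, mul_comm]) (by simp [hrm, mul_comm])
      (T ×ˢ Finset.univ) (by rw [Finset.card_product, Finset.card_univ, Fintype.card_fin]; positivity)
      (by rw [Finset.card_product, Finset.card_univ, Fintype.card_fin]
          exact Nat.mul_lt_mul_of_pos_right hTn hℓ) hu
    have hexp : (Fintype.card (Fin r) : ℝ) * lam m u ((T ×ˢ (Finset.univ : Finset (Fin ℓ))).card /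
        ((n * ℓ : ℕ) : ℝ)) - ((n * ℓ : ℕ) : ℝ) * Real.binEntropy
        ((T ×ˢ (Finset.univ : Finset (Fin ℓ))).card / ((n * ℓ : ℕ) : ℝ)) =
        n * qNat ℓ m u (T.card / n) := by
      have hn0 : (0 : ℝ) < n := by exact_mod_cast hT.trans hTn
      have hℓ0 : (0 : ℝ) < ℓ := by exact_mod_cast hℓ
      have hm0 : (0 : ℝ) < m := by exact_mod_cast hm
      have hr : (r : ℝ) = n * (ℓ / m) := by
        field_simp
        have : (r : ℝ) * m = ℓ * n := by exact_mod_cast hrm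
        linarith
      rw [Finset.card_product, Finset.card_univ, Fintype.card_fin, Fintype.card_fin]
      have e : ((T.card * ℓ : ℕ) : ℝ) / ((n * ℓ : ℕ) : ℝ) = T.card / n := by
        push_cast; field_simp
      rw [e, hr]
      unfold qNat
      push_cast
      ring
    rw [hexp] at h2
    push_cast at h2
    refine le_trans ?_ h2
    have hT'' : (Finset.univ.filter fun H : ensembleA ℓ m r n =>
        ∀ i, ∑ j ∈ T, H.1 i j = 0).card * F = (Finset.univ.filter fun φ : Config ℓ m r n =>
        φ.Simple ∧ ∀ i, ∑ j ∈ T, φ.mat i j = 0).card := by convert hT'.symm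
    rw [hT'', Fintype.card_subtype]
    refine Nat.cast_le.2 (Finset.card_le_card fun φ hφ => ?_)
    simp only [Finset.mem_filter, Finset.mem_univ, true_and] at hφ ⊢
    intro i
    convert (hφ.1.even_iff T i).1 (hφ.2 i)
  set X := Real.exp (n * qNat ℓ m u (T.card / n)) with hX
  have hXpos : 0 < X := Real.exp_pos _
  have hcfg : (Fintype.card (Config ℓ m r n) : ℝ) ≤
      2 * ((n * ℓ) ^ 2 + 1 : ℝ) ^ (4 * (ℓ * m)) * (Fintype.card (ensembleA ℓ m r n) * F) := by
    have h := hsimple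
    have : (Finset.univ.filter fun φ : Config ℓ m r n => φ.Simple).card =
        Fintype.card (ensembleA ℓ m r n) * F := by convert hall
    rw [this] at h
    exact_mod_cast h
  have hFR : (0 : ℝ) < F := by exact_mod_cast hFpos
  have hℓ1 : (1 : ℝ) ≤ ℓ := by exact_mod_cast hℓ
  have hn0 : (0 : ℝ) ≤ n := Nat.cast_nonneg n
  have b1 : (n * ℓ + 1 : ℝ) ≤ ℓ * (n + 1) := by nlinarith
  have b2 : ((n * ℓ) ^ 2 + 1 : ℝ) ≤ (ℓ * (n + 1)) ^ 2 := by nlinarith [mul_nonneg hn0 (by linarith : (0 : ℝ) ≤ ℓ)]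
  refine le_of_mul_le_mul_right ?_ hFR
  push_cast at heven
  calc _ ≤ (n * ℓ + 1) * X * Fintype.card (Config ℓ m r n) := heven
    _ ≤ (ℓ * (n + 1)) * X * (2 * ((ℓ * (n + 1)) ^ 2) ^ (4 * (ℓ * m)) *
        (Fintype.card (ensembleA ℓ m r n) * F)) := by
        gcongr
        refine hcfg.trans ?_
        gcongr
    _ = _ := by rw [← pow_mul, show 2 * (4 * (ℓ * m)) = 8 * (ℓ * m) by ring, pow_succ]; ring

theorem mostA_sparse {ℓ m : ℕ} (hℓ : 1 ≤ ℓ) (hm : 3 ≤ m) {θ : ℝ} (hθ : IsErasureRoot ℓ m θ) :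
    MostA ℓ m fun _ n H => Sparse H (winLen θ n) := by
  classical
  intro κ hκ
  set e := 8 * (ℓ * m) + 1 with he
  obtain ⟨N, hN⟩ := exists_poly_le_two_pow_sqrt (2 * (ℓ : ℝ) ^ e) (by positivity) e κ hκ
  refine ⟨max N (2 * m + 1), fun n r hn hrm => ?_⟩
  have hw := winLen_spec hθ.1 hθ.2.1 n
  have hnm : 2 * m + 1 ≤ n := (le_max_right _ _).trans hn
  have h1 := card_not_sparse_le hm hθ (fun H : ensembleA ℓ m r n => H.1)
    (K := 2 * (ℓ * (n + 1 : ℝ)) ^ e) (by positivity)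
    (fun T hT hTn u hu => ensembleA_even_le hℓ (by omega) hrm (by nlinarith) T hT hTn hu) hw.1 hw.2.1
  have h2 := hN n ((le_max_left _ _).trans hn)
  rw [mul_pow, ← mul_assoc] at h1
  have h3 : ((Finset.univ.filter fun H : ensembleA ℓ m r n => ¬ Sparse H.1 (winLen θ n)).card : ℝ) ≤
      κ * Fintype.card (ensembleA ℓ m r n) := by
    have hp : (0 : ℝ) < 2 ^ Nat.sqrt n := by positivity
    refine le_of_mul_le_mul_right (h1.trans ?_) hp
    have := mul_le_mul_of_nonneg_right h2
      (Nat.cast_nonneg (α := ℝ) (Fintype.card (ensembleA ℓ m r n)))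
    linarith
  have h4 := Finset.card_filter_add_card_filter_not (s := Finset.univ)
    (fun H : ensembleA ℓ m r n => Sparse H.1 (winLen θ n))
  have h5 : {H ∈ ensembleA ℓ m r n | Sparse H (winLen θ n)}.ncard =
      (Finset.univ.filter fun H : ensembleA ℓ m r n => Sparse H.1 (winLen θ n)).card := by
    rw [← Finset.card_map (Function.Embedding.subtype _), ← Set.ncard_coe_finset]
    congr 1
    ext H
    simp [and_comm]
  have h7 : (ensembleA ℓ m r n).ncard = Fintype.card (ensembleA ℓ m r n) := by
    rw [← Nat.card_coe_set_eq, Nat.card_eq_fintype_card]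
  rw [h5, h7]
  rw [Finset.card_univ] at h4
  have h6 : ((Finset.univ.filter fun H : ensembleA ℓ m r n =>
      Sparse H.1 (winLen θ n)).card : ℝ) +
      (Finset.univ.filter fun H : ensembleA ℓ m r n => ¬ Sparse H.1 (winLen θ n)).card =
      Fintype.card (ensembleA ℓ m r n) := by exact_mod_cast h4
  linarith

/-! ### A program logic with operation counts -/

/-- All cells of the state hold numbers of at most `W` bits. -/
def Bdd (W : ℕ) (σ : State) : Prop := (∀ a, σ.reg a < 2 ^ W) ∧ ∀ p, σ.mem p < 2 ^ W

/-- If all cells have at most `W` bits, then they do so throughout the run of `P` from `σ`, which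
takes at most `N` operations and ends in a state with the property `Q`. -/
def HT (W : ℕ) (P : Prog) (σ : State) (N : ℕ) (Q : State → Prop) : Prop :=
  Bdd W σ → ∃ T σ', Runs P σ T σ' ∧ T ≤ N * (2 * W + 1) ∧ Bdd W σ' ∧ Q σ'

infixr:60 " ;; " => Prog.seq

namespace State

@[simp] theorem reg_setReg (σ : State) (a v b : ℕ) :
    (σ.setReg a v).reg b = if b = a then v else σ.reg b := by
  simp [setReg, Function.update_apply]

@[simp] theorem mem_setReg (σ : State) (a v : ℕ) : (σ.setReg a v).mem = σ.mem := rfl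

@[simp] theorem reg_setMem (σ : State) (p v : ℕ) : (σ.setMem p v).reg = σ.reg := rfl

@[simp] theorem mem_setMem (σ : State) (p v q : ℕ) :
    (σ.setMem p v).mem q = if q = p then v else σ.mem q := by
  simp [setMem, Function.update_apply]

/-- Entry `i` of array `k`; the eight arrays are interleaved and start at `B`. -/
def arr (σ : State) (B k i : ℕ) : ℕ := σ.mem (B + 8 * i + k)

@[simp] theorem arr_setReg (σ : State) (a v B k i : ℕ) :
    (σ.setReg a v).arr B k i = σ.arr B k i := rfl

/-- Assignment to entry `i` of array `k`. -/
def setArr (σ : State) (B k i v : ℕ) : State := σ.setMem (B + 8 * i + k) v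

@[simp] theorem reg_setArr (σ : State) (B k i v : ℕ) : (σ.setArr B k i v).reg = σ.reg := rfl

/-- The stride is `8` and array numbers are below `8`, so distinct pairs of array and index have
distinct addresses. -/
theorem arr_setArr (σ : State) (B : ℕ) {k k' : ℕ} (hk : k < 8) (hk' : k' < 8) (i v i' : ℕ) :
    (σ.setArr B k i v).arr B k' i' = if k' = k ∧ i' = i then v else σ.arr B k' i' := by
  unfold setArr arr
  rw [mem_setMem]
  congr 1
  rw [eq_iff_iff]
  omega

theorem arr_setArr_self (σ : State) (B : ℕ) {k : ℕ} (hk : k < 8) (i v i' : ℕ) :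
    (σ.setArr B k i v).arr B k i' = if i' = i then v else σ.arr B k i' := by
  rw [arr_setArr σ B hk hk]; simp

theorem arr_setArr_of_ne (σ : State) (B : ℕ) {k k' : ℕ} (hk : k < 8) (hk' : k' < 8) (h : k' ≠ k)
    (i v i' : ℕ) : (σ.setArr B k i v).arr B k' i' = σ.arr B k' i' := by
  rw [arr_setArr σ B hk hk']; simp [h]

theorem mem_setArr_of_lt (σ : State) {B p : ℕ} (hp : p < B) (k i v : ℕ) :
    (σ.setArr B k i v).mem p = σ.mem p := by
  unfold setArr
  rw [mem_setMem, if_neg (by omega)]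

theorem ext' {σ σ' : State} (h : σ.reg = σ'.reg) (h' : σ.mem = σ'.mem) : σ = σ' := by
  cases σ; cases σ'; simp_all

end State

theorem Bdd.setReg {W : ℕ} {σ : State} (h : Bdd W σ) {a v : ℕ} (hv : v < 2 ^ W) :
    Bdd W (σ.setReg a v) := by
  refine ⟨fun b => ?_, h.2⟩
  rw [State.reg_setReg]
  split_ifs
  · exact hv
  · exact h.1 b

theorem Bdd.setMem {W : ℕ} {σ : State} (h : Bdd W σ) {p v : ℕ} (hv : v < 2 ^ W) :
    Bdd W (σ.setMem p v) := by
  refine ⟨h.1, fun q => ?_⟩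
  rw [State.mem_setMem]
  split_ifs
  · exact hv
  · exact h.2 q

theorem size_le_of_lt {W v : ℕ} (h : v < 2 ^ W) : v.size ≤ W := Nat.size_le.2 h

namespace HT

variable {W : ℕ} {P R : Prog} {σ : State} {N N₁ N₂ : ℕ} {Q Q₁ : State → Prop}

theorem weaken (h : HT W P σ N₁ Q) (hN : N₁ ≤ N) : HT W P σ N Q := fun hb => by
  obtain ⟨T, σ', h1, h2, h3, h4⟩ := h hb
  exact ⟨T, σ', h1, h2.trans (Nat.mul_le_mul_right _ hN), h3, h4⟩

theorem imp (h : HT W P σ N Q₁) (hQ : ∀ σ', Q₁ σ' → Q σ') : HT W P σ N Q := fun hb => by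
  obtain ⟨T, σ', h1, h2, h3, h4⟩ := h hb
  exact ⟨T, σ', h1, h2, h3, hQ _ h4⟩

theorem call (h : HT W P σ N₁ Q₁) (h' : ∀ σ', Q₁ σ' → HT W R σ' N₂ Q) :
    HT W (P ;; R) σ (N₁ + N₂) Q := fun hb => by
  obtain ⟨T, σ', h1, h2, h3, h4⟩ := h hb
  obtain ⟨T', σ'', h5, h6, h7, h8⟩ := h' σ' h4 h3
  exact ⟨T + T', σ'', Runs.seq h1 h5, by rw [Nat.add_mul]; omega, h7, h8⟩

theorem skip (h : Q σ) : HT W .skip σ 1 Q := fun hb => ⟨1, σ, Runs.skip σ, by omega, hb, h⟩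

theorem const {a k : ℕ} (hk : k < 2 ^ W) (h : Q (σ.setReg a k)) : HT W (.const a k) σ 1 Q :=
  fun hb => ⟨_, _, Runs.const a k σ, by have := size_le_of_lt hk; omega, hb.setReg hk, h⟩

theorem add {a b c : ℕ} (hk : σ.reg b + σ.reg c < 2 ^ W) (h : Q (σ.setReg a (σ.reg b + σ.reg c))) :
    HT W (.add a b c) σ 1 Q := fun hb =>
  ⟨_, _, Runs.add a b c σ, by
    have := size_le_of_lt (hb.1 b); have := size_le_of_lt (hb.1 c); omega, hb.setReg hk, h⟩

theorem sub {a b c : ℕ} (h : Q (σ.setReg a (σ.reg b - σ.reg c))) :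
    HT W (.sub a b c) σ 1 Q := fun hb =>
  ⟨_, _, Runs.sub a b c σ, by
    have := size_le_of_lt (hb.1 b); have := size_le_of_lt (hb.1 c); omega,
    hb.setReg (lt_of_le_of_lt (Nat.sub_le _ _) (hb.1 b)), h⟩

theorem load {a b : ℕ} (h : Q (σ.setReg a (σ.mem (σ.reg b)))) : HT W (.load a b) σ 1 Q := fun hb =>
  ⟨_, _, Runs.load a b σ, by
    have := size_le_of_lt (hb.1 b); have := size_le_of_lt (hb.2 (σ.reg b)); omega,
    hb.setReg (hb.2 _), h⟩

theorem store {a b : ℕ} (h : Q (σ.setMem (σ.reg a) (σ.reg b))) : HT W (.store a b) σ 1 Q :=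
  fun hb => ⟨_, _, Runs.store a b σ, by
    have := size_le_of_lt (hb.1 a); have := size_le_of_lt (hb.1 b); omega,
    hb.setMem (hb.1 _), h⟩

theorem ifLt {a b : ℕ} (h1 : σ.reg a < σ.reg b → HT W P σ N Q)
    (h2 : ¬ σ.reg a < σ.reg b → HT W R σ N Q) : HT W (.ifLt a b P R) σ (N + 1) Q := fun hb => by
  have ha := size_le_of_lt (hb.1 a)
  have hb' := size_le_of_lt (hb.1 b)
  by_cases h : σ.reg a < σ.reg b
  · obtain ⟨T, σ', r1, r2, r3, r4⟩ := h1 h hb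
    exact ⟨_, σ', Runs.ifTrue h r1, by rw [Nat.add_mul]; omega, r3, r4⟩
  · obtain ⟨T, σ', r1, r2, r3, r4⟩ := h2 h hb
    exact ⟨_, σ', Runs.ifFalse h r1, by rw [Nat.add_mul]; omega, r3, r4⟩

/-! The same rules for the first operation of a sequence. -/

theorem const' {a k : ℕ} (hk : k < 2 ^ W) (h : HT W R (σ.setReg a k) N Q) :
    HT W (.const a k ;; R) σ (1 + N) Q :=
  call (Q₁ := fun σ' => σ' = σ.setReg a k) (const hk rfl) fun _ e => e ▸ h

theorem add' {a b c : ℕ} (hk : σ.reg b + σ.reg c < 2 ^ W)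
    (h : HT W R (σ.setReg a (σ.reg b + σ.reg c)) N Q) : HT W (.add a b c ;; R) σ (1 + N) Q :=
  call (Q₁ := fun σ' => σ' = σ.setReg a (σ.reg b + σ.reg c)) (add hk rfl) fun _ e => e ▸ h

theorem sub' {a b c : ℕ} (h : HT W R (σ.setReg a (σ.reg b - σ.reg c)) N Q) :
    HT W (.sub a b c ;; R) σ (1 + N) Q :=
  call (Q₁ := fun σ' => σ' = σ.setReg a (σ.reg b - σ.reg c)) (sub rfl) fun _ e => e ▸ h

theorem load' {a b : ℕ} (h : HT W R (σ.setReg a (σ.mem (σ.reg b))) N Q) :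
    HT W (.load a b ;; R) σ (1 + N) Q :=
  call (Q₁ := fun σ' => σ' = σ.setReg a (σ.mem (σ.reg b))) (load rfl) fun _ e => e ▸ h

/-- Counting loops in a given state. -/
theorem whileLt {i b v c : ℕ} (J : ℕ → State → Prop)
    (hstep : ∀ k σ', k < v → J k σ' → σ'.reg i = k → σ'.reg b = v → HT W P σ' c
      (fun σ'' => J (k + 1) σ'' ∧ σ''.reg i = k + 1 ∧ σ''.reg b = v)) :
    ∀ d k σ, k + d = v → J k σ → σ.reg i = k → σ.reg b = v →
      HT W (.whileLt i b P) σ ((c + 1) * d + 1) (fun σ' => J v σ' ∧ σ'.reg i = v ∧ σ'.reg b = v) := by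
  intro d
  induction d with
  | zero =>
    intro k σ hk hJ hi hb hB
    refine ⟨_, σ, Runs.whileFalse (by omega), ?_, hB, ?_, by omega, hb⟩
    · have := size_le_of_lt (hB.1 i); have := size_le_of_lt (hB.1 b); omega
    · rw [show v = k by omega]; exact hJ
  | succ d ih =>
    intro k σ hk hJ hi hb hB
    obtain ⟨T, σ', r1, r2, r3, r4, r5, r6⟩ := hstep k σ (by omega) hJ hi hb hB
    obtain ⟨T', σ'', q1, q2, q3, q4⟩ := ih (k + 1) σ' (by omega) r4 r5 r6 r3
    refine ⟨_, σ'', Runs.whileTrue (by omega) r1 q1, ?_, q3, q4⟩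
    have := size_le_of_lt (hB.1 i)
    have := size_le_of_lt (hB.1 b)
    have e : ((c + 1) * (d + 1) + 1) * (2 * W + 1) =
      c * (2 * W + 1) + (2 * W + 1) + ((c + 1) * d + 1) * (2 * W + 1) := by ring
    rw [e]
    omega

end HT

/-- `for R_i in [0, R_b) do P`; register `3` holds one. -/
def Prog.forLt (i b : ℕ) (P : Prog) : Prog :=
  .const i 0 ;; .whileLt i b (P ;; .add i i 3)

/-- The invariant is indexed by the counter and is required after the increment. The body has to
preserve the counter, the bound and the constant one in register `3`; a round costs the body, one
addition and one test. -/
theorem HT.forLt {W : ℕ} {P : Prog} {σ : State} {Q : State → Prop} {i b : ℕ} (v c : ℕ)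
    (J : ℕ → State → Prop) (hib : i ≠ b) (hb : σ.reg b = v)
    (h0 : J 0 (σ.setReg i 0))
    (hstep : ∀ k σ', k < v → J k σ' → σ'.reg i = k → σ'.reg b = v → HT W P σ' c
      (fun σ'' => σ''.reg i = k ∧ σ''.reg b = v ∧ σ''.reg 3 = 1 ∧ J (k + 1) (σ''.setReg i (k + 1))))
    (hend : ∀ σ', J v σ' → Q σ') :
    HT W (Prog.forLt i b P) σ ((c + 2) * v + 2) Q := by
  intro hB
  have hv : v < 2 ^ W := hb ▸ hB.1 b
  refine (HT.weaken (N₁ := 1 + ((c + 1 + 1) * v + 1)) (HT.const' (Nat.two_pow_pos W)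
    (HT.imp (HT.whileLt (v := v) J ?_ v 0 _ (by omega) h0 (by simp) ?_) ?_)) (by ring_nf; omega)) hB
  · intro k σ' hk hJ hi' hb'
    refine HT.call (hstep k σ' hk hJ hi' hb') fun σ'' h => ?_
    obtain ⟨h1, h2, h3, h4⟩ := h
    refine HT.add (by rw [h1, h3]; omega) ?_
    rw [h1, h3]
    exact ⟨h4, by simp, by simp [hib.symm, h2]⟩
  · simp [hib.symm, hb]
  · intro σ' h
    exact hend σ' h.1

/-! ### Array access -/

/-- `R_a := A_k[R_i]`, with the base of the arrays in register `4`. -/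
def Prog.aget (a k i : ℕ) : Prog :=
  .add 90 i i ;; .add 90 90 90 ;; .add 90 90 90 ;; .add 90 90 4 ;; .const 91 k ;; .add 90 90 91 ;;
    .load a 90

/-- `A_k[R_i] := R_b`. -/
def Prog.aset (k i b : ℕ) : Prog :=
  .add 90 i i ;; .add 90 90 90 ;; .add 90 90 90 ;; .add 90 90 4 ;; .const 91 k ;; .add 90 90 91 ;;
    .store 90 b

namespace HT

variable {W : ℕ} {R : Prog} {σ : State} {N : ℕ} {Q : State → Prop}

/-- The machine does not multiply, so `8x` is formed by three doublings in register `90`. Later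
assignments overwrite earlier ones, and only the last values of the registers `90` and `91` remain
visible. -/
theorem address {x B k i : ℕ} (hx : σ.reg i = x) (hB : σ.reg 4 = B)
    (hW : B + 8 * x + k < 2 ^ W)
    (h : HT W R ((σ.setReg 91 k).setReg 90 (B + 8 * x + k)) N Q) :
    HT W (.add 90 i i ;; .add 90 90 90 ;; .add 90 90 90 ;; .add 90 90 4 ;; .const 91 k ;;
      .add 90 90 91 ;; R) σ (6 + N) Q := by
  have e : ∀ y₁ y₂ y₃ y₄ y₅ : ℕ, y₅ = B + 8 * x + k →
      (((((σ.setReg 90 y₁).setReg 90 y₂).setReg 90 y₃).setReg 90 y₄).setReg 91 k).setReg 90 y₅ =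
      (σ.setReg 91 k).setReg 90 (B + 8 * x + k) := by
    rintro y₁ y₂ y₃ y₄ _ rfl
    refine State.ext' (funext fun b => ?_) rfl
    simp only [State.reg_setReg]
    split_ifs <;> rfl
  refine weaken (N₁ := 1 + (1 + (1 + (1 + (1 + (1 + N)))))) (add' ?_ (add' ?_ (add' ?_ (add' ?_
    (const' ?_ (add' ?_ ?_)))))) (by omega)
  · rw [hx]; omega
  · simp [hx]; omega
  · simp [hx]; omega
  · simp [hx, hB]; omega
  · omega
  · simp [hx, hB]; omega
  · rw [e]
    · exact h
    · simp [hx, hB]; omega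

theorem aget {a k i x B : ℕ} (hx : σ.reg i = x) (hB : σ.reg 4 = B)
    (hW : B + 8 * x + k < 2 ^ W)
    (h : Q (((σ.setReg 91 k).setReg 90 (B + 8 * x + k)).setReg a (σ.arr B k x))) :
    HT W (Prog.aget a k i) σ 7 Q :=
  address hx hB hW (load (by simpa [State.arr] using h))

theorem aget' {a k i x B : ℕ} (hx : σ.reg i = x) (hB : σ.reg 4 = B)
    (hW : B + 8 * x + k < 2 ^ W)
    (h : HT W R (((σ.setReg 91 k).setReg 90 (B + 8 * x + k)).setReg a (σ.arr B k x)) N Q) :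
    HT W (Prog.aget a k i ;; R) σ (7 + N) Q :=
  call (Q₁ := fun σ' => σ' = ((σ.setReg 91 k).setReg 90 (B + 8 * x + k)).setReg a (σ.arr B k x))
    (aget hx hB hW rfl) fun _ e => e ▸ h

/-- Requiring `b < 90` protects the value from the address computation, whose scratch registers are
`90` and `91`. -/
theorem aset {k i b x B : ℕ} (hb : b < 90) (hx : σ.reg i = x) (hB : σ.reg 4 = B)
    (hW : B + 8 * x + k < 2 ^ W)
    (h : Q (((σ.setReg 91 k).setReg 90 (B + 8 * x + k)).setArr B k x (σ.reg b))) :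
    HT W (Prog.aset k i b) σ 7 Q := by
  refine address hx hB hW (store ?_)
  simpa [State.setArr, show b ≠ 90 by omega, show b ≠ 91 by omega] using h

theorem aset' {k i b x B : ℕ} (hb : b < 90) (hx : σ.reg i = x) (hB : σ.reg 4 = B)
    (hW : B + 8 * x + k < 2 ^ W)
    (h : HT W R (((σ.setReg 91 k).setReg 90 (B + 8 * x + k)).setArr B k x (σ.reg b)) N Q) :
    HT W (Prog.aset k i b ;; R) σ (7 + N) Q :=
  call (Q₁ := fun σ' => σ' = ((σ.setReg 91 k).setReg 90 (B + 8 * x + k)).setArr B k x (σ.reg b))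
    (aset hb hx hB hW rfl) fun _ e => e ▸ h

end HT

/-! ### Binary words as numbers -/

/-- The number whose binary digits are the first `n` entries of `u`. -/
def enc (n : ℕ) (u : ℕ → ZMod 2) : ℕ := ∑ k ∈ Finset.range n, 2 ^ k * (u k).val

/-- The inner product of the first `n` entries. -/
def dot (n : ℕ) (u v : ℕ → ZMod 2) : ZMod 2 := ∑ k ∈ Finset.range n, u k * v k

/-- The Hamming weight of the first `n` entries. -/
def wt (n : ℕ) (u : ℕ → ZMod 2) : ℕ := ∑ k ∈ Finset.range n, (u k).val

theorem enc_succ (n : ℕ) (u : ℕ → ZMod 2) : enc (n + 1) u = enc n u + 2 ^ n * (u n).val :=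
  Finset.sum_range_succ _ _

theorem dot_succ (n : ℕ) (u v : ℕ → ZMod 2) : dot (n + 1) u v = dot n u v + u n * v n :=
  Finset.sum_range_succ _ _

theorem wt_succ (n : ℕ) (u : ℕ → ZMod 2) : wt (n + 1) u = wt n u + (u n).val :=
  Finset.sum_range_succ _ _

theorem zmod_two_cases (x : ZMod 2) : x = 0 ∨ x = 1 := by revert x; decide

theorem enc_lt (n : ℕ) (u : ℕ → ZMod 2) : enc n u < 2 ^ n := by
  induction n with
  | zero => simp [enc]
  | succ n ih =>
    rw [enc_succ, pow_succ]
    rcases zmod_two_cases (u n) with h | h <;> rw [h] <;>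
      simp only [ZMod.val_zero, ZMod.val_one, mul_zero, mul_one] <;> omega

theorem enc_zero (n : ℕ) : enc n 0 = 0 := by simp [enc]

theorem enc_single {n j : ℕ} (hj : j < n) : enc n (Pi.single j 1) = 2 ^ j := by
  unfold enc
  rw [Finset.sum_eq_single_of_mem j (Finset.mem_range.2 hj)]
  · simp [ZMod.val_one]
  · intro k _ hk; simp [hk]

theorem dot_add_right (n : ℕ) (u v w : ℕ → ZMod 2) : dot n u (v + w) = dot n u v + dot n u w := by
  simp [dot, mul_add, Finset.sum_add_distrib]

theorem dot_comm (n : ℕ) (u v : ℕ → ZMod 2) : dot n u v = dot n v u := by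
  simp [dot, mul_comm]

theorem dot_smul_right (n : ℕ) (c : ZMod 2) (u v : ℕ → ZMod 2) : dot n u (c • v) = c * dot n u v := by
  simp [dot, Finset.mul_sum, mul_left_comm]

theorem dot_sum_right {ι : Type*} (n : ℕ) (u : ℕ → ZMod 2) (s : Finset ι) (f : ι → ℕ → ZMod 2) :
    dot n u (∑ i ∈ s, f i) = ∑ i ∈ s, dot n u (f i) := by
  classical
  induction s using Finset.induction_on with
  | empty => simp [dot]
  | insert a s ha ih => rw [Finset.sum_insert ha, dot_add_right, ih, Finset.sum_insert ha]

theorem dot_congr_right {n : ℕ} {u v w : ℕ → ZMod 2} (h : ∀ k < n, v k = w k) :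
    dot n u v = dot n u w :=
  Finset.sum_congr rfl fun k hk => by rw [h k (Finset.mem_range.1 hk)]

theorem wt_congr {n : ℕ} {u v : ℕ → ZMod 2} (h : ∀ k < n, u k = v k) : wt n u = wt n v :=
  Finset.sum_congr rfl fun k hk => by rw [h k (Finset.mem_range.1 hk)]

theorem val_eq_ite (x : ZMod 2) : x.val = if x ≠ 0 then 1 else 0 := by revert x; decide

theorem wt_eq_card (n : ℕ) (u : ℕ → ZMod 2) :
    wt n u = ((Finset.range n).filter fun k => u k ≠ 0).card := by
  unfold wt
  rw [Finset.card_filter]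
  exact Finset.sum_congr rfl fun k _ => val_eq_ite _

theorem wt_le (n : ℕ) (u : ℕ → ZMod 2) : wt n u ≤ n := by
  rw [wt_eq_card]
  exact (Finset.card_filter_le _ _).trans (by simp)

theorem enc_pos_of_wt_pos {n : ℕ} {u : ℕ → ZMod 2} (h : 0 < wt n u) : 0 < enc n u := by
  by_contra h0
  have h1 : enc n u = 0 := by omega
  unfold enc at h1
  rw [Finset.sum_eq_zero_iff] at h1
  have : wt n u = 0 := Finset.sum_eq_zero fun k hk => by
    have := h1 k hk
    simpa using this
  omega

/-! ### Sum, inner product, and weight of binary words -/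

/-- The registers and the table of powers of two that all routines rely on. -/
structure Env (n B : ℕ) (σ : State) : Prop where
  len : σ.reg 0 = n
  one : σ.reg 3 = 1
  base : σ.reg 4 = B
  pow : ∀ i < n, σ.arr B 1 i = 2 ^ i

theorem Env.of_eq {n B : ℕ} {σ σ' : State} (h : Env n B σ) (hr : ∀ a < 5, σ'.reg a = σ.reg a)
    (hp : ∀ i < n, σ'.arr B 1 i = σ.arr B 1 i) : Env n B σ' :=
  ⟨by rw [hr 0 (by omega), h.len], by rw [hr 3 (by omega), h.one], by rw [hr 4 (by omega), h.base],
    fun i hi => by rw [hp i hi, h.pow i hi]⟩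

/-- One step of `comb`. -/
def Prog.combStep : Prog :=
  .sub 66 0 65 ;; .sub 66 66 3 ;; .aget 67 1 66 ;;
    .ifLt 60 67 (.ifLt 61 67 .skip (.sub 61 61 67 ;; .add 62 62 67))
      (.sub 60 60 67 ;; .add 64 64 3 ;;
        .ifLt 61 67 (.add 62 62 67) (.sub 61 61 67 ;; .sub 63 3 63))

/-- For words `x`, `y` in the registers `60`, `61`, computes their sum in register `62`, their inner
product in register `63`, and the weight of `x` in register `64`. -/
def Prog.comb : Prog :=
  .const 62 0 ;; .const 63 0 ;; .const 64 0 ;; .forLt 65 0 .combStep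

/-- The number of operations of `comb`. -/
def combCost (n : ℕ) : ℕ := 17 * n + 5

/-- Digits are processed from the top. What is left of a word is below `2^(p+1)`, so a comparison
with `2^p` reads digit `p`, and subtracting `2^p` removes it. The four cases are the values of the
two digits. -/
theorem comb_spec {W n B : ℕ} {σ : State} {u v : ℕ → ZMod 2} (henv : Env n B σ)
    (hnW : 2 ^ n + n + 1 < 2 ^ W) (hBW : B + 8 * n + 8 < 2 ^ W)
    (hx : σ.reg 60 = enc n u) (hy : σ.reg 61 = enc n v) :
    HT W .comb σ (combCost n) fun σ' => σ'.mem = σ.mem ∧ (∀ a < 60, σ'.reg a = σ.reg a) ∧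
      σ'.reg 62 = enc n (u + v) ∧ σ'.reg 63 = (dot n u v).val ∧ σ'.reg 64 = wt n u := by
  refine HT.weaken (N₁ := 1 + (1 + (1 + ((15 + 2) * n + 2)))) ?_ (by unfold combCost; omega)
  refine HT.const' (by omega) (HT.const' (by omega) (HT.const' (by omega) ?_))
  -- After `k` rounds the registers `60` and `61` hold the lowest `n - k` digits, and the results
  -- lack exactly the contribution of those.
  refine HT.forLt n 15 (fun k σ' => σ'.mem = σ.mem ∧ (∀ a < 60, σ'.reg a = σ.reg a) ∧
    σ'.reg 60 = enc (n - k) u ∧ σ'.reg 61 = enc (n - k) v ∧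
    σ'.reg 62 + enc (n - k) (u + v) = enc n (u + v) ∧
    σ'.reg 63 = (dot n u v - dot (n - k) u v).val ∧ σ'.reg 64 + wt (n - k) u = wt n u)
    (by omega) (by simp [henv.len]) ?_ ?_ ?_
  · refine ⟨rfl, fun a ha => ?_, ?_, ?_, ?_, ?_, ?_⟩
    · simp [show a ≠ 62 by omega, show a ≠ 63 by omega, show a ≠ 64 by omega, show a ≠ 65 by omega]
    all_goals simp [hx, hy]
  · rintro k σ' hk ⟨hmem, hreg, h60, h61, h62, h63, h64⟩ hi hb
    have h0 : σ'.reg 0 = n := hb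
    have h3 : σ'.reg 3 = 1 := (hreg 3 (by omega)).trans henv.one
    have h4 : σ'.reg 4 = B := (hreg 4 (by omega)).trans henv.base
    obtain ⟨p, hp⟩ : ∃ p, n - k = p + 1 := ⟨n - k - 1, by omega⟩
    have hp' : n - (k + 1) = p := by omega
    have hpow : σ'.arr B 1 p = 2 ^ p := by
      have := henv.pow p (by omega)
      simp only [State.arr, hmem] at this ⊢
      exact this
    have hu := enc_lt p u
    have hv := enc_lt p v
    have hpn : 2 ^ p ≤ 2 ^ n := Nat.pow_le_pow_right (by norm_num) (by omega)
    have hwn := wt_le n u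
    have hsum := enc_lt n (u + v)
    rw [hp, enc_succ] at h60 h61 h62
    rw [hp, dot_succ] at h63
    rw [hp, wt_succ] at h64
    refine HT.weaken (N₁ := 1 + (1 + (7 + (5 + 1)))) ?_ (by omega)
    refine HT.sub' (HT.sub' (HT.aget' (x := p) (B := B) (by simp [h0, h3, hi]; omega)
      (by simp [h4]) (by omega) ?_))
    simp only [State.arr_setReg, hpow]
    have hframe : ∀ a < 60, a ≠ 66 ∧ a ≠ 67 ∧ a ≠ 90 ∧ a ≠ 91 ∧ a ≠ 60 ∧ a ≠ 61 ∧ a ≠ 62 ∧ a ≠ 63 ∧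
      a ≠ 64 ∧ a ≠ 65 := fun a ha => by omega
    rcases zmod_two_cases (u p) with hup | hup <;> rcases zmod_two_cases (v p) with hvp | hvp
    · rw [Pi.add_apply, hup, hvp] at h62
      rw [hup] at h60 h63 h64; rw [hvp] at h61 h63
      simp only [add_zero, ZMod.val_zero, mul_zero] at h60 h61 h62 h63 h64
      refine HT.ifLt (fun _ => HT.weaken (N₁ := 1 + 1) (HT.ifLt (fun _ => HT.skip ?_)
        (fun h => ?_)) (by omega)) (fun h => ?_)
      · simp only [State.mem_setReg, hp']
        refine ⟨by simp [hi], by simp [h0], by simp [h3], hmem, fun a ha => ?_, ?_⟩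
        · simp [hframe a ha, hreg a ha]
        · simp [h60, h61, h62, h63, h64]
      · simp [h61] at h; omega
      · simp [h60] at h; omega
    · rw [Pi.add_apply, hup, hvp] at h62
      rw [hup] at h60 h63 h64; rw [hvp] at h61 h63
      simp only [add_zero, zero_add, ZMod.val_zero, ZMod.val_one, mul_zero, mul_one]
        at h60 h61 h62 h63 h64
      refine HT.ifLt (fun _ => HT.weaken (N₁ := (1 + 1) + 1) (HT.ifLt (fun h => ?_)
        (fun h => HT.sub' (HT.add ?_ ?_))) (by omega)) (fun h => ?_)
      · simp [h61] at h
      · simp; omega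
      · simp only [State.mem_setReg, hp']
        refine ⟨by simp [hi], by simp [h0], by simp [h3], hmem, fun a ha => ?_, ?_⟩
        · simp [hframe a ha, hreg a ha]
        · simp [h60, h61, h63, h64]; omega
      · simp [h60] at h; omega
    · rw [Pi.add_apply, hup, hvp] at h62
      rw [hup] at h60 h63 h64; rw [hvp] at h61 h63
      simp only [add_zero, ZMod.val_zero, ZMod.val_one, mul_zero, mul_one]
        at h60 h61 h62 h63 h64
      refine HT.ifLt (fun h => ?_) (fun h => HT.weaken (N₁ := 1 + (1 + (1 + 1))) (HT.sub' (HT.add' ?_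
        (HT.ifLt (fun _ => HT.add ?_ ?_) (fun h => ?_)))) (by omega))
      · simp [h60] at h
      · simp [h3]; omega
      · simp; omega
      · simp only [State.mem_setReg, hp']
        refine ⟨by simp [hi], by simp [h0], by simp [h3], hmem, fun a ha => ?_, ?_⟩
        · simp [hframe a ha, hreg a ha]
        · simp [h60, h61, h63, h3]; omega
      · simp [h61] at h; omega
    · rw [Pi.add_apply, hup, hvp] at h62
      rw [hup] at h60 h63 h64; rw [hvp] at h61 h63
      simp only [ZMod.val_one, mul_one] at h60 h61 h63 h64
      rw [show (1 + 1 : ZMod 2) = 0 from rfl] at h62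
      simp only [ZMod.val_zero, mul_zero, add_zero] at h62
      refine HT.ifLt (fun h => ?_) (fun h => HT.weaken (N₁ := 1 + (1 + ((1 + 1) + 1))) (HT.sub' (HT.add' ?_
        (HT.ifLt (fun h => ?_) (fun _ => HT.sub' (HT.sub ?_))))) (by omega))
      · simp [h60] at h
      · simp [h3]; omega
      · simp [h61] at h
      · simp only [State.mem_setReg, hp']
        refine ⟨by simp [hi], by simp [h0], by simp [h3], hmem, fun a ha => ?_, ?_⟩
        · simp [hframe a ha, hreg a ha]
        · simp [h60, h61, h62, h63, h3]
          refine ⟨?_, by omega⟩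
          generalize dot n u v = x
          generalize dot p u v = y
          revert x y; decide
  · rintro σ' ⟨hmem, hreg, h60, h61, h62, h63, h64⟩
    refine ⟨hmem, hreg, ?_, ?_, ?_⟩
    · simpa [enc] using h62
    · simpa [dot] using h63
    · simpa [wt] using h64

/-! ### Enumeration of the subset sums within a budget -/

/-- The sets of numbers below `j` of total cost at most `b`, in the order of their enumeration. -/
def budgetList (κ : ℕ → ℕ) (b : ℕ) : ℕ → List (Finset ℕ)
  | 0 => [∅]
  | j + 1 => budgetList κ b j ++
      ((budgetList κ b j).filter fun S => (∑ i ∈ S, κ i) + κ j ≤ b).map (insert j)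

/-- Costs are nonnegative, so every subset of an admissible set is admissible and pruning at each
stage loses nothing. The work is then governed by the length of the final list. -/
theorem mem_budgetList {κ : ℕ → ℕ} {b : ℕ} {j : ℕ} {S : Finset ℕ} :
    S ∈ budgetList κ b j ↔ S ⊆ Finset.range j ∧ ∑ i ∈ S, κ i ≤ b := by
  induction j generalizing S with
  | zero =>
    simp only [budgetList, List.mem_singleton, Finset.range_zero, Finset.subset_empty]
    constructor
    · rintro rfl; simp
    · exact fun h => h.1
  | succ j ih =>
    simp only [budgetList, List.mem_append, List.mem_map, List.mem_filter, decide_eq_true_eq, ih]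
    constructor
    · rintro (⟨h1, h2⟩ | ⟨S', ⟨⟨h1, h2⟩, h3⟩, rfl⟩)
      · exact ⟨h1.trans (Finset.range_mono (Nat.le_succ j)), h2⟩
      · refine ⟨?_, ?_⟩
        · rw [Finset.range_add_one]
          exact Finset.insert_subset_insert _ h1
        · rw [Finset.sum_insert (fun h => by simpa using h1 h)]
          omega
    · rintro ⟨h1, h2⟩
      by_cases hj : j ∈ S
      · right
        have hs := Finset.add_sum_erase S κ hj
        refine ⟨S.erase j, ⟨⟨fun x hx => ?_, by omega⟩, by omega⟩, Finset.insert_erase hj⟩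
        have := Finset.mem_range.1 (h1 (Finset.mem_of_mem_erase hx))
        have := Finset.ne_of_mem_erase hx
        exact Finset.mem_range.2 (by omega)
      · left
        refine ⟨fun x hx => ?_, h2⟩
        have := Finset.mem_range.1 (h1 hx)
        have : x ≠ j := fun h => hj (h ▸ hx)
        exact Finset.mem_range.2 (by omega)

theorem nodup_budgetList (κ : ℕ → ℕ) (b j : ℕ) : (budgetList κ b j).Nodup := by
  induction j with
  | zero => simp [budgetList]
  | succ j ih =>
    rw [budgetList, List.nodup_append]
    have hnot : ∀ S ∈ budgetList κ b j, j ∉ S := fun S hS hj => by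
      simpa using (mem_budgetList.1 hS).1 hj
    refine ⟨ih, ?_, ?_⟩
    · refine List.Nodup.map_on ?_ (ih.filter _)
      intro S hS S' hS' h
      have h1 := hnot S (List.mem_of_mem_filter hS)
      have h2 := hnot S' (List.mem_of_mem_filter hS')
      rw [← Finset.erase_insert h1, h, Finset.erase_insert h2]
    · rintro S hS S' hS' rfl
      obtain ⟨S', _, rfl⟩ := List.mem_map.1 hS'
      exact hnot _ hS (Finset.mem_insert_self _ _)

theorem length_budgetList (κ : ℕ → ℕ) (b j : ℕ) : (budgetList κ b j).length =
    ((Finset.range j).powerset.filter fun S => ∑ i ∈ S, κ i ≤ b).card := by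
  rw [← List.toFinset_card_of_nodup (nodup_budgetList κ b j)]
  congr 1
  ext S
  simp [mem_budgetList]

theorem length_budgetList_le (κ : ℕ → ℕ) (b j : ℕ) : (budgetList κ b j).length ≤ 2 ^ j := by
  rw [length_budgetList]
  refine (Finset.card_filter_le _ _).trans ?_
  rw [Finset.card_powerset, Finset.card_range]

theorem length_budgetList_mono (κ : ℕ → ℕ) (b : ℕ) {i j : ℕ} (h : i ≤ j) :
    (budgetList κ b i).length ≤ (budgetList κ b j).length := by
  rw [length_budgetList, length_budgetList]
  refine Finset.card_le_card (Finset.filter_subset_filter _ ?_)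
  exact Finset.powerset_mono.2 (Finset.range_mono h)

/-- The arrays `4`, `5` hold the costs and the sums of the sets of the list `L`, and register `11`
holds its length. -/
structure Holds (n B : ℕ) (g : ℕ → ℕ → ZMod 2) (κ : ℕ → ℕ) (σ : State) (L : List (Finset ℕ)) :
    Prop where
  len : σ.reg 11 = L.length
  cost : ∀ q (h : q < L.length), σ.arr B 4 q = ∑ i ∈ L[q], κ i
  vec : ∀ q (h : q < L.length), σ.arr B 5 q = enc n (∑ i ∈ L[q], g i)

theorem Holds.of_eq {n B : ℕ} {g : ℕ → ℕ → ZMod 2} {κ : ℕ → ℕ} {σ σ' : State}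
    {L : List (Finset ℕ)} (h : Holds n B g κ σ L) (h1 : σ'.reg 11 = σ.reg 11)
    (h2 : σ'.mem = σ.mem) : Holds n B g κ σ' L :=
  ⟨by rw [h1, h.len], fun q hq => by simpa [State.arr, h2] using h.cost q hq,
    fun q hq => by simpa [State.arr, h2] using h.vec q hq⟩

theorem Holds.append {n B : ℕ} {g : ℕ → ℕ → ZMod 2} {κ : ℕ → ℕ} {σ σ' : State}
    {L : List (Finset ℕ)} (h : Holds n B g κ σ L) (S : Finset ℕ)
    (h1 : σ'.reg 11 = σ.reg 11 + 1)
    (h4 : ∀ q, σ'.arr B 4 q = if q = L.length then ∑ i ∈ S, κ i else σ.arr B 4 q)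
    (h5 : ∀ q, σ'.arr B 5 q = if q = L.length then enc n (∑ i ∈ S, g i) else σ.arr B 5 q) :
    Holds n B g κ σ' (L ++ [S]) := by
  refine ⟨by simp [h1, h.len], fun q hq => ?_, fun q hq => ?_⟩
  · rw [List.length_append, List.length_singleton] at hq
    rw [h4]
    split_ifs with hql
    · subst hql; simp
    · have : q < L.length := by omega
      rw [h.cost q this, List.getElem_append_left this]
  · rw [List.length_append, List.length_singleton] at hq
    rw [h5]
    split_ifs with hql
    · subst hql; simp
    · have : q < L.length := by omega
      rw [h.vec q this, List.getElem_append_left this]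

/-- Appends one entry of the list, extended by the current vector, if the budget allows. -/
def Prog.enumItem : Prog :=
  .aget 47 4 46 ;; .add 47 47 45 ;;
    .ifLt 10 47 .skip (.aget 60 5 46 ;; .add 61 44 40 ;; .comb ;; .aset 4 11 47 ;; .aset 5 11 62 ;;
      .add 11 11 3)

/-- Lists, for the vectors in array `2` with the costs in array `3`, the sums of cost at most the
budget in register `10`. -/
def Prog.enum : Prog :=
  .const 40 0 ;; .const 11 1 ;; .aset 4 40 40 ;; .aset 5 40 40 ;;
    -- Register `43` freezes the length of the list, since register `11` grows during the inner
    -- loop. Register `40` is zero, so the addition is a copy.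
    .forLt 42 0 (.add 43 11 40 ;; .aget 44 2 42 ;; .aget 45 3 42 ;; .forLt 46 43 .enumItem)

/-- The number of operations of `enum` for lists of at most `M` entries. -/
def enumCost (n M : ℕ) : ℕ := ((17 * n + 39) * M + 19) * n + 18

theorem enumItem_spec {W n B : ℕ} {σ : State} {g : ℕ → ℕ → ZMod 2} {κ : ℕ → ℕ} {b j p : ℕ}
    {L : List (Finset ℕ)} {S : Finset ℕ} (henv : Env n B σ)
    (hnW : 2 ^ n + n + 1 < 2 ^ W) (hBW : B + 8 * 2 ^ n + 8 < 2 ^ W) (hbW : b + κ j < 2 ^ W)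
    (hb : σ.reg 10 = b) (h40 : σ.reg 40 = 0) (h44 : σ.reg 44 = enc n (g j)) (h45 : σ.reg 45 = κ j)
    (h46 : σ.reg 46 = p) (hL : Holds n B g κ σ L) (hp : p < L.length) (hLn : L.length < 2 ^ n)
    (hS : L[p] = S) (hSj : j ∉ S) (hSb : ∑ i ∈ S, κ i ≤ b) :
    HT W .enumItem σ (17 * n + 37) fun σ' =>
      Holds n B g κ σ' (if (∑ i ∈ S, κ i) + κ j ≤ b then L ++ [insert j S] else L) ∧
      (∀ a < 47, a ≠ 11 → σ'.reg a = σ.reg a) ∧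
      ∀ k < 8, k ≠ 4 → k ≠ 5 → ∀ i, σ'.arr B k i = σ.arr B k i := by
  have hcost := hL.cost p hp
  have hvec := hL.vec p hp
  rw [hS] at hcost hvec
  have hn2 : n < 2 ^ n := Nat.lt_two_pow_self
  refine HT.weaken (N₁ := 7 + (1 + ((7 + (1 + (combCost n + (7 + (7 + 1))))) + 1))) ?_
    (by unfold combCost; omega)
  refine HT.aget' (x := p) (B := B) h46 henv.base (by omega) (HT.add' ?_ (HT.ifLt (fun h => ?_)
    (fun h => ?_)))
  · simp [hcost, h45]; omega
  · simp [hb, hcost, h45] at h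
    rw [if_neg (by omega)]
    refine HT.weaken (HT.skip ⟨hL.of_eq (by simp) rfl, fun a ha _ => ?_, fun k _ _ _ i => rfl⟩) (by omega)
    simp [show a ≠ 47 by omega, show a ≠ 90 by omega, show a ≠ 91 by omega]
  · simp [hb, hcost, h45] at h
    rw [if_pos h]
    refine HT.aget' (x := p) (B := B) (by simp [h46]) (by simp [henv.base]) (by omega) (HT.add' ?_ ?_)
    · simp [h44, h40]; have := enc_lt n (g j); omega
    refine HT.call (comb_spec (u := ∑ i ∈ S, g i) (v := g j) (henv.of_eq ?_ fun i _ => rfl) hnW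
      (by omega) ?_ ?_) ?_
    · intro a ha
      simp [show a ≠ 47 by omega, show a ≠ 90 by omega, show a ≠ 91 by omega, show a ≠ 60 by omega,
        show a ≠ 61 by omega]
    · simp [hvec]
    · simp [h44, h40]
    rintro σ' ⟨hmem, hreg, h62, -, -⟩
    have hr : ∀ a < 47, σ'.reg a = σ.reg a := fun a ha => by
      rw [hreg a (by omega)]
      simp [show a ≠ 47 by omega, show a ≠ 90 by omega, show a ≠ 91 by omega, show a ≠ 60 by omega,
        show a ≠ 61 by omega]
    have h47 : σ'.reg 47 = ∑ i ∈ S, κ i + κ j := by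
      rw [hreg 47 (by omega)]; simp [hcost, h45]
    have harr : ∀ k i, σ'.arr B k i = σ.arr B k i := fun k i => by
      unfold State.arr; rw [hmem]; rfl
    have h11 := hL.len
    refine HT.aset' (x := L.length) (B := B) (by omega) (by rw [hr 11 (by omega), h11])
      (by rw [hr 4 (by omega), henv.base]) (by omega) (HT.aset' (x := L.length) (B := B) (by omega)
      (by simp [hr 11, h11]) (by simp [hr 4, henv.base]) (by omega) (HT.add ?_ ?_))
    · simp [hr 11, hr 3, h11, henv.one]; omega
    · refine ⟨hL.append _ ?_ ?_ ?_, ?_, ?_⟩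
      · simp [hr 11, hr 3, henv.one]
      · intro q
        simp only [State.arr_setReg]
        rw [State.arr_setArr_of_ne _ _ (by omega) (by omega) (by omega)]
        simp only [State.arr_setReg]
        rw [State.arr_setArr_self _ _ (by omega), Finset.sum_insert hSj]
        simp only [State.arr_setReg, harr, h47, add_comm]
      · intro q
        simp only [State.arr_setReg]
        rw [State.arr_setArr_self _ _ (by omega), Finset.sum_insert hSj]
        simp only [State.arr_setReg]
        rw [State.arr_setArr_of_ne _ _ (by omega) (by omega) (by omega)]
        simp [harr, h62, add_comm]
      · intro a ha ha'
        simp [show a ≠ 90 by omega, show a ≠ 91 by omega, ha', hr a ha]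
      · intro k hk h4 h5 i
        simp only [State.arr_setReg]
        rw [State.arr_setArr_of_ne _ _ (by omega) hk h5]
        simp only [State.arr_setReg]
        rw [State.arr_setArr_of_ne _ _ (by omega) hk h4]
        simp [harr]

/-- After `j` rounds the list is the one for the first `j` vectors. Lengths increase with `j`, so
the final bound `M` also bounds each inner loop. -/
theorem enum_spec {W n B : ℕ} {σ : State} {g : ℕ → ℕ → ZMod 2} {κ : ℕ → ℕ} {b M : ℕ}
    (henv : Env n B σ) (hnW : 2 ^ n + n + 1 < 2 ^ W) (hBW : B + 8 * 2 ^ n + 8 < 2 ^ W)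
    (hbW : ∀ j < n, b + κ j < 2 ^ W) (hb : σ.reg 10 = b)
    (hg : ∀ j < n, σ.arr B 2 j = enc n (g j)) (hκ : ∀ j < n, σ.arr B 3 j = κ j)
    (hM : (budgetList κ b n).length ≤ M) :
    HT W .enum σ (enumCost n M) fun σ' => Holds n B g κ σ' (budgetList κ b n) ∧
      (∀ a < 40, a ≠ 11 → σ'.reg a = σ.reg a) ∧
      ∀ k < 8, k ≠ 4 → k ≠ 5 → ∀ i, σ'.arr B k i = σ.arr B k i := by
  have hn2 : n < 2 ^ n := Nat.lt_two_pow_self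
  refine HT.weaken (N₁ := 1 + (1 + (7 + (7 + (((1 + (7 + (7 + ((17 * n + 37 + 2) * M + 2)))) + 2) * n + 2)))))
    ?_ (by unfold enumCost; ring_nf; omega)
  refine HT.const' (by omega) (HT.const' (by omega) (HT.aset' (x := 0) (B := B) (by omega) (by simp)
    (by simp [henv.base]) (by omega) (HT.aset' (x := 0) (B := B) (by omega) (by simp)
    (by simp [henv.base]) (by omega) ?_)))
  refine HT.forLt n _ (fun j σ' => Holds n B g κ σ' (budgetList κ b j) ∧ σ'.reg 40 = 0 ∧
      (∀ a < 40, a ≠ 11 → σ'.reg a = σ.reg a) ∧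
      ∀ k < 8, k ≠ 4 → k ≠ 5 → ∀ i, σ'.arr B k i = σ.arr B k i) (by omega) (by simp [henv.len]) ?_ ?_ ?_
  · refine ⟨⟨by simp [budgetList], ?_, ?_⟩, by simp, ?_, ?_⟩
    · intro q hq
      have hq0 : q = 0 := by simpa [budgetList] using hq
      subst hq0
      simp only [State.arr_setReg]
      rw [State.arr_setArr_of_ne _ _ (by omega) (by omega) (by omega)]
      simp only [State.arr_setReg]
      rw [State.arr_setArr_self _ _ (by omega)]
      simp [budgetList]
    · intro q hq
      have hq0 : q = 0 := by simpa [budgetList] using hq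
      subst hq0
      simp only [State.arr_setReg]
      rw [State.arr_setArr_self _ _ (by omega)]
      simp [budgetList, enc_zero]
    · intro a ha ha'
      simp [show a ≠ 42 by omega, show a ≠ 90 by omega, show a ≠ 91 by omega, ha', show a ≠ 40 by omega]
    · intro k hk h4 h5 i
      simp only [State.arr_setReg]
      rw [State.arr_setArr_of_ne _ _ (by omega) hk h5]
      simp only [State.arr_setReg]
      rw [State.arr_setArr_of_ne _ _ (by omega) hk h4]
      simp
  · rintro j σ₁ hj ⟨hL, h40, hreg, harr⟩ hi hlen
    set L := budgetList κ b j with hLdef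
    have hLj : L.length ≤ 2 ^ j := length_budgetList_le κ b j
    have hjn : 2 * 2 ^ j ≤ 2 ^ n := by
      rw [← pow_succ']; exact Nat.pow_le_pow_right (by omega) (by omega)
    have hLM : L.length ≤ M := (length_budgetList_mono κ b hj.le).trans hM
    have h4 : σ₁.reg 4 = B := (hreg 4 (by omega) (by omega)).trans henv.base
    have h3 : σ₁.reg 3 = 1 := (hreg 3 (by omega) (by omega)).trans henv.one
    have h10 : σ₁.reg 10 = b := (hreg 10 (by omega) (by omega)).trans hb
    have henv₁ : Env n B σ₁ := henv.of_eq (fun a ha => hreg a (by omega) (by omega))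
      fun i _ => harr 1 (by omega) (by omega) (by omega) i
    refine HT.add' (by rw [hL.len, h40]; omega) (HT.aget' (x := j) (B := B) (by simp [hi]) (by simp [h4])
      (by omega) (HT.aget' (x := j) (B := B) (by simp [hi]) (by simp [h4]) (by omega) ?_))
    simp only [State.arr_setReg, harr 2 (by omega) (by omega) (by omega),
      harr 3 (by omega) (by omega) (by omega), hg j hj, hκ j hj]
    refine HT.weaken (HT.forLt L.length (17 * n + 37) (fun p σ' => Holds n B g κ σ' (L ++
        ((L.take p).filter fun S => (∑ i ∈ S, κ i) + κ j ≤ b).map (insert j)) ∧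
      (∀ a < 46, a ≠ 11 → a ≠ 43 → a ≠ 44 → a ≠ 45 → σ'.reg a = σ₁.reg a) ∧
      σ'.reg 44 = enc n (g j) ∧ σ'.reg 45 = κ j ∧
      ∀ k < 8, k ≠ 4 → k ≠ 5 → ∀ i, σ'.arr B k i = σ.arr B k i) (by omega)
      (by simp [hL.len, h40]) ?_ ?_ ?_) (by gcongr)
    · refine ⟨?_, fun a ha h1 h2 h5 h6 => ?_, by simp, by simp,
        fun k hk h4 h5 i => ?_⟩
      · rw [List.take_zero, List.filter_nil, List.map_nil, List.append_nil]
        exact hL.of_eq (by simp) rfl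
      · simp [show a ≠ 46 by omega, show a ≠ 90 by omega, show a ≠ 91 by omega, h2, h5, h6]
      · simp [harr k hk h4 h5 i]
    · rintro p σ₂ hp ⟨hL₂, hreg₂, h44, h45, harr₂⟩ hi₂ h43
      set F := ((L.take p).filter fun S => (∑ i ∈ S, κ i) + κ j ≤ b).map (insert j) with hF
      have hFl : F.length ≤ p := by
        rw [hF, List.length_map]
        refine (List.length_filter_le _ _).trans ?_
        simp
      have hSm : L[p] ∈ L := List.getElem_mem hp
      have hSm' := mem_budgetList.1 hSm
      have henv₂ : Env n B σ₂ := henv₁.of_eq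
        (fun a ha => hreg₂ a (by omega) (by omega) (by omega) (by omega) (by omega))
        fun i _ => by rw [harr₂ 1 (by omega) (by omega) (by omega),
          harr 1 (by omega) (by omega) (by omega)]
      refine HT.imp (enumItem_spec (b := b) (j := j) (p := p) (S := L[p]) henv₂ hnW hBW (hbW j hj)
        (by rw [hreg₂ 10 (by omega) (by omega) (by omega) (by omega) (by omega), h10])
        (by rw [hreg₂ 40 (by omega) (by omega) (by omega) (by omega) (by omega), h40])
        h44 h45 hi₂ hL₂ (by rw [List.length_append]; omega) (by rw [List.length_append]; omega)
        (List.getElem_append_left hp) (fun h => by simpa using hSm'.1 h) hSm'.2) ?_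
      rintro σ₃ ⟨hL₃, hreg₃, harr₃⟩
      refine ⟨by rw [hreg₃ 46 (by omega) (by omega), hi₂], by rw [hreg₃ 43 (by omega) (by omega), h43],
        by rw [hreg₃ 3 (by omega) (by omega), henv₂.one], ?_, fun a ha h1 h2 h3 h4 => ?_, ?_, ?_,
        fun k hk h4 h5 i => ?_⟩
      · refine Holds.of_eq ?_ (σ := σ₃) (by simp) rfl
        convert hL₃ using 1
        rw [List.take_add_one, List.getElem?_eq_getElem hp, Option.toList_some, List.filter_append,
          List.map_append, List.filter_singleton]
        rw [Bool.cond_decide]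
        split_ifs <;> simp [hF]
      · simp [show a ≠ 46 by omega, hreg₃ a (by omega) h1, hreg₂ a ha h1 h2 h3 h4]
      · rw [State.reg_setReg, if_neg (by omega), hreg₃ 44 (by omega) (by omega), h44]
      · rw [State.reg_setReg, if_neg (by omega), hreg₃ 45 (by omega) (by omega), h45]
      · simp [harr₃ k hk h4 h5 i, harr₂ k hk h4 h5 i]
    · rintro σ₂ ⟨hL₂, hreg₂, h44, h45, harr₂⟩
      have e : ∀ a < 43, a ≠ 11 → σ₂.reg a = σ₁.reg a := fun a ha h1 =>
        hreg₂ a (by omega) h1 (by omega) (by omega) (by omega)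
      refine ⟨by rw [e 42 (by omega) (by omega), hi], by rw [e 0 (by omega) (by omega), hlen],
        by rw [e 3 (by omega) (by omega), h3], ?_, ?_, fun a ha h1 => ?_, fun k hk h4 h5 i => ?_⟩
      · refine Holds.of_eq ?_ (σ := σ₂) (by simp) rfl
        rw [List.take_length] at hL₂
        exact hL₂
      · simp [e 40, h40]
      · simp [show a ≠ 42 by omega, e a (by omega) h1, hreg a ha h1]
      · simp [harr₂ k hk h4 h5 i]
  · rintro σ' ⟨h1, _, h2, h3⟩
    exact ⟨h1, h2, h3⟩

/-! ### Elimination with preferred pivots -/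

/-- The vectors `g j` that have not been removed (those of cost `κ j ≤ n`) form a basis of the
words that satisfy the first `i` checks, in echelon form; and those of cost zero are supported on
the positions of initial cost zero. -/
structure Elim (n : ℕ) (A : ℕ → ℕ → ZMod 2) (κ₀ : ℕ → ℕ) (i : ℕ) (g : ℕ → ℕ → ZMod 2) (κ : ℕ → ℕ) :
    Prop where
  cost : ∀ j < n, κ j = κ₀ j ∨ κ j = n * n + 1
  check : ∀ j < n, κ j ≤ n → ∀ i' < i, dot n (A i') (g j) = 0
  unit : ∀ j < n, κ j ≤ n → ∀ k < n, κ k ≤ n → g j k = if j = k then 1 else 0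
  span : ∀ c : ℕ → ZMod 2, (∀ i' < i, dot n (A i') c = 0) → ∀ k < n,
    c k = ∑ j ∈ (Finset.range n).filter (fun j => κ j ≤ n), c j * g j k
  supp : ∀ j < n, κ j = 0 → ∀ k < n, κ₀ k ≠ 0 → g j k = 0

theorem Elim.init (n : ℕ) (A : ℕ → ℕ → ZMod 2) {κ₀ : ℕ → ℕ} (hκ₀ : ∀ j, κ₀ j ≤ n) :
    Elim n A κ₀ 0 (fun j => Pi.single j 1) κ₀ := by
  refine ⟨fun j _ => Or.inl rfl, fun j _ _ i' hi => by omega, fun j _ _ k _ _ => ?_,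
    fun c _ k hk => ?_, fun j hj h k hk hk' => ?_⟩
  · rw [Pi.single_apply]; simp [eq_comm]
  · rw [Finset.filter_true_of_mem (fun j _ => hκ₀ j), Finset.sum_eq_single_of_mem k
      (Finset.mem_range.2 hk)]
    · simp
    · intro j _ hj
      simp [Ne.symm hj]
  · rw [Pi.single_apply, if_neg]
    rintro rfl
    exact hk' h

theorem Elim.step_of_zero {n : ℕ} {A : ℕ → ℕ → ZMod 2} {κ₀ : ℕ → ℕ} {i : ℕ} {g : ℕ → ℕ → ZMod 2}
    {κ : ℕ → ℕ} (h : Elim n A κ₀ i g κ) (h0 : ∀ j < n, κ j ≤ n → dot n (A i) (g j) = 0) :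
    Elim n A κ₀ (i + 1) g κ := by
  refine ⟨h.cost, fun j hj hκ i' hi => ?_, h.unit, fun c hc => h.span c fun i' hi => hc i' (by omega),
    h.supp⟩
  rcases Nat.lt_succ_iff_lt_or_eq.1 hi with h1 | rfl
  · exact h.check j hj hκ i' h1
  · exact h0 j hj hκ

/-- The pivot is added to all vectors that violate the check, and is then retired by a cost above
every budget. A word that satisfies the check has its coefficient at `p` determined by the others,
so no solutions are lost. The minimality of the pivot's cost keeps vectors of cost zero off the
window: if one of them is corrected at all, the pivot has cost zero too. -/
theorem Elim.step {n : ℕ} {A : ℕ → ℕ → ZMod 2} {κ₀ : ℕ → ℕ} {i : ℕ} {g : ℕ → ℕ → ZMod 2}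
    {κ : ℕ → ℕ} (h : Elim n A κ₀ i g κ) {p : ℕ} (hp : p < n) (hκp : κ p ≤ n)
    (h1 : dot n (A i) (g p) = 1)
    (hmin : ∀ j < n, κ j ≤ n → dot n (A i) (g j) = 1 → κ p ≤ κ j) :
    Elim n A κ₀ (i + 1) (fun j => g j + dot n (A i) (g j) • g p)
      (Function.update κ p (n * n + 1)) := by
  have hnn : n ≤ n * n := by nlinarith
  have halive : ∀ j, Function.update κ p (n * n + 1) j ≤ n ↔ j ≠ p ∧ κ j ≤ n := fun j => by
    rw [Function.update_apply]
    split_ifs with hj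
    · simp only [hj]; omega
    · simp [hj]
  refine ⟨fun j hj => ?_, fun j hj hκ i' hi => ?_, fun j hj hκ k hk hκk => ?_, fun c hc k hk => ?_,
    fun j hj hκ k hk hκk => ?_⟩
  · rw [Function.update_apply]
    split_ifs
    · exact Or.inr rfl
    · exact h.cost j hj
  · rw [halive] at hκ
    rw [dot_add_right, dot_smul_right]
    rcases Nat.lt_succ_iff_lt_or_eq.1 hi with h2 | rfl
    · rw [h.check j hj hκ.2 i' h2, h.check p hp hκp i' h2]; simp
    · rw [h1, mul_one]; exact CharTwo.add_self_eq_zero _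
  · rw [halive] at hκ hκk
    rw [Pi.add_apply, Pi.smul_apply, h.unit p hp hκp k hk hκk.2, if_neg (Ne.symm hκk.1),
      h.unit j hj hκ.2 k hk hκk.2]
    simp
  · have hset : (Finset.range n).filter (fun j => Function.update κ p (n * n + 1) j ≤ n) =
        ((Finset.range n).filter (fun j => κ j ≤ n)).erase p := by
      ext j
      simp only [Finset.mem_filter, halive, Finset.mem_erase]
      tauto
    set S := (Finset.range n).filter (fun j => κ j ≤ n) with hS
    have hpS : p ∈ S := by simp [hS, hp, hκp]
    have hspan := h.span c fun i' hi => hc i' (by omega)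
    have hdot : ∑ j ∈ S, c j * dot n (A i) (g j) = 0 := by
      rw [← hc i (by omega), dot_congr_right (w := ∑ j ∈ S, c j • g j)
        (fun k hk => by rw [hspan k hk, Finset.sum_apply]; rfl), dot_sum_right]
      simp [dot_smul_right]
    rw [hset, hspan k hk]
    rw [← Finset.add_sum_erase _ _ hpS] at hdot ⊢
    rw [h1, mul_one] at hdot
    have hcp : c p = ∑ j ∈ S.erase p, c j * dot n (A i) (g j) := by
      rw [← sub_eq_zero, CharTwo.sub_eq_add]; exact hdot
    rw [hcp, Finset.sum_mul, ← Finset.sum_add_distrib]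
    refine Finset.sum_congr rfl fun j _ => ?_
    simp only [Pi.add_apply, Pi.smul_apply, smul_eq_mul]
    ring
  · have hjp : j ≠ p ∧ κ j ≤ n := (halive j).1 (by omega)
    rw [Function.update_of_ne hjp.1] at hκ
    rw [Pi.add_apply, Pi.smul_apply, h.supp j hj hκ k hk hκk]
    rcases zmod_two_cases (dot n (A i) (g j)) with h2 | h2
    · simp [h2]
    · have := hmin j hj hjp.2 h2
      rw [h.supp p hp (by omega) k hk hκk]; simp

/-- Sums of vectors of the basis are codewords. -/
theorem Elim.dot_sum {n r : ℕ} {A : ℕ → ℕ → ZMod 2} {κ₀ : ℕ → ℕ} {g : ℕ → ℕ → ZMod 2} {κ : ℕ → ℕ}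
    (h : Elim n A κ₀ r g κ) {S : Finset ℕ} (hS : S ⊆ Finset.range n) {b : ℕ} (hb : b ≤ n * n)
    (hκ₀ : ∀ j, κ₀ j ≤ n) (hSb : ∑ j ∈ S, κ j ≤ b) {i : ℕ} (hi : i < r) :
    dot n (A i) (∑ j ∈ S, g j) = 0 := by
  rw [dot_sum_right]
  refine Finset.sum_eq_zero fun j hj => h.check j (Finset.mem_range.1 (hS hj)) ?_ i hi
  have h1 := Finset.single_le_sum (f := κ) (fun _ _ => Nat.zero_le _) hj
  rcases h.cost j (Finset.mem_range.1 (hS hj)) with h2 | h2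
  · rw [h2]; exact hκ₀ j
  · omega

/-- Each codeword is the sum of the vectors at its positions. -/
theorem Elim.eq_sum {n r : ℕ} {A : ℕ → ℕ → ZMod 2} {κ₀ : ℕ → ℕ} {g : ℕ → ℕ → ZMod 2} {κ : ℕ → ℕ}
    (h : Elim n A κ₀ r g κ) {c : ℕ → ZMod 2} (hc : ∀ i < r, dot n (A i) c = 0) {k : ℕ} (hk : k < n) :
    c k = (∑ j ∈ (Finset.range n).filter (fun j => κ j ≤ n ∧ c j ≠ 0), g j) k := by
  rw [h.span c hc k hk, Finset.sum_apply, ← Finset.filter_filter, Finset.sum_filter (fun j => c j ≠ 0)]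
  refine Finset.sum_congr rfl fun j _ => ?_
  rcases zmod_two_cases (c j) with h | h <;> simp [h]

/-- Distinct sums of the vectors of the basis are distinct. -/
theorem Elim.sum_injOn {n r : ℕ} {A : ℕ → ℕ → ZMod 2} {κ₀ : ℕ → ℕ} {g : ℕ → ℕ → ZMod 2}
    {κ : ℕ → ℕ} (h : Elim n A κ₀ r g κ) {S : Finset ℕ} (hS : S ⊆ Finset.range n)
    (hSn : ∀ j ∈ S, κ j ≤ n) {k : ℕ} (hk : k < n) (hκk : κ k ≤ n) :
    (∑ j ∈ S, g j) k = if k ∈ S then 1 else 0 := by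
  rw [Finset.sum_apply, Finset.sum_congr rfl (g := fun j => if k = j then (1 : ZMod 2) else 0)
    (fun j hj => by rw [h.unit j (Finset.mem_range.1 (hS hj)) (hSn j hj) k hk hκk]; simp [eq_comm]),
    Finset.sum_ite_eq]

/-! ### The elimination routine -/

/-- The machine has enough room for all addresses and numbers. -/
def Room (W n r B : ℕ) : Prop := B + 8 * 2 ^ n + 8 * 2 ^ r + 8 * (n * n) + 8 * n + 16 < 2 ^ W

/-- The arrays `2`, `3` hold the vectors `g j` and their costs `κ j`. -/
structure Vecs (n B : ℕ) (g : ℕ → ℕ → ZMod 2) (κ : ℕ → ℕ) (σ : State) : Prop where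
  vec : ∀ j < n, σ.arr B 2 j = enc n (g j)
  cost : ∀ j < n, σ.arr B 3 j = κ j

theorem Vecs.of_eq {n B : ℕ} {g : ℕ → ℕ → ZMod 2} {κ : ℕ → ℕ} {σ σ' : State}
    (h : Vecs n B g κ σ) (h2 : ∀ j, σ'.arr B 2 j = σ.arr B 2 j)
    (h3 : ∀ j, σ'.arr B 3 j = σ.arr B 3 j) : Vecs n B g κ σ' :=
  ⟨fun j hj => by rw [h2, h.vec j hj], fun j hj => by rw [h3, h.cost j hj]⟩

/-- Replaces the pivot by vector number `R_30`, if that is better. -/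
def Prog.pivotStep : Prog :=
  .aget 31 3 30 ;; .ifLt 27 31 .skip (.aget 61 2 30 ;; .add 60 26 17 ;; .comb ;;
    .ifLt 17 63 (.add 27 31 17 ;; .add 28 30 17 ;; .const 29 1) .skip)

/-- Finds the cheapest pivot for the row in register `26`. -/
def Prog.pivot : Prog :=
  .add 27 0 17 ;; .const 28 0 ;; .const 29 0 ;; .forLt 30 0 .pivotStep

/-- Register `27` holds the best cost so far and starts at `n`, which excludes the retired vectors
of cost `n * n + 1`. A candidate whose cost equals the best one is accepted. -/
theorem pivot_spec {W n r B : ℕ} {σ : State} {u : ℕ → ZMod 2} {g : ℕ → ℕ → ZMod 2} {κ : ℕ → ℕ}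
    (henv : Env n B σ) (hroom : Room W n r B) (hv : Vecs n B g κ σ) (h17 : σ.reg 17 = 0)
    (h26 : σ.reg 26 = enc n u) (hκW : ∀ j < n, κ j < 2 ^ W) :
    HT W .pivot σ ((combCost n + 22) * n + 5) fun σ' => σ'.mem = σ.mem ∧
      (∀ a < 27, σ'.reg a = σ.reg a) ∧
      ((σ'.reg 29 = 0 ∧ ∀ j < n, κ j ≤ n → dot n u (g j) = 0) ∨
        σ'.reg 29 = 1 ∧ ∃ p < n, σ'.reg 28 = p ∧ κ p ≤ n ∧ dot n u (g p) = 1 ∧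
          ∀ j < n, κ j ≤ n → dot n u (g j) = 1 → κ p ≤ κ j) := by
  unfold Room at hroom
  have hn2 : n < 2 ^ n := Nat.lt_two_pow_self
  refine HT.weaken (N₁ := 1 + (1 + (1 + (((combCost n + 20) + 2) * n + 2)))) ?_ (by ring_nf; omega)
  refine HT.add' (by rw [henv.len, h17]; omega) (HT.const' (by omega) (HT.const' (by omega) ?_))
  refine HT.forLt n _ (fun k σ' => σ'.mem = σ.mem ∧ (∀ a < 27, σ'.reg a = σ.reg a) ∧
      ((σ'.reg 29 = 0 ∧ σ'.reg 27 = n ∧ ∀ j < k, κ j ≤ n → dot n u (g j) = 0) ∨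
        σ'.reg 29 = 1 ∧ ∃ p < k, σ'.reg 28 = p ∧ σ'.reg 27 = κ p ∧ κ p ≤ n ∧ dot n u (g p) = 1 ∧
          ∀ j < k, κ j ≤ n → dot n u (g j) = 1 → κ p ≤ κ j)) (by omega) (by simp [henv.len]) ?_ ?_ ?_
  · refine ⟨rfl, fun a ha => ?_, Or.inl ⟨by simp, by simp [henv.len, h17], fun j hj => by omega⟩⟩
    simp (disch := omega) only [State.reg_setReg, if_neg]
  · rintro k σ₁ hk ⟨hmem, hreg, hcase⟩ hi hlen
    have h4 : σ₁.reg 4 = B := (hreg 4 (by omega)).trans henv.base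
    have h3 : σ₁.reg 3 = 1 := (hreg 3 (by omega)).trans henv.one
    have harr : ∀ k i, σ₁.arr B k i = σ.arr B k i := fun k i => by unfold State.arr; rw [hmem]
    have h27 : σ₁.reg 27 ≤ n := by
      rcases hcase with h | ⟨_, p, _, _, h, h', _⟩ <;> omega
    refine HT.weaken (N₁ := 7 + ((7 + (1 + (combCost n + (1 + (1 + 1) + 1)))) + 1)) ?_ (by omega)
    refine HT.aget' (x := k) (B := B) hi h4 (by omega) ?_
    rw [harr, hv.cost k hk]
    refine HT.ifLt (fun h => ?_) (fun h => ?_)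
    · simp at h
      refine HT.weaken (HT.skip ?_) (by omega)
      refine ⟨by simp [hi], by simp [hlen], by simp [h3], hmem, fun a ha => ?_, ?_⟩
      · simp (disch := omega) only [State.reg_setReg, if_neg]
        exact hreg a ha
      · simp
        rcases hcase with ⟨c1, c2, c3⟩ | ⟨c1, p, hp, c2, c3, c4, c5, c6⟩
        · refine Or.inl ⟨c1, c2, fun j hj hjn => ?_⟩
          rcases Nat.lt_or_eq_of_le hj with h1 | rfl
          · exact c3 j h1 hjn
          · omega
        · refine Or.inr ⟨c1, by omega, by rw [c2]; exact c3, by rw [c2]; exact c4, by rw [c2]; exact c5,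
            fun j hj hjn hj1 => ?_⟩
          rw [c2]
          rcases Nat.lt_or_eq_of_le hj with h1 | rfl
          · exact c6 j h1 hjn hj1
          · omega
    · simp at h
      refine HT.aget' (x := k) (B := B) (by simp [hi]) (by simp [h4]) (by omega) (HT.add' ?_ ?_)
      · simp [hreg 17, hreg 26, h17, h26]
        have := enc_lt n u; omega
      refine HT.call (comb_spec (u := u) (v := g k) (henv.of_eq (fun a ha => ?_) fun i _ => ?_)
        (by omega) (by omega) ?_ ?_) ?_
      · simp (disch := omega) only [State.reg_setReg, if_neg]
        exact hreg a (by omega)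
      · simp [harr]
      · simp [hreg 17, hreg 26, h17, h26]
      · simp [harr, hv.vec k hk]
      rintro σ₂ ⟨hmem₂, hreg₂, -, h63, -⟩
      have hmem₂' : σ₂.mem = σ.mem := by rw [hmem₂]; simpa using hmem
      have hr : ∀ a < 31, σ₂.reg a = σ₁.reg a := fun a ha => by
        rw [hreg₂ a (by omega)]
        simp (disch := omega) only [State.reg_setReg, if_neg]
      have h31 : σ₂.reg 31 = κ k := by rw [hreg₂ 31 (by omega)]; simp
      have h17' : σ₂.reg 17 = 0 := by rw [hr 17 (by omega), hreg 17 (by omega), h17]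
      rcases zmod_two_cases (dot n u (g k)) with hd | hd
      · rw [hd, ZMod.val_zero] at h63
        refine HT.ifLt (fun h => by omega) (fun _ => HT.weaken (HT.skip ?_) (by omega))
        refine ⟨by rw [hr 30 (by omega), hi], by rw [hr 0 (by omega), hlen],
          by rw [hr 3 (by omega), h3], hmem₂', fun a ha => ?_, ?_⟩
        · simp (disch := omega) only [State.reg_setReg, if_neg]
          rw [hr a (by omega), hreg a ha]
        · simp [hr]
          rcases hcase with ⟨c1, c2, c3⟩ | ⟨c1, p, hp, c2, c3, c4, c5, c6⟩
          · refine Or.inl ⟨c1, c2, fun j hj hjn => ?_⟩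
            rcases Nat.lt_or_eq_of_le hj with h1 | rfl
            · exact c3 j h1 hjn
            · exact hd
          · refine Or.inr ⟨c1, by omega, by rw [c2]; exact c3, by rw [c2]; exact c4,
              by rw [c2]; exact c5, fun j hj hjn hj1 => ?_⟩
            rw [c2]
            rcases Nat.lt_or_eq_of_le hj with h1 | rfl
            · exact c6 j h1 hjn hj1
            · rw [hd] at hj1; simp at hj1
      · rw [hd, ZMod.val_one] at h63
        refine HT.ifLt (fun _ => ?_) (fun h => by omega)
        have hκk := hκW k hk
        refine HT.add' (by rw [h31, h17']; omega) (HT.add' ?_ (HT.const (by omega) ?_))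
        · simp [hr 30, hi, h17']; omega
        refine ⟨by simp [hr 30, hi], by simp [hr 0, hlen], by simp [hr 3, h3], hmem₂', fun a ha => ?_,
          Or.inr ⟨by simp, k, by omega, ?_, ?_, ?_, hd, ?_⟩⟩
        · simp (disch := omega) only [State.reg_setReg, if_neg]
          rw [hr a (by omega), hreg a ha]
        · simp [hr 30, hi, h17']
        · simp [h31, h17']
        · omega
        · intro j hj hjn hj1
          rcases Nat.lt_succ_iff_lt_or_eq.1 hj with h1 | rfl
          · rcases hcase with ⟨c1, c2, c3⟩ | ⟨c1, p, hp, c2, c3, c4, c5, c6⟩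
            · rw [c3 j h1 hjn] at hj1; simp at hj1
            · have := c6 j h1 hjn hj1
              omega
          · exact le_rfl
  · rintro σ' ⟨h1, h2, h3⟩
    refine ⟨h1, h2, ?_⟩
    rcases h3 with ⟨c1, -, c3⟩ | ⟨c1, p, hp, c2, -, c⟩
    · exact Or.inl ⟨c1, c3⟩
    · exact Or.inr ⟨c1, p, hp, c2, c⟩

/-- Adds the pivot vector in register `32` to vector number `R_30`, if that violates the check in
register `26`. -/
def Prog.clearStep : Prog :=
  .aget 61 2 30 ;; .add 60 26 17 ;; .comb ;;
    .ifLt 17 63 (.aget 60 2 30 ;; .add 61 32 17 ;; .comb ;; .aset 2 30 62) .skip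

/-- Removes the pivot in register `28`. -/
def Prog.clear : Prog :=
  .aget 32 2 28 ;; .aset 3 28 5 ;; .forLt 30 0 .clearStep

/-- Register `32` keeps a copy of the pivot vector, because the loop also reaches the pivot itself
and may turn it into zero. -/
theorem clear_spec {W n r B p : ℕ} {σ : State} {u : ℕ → ZMod 2} {g : ℕ → ℕ → ZMod 2} {κ : ℕ → ℕ}
    (henv : Env n B σ) (hroom : Room W n r B) (hv : Vecs n B g κ σ) (h17 : σ.reg 17 = 0)
    (h26 : σ.reg 26 = enc n u) (h28 : σ.reg 28 = p) (hp : p < n) :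
    HT W .clear σ ((2 * combCost n + 27) * n + 16) fun σ' =>
      (∀ a < 30, σ'.reg a = σ.reg a) ∧
      Vecs n B (fun j => g j + dot n u (g j) • g p) (Function.update κ p (σ.reg 5)) σ' ∧
      ∀ k < 8, k ≠ 2 → k ≠ 3 → ∀ i, σ'.arr B k i = σ.arr B k i := by
  unfold Room at hroom
  have hn2 : n < 2 ^ n := Nat.lt_two_pow_self
  refine HT.weaken (N₁ := 7 + (7 + (((2 * combCost n + 25) + 2) * n + 2))) ?_ (by ring_nf; omega)
  refine HT.aget' (x := p) (B := B) h28 henv.base (by omega) (HT.aset' (x := p) (B := B) (by omega)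
    (by simp [h28]) (by simp [henv.base]) (by omega) ?_)
  rw [hv.vec p hp]
  refine HT.forLt n _ (fun k σ' => (∀ a < 30, σ'.reg a = σ.reg a) ∧ σ'.reg 32 = enc n (g p) ∧
      Vecs n B (fun j => if j < k then g j + dot n u (g j) • g p else g j)
        (Function.update κ p (σ.reg 5)) σ' ∧
      ∀ k < 8, k ≠ 2 → k ≠ 3 → ∀ i, σ'.arr B k i = σ.arr B k i) (by omega) (by simp [henv.len]) ?_ ?_ ?_
  · refine ⟨fun a ha => ?_, by simp, ⟨fun j hj => ?_, fun j hj => ?_⟩, fun k hk h2 h3 i => ?_⟩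
    · simp only [State.reg_setReg, State.reg_setArr]
      simp (disch := omega) only [if_neg]
    · simp only [State.arr_setReg]
      rw [State.arr_setArr_of_ne _ _ (by omega) (by omega) (by omega)]
      simp [hv.vec j hj]
    · simp only [State.arr_setReg]
      rw [State.arr_setArr_self _ _ (by omega)]
      simp [hv.cost j hj, Function.update_apply]
    · simp only [State.arr_setReg]
      rw [State.arr_setArr_of_ne _ _ (by omega) hk h3]
      simp
  · rintro k σ₁ hk ⟨hreg, h32, hv₁, harr⟩ hi hlen
    have h4 : σ₁.reg 4 = B := (hreg 4 (by omega)).trans henv.base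
    have h3 : σ₁.reg 3 = 1 := (hreg 3 (by omega)).trans henv.one
    have hvk : σ₁.arr B 2 k = enc n (g k) := by have := hv₁.vec k hk; simpa using this
    refine HT.weaken (N₁ := 7 + (1 + (combCost n + ((7 + (1 + (combCost n + 7))) + 1)))) ?_ (by omega)
    refine HT.aget' (x := k) (B := B) hi h4 (by omega) (HT.add' ?_ ?_)
    · simp [hreg 17, hreg 26, h17, h26]
      have := enc_lt n u; omega
    rw [hvk]
    refine HT.call (comb_spec (u := u) (v := g k) (henv.of_eq (fun a ha => ?_) fun i _ => ?_)
      (by omega) (by omega) ?_ ?_) ?_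
    · simp (disch := omega) only [State.reg_setReg, if_neg]
      exact hreg a (by omega)
    · simp [harr]
    · simp [hreg 17, hreg 26, h17, h26]
    · simp
    rintro σ₂ ⟨hmem₂, hreg₂, -, h63, -⟩
    have hr : ∀ a < 60, σ₂.reg a = σ₁.reg a := fun a ha => by
      rw [hreg₂ a (by omega)]
      simp (disch := omega) only [State.reg_setReg, if_neg]
    have hm₂ : ∀ k i, σ₂.arr B k i = σ₁.arr B k i := fun k i => by
      unfold State.arr; rw [hmem₂]; rfl
    have h17' : σ₂.reg 17 = 0 := by rw [hr 17 (by omega), hreg 17 (by omega), h17]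
    rcases zmod_two_cases (dot n u (g k)) with hd | hd
    · rw [hd, ZMod.val_zero] at h63
      refine HT.ifLt (fun h => by omega) (fun _ => HT.weaken (HT.skip ?_) (by omega))
      refine ⟨by rw [hr 30 (by omega), hi], by rw [hr 0 (by omega), hlen],
        by rw [hr 3 (by omega), h3], fun a ha => ?_, ?_, ⟨fun j hj => ?_, fun j hj => ?_⟩,
        fun k hk h2 h3 i => ?_⟩
      · simp (disch := omega) only [State.reg_setReg, if_neg]
        rw [hr a (by omega), hreg a ha]
      · simp [hr 32, h32]
      · rw [State.arr_setReg, hm₂, hv₁.vec j hj]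
        congr 1
        by_cases hjk : j = k
        · subst hjk; simp [hd]
        · simp [show j < k + 1 ↔ j < k by omega]
      · rw [State.arr_setReg, hm₂, hv₁.cost j hj]
      · rw [State.arr_setReg, hm₂, harr k hk h2 h3]
    · rw [hd, ZMod.val_one] at h63
      refine HT.ifLt (fun _ => ?_) (fun h => by omega)
      refine HT.aget' (x := k) (B := B) (by rw [hr 30 (by omega), hi]) (by rw [hr 4 (by omega), h4])
        (by omega) (HT.add' ?_ ?_)
      · simp [hr 32, h32, h17']
        have := enc_lt n (g p); omega
      refine HT.call (comb_spec (u := g k) (v := g p) (henv.of_eq (fun a ha => ?_) fun i _ => ?_)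
        (by omega) (by omega) ?_ ?_) ?_
      · simp (disch := omega) only [State.reg_setReg, if_neg]
        rw [hr a (by omega), hreg a (by omega)]
      · simp [hm₂, harr]
      · simp [hm₂, hvk]
      · simp [hr 32, h32, h17']
      rintro σ₃ ⟨hmem₃, hreg₃, h62, -, -⟩
      have hr₃ : ∀ a < 60, σ₃.reg a = σ₁.reg a := fun a ha => by
        rw [hreg₃ a (by omega), ← hr a ha]
        simp (disch := omega) only [State.reg_setReg, if_neg]
      have hm₃ : ∀ k i, σ₃.arr B k i = σ₁.arr B k i := fun k i => by
        rw [← hm₂]; unfold State.arr; rw [hmem₃]; rfl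
      refine HT.aset (x := k) (B := B) (by omega) (by rw [hr₃ 30 (by omega), hi])
        (by rw [hr₃ 4 (by omega), h4]) (by omega) ?_
      rw [h62]
      refine ⟨by simp [hr₃ 30, hi], by simp [hr₃ 0, hlen], by simp [hr₃ 3, h3], fun a ha => ?_, ?_,
        ⟨fun j hj => ?_, fun j hj => ?_⟩, fun k hk h2 h3 i => ?_⟩
      · simp only [State.reg_setReg, State.reg_setArr]
        simp (disch := omega) only [if_neg]
        rw [hr₃ a (by omega), hreg a ha]
      · simp [hr₃ 32, h32]
      · rw [State.arr_setReg, State.arr_setArr_self _ _ (by omega)]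
        by_cases hjk : j = k
        · subst hjk; simp [hd]
        · simp [show j < k + 1 ↔ j < k by omega, hm₃, hjk, hv₁.vec j hj]
      · rw [State.arr_setReg, State.arr_setArr_of_ne _ _ (by omega) (by omega) (by omega)]
        simp [hm₃, hv₁.cost j hj]
      · rw [State.arr_setReg, State.arr_setArr_of_ne _ _ (by omega) hk h2]
        simp [hm₃, harr k hk h2 h3]
  · rintro σ' ⟨h1, -, h2, h3⟩
    exact ⟨h1, ⟨fun j hj => by have := h2.vec j hj; rwa [if_pos hj] at this, h2.cost⟩, h3⟩

/-- Eliminates with row number `R_25`. -/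
def Prog.elimRow : Prog :=
  .aget 26 0 25 ;; .pivot ;; .ifLt 17 29 .clear .skip

/-- The number of operations of `elimRow`. -/
def elimRowCost (n : ℕ) : ℕ := (3 * combCost n + 50) * n + 30

theorem elimRow_spec {W n r B i : ℕ} {σ : State} {A : ℕ → ℕ → ZMod 2} {κ₀ : ℕ → ℕ}
    {g : ℕ → ℕ → ZMod 2} {κ : ℕ → ℕ}
    (henv : Env n B σ) (hroom : Room W n r B) (hv : Vecs n B g κ σ) (h17 : σ.reg 17 = 0)
    (h5 : σ.reg 5 = n * n + 1) (h25 : σ.reg 25 = i) (hi : i < r) (hrow : σ.arr B 0 i = enc n (A i))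
    (hκ₀ : ∀ j, κ₀ j ≤ n) (h : Elim n A κ₀ i g κ) :
    HT W .elimRow σ (elimRowCost n) fun σ' => (∀ a < 26, σ'.reg a = σ.reg a) ∧
      (∃ g' κ', Vecs n B g' κ' σ' ∧ Elim n A κ₀ (i + 1) g' κ') ∧
      ∀ k < 8, k ≠ 2 → k ≠ 3 → ∀ i, σ'.arr B k i = σ.arr B k i := by
  have hroom' := hroom
  unfold Room at hroom'
  have hn2 : n < 2 ^ n := Nat.lt_two_pow_self
  have hr2 : r < 2 ^ r := Nat.lt_two_pow_self
  refine HT.weaken (N₁ := 7 + (((combCost n + 22) * n + 5) + (((2 * combCost n + 27) * n + 16) + 1))) ?_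
    (by unfold elimRowCost; ring_nf; omega)
  refine HT.aget' (x := i) (B := B) h25 henv.base (by omega) ?_
  rw [hrow]
  refine HT.call (pivot_spec (u := A i) (henv.of_eq (fun a ha => ?_) fun i _ => rfl) hroom
    (hv.of_eq (fun _ => rfl) fun _ => rfl) (by simp [h17]) (by simp) fun j hj => ?_) ?_
  · simp (disch := omega) only [State.reg_setReg, if_neg]
  · rcases h.cost j hj with h1 | h1
    · rw [h1]; have := hκ₀ j; omega
    · omega
  rintro σ₁ ⟨hmem, hreg, hcase⟩
  have hr : ∀ a < 26, σ₁.reg a = σ.reg a := fun a ha => by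
    rw [hreg a (by omega)]
    simp (disch := omega) only [State.reg_setReg, if_neg]
  have harr : ∀ k i, σ₁.arr B k i = σ.arr B k i := fun k i => by
    unfold State.arr; rw [hmem]; rfl
  have hv₁ : Vecs n B g κ σ₁ := hv.of_eq (fun _ => harr _ _) fun _ => harr _ _
  have h17' : σ₁.reg 17 = 0 := by rw [hr 17 (by omega), h17]
  rcases hcase with ⟨h29, h0⟩ | ⟨h29, p, hp, h28, hκp, h1, hmin⟩
  · refine HT.ifLt (fun h => by omega) (fun _ => HT.weaken (HT.skip ?_) (by omega))
    exact ⟨hr, ⟨g, κ, hv₁, h.step_of_zero h0⟩, fun k _ _ _ i => harr k i⟩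
  · refine HT.ifLt (fun _ => ?_) (fun h => by omega)
    refine HT.imp (clear_spec (u := A i) (p := p) (henv.of_eq (fun a ha => hr a (by omega))
      fun i _ => harr _ _) hroom hv₁ h17' (by rw [hreg 26 (by omega)]; simp) h28 hp) ?_
    rintro σ₂ ⟨hreg₂, hv₂, harr₂⟩
    rw [hr 5 (by omega), h5] at hv₂
    refine ⟨fun a ha => by rw [hreg₂ a (by omega), hr a ha], ⟨_, _, hv₂, h.step hp hκp h1 hmin⟩,
      fun k hk h2 h3 i => by rw [harr₂ k hk h2 h3, harr]⟩

/-- Initial vector number `R_20` and its cost, for the window of length `R_13` at `R_12`. -/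
def Prog.basisInit : Prog :=
  .aget 21 1 20 ;; .aset 2 20 21 ;; .add 22 12 13 ;; .add 23 20 0 ;; .const 24 0 ;;
    .ifLt 23 22 (.add 24 0 24) (.ifLt 20 12 .skip (.ifLt 20 22 (.add 24 0 24) .skip)) ;;
    .aset 3 20 24

/-- The initial costs: `n` in the window, and zero elsewhere. -/
def windowCost (n a s j : ℕ) : ℕ := if InWindow n a s j then n else 0

theorem windowCost_le (n a s j : ℕ) : windowCost n a s j ≤ n := by
  unfold windowCost; split_ifs <;> omega

theorem basisInit_spec {W n r B s a k : ℕ} {σ : State} (henv : Env n B σ) (hroom : Room W n r B)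
    (h12 : σ.reg 12 = s) (h13 : σ.reg 13 = a) (hs : s ≤ n) (ha : a ≤ n) (h20 : σ.reg 20 = k)
    (hk : k < n) :
    HT W .basisInit σ 30 fun σ' => (∀ a < 21, σ'.reg a = σ.reg a) ∧
      (∀ j, σ'.arr B 2 j = if j = k then 2 ^ k else σ.arr B 2 j) ∧
      (∀ j, σ'.arr B 3 j = if j = k then windowCost n a s k else σ.arr B 3 j) ∧
      ∀ k < 8, k ≠ 2 → k ≠ 3 → ∀ i, σ'.arr B k i = σ.arr B k i := by
  unfold Room at hroom
  have hn2 : n < 2 ^ n := Nat.lt_two_pow_self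
  refine HT.weaken (N₁ := 7 + (7 + (1 + (1 + (1 + ((3 + 1) + 7)))))) ?_ (by omega)
  refine HT.aget' (x := k) (B := B) h20 henv.base (by omega) (HT.aset' (x := k) (B := B) (by omega)
    (by simp [h20]) (by simp [henv.base]) (by omega) (HT.add' (by simp [h12, h13]; omega)
    (HT.add' (by simp [h20, henv.len]; omega) (HT.const' (by omega) ?_))))
  rw [henv.pow k hk]
  refine HT.call (Q₁ := fun σ' => σ'.reg 24 = windowCost n a s k ∧ (∀ a < 21, σ'.reg a = σ.reg a) ∧
    (∀ j, σ'.arr B 2 j = if j = k then 2 ^ k else σ.arr B 2 j) ∧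
    ∀ k < 8, k ≠ 2 → ∀ i, σ'.arr B k i = σ.arr B k i) ?_ ?_
  · have key : ∀ σ' : State, σ'.reg 24 = windowCost n a s k → σ'.mem = (((σ.setReg 91 1).setReg 90
          (B + 8 * k + 1)).setReg 21 (2 ^ k) |>.setReg 91 2 |>.setReg 90 (B + 8 * k + 2)
          |>.setArr B 2 k (2 ^ k)).mem → (∀ a < 21, σ'.reg a = σ.reg a) →
        σ'.reg 24 = windowCost n a s k ∧ (∀ a < 21, σ'.reg a = σ.reg a) ∧
        (∀ j, σ'.arr B 2 j = if j = k then 2 ^ k else σ.arr B 2 j) ∧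
        ∀ k < 8, k ≠ 2 → ∀ i, σ'.arr B k i = σ.arr B k i := by
      intro σ' h1 h2 h3
      have harr : ∀ q i, σ'.arr B q i = (((σ.setReg 91 1).setReg 90
          (B + 8 * k + 1)).setReg 21 (2 ^ k) |>.setReg 91 2 |>.setReg 90 (B + 8 * k + 2)
          |>.setArr B 2 k (2 ^ k)).arr B q i := fun q i => by unfold State.arr; rw [h2]
      refine ⟨h1, h3, fun j => ?_, fun q hq hq2 i => ?_⟩
      · rw [harr, State.arr_setArr_self _ _ (by omega)]; rfl
      · rw [harr, State.arr_setArr_of_ne _ _ (by omega) hq hq2]; rfl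
    refine HT.weaken (N₁ := (1 + 1 + 1) + 1) (HT.ifLt (fun h => HT.weaken (HT.add ?_ ?_) (by omega))
      (fun h => HT.ifLt (fun h' => HT.weaken (HT.skip ?_) (by omega))
      (fun h' => HT.ifLt (fun h'' => HT.add ?_ ?_) (fun h'' => HT.skip ?_)))) (by omega)
    · simp [henv.len]; omega
    · simp [h12, h13, h20, henv.len] at h
      refine key _ ?_ (by simp) ?_
      · simp [windowCost, InWindow, h, henv.len]
      · intro b hb
        simp (disch := omega) only [State.reg_setReg, State.reg_setArr, if_neg]
    · simp [h12, h13, h20, henv.len] at h h'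
      refine key _ ?_ (by simp) ?_
      · have : ¬ InWindow n a s k := by unfold InWindow; omega
        simp [windowCost, this]
      · intro b hb
        simp (disch := omega) only [State.reg_setReg, State.reg_setArr, if_neg]
    · simp [henv.len]; omega
    · simp [h12, h13, h20, henv.len] at h h' h''
      refine key _ ?_ (by simp) ?_
      · simp [windowCost, InWindow, h', h'', henv.len]
      · intro b hb
        simp (disch := omega) only [State.reg_setReg, State.reg_setArr, if_neg]
    · simp [h12, h13, h20, henv.len] at h h' h''
      refine key _ ?_ (by simp) ?_
      · have : ¬ InWindow n a s k := by unfold InWindow; omega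
        simp [windowCost, this]
      · intro b hb
        simp (disch := omega) only [State.reg_setReg, State.reg_setArr, if_neg]
  · rintro σ₁ ⟨h24, hreg, h2, harr⟩
    refine HT.aset (x := k) (B := B) (by omega) (by rw [hreg 20 (by omega), h20])
      (by rw [hreg 4 (by omega), henv.base]) (by omega) ?_
    rw [h24]
    refine ⟨fun b hb => ?_, fun j => ?_, fun j => ?_, fun q hq hq2 hq3 i => ?_⟩
    · simp (disch := omega) only [State.reg_setReg, State.reg_setArr, if_neg]
      exact hreg b hb
    · rw [State.arr_setArr_of_ne _ _ (by omega) (by omega) (by omega)]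
      exact h2 j
    · rw [State.arr_setArr_self _ _ (by omega)]
      simp [harr]
    · rw [State.arr_setArr_of_ne _ _ (by omega) hq hq3]
      exact harr q hq hq2 i

/-- Counts in register `14` the square of the number of vectors of cost zero. -/
def Prog.countStep : Prog :=
  .aget 31 3 30 ;;
    -- The increment is `(z + 1)² = z² + 2z + 1`. The square is kept so that `z ≤ √n` can be tested
    -- without a root.
    .ifLt 17 31 .skip (.add 14 14 35 ;; .add 14 14 35 ;; .add 14 14 3 ;; .add 35 35 3)

/-- Computes a basis of the code in echelon form, for the window of length `R_13` at `R_12`, and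
the squared number of its vectors outside the window. -/
def Prog.basis : Prog :=
  .const 17 0 ;; .forLt 20 0 .basisInit ;; .forLt 25 1 .elimRow ;; .const 14 0 ;; .const 35 0 ;;
    .forLt 30 0 .countStep

/-- The number of operations of `basis`. -/
def basisCost (n r : ℕ) : ℕ := 50 * n + (elimRowCost n + 2) * r + 20

/-- The number of positions below `k` of cost zero. -/
def zeroCount (κ : ℕ → ℕ) (k : ℕ) : ℕ := ((Finset.range k).filter fun j => κ j = 0).card

theorem zeroCount_succ (κ : ℕ → ℕ) (k : ℕ) :
    zeroCount κ (k + 1) = zeroCount κ k + if κ k = 0 then 1 else 0 := by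
  unfold zeroCount
  rw [Finset.range_add_one, Finset.filter_insert]
  split_ifs
  · rw [Finset.card_insert_of_notMem (by simp)]
  · rfl

theorem zeroCount_le (κ : ℕ → ℕ) (k : ℕ) : zeroCount κ k ≤ k := by
  unfold zeroCount
  exact (Finset.card_filter_le _ _).trans (by simp)

theorem basis_spec {W n r B s a : ℕ} {σ : State} {A : ℕ → ℕ → ZMod 2} (henv : Env n B σ)
    (hroom : Room W n r B) (h1 : σ.reg 1 = r) (h5 : σ.reg 5 = n * n + 1)
    (h12 : σ.reg 12 = s) (h13 : σ.reg 13 = a) (hs : s ≤ n) (ha : a ≤ n)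
    (hrow : ∀ i < r, σ.arr B 0 i = enc n (A i)) :
    HT W .basis σ (basisCost n r) fun σ' => (∀ a < 17, a ≠ 14 → σ'.reg a = σ.reg a) ∧
      σ'.reg 17 = 0 ∧
      (∃ g κ, Vecs n B g κ σ' ∧ Elim n A (windowCost n a s) r g κ ∧
        σ'.reg 14 = zeroCount κ n * zeroCount κ n) ∧
      ∀ k < 8, k ≠ 2 → k ≠ 3 → ∀ i, σ'.arr B k i = σ.arr B k i := by
  have hroom' := hroom
  unfold Room at hroom'
  have hn2 : n < 2 ^ n := Nat.lt_two_pow_self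
  refine HT.weaken (N₁ := 1 + (((30 + 2) * n + 2) + (((elimRowCost n + 2) * r + 2) + (1 + (1 +
    ((12 + 2) * n + 2)))))) ?_ (by unfold basisCost; ring_nf; omega)
  refine HT.const' (by omega) (HT.call (Q₁ := fun σ' => (∀ a < 18, a ≠ 17 → σ'.reg a = σ.reg a) ∧
    σ'.reg 17 = 0 ∧
    Vecs n B (fun j => Pi.single j 1) (windowCost n a s) σ' ∧
    ∀ k < 8, k ≠ 2 → k ≠ 3 → ∀ i, σ'.arr B k i = σ.arr B k i) (HT.forLt n 30
      (fun k σ' => (∀ a < 18, a ≠ 17 → σ'.reg a = σ.reg a) ∧ σ'.reg 17 = 0 ∧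
        (∀ j < k, σ'.arr B 2 j = 2 ^ j ∧ σ'.arr B 3 j = windowCost n a s j) ∧
        ∀ k < 8, k ≠ 2 → k ≠ 3 → ∀ i, σ'.arr B k i = σ.arr B k i) (by omega) (by simp [henv.len])
      ?_ ?_ ?_) ?_)
  · refine ⟨fun b hb hb' => ?_, by simp, fun j hj => by omega, fun k _ _ _ i => rfl⟩
    simp (disch := omega) only [State.reg_setReg, if_neg]
  · rintro k σ₁ hk ⟨hreg, h17, hv, harr⟩ hi hlen
    refine HT.imp (basisInit_spec (henv.of_eq (fun b hb => hreg b (by omega) (by omega))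
      fun i _ => harr 1 (by omega) (by omega) (by omega) i) hroom ((hreg 12 (by omega)
      (by omega)).trans h12) ((hreg 13 (by omega) (by omega)).trans h13) hs ha hi hk) ?_
    rintro σ₂ ⟨hreg₂, hg, hκ, harr₂⟩
    refine ⟨by rw [hreg₂ 20 (by omega), hi], by rw [hreg₂ 0 (by omega), hlen],
      by rw [hreg₂ 3 (by omega), hreg 3 (by omega) (by omega), henv.one], fun b hb hb' => ?_, ?_,
      fun j hj => ?_, fun q hq h2 h3 i => ?_⟩
    · simp (disch := omega) only [State.reg_setReg, if_neg]
      rw [hreg₂ b (by omega), hreg b hb hb']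
    · simp [hreg₂ 17, h17]
    · rw [State.arr_setReg, State.arr_setReg, hg, hκ]
      split_ifs with h
      · rw [h]; exact ⟨rfl, rfl⟩
      · exact hv j (by omega)
    · rw [State.arr_setReg, harr₂ q hq h2 h3, harr q hq h2 h3]
  · rintro σ' ⟨c1, c2, c3, c4⟩
    exact ⟨c1, c2, ⟨fun j hj => by rw [(c3 j hj).1, enc_single hj], fun j hj => (c3 j hj).2⟩, c4⟩
  rintro σ₁ ⟨hreg₁, h17, hv₁, harr₁⟩
  refine HT.call (Q₁ := fun σ' => (∀ a < 18, a ≠ 17 → σ'.reg a = σ.reg a) ∧ σ'.reg 17 = 0 ∧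
    (∃ g κ, Vecs n B g κ σ' ∧ Elim n A (windowCost n a s) r g κ) ∧
    ∀ k < 8, k ≠ 2 → k ≠ 3 → ∀ i, σ'.arr B k i = σ.arr B k i) (HT.forLt r (elimRowCost n)
      (fun i σ' => (∀ a < 18, a ≠ 17 → σ'.reg a = σ.reg a) ∧ σ'.reg 17 = 0 ∧
        (∃ g κ, Vecs n B g κ σ' ∧ Elim n A (windowCost n a s) i g κ) ∧
        ∀ k < 8, k ≠ 2 → k ≠ 3 → ∀ i, σ'.arr B k i = σ.arr B k i) (by omega)
      (by rw [hreg₁ 1 (by omega) (by omega), h1]) ?_ ?_ fun σ' h => h) ?_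
  · refine ⟨fun b hb hb' => ?_, by simp [h17], ⟨_, _, hv₁.of_eq (fun _ => rfl) fun _ => rfl,
      Elim.init n A (windowCost_le n a s)⟩, fun q hq h2 h3 i => ?_⟩
    · simp (disch := omega) only [State.reg_setReg, if_neg]
      exact hreg₁ b hb hb'
    · exact harr₁ q hq h2 h3 i
  · rintro i σ₂ hi ⟨hreg₂, h17₂, ⟨g, κ, hv₂, he₂⟩, harr₂⟩ hi₂ hlen
    refine HT.imp (elimRow_spec (henv.of_eq (fun b hb => hreg₂ b (by omega) (by omega))
      fun i _ => harr₂ 1 (by omega) (by omega) (by omega) i) hroom hv₂ h17₂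
      ((hreg₂ 5 (by omega) (by omega)).trans h5) hi₂ hi
      ((harr₂ 0 (by omega) (by omega) (by omega) i).trans (hrow i hi)) (windowCost_le n a s) he₂) ?_
    rintro σ₃ ⟨hreg₃, ⟨g', κ', hv₃, he₃⟩, harr₃⟩
    refine ⟨by rw [hreg₃ 25 (by omega), hi₂], by rw [hreg₃ 1 (by omega), hlen],
      by rw [hreg₃ 3 (by omega), hreg₂ 3 (by omega) (by omega), henv.one], fun b hb hb' => ?_, ?_,
      ⟨g', κ', hv₃.of_eq (fun _ => rfl) fun _ => rfl, he₃⟩, fun q hq h2 h3 i => ?_⟩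
    · simp (disch := omega) only [State.reg_setReg, if_neg]
      rw [hreg₃ b (by omega), hreg₂ b hb hb']
    · simp [hreg₃ 17, h17₂]
    · rw [State.arr_setReg, harr₃ q hq h2 h3, harr₂ q hq h2 h3]
  rintro σ₂ ⟨hreg₂, h17₂, ⟨g, κ, hv₂, he₂⟩, harr₂⟩
  refine HT.const' (by omega) (HT.const' (by omega) (HT.forLt n 12 (fun k σ' =>
    (∀ a < 18, a ≠ 14 → a ≠ 17 → σ'.reg a = σ.reg a) ∧ σ'.reg 17 = 0 ∧ σ'.mem = σ₂.mem ∧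
    σ'.reg 35 = zeroCount κ k ∧ σ'.reg 14 = zeroCount κ k * zeroCount κ k) (by omega)
    (by simp [hreg₂ 0, henv.len]) ?_ ?_ ?_))
  · refine ⟨fun b hb hb' hb'' => ?_, by simp [h17₂], rfl, by simp [zeroCount], by simp [zeroCount]⟩
    simp (disch := omega) only [State.reg_setReg, if_neg]
    exact hreg₂ b hb hb''
  · rintro k σ₃ hk ⟨hreg, h17, hmem, h35, h14⟩ hi hlen
    have h4 : σ₃.reg 4 = B := (hreg 4 (by omega) (by omega) (by omega)).trans henv.base
    have h3 : σ₃.reg 3 = 1 := (hreg 3 (by omega) (by omega) (by omega)).trans henv.one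
    have hκ : σ₃.arr B 3 k = κ k := by rw [← hv₂.cost k hk]; unfold State.arr; rw [hmem]
    have hz := zeroCount_le κ k
    have hzz : zeroCount κ k * zeroCount κ k ≤ n * n := Nat.mul_le_mul (by omega) (by omega)
    refine HT.weaken (N₁ := 7 + ((1 + (1 + (1 + 1))) + 1)) ?_ (by omega)
    refine HT.aget' (x := k) (B := B) hi h4 (by omega) (HT.ifLt (fun h => ?_) (fun h => ?_))
    · simp [h17, hκ] at h
      refine HT.weaken (HT.skip ?_) (by omega)
      refine ⟨by simp [hi], by simp [hlen], by simp [h3], fun b hb hb' hb'' => ?_, by simp [h17], hmem,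
        ?_, ?_⟩
      · simp (disch := omega) only [State.reg_setReg, if_neg]
        exact hreg b hb hb' hb''
      · simp [zeroCount_succ, h35, show κ k ≠ 0 by omega]
      · simp [zeroCount_succ, h14, show κ k ≠ 0 by omega]
    · simp [h17, hκ] at h
      refine HT.add' (by simp [h14, h35]; omega) (HT.add' (by simp [h14, h35]; omega)
        (HT.add' (by simp [h14, h35, h3]; omega) (HT.add (by simp [h35, h3]; omega) ?_)))
      refine ⟨by simp [hi], by simp [hlen], by simp [h3], fun b hb hb' hb'' => ?_, by simp [h17], hmem,
        ?_, ?_⟩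
      · simp (disch := omega) only [State.reg_setReg, if_neg]
        exact hreg b hb hb' hb''
      · simp [zeroCount_succ, h35, h, h3]
      · simp [zeroCount_succ, h14, h, h35, h3]; ring
  · rintro σ' ⟨c1, c2, c3, c4, c5⟩
    have harr' : ∀ k i, σ'.arr B k i = σ₂.arr B k i := fun k i => by unfold State.arr; rw [c3]
    refine ⟨fun b hb hb' => c1 b (by omega) hb' (by omega), c2, ⟨g, κ, hv₂.of_eq (fun _ => harr' _ _)
      fun _ => harr' _ _, he₂, c5⟩, fun q hq h2 h3 i => ?_⟩
    rw [harr', harr₂ q hq h2 h3]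

/-! ### Cyclic windows -/

theorem card_window_le {n a s : ℕ} (hs : s ≤ n) :
    ((Finset.range n).filter (InWindow n a s)).card ≤ a := by
  have hsub : (Finset.range n).filter (InWindow n a s) ⊆
      Finset.Ico s (min (s + a) n) ∪ Finset.range (s + a - n) := by
    intro j hj
    simp only [Finset.mem_filter, Finset.mem_range, InWindow, Finset.mem_union, Finset.mem_Ico] at hj ⊢
    omega
  refine (Finset.card_le_card hsub).trans ((Finset.card_union_le _ _).trans ?_)
  rw [Nat.card_Ico, Finset.card_range]
  omega

theorem card_window_starts_le {n a j : ℕ} (ha : a ≤ n) :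
    ((Finset.range n).filter fun s => InWindow n a s j).card ≤ a := by
  have hsub : ((Finset.range n).filter fun s => InWindow n a s j) ⊆
      Finset.Ico (j + 1 - a) (min (j + 1) n) ∪ Finset.Ico (j + n + 1 - a) n := by
    intro s hs
    rw [Finset.mem_filter, Finset.mem_range] at hs
    rw [Finset.mem_union, Finset.mem_Ico, Finset.mem_Ico]
    unfold InWindow at hs
    omega
  refine (Finset.card_le_card hsub).trans ((Finset.card_union_le _ _).trans ?_)
  rw [Nat.card_Ico, Nat.card_Ico]
  omega

/-- Some cyclic window of length `a` contains at most its share of a set. -/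
theorem exists_light_window {n a : ℕ} (hn : 0 < n) (ha : a ≤ n) (p : ℕ → Prop) [DecidablePred p] :
    ∃ s < n, n * ((Finset.range n).filter fun j => InWindow n a s j ∧ p j).card ≤
      ((Finset.range n).filter p).card * a := by
  by_contra! h
  -- Averaging: each position lies in at most `a` of the `n` windows.
  have h1 : ∑ s ∈ Finset.range n, ((Finset.range n).filter fun j => InWindow n a s j ∧ p j).card ≤
      ((Finset.range n).filter p).card * a := by
    simp only [Finset.card_filter]
    rw [Finset.sum_comm, Finset.sum_mul]
    refine Finset.sum_le_sum fun j _ => ?_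
    by_cases hp : p j
    · simp only [hp, and_true, if_true, one_mul]
      rw [← Finset.card_filter]
      exact card_window_starts_le ha
    · simp [hp]
  have h2 : ∑ s ∈ Finset.range n, ((Finset.range n).filter p).card * a <
      ∑ s ∈ Finset.range n, n * ((Finset.range n).filter fun j => InWindow n a s j ∧ p j).card :=
    Finset.sum_lt_sum_of_nonempty ⟨0, Finset.mem_range.2 hn⟩ fun s hs => h s (Finset.mem_range.1 hs)
  rw [Finset.sum_const, Finset.card_range, smul_eq_mul, ← Finset.mul_sum] at h2
  exact absurd (Nat.lt_of_mul_lt_mul_left h2) (by omega)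

/-- The number of subsets of at most `b` of `a` elements. -/
def ballVol (a b : ℕ) : ℕ := ∑ i ∈ Finset.range (b + 1), a.choose i

theorem ballVol_mono {a a' b b' : ℕ} (ha : a ≤ a') (hb : b ≤ b') : ballVol a b ≤ ballVol a' b' := by
  unfold ballVol
  refine (Finset.sum_le_sum fun i _ => Nat.choose_le_choose i ha).trans
    (Finset.sum_le_sum_of_subset (Finset.range_mono (by omega)))

theorem card_filter_card_le (T : Finset ℕ) (b : ℕ) :
    (T.powerset.filter fun S => S.card ≤ b).card ≤ ballVol T.card b := by
  have : (T.powerset.filter fun S => S.card ≤ b) ⊆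
      (Finset.range (b + 1)).biUnion fun i => T.powersetCard i := by
    intro S hS
    simp only [Finset.mem_filter, Finset.mem_powerset, Finset.mem_biUnion, Finset.mem_range,
      Finset.mem_powersetCard] at hS ⊢
    exact ⟨S.card, by omega, hS.1, rfl⟩
  refine (Finset.card_le_card this).trans (Finset.card_biUnion_le.trans ?_)
  unfold ballVol
  simp [Finset.card_powersetCard]

/-- A set within the budget splits into an arbitrary set of positions of cost zero and at most `D *
a / n` window positions of cost `n` each. Retired positions are too expensive, as `D * a ≤ n * n`.
-/
theorem Elim.length_budgetList_le {n r a s D : ℕ} {A : ℕ → ℕ → ZMod 2} {g : ℕ → ℕ → ZMod 2}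
    {κ : ℕ → ℕ} (h : Elim n A (windowCost n a s) r g κ) (hn : 0 < n) (ha : a ≤ n) (hs : s ≤ n)
    (hD : D ≤ n) :
    (budgetList κ (D * a) n).length ≤ 2 ^ zeroCount κ n * ballVol a (D * a / n) := by
  have hDa : D * a ≤ n * n := Nat.mul_le_mul hD ha
  set Z := (Finset.range n).filter fun j => κ j = 0 with hZ
  set I := (Finset.range n).filter (InWindow n a s) with hI
  rw [length_budgetList]
  have h1 : ((Finset.range n).powerset.filter fun S => ∑ i ∈ S, κ i ≤ D * a).card ≤
      (Z.powerset ×ˢ (I.powerset.filter fun S => S.card ≤ D * a / n)).card := by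
    refine Finset.card_le_card_of_injOn
      (fun S => (S.filter fun j => κ j = 0, S.filter fun j => ¬ κ j = 0)) ?_ ?_
    · intro S hS
      rw [Finset.mem_coe, Finset.mem_filter, Finset.mem_powerset] at hS
      obtain ⟨hSn, hSb⟩ := hS
      have hκ : ∀ j ∈ S, κ j ≠ 0 → InWindow n a s j ∧ κ j = n := fun j hj hj0 => by
        have h1 := Finset.single_le_sum (f := κ) (fun _ _ => Nat.zero_le _) hj
        rcases h.cost j (Finset.mem_range.1 (hSn hj)) with h2 | h2
        · unfold windowCost at h2
          split_ifs at h2 with h3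
          · exact ⟨h3, h2⟩
          · exact absurd h2 hj0
        · omega
      simp only [Finset.coe_product, Set.mem_prod, Finset.mem_coe, Finset.mem_powerset,
        Finset.mem_filter]
      refine ⟨Finset.filter_subset_filter _ hSn, fun j hj => ?_, ?_⟩
      · rw [Finset.mem_filter] at hj
        exact Finset.mem_filter.2 ⟨hSn hj.1, (hκ j hj.1 hj.2).1⟩
      · rw [Nat.le_div_iff_mul_le hn]
        have h2 : ∑ j ∈ S.filter (fun j => ¬ κ j = 0), κ j = (S.filter fun j => ¬ κ j = 0).card * n := by
          rw [Finset.sum_congr rfl (g := fun _ => n) (fun j hj => ?_), Finset.sum_const, smul_eq_mul]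
          rw [Finset.mem_filter] at hj
          exact (hκ j hj.1 hj.2).2
        rw [← h2]
        exact (Finset.sum_le_sum_of_subset (Finset.filter_subset _ _)).trans hSb
    · intro S _ S' _ hSS
      simp only [Prod.mk.injEq] at hSS
      rw [← Finset.filter_union_filter_not_eq (fun j => κ j = 0) S, hSS.1, hSS.2,
        Finset.filter_union_filter_not_eq]
  refine h1.trans ?_
  rw [Finset.card_product, Finset.card_powerset]
  refine Nat.mul_le_mul_left _ ((card_filter_card_le _ _).trans (ballVol_mono ?_ le_rfl))
  exact card_window_le hs

/-! ### The search with punctured information sets -/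

/-- The codewords, as sequences of which only the first `n` entries matter. -/
def IsWord (n r : ℕ) (A : ℕ → ℕ → ZMod 2) (x : ℕ → ZMod 2) : Prop := ∀ i < r, dot n (A i) x = 0

/-- `v` is the number of a nonzero codeword of weight at most `D`. -/
def IsHit (n r : ℕ) (A : ℕ → ℕ → ZMod 2) (D v : ℕ) : Prop :=
  ∃ x, v = enc n x ∧ IsWord n r A x ∧ 0 < wt n x ∧ wt n x ≤ D

theorem IsHit.ne_zero {n r : ℕ} {A : ℕ → ℕ → ZMod 2} {D v : ℕ} (h : IsHit n r A D v) : v ≠ 0 := by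
  obtain ⟨x, rfl, -, h, -⟩ := h
  exact (enc_pos_of_wt_pos h).ne'

/-- Keeps item number `R_36` of the list if its weight is positive and at most `R_7`. -/
def Prog.scanStep : Prog :=
  .aget 60 5 36 ;; .const 61 0 ;; .comb ;;
    .ifLt 7 64 .skip (.ifLt 17 64 (.add 6 62 17) .skip)

/-- A zero in register `6` can stand for "nothing found", since a nonzero word never has the number
zero. Later hits may replace earlier ones. -/
theorem scan_spec {W n r B D M : ℕ} {σ : State} {A : ℕ → ℕ → ZMod 2} {g : ℕ → ℕ → ZMod 2}
    {κ : ℕ → ℕ} {L : List (Finset ℕ)} (henv : Env n B σ) (hroom : Room W n r B)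
    (h7 : σ.reg 7 = D) (h17 : σ.reg 17 = 0) (hL : Holds n B g κ σ L) (hLM : L.length ≤ M)
    (hLn : L.length ≤ 2 ^ n)
    (hword : ∀ S ∈ L, IsWord n r A (∑ j ∈ S, g j)) (h6 : σ.reg 6 = 0 ∨ IsHit n r A D (σ.reg 6)) :
    HT W (.forLt 36 11 .scanStep) σ ((combCost n + 13) * M + 2) fun σ' => σ'.mem = σ.mem ∧
      (∀ a < 36, a ≠ 6 → σ'.reg a = σ.reg a) ∧ (σ'.reg 6 = 0 ∨ IsHit n r A D (σ'.reg 6)) ∧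
      (σ'.reg 6 = 0 → σ.reg 6 = 0 ∧ ∀ S ∈ L, ¬ (0 < wt n (∑ j ∈ S, g j) ∧
        wt n (∑ j ∈ S, g j) ≤ D)) := by
  unfold Room at hroom
  have hn2 : n < 2 ^ n := Nat.lt_two_pow_self
  refine HT.weaken (HT.forLt L.length (combCost n + 11) (fun k σ' => σ'.mem = σ.mem ∧
      (∀ a < 36, a ≠ 6 → σ'.reg a = σ.reg a) ∧ (σ'.reg 6 = 0 ∨ IsHit n r A D (σ'.reg 6)) ∧
      (σ'.reg 6 = 0 → σ.reg 6 = 0 ∧ ∀ q (hq : q < L.length), q < k → ¬ (0 < wt n (∑ j ∈ L[q], g j) ∧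
        wt n (∑ j ∈ L[q], g j) ≤ D))) (by omega) hL.len ?_ ?_ ?_)
    (Nat.add_le_add_right (Nat.mul_le_mul_left (combCost n + 13) hLM) 2)
  · refine ⟨rfl, fun a ha _ => ?_, by simpa using h6, fun h => ⟨by simpa using h, fun q _ hq => by omega⟩⟩
    simp (disch := omega) only [State.reg_setReg, if_neg]
  · rintro k σ₁ hk ⟨hmem, hreg, h6₁, h6₁'⟩ hi hlen
    have h4 : σ₁.reg 4 = B := (hreg 4 (by omega) (by omega)).trans henv.base
    have h3 : σ₁.reg 3 = 1 := (hreg 3 (by omega) (by omega)).trans henv.one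
    have harr : ∀ k i, σ₁.arr B k i = σ.arr B k i := fun k i => by unfold State.arr; rw [hmem]
    set x := ∑ j ∈ L[k], g j with hx
    refine HT.weaken (N₁ := 7 + (1 + (combCost n + ((1 + 1) + 1)))) ?_ (by omega)
    refine HT.aget' (x := k) (B := B) hi h4 (by omega) (HT.const' (by omega) ?_)
    rw [harr, hL.vec k hk]
    refine HT.call (comb_spec (u := x) (v := 0) (henv.of_eq (fun a ha => ?_) fun i _ => ?_)
        (by omega) (by omega) (by simp [hx]) (by simp [enc_zero])) ?_
    · simp (disch := omega) only [State.reg_setReg, if_neg]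
      exact hreg a (by omega) (by omega)
    · simp [harr]
    rintro σ₂ ⟨hmem₂, hreg₂, h62, -, h64⟩
    rw [add_zero] at h62
    have hmem₂' : σ₂.mem = σ.mem := by rw [hmem₂]; simpa using hmem
    have hr : ∀ a < 60, σ₂.reg a = σ₁.reg a := fun a ha => by
      rw [hreg₂ a (by omega)]
      simp (disch := omega) only [State.reg_setReg, if_neg]
    have h17' : σ₂.reg 17 = 0 := by rw [hr 17 (by omega), hreg 17 (by omega) (by omega), h17]
    have h7' : σ₂.reg 7 = D := by rw [hr 7 (by omega), hreg 7 (by omega) (by omega), h7]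
    have hskip : ¬ (0 < wt n x ∧ wt n x ≤ D) → (fun σ'' : State => σ''.reg 36 = k ∧
        σ''.reg 11 = L.length ∧ σ''.reg 3 = 1 ∧ (σ''.setReg 36 (k + 1)).mem = σ.mem ∧
        (∀ a < 36, a ≠ 6 → (σ''.setReg 36 (k + 1)).reg a = σ.reg a) ∧
        ((σ''.setReg 36 (k + 1)).reg 6 = 0 ∨ IsHit n r A D ((σ''.setReg 36 (k + 1)).reg 6)) ∧
        ((σ''.setReg 36 (k + 1)).reg 6 = 0 → σ.reg 6 = 0 ∧ ∀ q (hq : q < L.length), q < k + 1 →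
          ¬ (0 < wt n (∑ j ∈ L[q], g j) ∧ wt n (∑ j ∈ L[q], g j) ≤ D))) σ₂ := by
      intro hwt
      refine ⟨by rw [hr 36 (by omega), hi], by rw [hr 11 (by omega), hlen],
          by rw [hr 3 (by omega), h3], hmem₂', fun a ha ha' => ?_, by simpa [hr 6] using h6₁,
          fun h => ?_⟩
      · simp (disch := omega) only [State.reg_setReg, if_neg]
        rw [hr a (by omega), hreg a ha ha']
      · simp [hr 6] at h
        refine ⟨(h6₁' h).1, fun q hq hqk => ?_⟩
        rcases Nat.lt_succ_iff_lt_or_eq.1 hqk with h1 | rfl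
        · exact (h6₁' h).2 q hq h1
        · exact hwt
    refine HT.ifLt (fun h => HT.weaken (HT.skip (hskip ?_)) (by omega)) (fun h => HT.ifLt (fun h' =>
      HT.add ?_ ?_) (fun h' => HT.skip (hskip ?_)))
    · rw [h7', h64] at h; omega
    · rw [h62, h17']; have := enc_lt n x; omega
    · rw [h7', h64] at h; rw [h17', h64] at h'
      have hhit : IsHit n r A D (enc n x) := ⟨x, rfl, hword _ (List.getElem_mem hk), h', by omega⟩
      refine ⟨by simp [hr 36, hi], by simp [hr 11, hlen], by simp [hr 3, h3], hmem₂',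
        fun a ha ha' => ?_, Or.inr (by simpa [h62, h17'] using hhit), fun h => ?_⟩
      · simp (disch := omega) only [State.reg_setReg, if_neg]
        rw [hr a (by omega), hreg a ha ha']
      · simp [h62, h17'] at h
        exact absurd h hhit.ne_zero
    · rw [h17', h64] at h'; omega
  · rintro σ' ⟨c1, c2, c3, c4⟩
    refine ⟨c1, c2, c3, fun h => ⟨(c4 h).1, fun S hS => ?_⟩⟩
    obtain ⟨q, hq, rfl⟩ := List.mem_iff_getElem.1 hS
    exact (c4 h).2 q hq hq

/-- Searches with the window of length `R_13` at `R_12`; clears the flag `R_15` if there are too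
many codewords outside the window. -/
def Prog.windowStep : Prog :=
  .basis ;; .ifLt 0 14 (.const 15 0) (.enum ;; .forLt 36 11 .scanStep)

/-- The number of operations of `windowStep`. -/
def windowStepCost (n r M : ℕ) : ℕ := basisCost n r + enumCost n M + (combCost n + 13) * M + 3

/-- A codeword is the sum of the basis vectors at those positions of the information set where it
does not vanish. The cost of this sum is `n` times the number of such positions in the window, hence
within the budget `D * a` if the word has at most its share there. -/
theorem windowStep_spec {W n r B s a D M : ℕ} {σ : State} {A : ℕ → ℕ → ZMod 2} (henv : Env n B σ)
    (hroom : Room W n r B) (hn : 0 < n) (h1 : σ.reg 1 = r) (h5 : σ.reg 5 = n * n + 1)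
    (h12 : σ.reg 12 = s) (h13 : σ.reg 13 = a) (hs : s ≤ n) (ha : a ≤ n) (hD : D ≤ n)
    (h7 : σ.reg 7 = D) (h10 : σ.reg 10 = D * a)
    (hrow : ∀ i < r, σ.arr B 0 i = enc n (A i)) (h6 : σ.reg 6 = 0 ∨ IsHit n r A D (σ.reg 6))
    (hM : 2 ^ Nat.sqrt n * ballVol a (D * a / n) ≤ M) :
    HT W .windowStep σ (windowStepCost n r M) fun σ' =>
      (∀ a < 17, a ≠ 6 → a ≠ 11 → a ≠ 14 → a ≠ 15 → σ'.reg a = σ.reg a) ∧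
      (∀ i, σ'.arr B 0 i = σ.arr B 0 i) ∧ (∀ i, σ'.arr B 1 i = σ.arr B 1 i) ∧
      (σ'.reg 6 = 0 ∨ IsHit n r A D (σ'.reg 6)) ∧ (σ'.reg 6 = 0 → σ.reg 6 = 0) ∧
      ((σ'.reg 15 = 0 ∧ ∃ g κ, Elim n A (windowCost n a s) r g κ ∧
          n < zeroCount κ n * zeroCount κ n) ∨
        (σ'.reg 15 = σ.reg 15 ∧ (σ'.reg 6 = 0 → ∀ c, IsWord n r A c → 0 < wt n c → wt n c = D →
          ¬ n * ((Finset.range n).filter fun j => InWindow n a s j ∧ c j ≠ 0).card ≤ D * a))) := by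
  have hroom' := hroom
  unfold Room at hroom'
  have hn2 : n < 2 ^ n := Nat.lt_two_pow_self
  have hDa : D * a ≤ n * n := Nat.mul_le_mul hD ha
  refine HT.weaken (N₁ := basisCost n r + ((enumCost n M + ((combCost n + 13) * M + 2)) + 1)) ?_
    (by unfold windowStepCost; omega)
  refine HT.call (basis_spec henv hroom h1 h5 h12 h13 hs ha hrow) ?_
  rintro σ₁ ⟨hreg, h17, ⟨g, κ, hv, he, h14⟩, harr⟩
  refine HT.ifLt (fun h => ?_) (fun h => ?_)
  · refine HT.weaken (N₁ := 1) (HT.const (by omega) ?_) (by unfold enumCost; omega)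
    rw [hreg 0 (by omega) (by omega), henv.len, h14] at h
    refine ⟨fun b hb h6 h11 h14 h15 => ?_, fun i => harr 0 (by omega) (by omega) (by omega) i,
      fun i => harr 1 (by omega) (by omega) (by omega) i, ?_, ?_, Or.inl ⟨by simp, g, κ, he, h⟩⟩
    · simp (disch := omega) only [State.reg_setReg, if_neg]
      exact hreg b hb h14
    · simpa [hreg 6] using h6
    · simp [hreg 6]
  · rw [hreg 0 (by omega) (by omega), henv.len, h14] at h
    have hlen : (budgetList κ (D * a) n).length ≤ M := by
      refine (he.length_budgetList_le hn ha hs hD).trans (le_trans ?_ hM)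
      refine Nat.mul_le_mul_right _ (Nat.pow_le_pow_right (by omega) ?_)
      rw [Nat.le_sqrt]
      omega
    have hcost : ∀ j < n, κ j ≤ n * n + 1 := fun j hj => by
      rcases he.cost j hj with h2 | h2
      · rw [h2]; have := windowCost_le n a s j; nlinarith
      · omega
    have henv₁ : Env n B σ₁ := henv.of_eq (fun b hb => hreg b (by omega) (by omega))
      fun i _ => harr 1 (by omega) (by omega) (by omega) i
    refine HT.call (enum_spec (b := D * a) henv₁ (by omega) (by omega)
      (fun j hj => by have := hcost j hj; omega) (by rw [hreg 10 (by omega) (by omega), h10])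
      hv.vec hv.cost hlen) ?_
    rintro σ₂ ⟨hL, hreg₂, harr₂⟩
    have hr : ∀ b < 17, b ≠ 11 → b ≠ 14 → σ₂.reg b = σ.reg b := fun b hb h11 h14 => by
      rw [hreg₂ b (by omega) h11, hreg b hb h14]
    have ha₂ : ∀ k < 2, ∀ i, σ₂.arr B k i = σ.arr B k i := fun k hk i => by
      rw [harr₂ k (by omega) (by omega) (by omega), harr k (by omega) (by omega) (by omega)]
    refine HT.imp (scan_spec (r := r) (A := A) (D := D) (henv.of_eq
      (fun b hb => hr b (by omega) (by omega) (by omega))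
      fun i _ => ha₂ 1 (by omega) i) hroom (by rw [hr 7 (by omega) (by omega) (by omega), h7])
      (by rw [hreg₂ 17 (by omega) (by omega), h17]) hL hlen (length_budgetList_le _ _ _) ?_ ?_) ?_
    · intro S hS i hi
      rw [mem_budgetList] at hS
      exact he.dot_sum hS.1 hDa (windowCost_le n a s) hS.2 hi
    · rw [hr 6 (by omega) (by omega) (by omega)]; exact h6
    · rintro σ₃ ⟨hmem₃, hreg₃, h6₃, h6₃'⟩
      rw [hr 6 (by omega) (by omega) (by omega)] at h6₃'
      have harr₃ : ∀ k i, σ₃.arr B k i = σ₂.arr B k i := fun k i => by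
        unfold State.arr; rw [hmem₃]
      refine ⟨fun b hb h6 h11 h14 h15 => by rw [hreg₃ b (by omega) h6, hr b hb h11 h14],
        fun i => by rw [harr₃, ha₂ 0 (by omega)], fun i => by rw [harr₃, ha₂ 1 (by omega)], h6₃,
        fun h => (h6₃' h).1, Or.inr ⟨?_, fun h0 c hc hc0 hcD hwin => ?_⟩⟩
      · rw [hreg₃ 15 (by omega) (by omega), hr 15 (by omega) (by omega) (by omega)]
      · set S := (Finset.range n).filter (fun j => κ j ≤ n ∧ c j ≠ 0) with hS
        have hw : wt n (∑ j ∈ S, g j) = wt n c := wt_congr fun k hk => (he.eq_sum hc hk).symm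
        refine (h6₃' h0).2 S ?_ ⟨by omega, by omega⟩
        rw [mem_budgetList]
        refine ⟨Finset.filter_subset _ _, le_trans ?_ hwin⟩
        have hκS : ∀ j ∈ S, κ j = windowCost n a s j := fun j hj => by
          rw [hS, Finset.mem_filter, Finset.mem_range] at hj
          rcases he.cost j hj.1 with h2 | h2
          · exact h2
          · have : n ≤ n * n := Nat.le_mul_self n
            omega
        rw [Finset.sum_congr rfl hκS]
        unfold windowCost
        rw [← Finset.sum_filter, Finset.sum_const, smul_eq_mul, mul_comm]
        refine Nat.mul_le_mul_left _ (Finset.card_le_card fun j hj => ?_)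
        rw [hS, Finset.mem_filter, Finset.mem_filter] at hj
        exact Finset.mem_filter.2 ⟨hj.1.1, hj.2, hj.1.2.2⟩

/-- The data that all searches rely on. -/
structure Ready (n r B : ℕ) (A : ℕ → ℕ → ZMod 2) (σ : State) : Prop where
  env : Env n B σ
  rows : σ.reg 1 = r
  dead : σ.reg 5 = n * n + 1
  bound : σ.reg 16 = n + 1
  row : ∀ i < r, σ.arr B 0 i = enc n (A i)

theorem Ready.of_eq {n r B : ℕ} {A : ℕ → ℕ → ZMod 2} {σ σ' : State} (h : Ready n r B A σ)
    (hr : ∀ a < 6, σ'.reg a = σ.reg a) (h16 : σ'.reg 16 = σ.reg 16)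
    (h0 : ∀ i, σ'.arr B 0 i = σ.arr B 0 i) (h1 : ∀ i, σ'.arr B 1 i = σ.arr B 1 i) :
    Ready n r B A σ' :=
  ⟨h.env.of_eq (fun a ha => hr a (by omega)) fun i _ => h1 i, by rw [hr 1 (by omega), h.rows],
    by rw [hr 5 (by omega), h.dead], by rw [h16, h.bound], fun i hi => by rw [h0, h.row i hi]⟩

/-- The routine `S` searches for a nonzero codeword of weight at most `D`, and finds one if there is
one of weight `D`. It maintains the invariant `I`. -/
def Searches (W n r B : ℕ) (A : ℕ → ℕ → ZMod 2) (I : ℕ → State → Prop) (S : Prog) (D N : ℕ) : Prop :=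
  ∀ σ, Ready n r B A σ → I D σ → σ.reg 6 = 0 → σ.reg 7 = D + 1 → HT W S σ N fun σ' =>
    Ready n r B A σ' ∧ I (D + 1) σ' ∧ σ'.reg 2 = σ.reg 2 ∧ σ'.reg 9 = σ.reg 9 ∧
    (σ'.reg 6 = 0 ∨ IsHit n r A (D + 1) (σ'.reg 6)) ∧
    (σ'.reg 6 = 0 → ∀ c, IsWord n r A c → 0 < wt n c → wt n c ≠ D + 1)

/-- Searches with all windows of length `R_13`. -/
def Prog.stage : Prog :=
  .const 15 1 ;; .const 10 0 ;; .forLt 18 13 (.add 10 10 7) ;; .forLt 12 0 .windowStep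

/-- The number of operations of `stage`. -/
def stageCost (n r M : ℕ) : ℕ := (windowStepCost n r M + 5) * n + 6

/-- If no window clears the flag, all of them were searched, and averaging provides one in which the
word is light. If one clears it, the others are still processed, and their hits remain valid. The
budget `D * a` is computed by repeated addition. -/
theorem stage_spec {W n r B a D M : ℕ} {σ : State} {A : ℕ → ℕ → ZMod 2} (hσ : Ready n r B A σ)
    (hroom : Room W n r B) (hn : 0 < n) (h13 : σ.reg 13 = a) (ha : a ≤ n) (hD0 : 0 < D) (hD : D ≤ n)
    (h7 : σ.reg 7 = D) (h6 : σ.reg 6 = 0 ∨ IsHit n r A D (σ.reg 6))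
    (hM : 2 ^ Nat.sqrt n * ballVol a (D * a / n) ≤ M) :
    HT W .stage σ (stageCost n r M) fun σ' =>
      (∀ a < 17, a ≠ 6 → a ≠ 10 → a ≠ 11 → a ≠ 12 → a ≠ 14 → a ≠ 15 → σ'.reg a = σ.reg a) ∧
      (∀ i, σ'.arr B 0 i = σ.arr B 0 i) ∧ (∀ i, σ'.arr B 1 i = σ.arr B 1 i) ∧
      (σ'.reg 6 = 0 ∨ IsHit n r A D (σ'.reg 6)) ∧
      ((σ'.reg 15 = 0 ∧ ∃ s < n, ∃ g κ, Elim n A (windowCost n a s) r g κ ∧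
          n < zeroCount κ n * zeroCount κ n) ∨
        (σ'.reg 15 = 1 ∧ (σ'.reg 6 = 0 → ∀ c, IsWord n r A c → wt n c ≠ D))) := by
  have hroom' := hroom
  unfold Room at hroom'
  have hn2 : n < 2 ^ n := Nat.lt_two_pow_self
  have hDa : D * a ≤ n * n := Nat.mul_le_mul hD ha
  refine HT.weaken (N₁ := 1 + (1 + (((1 + 2) * a + 2) + ((windowStepCost n r M + 2) * n + 2)))) ?_
    (by unfold stageCost; ring_nf; omega)
  refine HT.const' (by omega) (HT.const' (by omega) (HT.call (Q₁ := fun σ' => σ'.mem = σ.mem ∧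
    σ'.reg 10 = D * a ∧ σ'.reg 15 = 1 ∧ ∀ b < 17, b ≠ 10 → b ≠ 15 → σ'.reg b = σ.reg b)
    (HT.forLt a 1 (fun k σ' => σ'.mem = σ.mem ∧
      σ'.reg 10 = D * k ∧ σ'.reg 15 = 1 ∧ ∀ b < 17, b ≠ 10 → b ≠ 15 → σ'.reg b = σ.reg b)
      (by omega) (by simp [h13]) ?_ ?_ fun _ h => h) ?_))
  · refine ⟨rfl, by simp, by simp, fun b hb h10 h15 => ?_⟩
    simp (disch := omega) only [State.reg_setReg, if_neg]
  · rintro k σ₁ hk ⟨hmem, h10, h15, hreg⟩ hi hlen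
    have hDk : D * k ≤ D * a := Nat.mul_le_mul_left _ hk.le
    have h7₁ : σ₁.reg 7 = D := by rw [hreg 7 (by omega) (by omega) (by omega), h7]
    have h3₁ : σ₁.reg 3 = 1 := by rw [hreg 3 (by omega) (by omega) (by omega), hσ.env.one]
    refine HT.add (by rw [h10, h7₁]; omega) ?_
    refine ⟨by simp [hi], by simp [hlen], by simp [h3₁], hmem, by simp [h10, h7₁]; ring, by simp [h15],
      fun b hb h10 h15 => ?_⟩
    simp (disch := omega) only [State.reg_setReg, if_neg]
    exact hreg b hb h10 h15
  rintro σ₁ ⟨hmem₁, h10₁, h15₁, hreg₁⟩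
  have harr₁ : ∀ k i, σ₁.arr B k i = σ.arr B k i := fun k i => by unfold State.arr; rw [hmem₁]
  refine HT.forLt n _ (fun k σ' =>
      (∀ b < 17, b ≠ 6 → b ≠ 10 → b ≠ 11 → b ≠ 12 → b ≠ 14 → b ≠ 15 → σ'.reg b = σ.reg b) ∧
      σ'.reg 10 = D * a ∧
      (∀ i, σ'.arr B 0 i = σ.arr B 0 i) ∧ (∀ i, σ'.arr B 1 i = σ.arr B 1 i) ∧
      (σ'.reg 6 = 0 ∨ IsHit n r A D (σ'.reg 6)) ∧
      ((σ'.reg 15 = 0 ∧ ∃ s < n, ∃ g κ, Elim n A (windowCost n a s) r g κ ∧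
          n < zeroCount κ n * zeroCount κ n) ∨
        (σ'.reg 15 = 1 ∧ (σ'.reg 6 = 0 → ∀ s < k, ∀ c, IsWord n r A c → wt n c = D →
          ¬ n * ((Finset.range n).filter fun j => InWindow n a s j ∧ c j ≠ 0).card ≤ D * a))))
    (by omega) (by rw [hreg₁ 0 (by omega) (by omega) (by omega), hσ.env.len]) ?_ ?_ ?_
  · refine ⟨fun b hb h6 h10 _ h12 _ h15 => ?_, by simp [h10₁], harr₁ 0, harr₁ 1, by simpa [hreg₁ 6] using h6,
      Or.inr ⟨by simp [h15₁], fun _ s hs => by omega⟩⟩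
    simp (disch := omega) only [State.reg_setReg, if_neg]
    exact hreg₁ b hb h10 h15
  · rintro k σ₂ hk ⟨hreg, h10, ha0, ha1, h6₂, hcase⟩ hi hlen
    have hσ₂ : Ready n r B A σ₂ := hσ.of_eq (fun b hb => hreg b (by omega) (by omega) (by omega)
      (by omega) (by omega) (by omega) (by omega)) (hreg 16 (by omega) (by omega) (by omega)
      (by omega) (by omega) (by omega) (by omega)) ha0 ha1
    refine HT.imp (windowStep_spec (D := D) hσ₂.env hroom hn hσ₂.rows hσ₂.dead hi (a := a) ?_ hk.le ha
      hD ?_ h10 hσ₂.row h6₂ hM) ?_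
    · rw [hreg 13 (by omega) (by omega) (by omega) (by omega) (by omega) (by omega) (by omega), h13]
    · rw [hreg 7 (by omega) (by omega) (by omega) (by omega) (by omega) (by omega) (by omega), h7]
    rintro σ₃ ⟨hreg₃, ha0₃, ha1₃, h6₃, h6₃', hcase₃⟩
    refine ⟨by rw [hreg₃ 12 (by omega) (by omega) (by omega) (by omega) (by omega), hi],
      by rw [hreg₃ 0 (by omega) (by omega) (by omega) (by omega) (by omega), hlen],
      by rw [hreg₃ 3 (by omega) (by omega) (by omega) (by omega) (by omega), hσ₂.env.one],
      fun b hb h6 h10 h11 h12 h14 h15 => ?_, ?_, fun i => ?_, fun i => ?_, by simpa using h6₃, ?_⟩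
    · simp (disch := omega) only [State.reg_setReg, if_neg]
      rw [hreg₃ b hb h6 h11 h14 h15, hreg b hb h6 h10 h11 h12 h14 h15]
    · simp [hreg₃ 10, h10]
    · rw [State.arr_setReg, ha0₃, ha0]
    · rw [State.arr_setReg, ha1₃, ha1]
    · rcases hcase₃ with ⟨c1, c2⟩ | ⟨c1, c2⟩
      · exact Or.inl ⟨by simp [c1], k, hk, c2⟩
      · rcases hcase with ⟨d1, d2⟩ | ⟨d1, d2⟩
        · exact Or.inl ⟨by simp [c1, d1], d2⟩
        · refine Or.inr ⟨by simp [c1, d1], fun h0 s hs c hc hcD => ?_⟩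
          have h0' : σ₃.reg 6 = 0 := by simpa using h0
          rcases Nat.lt_succ_iff_lt_or_eq.1 hs with h1 | rfl
          · exact d2 (h6₃' h0') s h1 c hc hcD
          · exact c2 h0' c hc (by omega) hcD
  · rintro σ' ⟨c1, -, c2, c3, c4, c5⟩
    refine ⟨c1, c2, c3, c4, ?_⟩
    rcases c5 with h | ⟨d1, d2⟩
    · exact Or.inl h
    · refine Or.inr ⟨d1, fun h0 c hc hcD => ?_⟩
      obtain ⟨s, hs, h⟩ := exists_light_window hn ha fun j => c j ≠ 0
      refine d2 h0 s hs c hc hcD (le_of_le_of_eq h ?_)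
      rw [← wt_eq_card, hcD]

/-- Searches with windows of increasing length, up to the first length for which there are few
codewords outside each window. -/
def Prog.windowSearch : Prog :=
  .const 15 0 ;; .forLt 13 16 (.ifLt 15 3 .stage .skip)

/-- The number of operations of `windowSearch`. -/
def windowSearchCost (n r M : ℕ) : ℕ := (stageCost n r M + 3) * (n + 1) + 3

/-- At length `a₁` no window clears the flag, so later rounds are skipped and only lengths up to
`a₁` count for the cost. The length `a₁` appears in the analysis only, not in the program. -/
theorem searches_windowSearch {W n r B a₁ D M : ℕ} {A : ℕ → ℕ → ZMod 2} (hroom : Room W n r B)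
    (hD : D < n) (ha₁ : a₁ ≤ n)
    (hfew : ∀ s < n, ∀ g κ, Elim n A (windowCost n a₁ s) r g κ →
      zeroCount κ n * zeroCount κ n ≤ n)
    (hM : ∀ a ≤ a₁, 2 ^ Nat.sqrt n * ballVol a ((D + 1) * a / n) ≤ M) :
    Searches W n r B A (fun _ _ => True) .windowSearch D (windowSearchCost n r M) := by
  intro σ hσ _ h6 h7
  have hroom' := hroom
  unfold Room at hroom'
  refine HT.weaken (N₁ := 1 + ((stageCost n r M + 1 + 2) * (n + 1) + 2)) ?_
    (by unfold windowSearchCost; ring_nf; omega)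
  refine HT.const' (by omega) (HT.forLt (n + 1) _ (fun k σ' =>
      (∀ a < 17, a ≠ 6 → a ≠ 10 → a ≠ 11 → a ≠ 12 → a ≠ 13 → a ≠ 14 → a ≠ 15 → σ'.reg a = σ.reg a) ∧
      (∀ i, σ'.arr B 0 i = σ.arr B 0 i) ∧ (∀ i, σ'.arr B 1 i = σ.arr B 1 i) ∧
      (σ'.reg 6 = 0 ∨ IsHit n r A (D + 1) (σ'.reg 6)) ∧
      ((σ'.reg 15 = 0 ∧ k ≤ a₁) ∨
        (σ'.reg 15 = 1 ∧ (σ'.reg 6 = 0 → ∀ c, IsWord n r A c → wt n c ≠ D + 1))))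
    (by omega) (by simp [hσ.bound]) ?_ ?_ ?_)
  · refine ⟨fun b hb _ _ _ _ h13 _ h15 => ?_, fun _ => rfl, fun _ => rfl, Or.inl (by simpa using h6),
      Or.inl ⟨by simp, by omega⟩⟩
    simp (disch := omega) only [State.reg_setReg, if_neg]
  · rintro k σ₁ hk ⟨hreg, ha0, ha1, h6₁, hcase⟩ hi hlen
    have hσ₁ : Ready n r B A σ₁ := hσ.of_eq (fun b hb => hreg b (by omega) (by omega) (by omega)
      (by omega) (by omega) (by omega) (by omega) (by omega)) (hreg 16 (by omega) (by omega) (by omega)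
      (by omega) (by omega) (by omega) (by omega) (by omega)) ha0 ha1
    have h7₁ : σ₁.reg 7 = D + 1 := by
      rw [hreg 7 (by omega) (by omega) (by omega) (by omega) (by omega) (by omega) (by omega)
        (by omega), h7]
    refine HT.ifLt (fun h => ?_) (fun h => ?_)
    · rw [hσ₁.env.one] at h
      rcases hcase with ⟨c1, c2⟩ | ⟨c1, -⟩
      · refine HT.imp (stage_spec hσ₁ hroom (by omega) hi (by omega) (by omega) (by omega) h7₁ h6₁
          (hM k c2)) ?_
        rintro σ₂ ⟨hreg₂, ha0₂, ha1₂, h6₂, hcase₂⟩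
        refine ⟨by rw [hreg₂ 13 (by omega) (by omega) (by omega) (by omega) (by omega) (by omega)
          (by omega), hi], by rw [hreg₂ 16 (by omega) (by omega) (by omega) (by omega) (by omega)
          (by omega) (by omega), hlen], by rw [hreg₂ 3 (by omega) (by omega) (by omega) (by omega)
          (by omega) (by omega) (by omega), hσ₁.env.one], fun b hb h6 h10 h11 h12 h13 h14 h15 => ?_,
          fun i => ?_, fun i => ?_, by simpa using h6₂, ?_⟩
        · simp (disch := omega) only [State.reg_setReg, if_neg]
          rw [hreg₂ b hb h6 h10 h11 h12 h14 h15, hreg b hb h6 h10 h11 h12 h13 h14 h15]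
        · rw [State.arr_setReg, ha0₂, ha0]
        · rw [State.arr_setReg, ha1₂, ha1]
        · rcases hcase₂ with ⟨d1, s, hs, g, κ, he, hlt⟩ | ⟨d1, d2⟩
          · refine Or.inl ⟨by simp [d1], ?_⟩
            by_contra hka
            have : k = a₁ := by omega
            subst this
            have := hfew s hs g κ he
            omega
          · exact Or.inr ⟨by simp [d1], by simpa using d2⟩
      · omega
    · rw [hσ₁.env.one] at h
      have hcase' := hcase.resolve_left (by rintro ⟨c1, -⟩; omega)
      refine HT.weaken (HT.skip ?_) (show 1 ≤ stageCost n r M by unfold stageCost; omega)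
      refine ⟨hi, hlen, hσ₁.env.one, fun b hb h6 h10 h11 h12 h13 h14 h15 => ?_, ha0, ha1, by simpa using h6₁,
        Or.inr (by simpa using hcase')⟩
      simp (disch := omega) only [State.reg_setReg, if_neg]
      rw [hreg b hb h6 h10 h11 h12 h13 h14 h15]
  · rintro σ' ⟨hreg, ha0, ha1, h6', hcase⟩
    have hcase' := hcase.resolve_left (by rintro ⟨-, c2⟩; omega)
    have hr : ∀ b < 17, b < 6 ∨ b = 9 ∨ b = 16 → σ'.reg b = σ.reg b := fun b hb h =>
      hreg b hb (by omega) (by omega) (by omega) (by omega) (by omega) (by omega) (by omega)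
    exact ⟨hσ.of_eq (fun b hb => hr b (by omega) (Or.inl hb)) (hr 16 (by omega) (by omega)) ha0 ha1,
      trivial, hr 2 (by omega) (by omega), hr 9 (by omega) (by omega), h6',
      fun h0 c hc _ => hcase'.2 h0 c hc⟩

/-! ### Splitting a set in two halves -/

/-- For some `s ≤ h` the window `[s, s + h)` contains half of the set, if `h = ⌈n/2⌉`. -/
theorem exists_half_window (n : ℕ) (p : ℕ → Prop) [DecidablePred p] :
    ∃ s ≤ (n + 1) / 2, ((Finset.range n).filter fun j =>
        (s ≤ j ∧ j < s + (n + 1) / 2) ∧ p j).card = ((Finset.range n).filter p).card / 2 := by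
  set h := (n + 1) / 2 with hh
  set d := ((Finset.range n).filter p).card with hd
  set f : ℕ → ℕ := fun s => ((Finset.range n).filter fun j => (s ≤ j ∧ j < s + h) ∧ p j).card with hf
  -- The windows at `0` and at `h` together cover all `n` positions without overlap.
  have hsum : f 0 + f h = d := by
    have := Finset.card_filter_add_card_filter_not (s := (Finset.range n).filter p)
      (fun j => j < h)
    rw [Finset.filter_filter, Finset.filter_filter] at this
    rw [hd, ← this]
    refine congr_arg₂ (· + ·) (congrArg Finset.card ?_) (congrArg Finset.card ?_)
    · ext j
      simp only [Finset.mem_filter, Finset.mem_range]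
      constructor
      · rintro ⟨h1, ⟨h2, h3⟩, h4⟩; exact ⟨h1, h4, by omega⟩
      · rintro ⟨h1, h2, h3⟩; exact ⟨h1, ⟨by omega, by omega⟩, h2⟩
    · ext j; simp only [Finset.mem_filter, Finset.mem_range]
      constructor
      · rintro ⟨h1, ⟨h2, h3⟩, h4⟩; exact ⟨h1, h4, by omega⟩
      · rintro ⟨h1, h2, h3⟩; exact ⟨h1, ⟨by omega, by omega⟩, h2⟩
  have hup : ∀ s, f (s + 1) ≤ f s + 1 := fun s => by
    have : ((Finset.range n).filter fun j => (s + 1 ≤ j ∧ j < s + 1 + h) ∧ p j) ⊆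
        insert (s + h) ((Finset.range n).filter fun j => (s ≤ j ∧ j < s + h) ∧ p j) := by
      intro j hj
      simp only [Finset.mem_filter, Finset.mem_range, Finset.mem_insert] at hj ⊢
      by_cases hjs : j = s + h
      · exact Or.inl hjs
      · exact Or.inr ⟨hj.1, ⟨by omega, by omega⟩, hj.2.2⟩
    exact (Finset.card_le_card this).trans (Finset.card_insert_le _ _)
  have hdown : ∀ s, f s ≤ f (s + 1) + 1 := fun s => by
    have : ((Finset.range n).filter fun j => (s ≤ j ∧ j < s + h) ∧ p j) ⊆
        insert s ((Finset.range n).filter fun j => (s + 1 ≤ j ∧ j < s + 1 + h) ∧ p j) := by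
      intro j hj
      simp only [Finset.mem_filter, Finset.mem_range, Finset.mem_insert] at hj ⊢
      by_cases hjs : j = s
      · exact Or.inl hjs
      · exact Or.inr ⟨hj.1, ⟨by omega, by omega⟩, hj.2.2⟩
    exact (Finset.card_le_card this).trans (Finset.card_insert_le _ _)
  -- Discrete continuity: a shift changes the count by at most one, so avoiding `d / 2` would keep
  -- `f 0` and `f h` on the same side of it, against `f 0 + f h = d`.
  by_contra! hne
  have hne' : ∀ s ≤ h, f s ≠ d / 2 := hne
  rcases lt_or_gt_of_ne (hne' 0 (by omega)) with h0 | h0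
  · have : ∀ s ≤ h, f s < d / 2 := by
      intro s
      induction s with
      | zero => intro _; exact h0
      | succ s ih =>
        intro hs
        have := ih (by omega)
        have := hup s
        have := hne' (s + 1) hs
        omega
    have := this h le_rfl
    omega
  · have : ∀ s ≤ h, d / 2 < f s := by
      intro s
      induction s with
      | zero => intro _; exact h0
      | succ s ih =>
        intro hs
        have := ih (by omega)
        have := hdown s
        have := hne' (s + 1) hs
        omega
    have := this h le_rfl
    omega

/-! ### Words of given support, and their syndromes -/

/-- The indicator word of a set. -/
def ind (S : Finset ℕ) : ℕ → ZMod 2 := ∑ j ∈ S, Pi.single j 1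

theorem ind_apply (S : Finset ℕ) (k : ℕ) : ind S k = if k ∈ S then 1 else 0 := by
  unfold ind
  rw [Finset.sum_apply, Finset.sum_congr rfl (g := fun j => if k = j then (1 : ZMod 2) else 0)
    (fun j _ => by rw [Pi.single_apply]), Finset.sum_ite_eq]

theorem wt_ind {n : ℕ} {S : Finset ℕ} (hS : S ⊆ Finset.range n) : wt n (ind S) = S.card := by
  rw [wt_eq_card]
  congr 1
  ext k
  rw [Finset.mem_filter, ind_apply]
  constructor
  · rintro ⟨-, h⟩; by_contra h'; simp [h'] at h
  · intro h; exact ⟨hS h, by simp [h]⟩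

theorem ind_add_ind {S T : Finset ℕ} (h : Disjoint S T) : ind S + ind T = ind (S ∪ T) := by
  unfold ind; rw [Finset.sum_union h]

/-- The number whose digits are the first `i` entries of the syndrome. -/
def synd (n : ℕ) (A : ℕ → ℕ → ZMod 2) (x : ℕ → ZMod 2) : ℕ → ℕ
  | 0 => 0
  | i + 1 => 2 * synd n A x i + (dot n (A i) x).val

theorem synd_lt (n : ℕ) (A : ℕ → ℕ → ZMod 2) (x : ℕ → ZMod 2) (i : ℕ) : synd n A x i < 2 ^ i := by
  induction i with
  | zero => simp [synd]
  | succ i ih =>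
    have := ZMod.val_lt (dot n (A i) x)
    rw [synd, pow_succ]; omega

theorem synd_eq_iff {n : ℕ} {A : ℕ → ℕ → ZMod 2} {x y : ℕ → ZMod 2} (i : ℕ) :
    synd n A x i = synd n A y i ↔ ∀ i' < i, dot n (A i') x = dot n (A i') y := by
  induction i with
  | zero => simp [synd]
  | succ i ih =>
    have h1 := ZMod.val_lt (dot n (A i) x)
    have h2 := ZMod.val_lt (dot n (A i) y)
    rw [synd, synd]
    constructor
    · intro h i' hi'
      rcases Nat.lt_succ_iff_lt_or_eq.1 hi' with h3 | rfl
      · exact ih.1 (by omega) i' h3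
      · exact ZMod.val_injective 2 (by omega)
    · intro h
      rw [ih.2 fun i' hi' => h i' (by omega), h i (by omega)]

theorem isWord_add_iff {n r : ℕ} {A : ℕ → ℕ → ZMod 2} {x y : ℕ → ZMod 2} :
    IsWord n r A (x + y) ↔ synd n A x r = synd n A y r := by
  rw [synd_eq_iff]
  unfold IsWord
  refine forall₂_congr fun i _ => ?_
  rw [dot_add_right, ← CharTwo.sub_eq_add, sub_eq_zero]

/-- Cost one at the positions with the property `p`, and a prohibitive cost elsewhere. -/
def sideCost (n : ℕ) (p : ℕ → Prop) [DecidablePred p] (j : ℕ) : ℕ := if p j then 1 else n * n + 1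

/-- A single position off the chosen side costs `n * n + 1`, more than the budget `b ≤ n`. -/
theorem mem_budgetList_sideCost {n b : ℕ} (hb : b ≤ n) {p : ℕ → Prop} [DecidablePred p]
    {S : Finset ℕ} : S ∈ budgetList (sideCost n p) b n ↔
      S ⊆ (Finset.range n).filter p ∧ ∑ j ∈ S, sideCost n p j = S.card ∧ S.card ≤ b := by
  rw [mem_budgetList]
  have key : S ⊆ (Finset.range n).filter p → ∑ j ∈ S, sideCost n p j = S.card := fun h => by
    rw [Finset.card_eq_sum_ones]
    exact Finset.sum_congr rfl fun j hj => if_pos (Finset.mem_filter.1 (h hj)).2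
  constructor
  · rintro ⟨h1, h2⟩
    have h3 : S ⊆ (Finset.range n).filter p := fun j hj => by
      refine Finset.mem_filter.2 ⟨h1 hj, ?_⟩
      by_contra hp
      have h4 := Finset.single_le_sum (f := sideCost n p) (fun _ _ => Nat.zero_le _) hj
      have h5 : sideCost n p j = n * n + 1 := if_neg hp
      have := Nat.le_mul_self n
      omega
    exact ⟨h3, key h3, key h3 ▸ h2⟩
  · rintro ⟨h1, h2, h3⟩
    exact ⟨h1.trans (Finset.filter_subset _ _), h2 ▸ h3⟩

theorem length_budgetList_sideCost_le {n b c : ℕ} (hb : b ≤ n) {p : ℕ → Prop} [DecidablePred p]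
    (hc : ((Finset.range n).filter p).card ≤ c) :
    (budgetList (sideCost n p) b n).length ≤ ballVol c b := by
  rw [← List.toFinset_card_of_nodup (nodup_budgetList _ b n)]
  refine (Finset.card_le_card (t := ((Finset.range n).filter p).powerset.filter fun S => S.card ≤ b)
    fun S hS => ?_).trans ((card_filter_card_le _ _).trans (ballVol_mono hc le_rfl))
  rw [List.mem_toFinset, mem_budgetList_sideCost hb] at hS
  exact Finset.mem_filter.2 ⟨Finset.mem_powerset.2 hS.1, hS.2.2⟩

/-! ### Routines of the collision search -/

/-- Half of `R_x`, rounded up. -/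
def Prog.half (a x : ℕ) : Prog :=
  .const a 0 ;; .forLt 19 x (.add 20 a a ;; .ifLt 20 x (.add a a 3) .skip)

/-- In place of a division, the result is increased as long as its double is below `v`; `v` rounds
are enough. -/
theorem half_spec {W a x v : ℕ} {σ : State} (hx : σ.reg x = v) (hv : 2 * v + 2 < 2 ^ W)
    (h3 : σ.reg 3 = 1) (ha : a ≠ 3 ∧ a ≠ 19 ∧ a ≠ 20 ∧ a ≠ x) (hx' : x ≠ 19 ∧ x ≠ 20) :
    HT W (.half a x) σ (5 * v + 3) fun σ' => σ'.mem = σ.mem ∧ σ'.reg a = (v + 1) / 2 ∧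
      ∀ b, b ≠ a → b ≠ 19 → b ≠ 20 → σ'.reg b = σ.reg b := by
  refine HT.weaken (N₁ := 1 + ((3 + 2) * v + 2)) ?_ (by omega)
  refine HT.const' (by omega) (HT.forLt v 3 (fun k σ' => σ'.mem = σ.mem ∧
    σ'.reg a = min k ((v + 1) / 2) ∧ ∀ b, b ≠ a → b ≠ 19 → b ≠ 20 → σ'.reg b = σ.reg b)
    (by omega) (by simp [hx, ha.2.2.2.symm]) ?_ ?_ ?_)
  · refine ⟨rfl, by simp [ha.2.1], fun b h1 h2 h3 => by simp [h1, h2]⟩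
  · rintro k σ₁ hk ⟨hmem, h1, hreg⟩ hi hlen
    have h3' : σ₁.reg 3 = 1 := by rw [hreg 3 (by omega) (by omega) (by omega), h3]
    refine HT.weaken (N₁ := 1 + (1 + 1)) (HT.add' (by omega) (HT.ifLt (fun h => HT.add ?_ ?_)
      (fun h => HT.skip ?_))) (by omega)
    · simp [ha.2.2.1, h1, h3']; omega
    · simp [hx'.2, hlen, h1] at h
      refine ⟨by simp [hi, ha.2.1.symm], by simp [ha.2.2.2.symm, hlen, hx'.2],
        by simp [h3', ha.1.symm], hmem, ?_, fun b hb1 hb2 hb3 => ?_⟩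
      · simp [ha.2.1, ha.2.2.1, h1, h3']; omega
      · simp [hb1, hb2, hb3, hreg b hb1 hb2 hb3]
    · simp [hx'.2, hlen, h1] at h
      refine ⟨by simp [hi], by simp [hlen, hx'.2], by simp [h3'], hmem, ?_, fun b hb1 hb2 hb3 => ?_⟩
      · simp [ha.2.1, ha.2.2.1, h1]; omega
      · simp [hb2, hb3, hreg b hb1 hb2 hb3]
  · rintro σ' ⟨h1, h2, h3⟩
    exact ⟨h1, by rw [h2]; omega, h3⟩

/-- Unit vectors with cost `R_a` in the window from `R_12` to `R_24` and cost `R_b` elsewhere. -/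
def Prog.sides (a b : ℕ) : Prog :=
  .forLt 20 0 (.aget 25 1 20 ;; .aset 2 20 25 ;;
    .ifLt 20 12 (.aset 3 20 b) (.ifLt 20 24 (.aset 3 20 a) (.aset 3 20 b)))

theorem sides_spec {W n r B a b s e : ℕ} {σ : State} (henv : Env n B σ) (hroom : Room W n r B)
    (h12 : σ.reg 12 = s) (h24 : σ.reg 24 = e) (ha : a < 20) (hb : b < 20) :
    HT W (.sides a b) σ (25 * n + 2) fun σ' =>
      Vecs n B (fun j => Pi.single j 1) (fun j => if s ≤ j ∧ j < e then σ.reg a else σ.reg b) σ' ∧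
      (∀ c < 90, c ≠ 20 → c ≠ 25 → σ'.reg c = σ.reg c) ∧
      ∀ k < 8, k ≠ 2 → k ≠ 3 → ∀ i, σ'.arr B k i = σ.arr B k i := by
  unfold Room at hroom
  have hn2 : n < 2 ^ n := Nat.lt_two_pow_self
  refine HT.forLt n 23 (fun k σ' =>
      (∀ j < k, σ'.arr B 2 j = 2 ^ j ∧ σ'.arr B 3 j = if s ≤ j ∧ j < e then σ.reg a else σ.reg b) ∧
      (∀ c < 90, c ≠ 20 → c ≠ 25 → σ'.reg c = σ.reg c) ∧
      ∀ k < 8, k ≠ 2 → k ≠ 3 → ∀ i, σ'.arr B k i = σ.arr B k i) (by omega) (by simp [henv.len]) ?_ ?_ ?_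
  · refine ⟨fun j hj => by omega, fun c hc h1 h2 => by simp [h1], fun k _ _ _ i => rfl⟩
  · rintro k σ₁ hk ⟨hv, hreg, harr⟩ hi hlen
    have h4 : σ₁.reg 4 = B := by rw [hreg 4 (by omega) (by omega) (by omega), henv.base]
    have h3 : σ₁.reg 3 = 1 := by rw [hreg 3 (by omega) (by omega) (by omega), henv.one]
    refine HT.weaken (N₁ := 7 + (7 + ((7 + 1) + 1))) ?_ (by omega)
    refine HT.aget' (x := k) (B := B) hi h4 (by omega) (HT.aset' (x := k) (B := B) (by omega)
      (by simp [hi]) (by simp [h4]) (by omega) ?_)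
    rw [harr 1 (by omega) (by omega) (by omega), henv.pow k hk]
    set σ₂ := ((((((σ₁.setReg 91 1).setReg 90 (B + 8 * k + 1)).setReg 25 (2 ^ k)).setReg 91 2).setReg 90
      (B + 8 * k + 2)).setArr B 2 k ((((σ₁.setReg 91 1).setReg 90 (B + 8 * k + 1)).setReg 25
        (2 ^ k)).reg 25)) with hσ₂
    have hr₂ : ∀ c < 90, c ≠ 25 → σ₂.reg c = σ₁.reg c := fun c h1 h2 => by
      simp (disch := omega) only [hσ₂, State.reg_setReg, State.reg_setArr, if_neg]
    have ha₂ : ∀ k' < 8, ∀ i, σ₂.arr B k' i = if k' = 2 ∧ i = k then 2 ^ k else σ₁.arr B k' i :=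
      fun k' hk' i => by
        rw [hσ₂, State.arr_setArr _ _ (by omega) hk']; simp
    have key : ∀ c < 20, σ₂.reg c = (if s ≤ k ∧ k < e then σ.reg a else σ.reg b) →
        HT W (.aset 3 20 c) σ₂ 7 fun σ'' => σ''.reg 20 = k ∧ σ''.reg 0 = n ∧ σ''.reg 3 = 1 ∧
          (∀ j < k + 1, (σ''.setReg 20 (k + 1)).arr B 2 j = 2 ^ j ∧
            (σ''.setReg 20 (k + 1)).arr B 3 j = if s ≤ j ∧ j < e then σ.reg a else σ.reg b) ∧
          (∀ c < 90, c ≠ 20 → c ≠ 25 → (σ''.setReg 20 (k + 1)).reg c = σ.reg c) ∧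
          ∀ k' < 8, k' ≠ 2 → k' ≠ 3 → ∀ i, (σ''.setReg 20 (k + 1)).arr B k' i = σ.arr B k' i := by
      intro c hc hval
      refine HT.aset (x := k) (B := B) (by omega) (by rw [hr₂ 20 (by omega) (by omega), hi])
        (by rw [hr₂ 4 (by omega) (by omega), h4]) (by omega) ?_
      rw [hval]
      refine ⟨by simp [hr₂ 20, hi], by simp [hr₂ 0, hlen], by simp [hr₂ 3, h3], fun j hj => ⟨?_, ?_⟩,
        fun c hc h1 h2 => ?_, fun k' hk' h2 h3 i => ?_⟩
      · rw [State.arr_setReg, State.arr_setArr_of_ne _ _ (by omega) (by omega) (by omega)]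
        rw [State.arr_setReg, State.arr_setReg, ha₂ 2 (by omega)]
        split_ifs with h
        · rw [h.2]
        · exact (hv j (by omega)).1
      · rw [State.arr_setReg, State.arr_setArr_self _ _ (by omega)]
        by_cases hjk : j = k
        · subst hjk; rw [if_pos rfl]
        · rw [if_neg hjk, State.arr_setReg, State.arr_setReg, ha₂ 3 (by omega), if_neg (by omega)]
          exact (hv j (by omega)).2
      · simp (disch := omega) only [State.reg_setReg, State.reg_setArr, if_neg]
        rw [hr₂ c hc h2, hreg c hc h1 h2]
      · rw [State.arr_setReg, State.arr_setArr_of_ne _ _ (by omega) hk' h3, State.arr_setReg,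
          State.arr_setReg, ha₂ k' hk', if_neg (by omega), harr k' hk' h2 h3]
    have hra : σ₂.reg a = σ.reg a := by
      rw [hr₂ a (by omega) (by omega), hreg a (by omega) (by omega) (by omega)]
    have hrb : σ₂.reg b = σ.reg b := by
      rw [hr₂ b (by omega) (by omega), hreg b (by omega) (by omega) (by omega)]
    have h20 : σ₂.reg 20 = k := by rw [hr₂ 20 (by omega) (by omega), hi]
    have h12₂ : σ₂.reg 12 = s := by
      rw [hr₂ 12 (by omega) (by omega), hreg 12 (by omega) (by omega) (by omega), h12]
    have h24₂ : σ₂.reg 24 = e := by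
      rw [hr₂ 24 (by omega) (by omega), hreg 24 (by omega) (by omega) (by omega), h24]
    refine HT.ifLt (fun h => HT.weaken (key b hb ?_) (by omega)) (fun h => HT.ifLt
      (fun h' => key a ha ?_) (fun h' => key b hb ?_))
    · rw [hrb, if_neg (by omega)]
    · rw [hra, if_pos (by omega)]
    · rw [hrb, if_neg (by omega)]
  · rintro σ' ⟨h1, h2, h3⟩
    exact ⟨⟨fun j hj => by rw [(h1 j hj).1, enc_single hj], fun j hj => (h1 j hj).2⟩, h2, h3⟩

/-- The syndrome of the word in register `38`, in register `39`. -/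
def Prog.syn : Prog :=
  .const 39 0 ;; .forLt 26 1 (.aget 61 0 26 ;; .add 60 38 17 ;; .comb ;; .add 39 39 39 ;; .add 39 39 63)

/-- The number of operations of `syn`. -/
def synCost (n r : ℕ) : ℕ := (combCost n + 12) * r + 3

theorem syn_spec {W n r B : ℕ} {σ : State} {A : ℕ → ℕ → ZMod 2} {x : ℕ → ZMod 2}
    (henv : Env n B σ) (hroom : Room W n r B) (h1 : σ.reg 1 = r) (h17 : σ.reg 17 = 0)
    (hrow : ∀ i < r, σ.arr B 0 i = enc n (A i)) (h38 : σ.reg 38 = enc n x) :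
    HT W .syn σ (synCost n r) fun σ' => σ'.mem = σ.mem ∧ σ'.reg 39 = synd n A x r ∧
      ∀ a < 60, a ≠ 26 → a ≠ 39 → σ'.reg a = σ.reg a := by
  unfold Room at hroom
  have hn2 : n < 2 ^ n := Nat.lt_two_pow_self
  have hr2 : r < 2 ^ r := Nat.lt_two_pow_self
  refine HT.weaken (N₁ := 1 + ((combCost n + 10 + 2) * r + 2)) ?_
    (by unfold synCost; ring_nf; omega)
  refine HT.const' (by omega) (HT.forLt r _ (fun k σ' => σ'.mem = σ.mem ∧ σ'.reg 39 = synd n A x k ∧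
      ∀ a < 60, a ≠ 26 → a ≠ 39 → σ'.reg a = σ.reg a) (by omega) (by simp [h1]) ?_ ?_ fun _ h => h)
  · refine ⟨rfl, by simp [synd], fun a _ h h' => by simp [h, h']⟩
  · rintro k σ₁ hk ⟨hmem, h39, hreg⟩ hi hlen
    have harr : ∀ k i, σ₁.arr B k i = σ.arr B k i := fun k i => by unfold State.arr; rw [hmem]
    have h4 : σ₁.reg 4 = B := by rw [hreg 4 (by omega) (by omega) (by omega), henv.base]
    have h3 : σ₁.reg 3 = 1 := by rw [hreg 3 (by omega) (by omega) (by omega), henv.one]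
    have hx := enc_lt n x
    have hs := synd_lt n A x (k + 1)
    have hkr : 2 ^ (k + 1) ≤ 2 ^ r := Nat.pow_le_pow_right (by omega) (by omega)
    rw [synd] at hs
    refine HT.weaken (N₁ := 7 + (1 + (combCost n + (1 + 1)))) ?_ (by omega)
    refine HT.aget' (x := k) (B := B) hi h4 (by omega) (HT.add' ?_ ?_)
    · simp [hreg 38, hreg 17, h38, h17]; omega
    rw [harr, hrow k hk]
    refine HT.call (comb_spec (u := x) (v := A k) (henv.of_eq (fun a ha => ?_) fun i _ => ?_)
      (by omega) (by omega) ?_ ?_) ?_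
    · simp (disch := omega) only [State.reg_setReg, if_neg]
      exact hreg a (by omega) (by omega) (by omega)
    · simp [harr]
    · simp [hreg 38, hreg 17, h38, h17]
    · simp
    rintro σ₂ ⟨hmem₂, hreg₂, -, h63, -⟩
    rw [dot_comm] at h63
    have hr : ∀ a < 60, σ₂.reg a = σ₁.reg a := fun a ha => by
      rw [hreg₂ a (by omega)]
      simp (disch := omega) only [State.reg_setReg, if_neg]
    refine HT.add' (by rw [hr 39 (by omega), h39]; omega) (HT.add ?_ ?_)
    · simp [hr 39, h39, h63]; omega
    refine ⟨by simp [hr 26, hi], by simp [hr 1, hlen], by simp [hr 3, h3], ?_, ?_, fun a ha h1 h2 => ?_⟩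
    · rw [← hmem]; simpa using hmem₂
    · simp [hr 39, h39, h63, synd]; ring
    · simp [h1, h2, hr a ha, hreg a ha h1 h2]

/-- The table in the arrays `6`, `7`, addressed by syndromes: the entries with the current stamp `t`
are those of the words of weight `u` with supports in the list `L`. -/
structure Table (n r B : ℕ) (A : ℕ → ℕ → ZMod 2) (t u : ℕ) (L : List (Finset ℕ)) (σ : State) :
    Prop where
  le : ∀ v < 2 ^ r, σ.arr B 6 v ≤ t
  sound : ∀ v < 2 ^ r, σ.arr B 6 v = t → ∃ S ∈ L, S.card = u ∧ synd n A (ind S) r = v ∧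
    σ.arr B 7 v = enc n (ind S)
  complete : ∀ S ∈ L, S.card = u → σ.arr B 6 (synd n A (ind S) r) = t

theorem Table.of_eq {n r B t u : ℕ} {A : ℕ → ℕ → ZMod 2} {L L' : List (Finset ℕ)} {σ σ' : State}
    (h : Table n r B A t u L σ) (hL : ∀ S, S.card = u → (S ∈ L' ↔ S ∈ L))
    (h6 : ∀ i, σ'.arr B 6 i = σ.arr B 6 i) (h7 : ∀ i, σ'.arr B 7 i = σ.arr B 7 i) :
    Table n r B A t u L' σ' := by
  refine ⟨fun v hv => by rw [h6]; exact h.le v hv, fun v hv ht => ?_, fun S hS hu => ?_⟩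
  · rw [h6] at ht
    obtain ⟨S, h1, h2, h3, h4⟩ := h.sound v hv ht
    exact ⟨S, (hL S h2).2 h1, h2, h3, by rw [h7, h4]⟩
  · rw [h6]
    exact h.complete S ((hL S hu).1 hS) hu

theorem mem_take_succ {α : Type*} {L : List α} {k : ℕ} (hk : k < L.length) (x : α) :
    x ∈ L.take (k + 1) ↔ x ∈ L.take k ∨ x = L[k] := by
  rw [List.take_succ_eq_append_getElem hk, List.mem_append, List.mem_singleton]

/-- Enters item number `R_36` of the list into the table, if its cost is `R_21`. -/
def Prog.fillStep : Prog :=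
  .aget 37 4 36 ;; .ifLt 37 21 .skip (.aget 38 5 36 ;; .syn ;; .aset 6 39 8 ;; .aset 7 39 38)

/-- The number of operations of `fillStep`. -/
def fillStepCost (n r : ℕ) : ℕ := synCost n r + 29

/-- All older stamps are below `t`, so entries of earlier rounds are recognised as void and the
`2^r` cells need not be cleared. Words of equal syndrome overwrite each other; one representative
suffices. -/
theorem fill_spec {W n r B t u M : ℕ} {σ : State} {A : ℕ → ℕ → ZMod 2} {κ : ℕ → ℕ}
    {L : List (Finset ℕ)} (hσ : Ready n r B A σ) (hroom : Room W n r B) (h17 : σ.reg 17 = 0)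
    (h8 : σ.reg 8 = t) (h21 : σ.reg 21 = u) (hL : Holds n B (fun j => Pi.single j 1) κ σ L)
    (hLκ : ∀ S ∈ L, ∑ j ∈ S, κ j = S.card ∧ S.card ≤ u) (hLM : L.length ≤ M)
    (hLn : L.length ≤ 2 ^ n) (hold : ∀ v < 2 ^ r, σ.arr B 6 v < t) :
    HT W (.forLt 36 11 .fillStep) σ ((fillStepCost n r + 2) * M + 2) fun σ' =>
      Table n r B A t u L σ' ∧ (∀ a < 36, a ≠ 26 → σ'.reg a = σ.reg a) ∧
      ∀ k < 8, k ≠ 6 → k ≠ 7 → ∀ i, σ'.arr B k i = σ.arr B k i := by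
  have hroom' := hroom
  unfold Room at hroom'
  refine HT.weaken (HT.forLt L.length (fillStepCost n r) (fun k σ' =>
      Table n r B A t u (L.take k) σ' ∧ (∀ a < 36, a ≠ 26 → σ'.reg a = σ.reg a) ∧
      ∀ k < 8, k ≠ 6 → k ≠ 7 → ∀ i, σ'.arr B k i = σ.arr B k i) (by omega) hL.len ?_ ?_ ?_)
      (Nat.add_le_add_right (Nat.mul_le_mul_left (fillStepCost n r + 2) hLM) 2)
  · refine ⟨⟨fun v hv => (hold v hv).le, fun v hv h => ?_, fun S hS => by simp at hS⟩,
      fun a ha _ => ?_, fun k _ _ _ i => rfl⟩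
    · have := hold v hv
      simp at h
      omega
    · simp (disch := omega) only [State.reg_setReg, if_neg]
  · rintro k σ₁ hk ⟨htab, hreg, harr⟩ hi hlen
    have hmem : L[k] ∈ L := List.getElem_mem hk
    have hr : ∀ a < 36, a ≠ 26 → σ₁.reg a = σ.reg a := hreg
    have h4 : σ₁.reg 4 = B := (hr 4 (by omega) (by omega)).trans hσ.env.base
    have h3 : σ₁.reg 3 = 1 := (hr 3 (by omega) (by omega)).trans hσ.env.one
    have hcost : σ₁.arr B 4 k = L[k].card := by
      rw [harr 4 (by omega) (by omega) (by omega), hL.cost k hk, (hLκ _ hmem).1]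
    have hvec : σ₁.arr B 5 k = enc n (ind L[k]) := by
      rw [harr 5 (by omega) (by omega) (by omega), hL.vec k hk]; rfl
    have hle := (hLκ _ hmem).2
    refine HT.weaken (N₁ := 7 + ((7 + (synCost n r + (7 + 7))) + 1)) ?_ (by unfold fillStepCost; omega)
    refine HT.aget' (x := k) (B := B) hi h4 (by omega) (HT.ifLt (fun h => ?_) (fun h => ?_))
    · simp [hcost, hr 21, h21] at h
      refine HT.weaken (HT.skip ?_) (by omega)
      refine ⟨by simp [hi], by simp [hlen], by simp [h3], htab.of_eq (fun S hS => ?_) (fun _ => rfl)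
        fun _ => rfl, fun a ha h26 => ?_, fun k' hk' h6 h7 i => ?_⟩
      · rw [mem_take_succ hk]
        constructor
        · rintro (h1 | rfl)
          · exact h1
          · omega
        · exact Or.inl
      · simp (disch := omega) only [State.reg_setReg, if_neg]
        exact hreg a ha h26
      · exact harr k' hk' h6 h7 i
    · simp [hcost, hr 21, h21] at h
      have hcard : L[k].card = u := by omega
      refine HT.aget' (x := k) (B := B) (by simp [hi]) (by simp [h4]) (by omega) ?_
      simp only [State.arr_setReg, hvec]
      refine HT.call (syn_spec (r := r) (A := A) (x := ind L[k]) (hσ.env.of_eq (fun a ha => ?_)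
        fun i _ => ?_) hroom ?_ ?_ (fun i hi => ?_) (by simp)) ?_
      · simp (disch := omega) only [State.reg_setReg, if_neg]
        exact hreg a (by omega) (by omega)
      · exact harr 1 (by omega) (by omega) (by omega) i
      · simp [hr 1, hσ.rows]
      · simp [hr 17, h17]
      · exact (harr 0 (by omega) (by omega) (by omega) i).trans (hσ.row i hi)
      rintro σ₂ ⟨hmem₂, h39, hreg₂⟩
      have hr₂ : ∀ a < 37, a ≠ 26 → σ₂.reg a = σ₁.reg a := fun a ha h26 => by
        rw [hreg₂ a (by omega) h26 (by omega)]
        simp (disch := omega) only [State.reg_setReg, if_neg]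
      have h38 : σ₂.reg 38 = enc n (ind L[k]) := by
        rw [hreg₂ 38 (by omega) (by omega) (by omega)]; simp
      have harr₂ : ∀ k i, σ₂.arr B k i = σ₁.arr B k i := fun k i => by
        unfold State.arr; rw [hmem₂]; rfl
      have hs := synd_lt n A (ind L[k]) r
      have h8₂ : σ₂.reg 8 = t := by
        rw [hr₂ 8 (by omega) (by omega), hr 8 (by omega) (by omega), h8]
      refine HT.aset' (x := synd n A (ind L[k]) r) (B := B) (by omega) h39
        (by rw [hr₂ 4 (by omega) (by omega), h4]) (by omega)
        (HT.aset (x := synd n A (ind L[k]) r) (B := B) (by omega) (by simp [h39])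
        (by simp [hr₂ 4, h4]) (by omega) ?_)
      have hval : ((((σ₂.setReg 91 6).setReg 90 (B + 8 * synd n A (ind L[k]) r + 6)).setArr B 6
        (synd n A (ind L[k]) r) (σ₂.reg 8)).reg 38) = enc n (ind L[k]) := by simp [h38]
      rw [hval, h8₂]
      set s := synd n A (ind L[k]) r with hsd
      set σ₃ := ((((((σ₂.setReg 91 6).setReg 90 (B + 8 * s + 6)).setArr B 6 s t).setReg 91 7).setReg 90
        (B + 8 * s + 7)).setArr B 7 s (enc n (ind L[k]))) with hσ₃
      have h6₃ : ∀ i, σ₃.arr B 6 i = if i = s then t else σ₁.arr B 6 i := fun i => by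
        rw [hσ₃, State.arr_setArr_of_ne _ _ (by omega) (by omega) (by omega), State.arr_setReg,
          State.arr_setReg, State.arr_setArr_self _ _ (by omega)]
        simp [harr₂]
      have h7₃ : ∀ i, σ₃.arr B 7 i = if i = s then enc n (ind L[k]) else σ₁.arr B 7 i := fun i => by
        rw [hσ₃, State.arr_setArr_self _ _ (by omega), State.arr_setReg, State.arr_setReg,
          State.arr_setArr_of_ne _ _ (by omega) (by omega) (by omega)]
        simp [harr₂]
      have hr₃ : ∀ a < 37, a ≠ 26 → σ₃.reg a = σ₁.reg a := fun a ha h26 => by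
        simp (disch := omega) only [hσ₃, State.reg_setReg, State.reg_setArr, if_neg]
        exact hr₂ a ha h26
      refine ⟨by rw [hr₃ 36 (by omega) (by omega), hi], by rw [hr₃ 11 (by omega) (by omega), hlen],
        by rw [hr₃ 3 (by omega) (by omega), h3], ⟨fun v hv => ?_, fun v hv ht => ?_, fun S hS hu => ?_⟩,
        fun a ha h26 => ?_, fun k' hk' h6 h7 i => ?_⟩
      · rw [State.arr_setReg, h6₃]
        split_ifs
        · exact le_rfl
        · exact htab.le v hv
      · rw [State.arr_setReg, h6₃] at ht
        rw [State.arr_setReg, h7₃]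
        by_cases hvs : v = s
        · exact ⟨L[k], (mem_take_succ hk _).2 (Or.inr rfl), hcard, by rw [hvs], by rw [if_pos hvs]⟩
        · rw [if_neg hvs] at ht
          obtain ⟨S, h1, h2, h3, h4⟩ := htab.sound v hv ht
          exact ⟨S, (mem_take_succ hk _).2 (Or.inl h1), h2, h3, by rw [if_neg hvs, h4]⟩
      · rw [State.arr_setReg, h6₃]
        split_ifs with hvs
        · rfl
        · rcases (mem_take_succ hk _).1 hS with h1 | rfl
          · exact htab.complete S h1 hu
          · exact absurd rfl hvs
      · simp (disch := omega) only [State.reg_setReg, if_neg]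
        rw [hr₃ a (by omega) h26, hreg a ha h26]
      · rw [hσ₃, State.arr_setArr_of_ne _ _ (by omega) hk' h7, State.arr_setReg,
          State.arr_setReg, State.arr_setArr_of_ne _ _ (by omega) hk' h6, State.arr_setReg,
          State.arr_setReg, harr₂, harr k' hk' h6 h7]
  · rintro σ' ⟨h1, h2, h3⟩
    rw [List.take_length] at h1
    exact ⟨h1, h2, h3⟩

/-- Looks up the syndrome of item number `R_36` of the list, if its cost is `R_22`. -/
def Prog.matchStep : Prog :=
  .aget 37 4 36 ;; .ifLt 37 22 .skip (.aget 38 5 36 ;; .syn ;; .aget 31 6 39 ;;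
    .ifLt 31 8 .skip (.aget 60 7 39 ;; .add 61 38 17 ;; .comb ;; .add 6 62 17))

/-- The number of operations of `matchStep`. -/
def matchStepCost (n r : ℕ) : ℕ := synCost n r + combCost n + 32

/-- Stamps never exceed `t`, so the test whether the stamp is below `t` decides if the syndrome
occurs in the table. If it does, the stored word and the current one form a codeword. -/
theorem match_spec {W n r B t u u' D M : ℕ} {σ : State} {A : ℕ → ℕ → ZMod 2} {κ : ℕ → ℕ}
    {L' L : List (Finset ℕ)} (hσ : Ready n r B A σ) (hroom : Room W n r B) (h17 : σ.reg 17 = 0)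
    (h8 : σ.reg 8 = t) (h22 : σ.reg 22 = u) (hL : Holds n B (fun j => Pi.single j 1) κ σ L)
    (hLκ : ∀ S ∈ L, ∑ j ∈ S, κ j = S.card ∧ S.card ≤ u) (hLM : L.length ≤ M)
    (hLn : L.length ≤ 2 ^ n) (htab : Table n r B A t u' L' σ)
    (h6 : σ.reg 6 = 0 ∨ IsHit n r A D (σ.reg 6))
    (hhit : ∀ S ∈ L', S.card = u' → ∀ T ∈ L, T.card = u → synd n A (ind S) r = synd n A (ind T) r →
      IsHit n r A D (enc n (ind S + ind T))) :
    HT W (.forLt 36 11 .matchStep) σ ((matchStepCost n r + 2) * M + 2) fun σ' => σ'.mem = σ.mem ∧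
      (∀ a < 36, a ≠ 6 → a ≠ 26 → a ≠ 31 → σ'.reg a = σ.reg a) ∧
      (σ'.reg 6 = 0 ∨ IsHit n r A D (σ'.reg 6)) ∧
      (σ'.reg 6 = 0 → σ.reg 6 = 0 ∧ ∀ S ∈ L', S.card = u' → ∀ T ∈ L, T.card = u →
        synd n A (ind S) r ≠ synd n A (ind T) r) := by
  have hroom' := hroom
  unfold Room at hroom'
  refine HT.weaken (HT.forLt L.length (matchStepCost n r) (fun k σ' => σ'.mem = σ.mem ∧
      (∀ a < 36, a ≠ 6 → a ≠ 26 → a ≠ 31 → σ'.reg a = σ.reg a) ∧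
      (σ'.reg 6 = 0 ∨ IsHit n r A D (σ'.reg 6)) ∧
      (σ'.reg 6 = 0 → σ.reg 6 = 0 ∧ ∀ S ∈ L', S.card = u' → ∀ T ∈ L.take k, T.card = u →
        synd n A (ind S) r ≠ synd n A (ind T) r)) (by omega) hL.len ?_ ?_ ?_)
      (Nat.add_le_add_right (Nat.mul_le_mul_left (matchStepCost n r + 2) hLM) 2)
  · refine ⟨rfl, fun a ha _ _ _ => ?_, by simpa using h6,
      fun h => ⟨by simpa using h, fun S _ _ T hT => by simp at hT⟩⟩
    simp (disch := omega) only [State.reg_setReg, if_neg]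
  · rintro k σ₁ hk ⟨hmem, hreg, h6₁, h6₁'⟩ hi hlen
    have hmemL : L[k] ∈ L := List.getElem_mem hk
    have harr : ∀ k i, σ₁.arr B k i = σ.arr B k i := fun k i => by unfold State.arr; rw [hmem]
    have h4 : σ₁.reg 4 = B := (hreg 4 (by omega) (by omega) (by omega) (by omega)).trans hσ.env.base
    have h3 : σ₁.reg 3 = 1 := (hreg 3 (by omega) (by omega) (by omega) (by omega)).trans hσ.env.one
    have hcost : σ₁.arr B 4 k = L[k].card := by rw [harr, hL.cost k hk, (hLκ _ hmemL).1]
    have hvec : σ₁.arr B 5 k = enc n (ind L[k]) := by rw [harr, hL.vec k hk]; rfl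
    have hle := (hLκ _ hmemL).2
    have hskip : ∀ σ₂ : State, σ₂.mem = σ₁.mem →
        (∀ a < 37, a ≠ 26 → a ≠ 31 → σ₂.reg a = σ₁.reg a) →
        (∀ S ∈ L', S.card = u' → L[k].card = u → synd n A (ind S) r ≠ synd n A (ind L[k]) r) →
        (fun σ'' : State => σ''.reg 36 = k ∧
          σ''.reg 11 = L.length ∧ σ''.reg 3 = 1 ∧ (σ''.setReg 36 (k + 1)).mem = σ.mem ∧
          (∀ a < 36, a ≠ 6 → a ≠ 26 → a ≠ 31 → (σ''.setReg 36 (k + 1)).reg a = σ.reg a) ∧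
          ((σ''.setReg 36 (k + 1)).reg 6 = 0 ∨ IsHit n r A D ((σ''.setReg 36 (k + 1)).reg 6)) ∧
          ((σ''.setReg 36 (k + 1)).reg 6 = 0 → σ.reg 6 = 0 ∧ ∀ S ∈ L', S.card = u' →
            ∀ T ∈ L.take (k + 1), T.card = u → synd n A (ind S) r ≠ synd n A (ind T) r)) σ₂ := by
      intro σ₂ hm hr hno
      refine ⟨by rw [hr 36 (by omega) (by omega) (by omega), hi],
        by rw [hr 11 (by omega) (by omega) (by omega), hlen],
        by rw [hr 3 (by omega) (by omega) (by omega), h3], hm.trans hmem, fun a ha h1 h2 h3 => ?_,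
        by simpa [hr 6] using h6₁, fun h => ?_⟩
      · simp (disch := omega) only [State.reg_setReg, if_neg]
        rw [hr a (by omega) h2 h3, hreg a ha h1 h2 h3]
      · simp [hr 6] at h
        refine ⟨(h6₁' h).1, fun S hS hu T hT hTu => ?_⟩
        rcases (mem_take_succ hk _).1 hT with h1 | rfl
        · exact (h6₁' h).2 S hS hu T h1 hTu
        · exact hno S hS hu hTu
    refine HT.weaken (N₁ := 7 + ((7 + (synCost n r + (7 + ((7 + (1 + (combCost n + 1))) + 1)))) + 1)) ?_
      (by unfold matchStepCost; omega)
    refine HT.aget' (x := k) (B := B) hi h4 (by omega) (HT.ifLt (fun h => ?_) (fun h => ?_))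
    · simp [hcost, hreg 22, h22] at h
      refine HT.weaken (HT.skip (hskip _ rfl (fun a ha _ _ => ?_) fun S _ _ hu => by omega)) (by omega)
      simp (disch := omega) only [State.reg_setReg, if_neg]
    · simp [hcost, hreg 22, h22] at h
      have hcard : L[k].card = u := by omega
      refine HT.aget' (x := k) (B := B) (by simp [hi]) (by simp [h4]) (by omega) ?_
      simp only [State.arr_setReg, hvec]
      refine HT.call (syn_spec (r := r) (A := A) (x := ind L[k]) (hσ.env.of_eq (fun a ha => ?_)
        fun i _ => ?_) hroom ?_ ?_ (fun i hi => ?_) (by simp)) ?_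
      · simp (disch := omega) only [State.reg_setReg, if_neg]
        exact hreg a (by omega) (by omega) (by omega) (by omega)
      · exact harr 1 i
      · simp [hreg 1, hσ.rows]
      · simp [hreg 17, h17]
      · exact (harr 0 i).trans (hσ.row i hi)
      rintro σ₂ ⟨hmem₂, h39, hreg₂⟩
      have hr₂ : ∀ a < 37, a ≠ 26 → σ₂.reg a = σ₁.reg a := fun a ha h26 => by
        rw [hreg₂ a (by omega) h26 (by omega)]
        simp (disch := omega) only [State.reg_setReg, if_neg]
      have h38 : σ₂.reg 38 = enc n (ind L[k]) := by
        rw [hreg₂ 38 (by omega) (by omega) (by omega)]; simp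
      have hmem₂' : σ₂.mem = σ₁.mem := hmem₂
      have harr₂ : ∀ k i, σ₂.arr B k i = σ.arr B k i := fun k i => by
        rw [← harr]; unfold State.arr; rw [hmem₂']
      have hs := synd_lt n A (ind L[k]) r
      have h8₂ : σ₂.reg 8 = t := by
        rw [hr₂ 8 (by omega) (by omega), hreg 8 (by omega) (by omega) (by omega) (by omega), h8]
      refine HT.aget' (x := synd n A (ind L[k]) r) (B := B) h39
        (by rw [hr₂ 4 (by omega) (by omega), h4]) (by omega) ?_
      refine HT.ifLt (fun h => ?_) (fun h => ?_)
      · simp [h8₂, harr₂] at h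
        refine HT.weaken (HT.skip (hskip _ hmem₂' (fun a ha h1 h2 => ?_) fun S hS hu _ he => ?_)) (by omega)
        · simp (disch := omega) only [State.reg_setReg, if_neg]
          exact hr₂ a ha h1
        · rw [← he, htab.complete S hS hu] at h
          omega
      · simp [h8₂, harr₂] at h
        obtain ⟨S, hS, hSu, hSs, hSv⟩ := htab.sound _ hs (le_antisymm (htab.le _ hs) h)
        have hit := hhit S hS hSu L[k] hmemL hcard hSs
        refine HT.aget' (x := synd n A (ind L[k]) r) (B := B) (by simp [h39]) (by simp [hr₂ 4, h4])
          (by omega) (HT.add' ?_ ?_)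
        · simp [h38, hr₂ 17, hreg 17, h17]
          have := enc_lt n (ind L[k])
          omega
        simp only [State.arr_setReg, harr₂, hSv]
        refine HT.call (comb_spec (u := ind S) (v := ind L[k]) (hσ.env.of_eq (fun a ha => ?_)
          fun i _ => harr₂ 1 i) (by have : n < 2 ^ n := Nat.lt_two_pow_self
                                    omega) (by have : n < 2 ^ n := Nat.lt_two_pow_self
                                               omega) ?_ ?_) ?_
        · simp (disch := omega) only [State.reg_setReg, if_neg]
          rw [hr₂ a (by omega) (by omega), hreg a (by omega) (by omega) (by omega) (by omega)]
        · simp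
        · simp [h38, hr₂ 17, hreg 17, h17]
        rintro σ₃ ⟨hmem₃, hreg₃, h62, -, -⟩
        have hr₃ : ∀ a < 37, a ≠ 26 → a ≠ 31 → σ₃.reg a = σ₁.reg a := fun a ha h26 h31 => by
          rw [hreg₃ a (by omega), ← hr₂ a ha h26]
          simp (disch := omega) only [State.reg_setReg, if_neg]
        have h17₃ : σ₃.reg 17 = 0 := by
          rw [hr₃ 17 (by omega) (by omega) (by omega), hreg 17 (by omega) (by omega) (by omega)
            (by omega), h17]
        refine HT.add (by rw [h62, h17₃]; have := enc_lt n (ind S + ind L[k]); omega) ?_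
        rw [h62, h17₃, add_zero]
        refine ⟨by simp [hr₃ 36, hi], by simp [hr₃ 11, hlen], by simp [hr₃ 3, h3], ?_,
          fun a ha h1 h2 h3 => ?_, Or.inr (by simpa using hit), fun h => ?_⟩
        · rw [← hmem, ← hmem₂']; simpa using hmem₃
        · simp (disch := omega) only [State.reg_setReg, if_neg]
          rw [hr₃ a (by omega) h2 h3, hreg a ha h1 h2 h3]
        · simp at h
          exact absurd h hit.ne_zero
  · rintro σ' ⟨h1, h2, h3, h4⟩
    rw [List.take_length] at h4
    exact ⟨h1, h2, h3, h4⟩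

/-! ### The collision search -/

/-- The window of length `⌈n/2⌉` at `s`. -/
abbrev HalfWindow (n s j : ℕ) : Prop := s ≤ j ∧ j < s + (n + 1) / 2

theorem card_halfWindow_le (n s : ℕ) :
    ((Finset.range n).filter (HalfWindow n s)).card ≤ (n + 1) / 2 := by
  refine (Finset.card_le_card (t := Finset.Ico s (s + (n + 1) / 2)) fun j hj => ?_).trans (by simp)
  rw [Finset.mem_filter] at hj
  exact Finset.mem_Ico.2 hj.2

theorem card_not_halfWindow_le {n s : ℕ} (hs : s ≤ (n + 1) / 2) :
    ((Finset.range n).filter fun j => ¬ HalfWindow n s j).card ≤ (n + 1) / 2 := by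
  refine (Finset.card_le_card (t := Finset.range s ∪ Finset.Ico (s + (n + 1) / 2) n)
    fun j hj => ?_).trans ((Finset.card_union_le _ _).trans ?_)
  · rw [Finset.mem_filter, Finset.mem_range] at hj
    rw [Finset.mem_union, Finset.mem_range, Finset.mem_Ico]
    unfold HalfWindow at hj
    omega
  · rw [Finset.card_range, Nat.card_Ico]
    omega

/-- Searches for codewords with weight `R_21` in the window at `R_12` and weight `R_22` outside. -/
def Prog.splitStep : Prog :=
  .add 8 8 3 ;; .add 24 12 23 ;; .sides 3 5 ;; .add 10 21 17 ;; .enum ;; .forLt 36 11 .fillStep ;;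
    .sides 5 3 ;; .add 10 22 17 ;; .enum ;; .forLt 36 11 .matchStep

/-- The number of operations of `splitStep`. -/
def splitStepCost (n r M : ℕ) : ℕ :=
  2 * (25 * n + 2) + 2 * enumCost n M + (fillStepCost n r + matchStepCost n r + 4) * M + 8

/-- The registers that `splitStep` uses. -/
structure Halved (n D : ℕ) (σ : State) : Prop where
  zero : σ.reg 17 = 0
  left : σ.reg 21 = D / 2
  right : σ.reg 22 = (D + 1) / 2
  half : σ.reg 23 = (n + 1) / 2

/-- The two lists have supports inside and outside the window, so a collision gives a word of weight
exactly `⌊D/2⌋ + ⌈D/2⌉ = D`. Conversely, the two parts of a codeword divided in this way have equal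
syndromes. -/
theorem splitStep_spec {W n r B s t D M : ℕ} {σ : State} {A : ℕ → ℕ → ZMod 2} (hσ : Ready n r B A σ)
    (hroom : Room W n r B) (hH : Halved n D σ) (h12 : σ.reg 12 = s) (hs : s ≤ (n + 1) / 2)
    (h8 : σ.reg 8 = t) (ht : t ≤ n * n + 2 * n) (hD0 : 0 < D) (hD : D ≤ n)
    (hold : ∀ v < 2 ^ r, σ.arr B 6 v ≤ t) (h6 : σ.reg 6 = 0 ∨ IsHit n r A D (σ.reg 6))
    (hM : ballVol ((n + 1) / 2) ((D + 1) / 2) ≤ M) :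
    HT W .splitStep σ (splitStepCost n r M) fun σ' =>
      (∀ a < 24, a ≠ 6 → a ≠ 8 → a ≠ 10 → a ≠ 11 → a ≠ 20 → σ'.reg a = σ.reg a) ∧
      σ'.reg 8 = t + 1 ∧ (∀ v < 2 ^ r, σ'.arr B 6 v ≤ t + 1) ∧
      (∀ i, σ'.arr B 0 i = σ.arr B 0 i) ∧ (∀ i, σ'.arr B 1 i = σ.arr B 1 i) ∧
      (σ'.reg 6 = 0 ∨ IsHit n r A D (σ'.reg 6)) ∧
      (σ'.reg 6 = 0 → σ.reg 6 = 0 ∧ ∀ c, IsWord n r A c → wt n c = D →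
        ((Finset.range n).filter fun j => HalfWindow n s j ∧ c j ≠ 0).card ≠ D / 2) := by
  have hroom' := hroom
  unfold Room at hroom'
  have hn2 : n < 2 ^ n := Nat.lt_two_pow_self
  refine HT.weaken (N₁ := 1 + (1 + ((25 * n + 2) + (1 + (enumCost n M + (((fillStepCost n r + 2) * M + 2) +
    ((25 * n + 2) + (1 + (enumCost n M + ((matchStepCost n r + 2) * M + 2)))))))))) ?_
    (by unfold splitStepCost; ring_nf; omega)
  refine HT.add' (by rw [h8, hσ.env.one]; omega) (HT.add' ?_ ?_)
  · simp [h12, hH.half]; omega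
  have hr₀ : ∀ a < 24, a ≠ 8 → ((σ.setReg 8 (σ.reg 8 + σ.reg 3)).setReg 24
      ((σ.setReg 8 (σ.reg 8 + σ.reg 3)).reg 12 + (σ.setReg 8 (σ.reg 8 + σ.reg 3)).reg 23)).reg a =
      σ.reg a := fun a ha h => by simp (disch := omega) only [State.reg_setReg, if_neg]
  refine HT.call (sides_spec (a := 3) (b := 5) (s := s) (e := s + (n + 1) / 2) (hσ.env.of_eq
    (fun a ha => hr₀ a (by omega) (by omega)) fun i _ => rfl) hroom (by simp [h12])
    (by simp [h12, hH.half]) (by omega) (by omega)) ?_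
  rintro σ₁ ⟨hv₁, hreg₁, harr₁⟩
  rw [hr₀ 3 (by omega) (by omega), hr₀ 5 (by omega) (by omega), hσ.env.one, hσ.dead] at hv₁
  have hr₁ : ∀ a < 24, a ≠ 8 → a ≠ 20 → σ₁.reg a = σ.reg a := fun a ha h h' => by
    rw [hreg₁ a (by omega) h' (by omega), hr₀ a ha h]
  have h8₁ : σ₁.reg 8 = t + 1 := by
    rw [hreg₁ 8 (by omega) (by omega) (by omega)]; simp [h8, hσ.env.one]
  have harr₁' : ∀ k < 8, k ≠ 2 → k ≠ 3 → ∀ i, σ₁.arr B k i = σ.arr B k i := harr₁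
  refine HT.add' (by rw [hr₁ 21 (by omega) (by omega) (by omega), hr₁ 17 (by omega) (by omega)
    (by omega), hH.left, hH.zero]; omega) ?_
  refine HT.call (enum_spec (g := fun j => Pi.single j 1) (κ := sideCost n (HalfWindow n s)) (M := M)
    (b := D / 2) (hσ.env.of_eq (fun a ha => ?_) fun i _ => harr₁ 1 (by omega) (by omega) (by omega) i)
    (by omega) (by omega) (fun j hj => ?_) ?_ hv₁.vec hv₁.cost ?_) ?_
  · simp (disch := omega) only [State.reg_setReg, if_neg]
    exact hr₁ a (by omega) (by omega) (by omega)
  · unfold sideCost; split_ifs <;> omega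
  · simp [hr₁ 21, hr₁ 17, hH.left, hH.zero]
  · exact (length_budgetList_sideCost_le (by omega) (card_halfWindow_le n s)).trans
      ((ballVol_mono le_rfl (by omega)).trans hM)
  rintro σ₂ ⟨hL₂, hreg₂, harr₂⟩
  have hr₂ : ∀ a < 24, a ≠ 8 → a ≠ 10 → a ≠ 11 → a ≠ 20 → σ₂.reg a = σ.reg a :=
    fun a ha h h10 h11 h20 => by
      rw [hreg₂ a (by omega) h11]
      simp (disch := omega) only [State.reg_setReg, if_neg]
      exact hr₁ a ha h h20
  have h8₂ : σ₂.reg 8 = t + 1 := by rw [hreg₂ 8 (by omega) (by omega)]; simp [h8₁]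
  have harr₂' : ∀ k < 8, k ≠ 2 → k ≠ 3 → k ≠ 4 → k ≠ 5 → ∀ i, σ₂.arr B k i = σ.arr B k i :=
    fun k hk h2 h3 h4 h5 i => by rw [harr₂ k hk h4 h5, State.arr_setReg, harr₁' k hk h2 h3]
  set L₁ := budgetList (sideCost n (HalfWindow n s)) (D / 2) n with hL₁
  have hσ₂ : Ready n r B A σ₂ := hσ.of_eq
    (fun a ha => hr₂ a (by omega) (by omega) (by omega) (by omega) (by omega))
    (hr₂ 16 (by omega) (by omega) (by omega) (by omega) (by omega))
    (harr₂' 0 (by omega) (by omega) (by omega) (by omega) (by omega))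
    (harr₂' 1 (by omega) (by omega) (by omega) (by omega) (by omega))
  refine HT.call (fill_spec (M := M) (u := D / 2) (t := t + 1) hσ₂ hroom
    (by rw [hr₂ 17 (by omega) (by omega) (by omega) (by omega) (by omega), hH.zero]) h8₂
    (by rw [hr₂ 21 (by omega) (by omega) (by omega) (by omega) (by omega), hH.left]) hL₂
    (fun S hS => ((mem_budgetList_sideCost (by omega)).1 hS).2) ?_ (length_budgetList_le _ _ _)
    fun v hv => ?_) ?_
  · exact (length_budgetList_sideCost_le (by omega) (card_halfWindow_le n s)).trans
      ((ballVol_mono le_rfl (by omega)).trans hM)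
  · rw [harr₂' 6 (by omega) (by omega) (by omega) (by omega) (by omega)]
    exact Nat.lt_succ_of_le (hold v hv)
  rintro σ₃ ⟨htab₃, hreg₃, harr₃⟩
  have hr₃ : ∀ a < 24, a ≠ 8 → a ≠ 10 → a ≠ 11 → a ≠ 20 → σ₃.reg a = σ.reg a :=
    fun a ha h h10 h11 h20 => by rw [hreg₃ a (by omega) (by omega), hr₂ a ha h h10 h11 h20]
  have harr₃' : ∀ k < 2, ∀ i, σ₃.arr B k i = σ.arr B k i := fun k hk i => by
    rw [harr₃ k (by omega) (by omega) (by omega),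
      harr₂' k (by omega) (by omega) (by omega) (by omega) (by omega)]
  have h24₃ : σ₃.reg 24 = s + (n + 1) / 2 := by
    rw [hreg₃ 24 (by omega) (by omega), hreg₂ 24 (by omega) (by omega)]
    simp [hreg₁ 24, h12, hH.half]
  refine HT.call (sides_spec (a := 5) (b := 3) (s := s) (e := s + (n + 1) / 2) (hσ.env.of_eq
    (fun a ha => hr₃ a (by omega) (by omega) (by omega) (by omega) (by omega))
    fun i _ => harr₃' 1 (by omega) i) hroom
    (by rw [hr₃ 12 (by omega) (by omega) (by omega) (by omega) (by omega), h12])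
    h24₃ (by omega) (by omega)) ?_
  rintro σ₄ ⟨hv₄, hreg₄, harr₄⟩
  rw [hr₃ 3 (by omega) (by omega) (by omega) (by omega) (by omega),
    hr₃ 5 (by omega) (by omega) (by omega) (by omega) (by omega), hσ.env.one, hσ.dead] at hv₄
  have hr₄ : ∀ a < 24, a ≠ 8 → a ≠ 10 → a ≠ 11 → a ≠ 20 → σ₄.reg a = σ.reg a :=
    fun a ha h h10 h11 h20 => by rw [hreg₄ a (by omega) h20 (by omega), hr₃ a ha h h10 h11 h20]
  refine HT.add' (by rw [hr₄ 22 (by omega) (by omega) (by omega) (by omega) (by omega), hr₄ 17 (by omega)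
    (by omega) (by omega) (by omega) (by omega), hH.right, hH.zero]; omega) ?_
  refine HT.call (enum_spec (g := fun j => Pi.single j 1)
    (κ := sideCost n fun j => ¬ HalfWindow n s j) (M := M)
    (b := (D + 1) / 2) (hσ.env.of_eq (fun a ha => ?_) fun i _ => ?_)
    (by omega) (by omega) (fun j hj => ?_) ?_ hv₄.vec (fun j hj => ?_) ?_) ?_
  · simp (disch := omega) only [State.reg_setReg, if_neg]
    exact hr₄ a (by omega) (by omega) (by omega) (by omega) (by omega)
  · rw [State.arr_setReg, harr₄ 1 (by omega) (by omega) (by omega), harr₃' 1 (by omega)]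
  · unfold sideCost; split_ifs <;> omega
  · simp [hr₄ 22, hr₄ 17, hH.right, hH.zero]
  · rw [State.arr_setReg, hv₄.cost j hj]
    by_cases hw : HalfWindow n s j
    · rw [sideCost, if_neg (not_not.2 hw)]; exact if_pos hw
    · rw [sideCost, if_pos hw]; exact if_neg hw
  · exact (length_budgetList_sideCost_le (by omega) (card_not_halfWindow_le hs)).trans hM
  rintro σ₅ ⟨hL₅, hreg₅, harr₅⟩
  set L₂ := budgetList (sideCost n fun j => ¬ HalfWindow n s j) ((D + 1) / 2) n with hL₂d
  have hr₅ : ∀ a < 24, a ≠ 8 → a ≠ 10 → a ≠ 11 → a ≠ 20 → σ₅.reg a = σ.reg a :=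
    fun a ha h h10 h11 h20 => by
      rw [hreg₅ a (by omega) h11]
      simp (disch := omega) only [State.reg_setReg, if_neg]
      exact hr₄ a ha h h10 h11 h20
  have h8₅ : σ₅.reg 8 = t + 1 := by
    rw [hreg₅ 8 (by omega) (by omega)]
    simp [hreg₄ 8, hreg₃ 8, h8₂]
  have harr₅' : ∀ k < 8, k ≠ 2 → k ≠ 3 → k ≠ 4 → k ≠ 5 → ∀ i, σ₅.arr B k i = σ₃.arr B k i :=
    fun k hk h2 h3 h4 h5 i => by rw [harr₅ k hk h4 h5, State.arr_setReg, harr₄ k hk h2 h3]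
  have hσ₅ : Ready n r B A σ₅ := hσ.of_eq
    (fun a ha => hr₅ a (by omega) (by omega) (by omega) (by omega) (by omega))
    (hr₅ 16 (by omega) (by omega) (by omega) (by omega) (by omega))
    (fun i => by rw [harr₅' 0 (by omega) (by omega) (by omega) (by omega) (by omega), harr₃' 0 (by omega)])
    (fun i => by rw [harr₅' 1 (by omega) (by omega) (by omega) (by omega) (by omega), harr₃' 1 (by omega)])
  have htab₅ : Table n r B A (t + 1) (D / 2) L₁ σ₅ := htab₃.of_eq (fun _ _ => Iff.rfl)
    (harr₅' 6 (by omega) (by omega) (by omega) (by omega) (by omega))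
    (harr₅' 7 (by omega) (by omega) (by omega) (by omega) (by omega))
  have h6₅ : σ₅.reg 6 = σ.reg 6 := hr₅ 6 (by omega) (by omega) (by omega) (by omega) (by omega)
  refine HT.imp (match_spec (M := M) (D := D) (u := (D + 1) / 2) (t := t + 1) hσ₅ hroom
    (by rw [hr₅ 17 (by omega) (by omega) (by omega) (by omega) (by omega), hH.zero]) h8₅
    (by rw [hr₅ 22 (by omega) (by omega) (by omega) (by omega) (by omega), hH.right]) hL₅
    (fun S hS => ((mem_budgetList_sideCost (by omega)).1 hS).2) ?_ (length_budgetList_le _ _ _)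
    htab₅ (by rw [h6₅]; exact h6) ?_) ?_
  · exact (length_budgetList_sideCost_le (by omega) (card_not_halfWindow_le hs)).trans hM
  · intro S hS hSu T hT hTu hsyn
    have hS' := ((mem_budgetList_sideCost (by omega)).1 hS).1
    have hT' := ((mem_budgetList_sideCost (by omega)).1 hT).1
    have hdisj : Disjoint S T := Finset.disjoint_left.2 fun j hj hj' =>
      (Finset.mem_filter.1 (hT' hj')).2 (Finset.mem_filter.1 (hS' hj)).2
    have hwt : wt n (ind S + ind T) = D := by
      rw [ind_add_ind hdisj, wt_ind (Finset.union_subset (hS'.trans (Finset.filter_subset _ _))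
        (hT'.trans (Finset.filter_subset _ _))), Finset.card_union_of_disjoint hdisj]
      omega
    exact ⟨_, rfl, isWord_add_iff.2 hsyn, by omega, by omega⟩
  · rintro σ₆ ⟨hmem₆, hreg₆, h6₆, h6₆'⟩
    have harr₆ : ∀ k i, σ₆.arr B k i = σ₅.arr B k i := fun k i => by unfold State.arr; rw [hmem₆]
    refine ⟨fun a ha h6 h8 h10 h11 h20 => ?_, ?_, fun v hv => ?_, fun i => ?_, fun i => ?_, h6₆,
      fun h0 => ⟨h6₅ ▸ (h6₆' h0).1, fun c hc hcD hwin => ?_⟩⟩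
    · rw [hreg₆ a (by omega) h6 (by omega) (by omega), hr₅ a ha h8 h10 h11 h20]
    · rw [hreg₆ 8 (by omega) (by omega) (by omega) (by omega), h8₅]
    · rw [harr₆]; exact htab₅.le v hv
    · rw [harr₆, harr₅' 0 (by omega) (by omega) (by omega) (by omega) (by omega), harr₃' 0 (by omega)]
    · rw [harr₆, harr₅' 1 (by omega) (by omega) (by omega) (by omega) (by omega), harr₃' 1 (by omega)]
    · set S := (Finset.range n).filter fun j => HalfWindow n s j ∧ c j ≠ 0 with hS
      set T := (Finset.range n).filter fun j => ¬ HalfWindow n s j ∧ c j ≠ 0 with hT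
      have hcard : S.card + T.card = D := by
        rw [← hcD, wt_eq_card, ← Finset.card_filter_add_card_filter_not (HalfWindow n s)
          (s := (Finset.range n).filter fun k => c k ≠ 0), Finset.filter_filter, Finset.filter_filter]
        simp only [hS, hT, and_comm]
      have hdisj : Disjoint S T := Finset.disjoint_left.2 fun j hj hj' =>
        (Finset.mem_filter.1 hj').2.1 (Finset.mem_filter.1 hj).2.1
      have hcST : ∀ k < n, c k = (ind S + ind T) k := fun k hk => by
        rw [ind_add_ind hdisj, ind_apply]
        rcases zmod_two_cases (c k) with h | h
        · rw [if_neg (by simp [hS, hT, h]), h]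
        · rw [if_pos, h]
          simp only [hS, hT, Finset.mem_union, Finset.mem_filter, Finset.mem_range, h]
          by_cases hw : HalfWindow n s k
          · exact Or.inl ⟨hk, hw, one_ne_zero⟩
          · exact Or.inr ⟨hk, hw, one_ne_zero⟩
      have hword : IsWord n r A (ind S + ind T) := fun i hi => by
        rw [← dot_congr_right hcST]; exact hc i hi
      refine (h6₆' h0).2 S ?_ hwin T ?_ (by omega) (isWord_add_iff.1 hword)
      · refine (mem_budgetList_sideCost (by omega)).2 ⟨fun j hj => ?_, ?_, by omega⟩
        · rw [hS, Finset.mem_filter] at hj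
          exact Finset.mem_filter.2 ⟨hj.1, hj.2.1⟩
        · rw [Finset.card_eq_sum_ones]
          exact Finset.sum_congr rfl fun j hj => if_pos (Finset.mem_filter.1 hj).2.1
      · refine (mem_budgetList_sideCost (by omega)).2 ⟨fun j hj => ?_, ?_, by omega⟩
        · rw [hT, Finset.mem_filter] at hj
          exact Finset.mem_filter.2 ⟨hj.1, hj.2.1⟩
        · rw [Finset.card_eq_sum_ones]
          exact Finset.sum_congr rfl fun j hj => if_pos (Finset.mem_filter.1 hj).2.1

/-- Searches for codewords of weight `R_7` by collisions of the syndromes of their halves. -/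
def Prog.collisionSearch : Prog :=
  .const 17 0 ;; .half 23 0 ;; .half 22 7 ;; .sub 21 7 22 ;; .add 18 23 3 ;; .forLt 12 18 .splitStep

/-- The number of operations of `collisionSearch`. -/
def collisionSearchCost (n r M : ℕ) : ℕ := (splitStepCost n r M + 2) * (n + 1) + 10 * n + 11

/-- Old stamps do not exceed the current one. -/
def StampInv (n r B D : ℕ) (σ : State) : Prop :=
  σ.reg 8 = D * ((n + 1) / 2 + 1) ∧ ∀ v < 2 ^ r, σ.arr B 6 v ≤ σ.reg 8

/-- Each weight consumes `⌈n/2⌉ + 1` stamps, one for each position of the window. The stamp is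
increased before use, so the zeros of fresh memory are never current, and it stays of order `n²`,
within the room available. -/
theorem searches_collisionSearch {W n r B D M : ℕ} {A : ℕ → ℕ → ZMod 2} (hroom : Room W n r B)
    (hD : D < n) (hM : ballVol ((n + 1) / 2) ((D + 2) / 2) ≤ M) :
    Searches W n r B A (StampInv n r B) .collisionSearch D (collisionSearchCost n r M) := by
  intro σ hσ hI h6 h7
  have hroom' := hroom
  unfold Room at hroom'
  have hn2 : n < 2 ^ n := Nat.lt_two_pow_self
  obtain ⟨hI8, hI6⟩ := hI
  set h := (n + 1) / 2 with hh
  have hDh : (D + 1) * (h + 1) ≤ n * n + 2 * n := by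
    have : (D + 1) * (h + 1) ≤ n * (n + 2) := Nat.mul_le_mul (by omega) (by omega)
    have e : n * (n + 2) = n * n + 2 * n := by ring
    omega
  have hDh' : (D + 1) * (h + 1) = D * (h + 1) + (h + 1) := by ring
  refine HT.weaken (N₁ := 1 + ((5 * n + 3) + ((5 * (D + 1) + 3) + (1 + (1 +
    ((splitStepCost n r M + 2) * (h + 1) + 2)))))) ?_ ?_
  swap
  · unfold collisionSearchCost
    have : (splitStepCost n r M + 2) * (h + 1) ≤ (splitStepCost n r M + 2) * (n + 1) :=
      Nat.mul_le_mul_left _ (by omega)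
    omega
  refine HT.const' (by omega) (HT.call (half_spec (v := n) (by simp [hσ.env.len]) (by omega)
    (by simp [hσ.env.one]) (by omega) (by omega)) ?_)
  rintro σ₁ ⟨hm₁, h23, hr₁⟩
  refine HT.call (half_spec (v := D + 1) (by rw [hr₁ 7 (by omega) (by omega) (by omega)]; simp [h7])
    (by omega) (by rw [hr₁ 3 (by omega) (by omega) (by omega)]; simp [hσ.env.one])
    (by omega) (by omega)) ?_
  rintro σ₂ ⟨hm₂, h22, hr₂⟩
  have hr : ∀ a < 18, a ≠ 17 → σ₂.reg a = σ.reg a := fun a ha h => by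
    rw [hr₂ a (by omega) (by omega) (by omega), hr₁ a (by omega) (by omega) (by omega)]
    simp (disch := omega) only [State.reg_setReg, if_neg]
  have h23₂ : σ₂.reg 23 = h := by rw [hr₂ 23 (by omega) (by omega) (by omega), h23]
  have h17₂ : σ₂.reg 17 = 0 := by
    rw [hr₂ 17 (by omega) (by omega) (by omega), hr₁ 17 (by omega) (by omega) (by omega)]; simp
  have harr₂ : ∀ k i, σ₂.arr B k i = σ.arr B k i := fun k i => by
    unfold State.arr; rw [hm₂, hm₁]; rfl
  refine HT.sub' (HT.add' ?_ ?_)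
  · simp [h23₂, hr 3, hσ.env.one]; omega
  refine HT.forLt (h + 1) _ (fun k σ' => Halved n (D + 1) σ' ∧
      (∀ a < 17, a ≠ 6 → a ≠ 8 → a ≠ 10 → a ≠ 11 → a ≠ 12 → σ'.reg a = σ.reg a) ∧
      σ'.reg 18 = h + 1 ∧
      σ'.reg 8 = D * (h + 1) + k ∧ (∀ v < 2 ^ r, σ'.arr B 6 v ≤ D * (h + 1) + k) ∧
      (∀ i, σ'.arr B 0 i = σ.arr B 0 i) ∧ (∀ i, σ'.arr B 1 i = σ.arr B 1 i) ∧
      (σ'.reg 6 = 0 ∨ IsHit n r A (D + 1) (σ'.reg 6)) ∧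
      (σ'.reg 6 = 0 → ∀ s < k, ∀ c, IsWord n r A c → wt n c = D + 1 →
        ((Finset.range n).filter fun j => HalfWindow n s j ∧ c j ≠ 0).card ≠ (D + 1) / 2))
      (by omega) (by simp [h23₂, hr 3, hσ.env.one]) ?_ ?_ ?_
  · refine ⟨⟨by simp [h17₂], ?_, by simp [h22], by simp [h23₂, hh]⟩, fun a ha _ _ _ _ h12 => ?_,
      by simp [h23₂, hr 3, hσ.env.one], ?_, fun v hv => ?_, harr₂ 0, harr₂ 1,
      Or.inl (by simp [hr 6, h6]), fun _ s hs => by omega⟩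
    · simp [hr 7, h7, h22]; omega
    · simp (disch := omega) only [State.reg_setReg, if_neg]
      exact hr a (by omega) (by omega)
    · simp [hr 8, hI8]
    · have := hI6 v hv
      rw [hI8] at this
      simpa [harr₂] using this
  · rintro k σ₃ hk ⟨hH, hreg, h18, h8, h6₃, ha0, ha1, hit, hnone⟩ hi hlen
    have hσ₃ : Ready n r B A σ₃ := hσ.of_eq (fun a ha => hreg a (by omega) (by omega) (by omega)
      (by omega) (by omega) (by omega)) (hreg 16 (by omega) (by omega) (by omega) (by omega)
      (by omega) (by omega)) ha0 ha1
    refine HT.imp (splitStep_spec (D := D + 1) hσ₃ hroom hH hi (by omega) h8 (by omega) (by omega)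
      (by omega) h6₃ hit hM) ?_
    rintro σ₄ ⟨hreg₄, h8₄, h6₄, ha0₄, ha1₄, hit₄, hnone₄⟩
    have hr₄ : ∀ a < 24, 12 ≤ a → a ≠ 20 → σ₄.reg a = σ₃.reg a := fun a h1 h2 h3 =>
      hreg₄ a h1 (by omega) (by omega) (by omega) (by omega) h3
    refine ⟨by rw [hr₄ 12 (by omega) (by omega) (by omega), hi],
      by rw [hr₄ 18 (by omega) (by omega) (by omega), hlen],
      by rw [hreg₄ 3 (by omega) (by omega) (by omega) (by omega) (by omega) (by omega), hσ₃.env.one],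
      ⟨?_, ?_, ?_, ?_⟩, fun a ha h6 h8 h10 h11 h12 => ?_, ?_, ?_, fun v hv => ?_, fun i => ?_,
      fun i => ?_, by simpa using hit₄, fun h0 s hs c hc hcD => ?_⟩
    · simp [hr₄ 17, hH.zero]
    · simp [hr₄ 21, hH.left]
    · simp [hr₄ 22, hH.right]
    · simp [hr₄ 23, hH.half]
    · simp (disch := omega) only [State.reg_setReg, if_neg]
      rw [hreg₄ a (by omega) h6 h8 h10 h11 (by omega), hreg a ha h6 h8 h10 h11 h12]
    · simp [hr₄ 18, h18]
    · simp [h8₄]; omega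
    · have := h6₄ v hv
      rw [State.arr_setReg]; omega
    · rw [State.arr_setReg, ha0₄, ha0]
    · rw [State.arr_setReg, ha1₄, ha1]
    · have h0' : σ₄.reg 6 = 0 := by simpa using h0
      rcases Nat.lt_succ_iff_lt_or_eq.1 hs with h1 | rfl
      · exact hnone (hnone₄ h0').1 s h1 c hc hcD
      · exact (hnone₄ h0').2 c hc hcD
  · rintro σ' ⟨-, hreg, -, h8, h6', ha0, ha1, hit, hnone⟩
    refine ⟨hσ.of_eq (fun a ha => hreg a (by omega) (by omega) (by omega)
      (by omega) (by omega) (by omega)) (hreg 16 (by omega) (by omega) (by omega) (by omega)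
      (by omega) (by omega)) ha0 ha1, ⟨by rw [h8, hDh'], fun v hv => by rw [h8]; exact h6' v hv⟩,
      hreg 2 (by omega) (by omega) (by omega) (by omega) (by omega) (by omega),
      hreg 9 (by omega) (by omega) (by omega) (by omega) (by omega) (by omega), hit,
      fun h0 c hc _ hcD => ?_⟩
    obtain ⟨s, hs, hcs⟩ := exists_half_window n fun j => c j ≠ 0
    rw [← wt_eq_card, hcD] at hcs
    exact hnone h0 s (by omega) c hc hcD hcs

/-! ### The program around the search -/

/-- The rows of a matrix as sequences. -/
def rowsOf {r n : ℕ} (H : Matrix (Fin r) (Fin n) (ZMod 2)) (i j : ℕ) : ZMod 2 :=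
  if h : i < r ∧ j < n then H ⟨i, h.1⟩ ⟨j, h.2⟩ else 0

theorem input_mem {r n : ℕ} (H : Matrix (Fin r) (Fin n) (ZMod 2)) (w : ℕ) {i j : ℕ} (hi : i < r)
    (hj : j < n) : (input H w).mem (n * i + j) = (rowsOf H i j).val := by
  have hlt : n * i + j < r * n := by
    calc n * i + j < n * i + n := by omega
      _ = n * (i + 1) := by ring
      _ ≤ n * r := Nat.mul_le_mul_left _ (by omega)
      _ = r * n := by ring
  have h1 : (n * i + j) / n = i := by
    rw [Nat.mul_add_div (by omega), Nat.div_eq_of_lt hj, add_zero]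
  have h2 : (n * i + j) % n = j := by rw [Nat.mul_add_mod, Nat.mod_eq_of_lt hj]
  have e1 : Fin.divNat (⟨n * i + j, hlt⟩ : Fin (r * n)) = ⟨i, hi⟩ := Fin.ext h1
  have e2 : Fin.modNat (⟨n * i + j, hlt⟩ : Fin (r * n)) = ⟨j, hj⟩ := Fin.ext h2
  simp only [input, dif_pos hlt, rowsOf, dif_pos (And.intro hi hj), e1, e2]

theorem input_mem_of_le {r n : ℕ} (H : Matrix (Fin r) (Fin n) (ZMod 2)) (w : ℕ) {p : ℕ}
    (hp : r * n ≤ p) : (input H w).mem p = 0 := by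
  simp [input, show ¬ p < r * n by omega]

theorem input_mem_le {r n : ℕ} (H : Matrix (Fin r) (Fin n) (ZMod 2)) (w p : ℕ) :
    (input H w).mem p ≤ 1 := by
  simp only [input]
  split_ifs with h
  · exact Nat.le_of_lt_succ (ZMod.val_lt _)
  · omega

/-- The product of `R_x` and `R_0`, in register `a`. -/
def Prog.timesLen (a x : ℕ) : Prog := .const a 0 ;; .forLt 20 x (.add a a 0)

theorem timesLen_spec {W n a x v : ℕ} {σ : State} (h0 : σ.reg 0 = n) (h3 : σ.reg 3 = 1)
    (hx : σ.reg x = v) (hv : v * n < 2 ^ W) (ha : a ≠ 0 ∧ a ≠ 3 ∧ a ≠ 20 ∧ a ≠ x) (hx' : x ≠ 20) :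
    HT W (.timesLen a x) σ (3 * v + 3) fun σ' => σ'.mem = σ.mem ∧ σ'.reg a = v * n ∧
      ∀ b, b ≠ a → b ≠ 20 → σ'.reg b = σ.reg b := by
  refine HT.weaken (N₁ := 1 + ((1 + 2) * v + 2)) ?_ (by omega)
  refine HT.const' (by omega) (HT.forLt v 1 (fun k σ' => σ'.mem = σ.mem ∧ σ'.reg a = k * n ∧
      ∀ b, b ≠ a → b ≠ 20 → σ'.reg b = σ.reg b) hx'.symm (by simp [hx, ha.2.2.2.symm]) ?_ ?_
      fun _ h => h)
  · exact ⟨rfl, by simp [ha.2.2.1], fun b h1 h2 => by simp [h1, h2]⟩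
  · rintro k σ₁ hk ⟨hmem, h1, hreg⟩ hi hlen
    have h0' : σ₁.reg 0 = n := by rw [hreg 0 (by omega) (by omega), h0]
    have h3' : σ₁.reg 3 = 1 := by rw [hreg 3 (by omega) (by omega), h3]
    have hkv : (k + 1) * n ≤ v * n := Nat.mul_le_mul_right _ hk
    rw [add_one_mul] at hkv
    refine HT.add (by rw [h1, h0']; omega) ?_
    refine ⟨by simp [hi, ha.2.2.1.symm], by simp [hlen, ha.2.2.2.symm], by simp [h3', ha.2.1.symm], hmem,
      by simp [h1, h0', ha.2.2.1]; ring, fun b hb1 hb2 => by simp [hb1, hb2, hreg b hb1 hb2]⟩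

/-- Reads the entry at `R_22` of the matrix. -/
def Prog.readEntry : Prog :=
  .load 25 22 ;; .add 22 22 3 ;; .ifLt 17 25 (.aget 26 1 20 ;; .add 24 24 26) .skip

/-- Packs row number `R_23`. -/
def Prog.readRow : Prog := .const 24 0 ;; .forLt 20 0 .readEntry ;; .aset 0 23 24

theorem readRow_spec {W n r B i : ℕ} {σ : State} {u : ℕ → ZMod 2} (henv : Env n B σ)
    (hroom : Room W n r B) (h17 : σ.reg 17 = 0) (h22 : σ.reg 22 = n * i) (h23 : σ.reg 23 = i)
    (hi : i < r) (hB : n * (i + 1) ≤ B) (hmem : ∀ j < n, σ.mem (n * i + j) = (u j).val) :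
    HT W .readRow σ (13 * n + 10) fun σ' => σ'.reg 22 = n * (i + 1) ∧
      (∀ a < 24, a ≠ 20 → a ≠ 22 → σ'.reg a = σ.reg a) ∧
      (∀ p < B, σ'.mem p = σ.mem p) ∧ (∀ j, σ'.arr B 0 j = if j = i then enc n u else σ.arr B 0 j) ∧
      ∀ k < 8, k ≠ 0 → ∀ i, σ'.arr B k i = σ.arr B k i := by
  unfold Room at hroom
  have hn2 : n < 2 ^ n := Nat.lt_two_pow_self
  have hr2 : r < 2 ^ r := Nat.lt_two_pow_self
  have hni : n * (i + 1) = n * i + n := by ring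
  refine HT.weaken (N₁ := 1 + (((11 + 2) * n + 2) + 7)) ?_ (by omega)
  refine HT.const' (by omega) (HT.call (Q₁ := fun σ' => σ'.mem = σ.mem ∧ σ'.reg 22 = n * i + n ∧
    σ'.reg 24 = enc n u ∧ ∀ a < 24, a ≠ 20 → a ≠ 22 → σ'.reg a = σ.reg a) (HT.forLt n 11
      (fun k σ' => σ'.mem = σ.mem ∧ σ'.reg 22 = n * i + k ∧ σ'.reg 24 = enc k u ∧
        ∀ a < 24, a ≠ 20 → a ≠ 22 → σ'.reg a = σ.reg a) (by omega) (by simp [henv.len]) ?_ ?_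
      fun _ h => h) ?_)
  · refine ⟨rfl, by simp [h22], by simp [enc], fun a ha h1 h2 => ?_⟩
    simp (disch := omega) only [State.reg_setReg, if_neg]
  · rintro k σ₁ hk ⟨hm, h22₁, h24, hreg⟩ hi₁ hlen
    have h4 : σ₁.reg 4 = B := (hreg 4 (by omega) (by omega) (by omega)).trans henv.base
    have h3 : σ₁.reg 3 = 1 := (hreg 3 (by omega) (by omega) (by omega)).trans henv.one
    have h17' : σ₁.reg 17 = 0 := (hreg 17 (by omega) (by omega) (by omega)).trans h17
    have hpow : σ₁.arr B 1 k = 2 ^ k := by rw [← henv.pow k hk]; unfold State.arr; rw [hm]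
    have hval : σ₁.mem (n * i + k) = (u k).val := by rw [hm, hmem k hk]
    have henc := enc_lt n u
    have hk1 := enc_lt (k + 1) u
    have hkn : 2 ^ (k + 1) ≤ 2 ^ n := Nat.pow_le_pow_right (by omega) (by omega)
    refine HT.weaken (N₁ := 1 + (1 + ((7 + 1) + 1))) ?_ (by omega)
    refine HT.load' (HT.add' (by simp [h22₁, h3]; omega) ?_)
    rw [h22₁, hval]
    rw [enc_succ] at hk1
    rcases zmod_two_cases (u k) with h | h
    · rw [h, ZMod.val_zero] at hk1 ⊢
      refine HT.ifLt (fun h' => by simp [h17'] at h') (fun _ => HT.weaken (HT.skip ?_) (by omega))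
      refine ⟨by simp [hi₁], by simp [hlen], by simp [h3], hm, by simp [h22₁, h3]; ring,
        by simp [h24, enc_succ, h], fun a ha h1 h2 => ?_⟩
      simp (disch := omega) only [State.reg_setReg, if_neg]
      exact hreg a ha h1 h2
    · rw [h, ZMod.val_one] at hk1 ⊢
      refine HT.ifLt (fun _ => ?_) (fun h' => by simp [h17'] at h')
      refine HT.aget' (x := k) (B := B) (by simp [hi₁]) (by simp [h4]) (by omega) (HT.add ?_ ?_)
      · simp [h24, hpow]; omega
      refine ⟨by simp [hi₁], by simp [hlen], by simp [h3], hm, by simp [h22₁, h3]; ring,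
        by simp [h24, hpow, enc_succ, h, ZMod.val_one], fun a ha h1 h2 => ?_⟩
      simp (disch := omega) only [State.reg_setReg, if_neg]
      exact hreg a ha h1 h2
  · rintro σ₁ ⟨hm, h22₁, h24, hreg⟩
    refine HT.aset (x := i) (B := B) (by omega) (by rw [hreg 23 (by omega) (by omega) (by omega), h23])
      (by rw [hreg 4 (by omega) (by omega) (by omega), henv.base]) (by omega) ?_
    rw [h24]
    have harr : ∀ k j, σ₁.arr B k j = σ.arr B k j := fun k j => by unfold State.arr; rw [hm]
    refine ⟨by simp [h22₁, hni], fun a ha h1 h2 => ?_, fun p hp => ?_, fun j => ?_, fun k hk h0 j => ?_⟩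
    · simp only [State.reg_setReg, State.reg_setArr]
      simp (disch := omega) only [if_neg]
      exact hreg a ha h1 h2
    · rw [State.mem_setArr_of_lt _ hp]; simp [hm]
    · rw [State.arr_setArr_self _ _ (by omega)]; simp [harr]
    · rw [State.arr_setArr_of_ne _ _ (by omega) hk h0]; simp [harr]

/-- Preparations. -/
def Prog.setup : Prog :=
  .const 3 1 ;; .const 17 0 ;; .ifLt 0 2 (.add 2 0 17) .skip ;; .timesLen 4 1 ;; .add 4 4 0 ;;
    .timesLen 5 0 ;; .add 5 5 3 ;; .add 16 0 3 ;;
    .const 21 1 ;; .forLt 20 0 (.aset 1 20 21 ;; .add 21 21 21) ;;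
    .const 22 0 ;; .forLt 23 1 .readRow

/-- The number of operations of `setup`. -/
def setupCost (n r : ℕ) : ℕ := 13 * (n * r) + 15 * r + 13 * n + 30

/-- The arrays start at `(r + 1) * n`: this is beyond the matrix and, even if `r = 0`, beyond the
first `n` cells, which take the output. Memory after the input is zero, which initialises the
stamps. The weight `w` is capped at `n`. -/
theorem setup_spec {W r n : ℕ} (H : Matrix (Fin r) (Fin n) (ZMod 2)) (w : ℕ)
    (hroom : Room W n r ((r + 1) * n)) :
    HT W .setup (input H w) (setupCost n r) fun σ' => Ready n r ((r + 1) * n) (rowsOf H) σ' ∧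
      σ'.reg 2 = min w n ∧ σ'.reg 6 = 0 ∧ σ'.reg 8 = 0 ∧ ∀ v, σ'.arr ((r + 1) * n) 6 v = 0 := by
  have hroom' := hroom
  set B := (r + 1) * n with hB
  unfold Room at hroom'
  have hn2 : n < 2 ^ n := Nat.lt_two_pow_self
  have hr2 : r < 2 ^ r := Nat.lt_two_pow_self
  have hBr : B = r * n + n := by rw [hB]; ring
  set σ := input H w with hσ
  have hreg : ∀ a, σ.reg a = if a = 0 then n else if a = 1 then r else if a = 2 then w else 0 :=
    fun _ => rfl
  refine HT.weaken (N₁ := 1 + (1 + ((1 + 1) + ((3 * r + 3) + (1 + ((3 * n + 3) + (1 + (1 + (1 +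
    (((8 + 2) * n + 2) + (1 + ((13 * n + 10 + 2) * r + 2)))))))))))) ?_
    (by unfold setupCost; ring_nf; omega)
  refine HT.const' (by omega) (HT.const' (by omega) (HT.call (Q₁ := fun σ' => σ'.mem = σ.mem ∧
    σ'.reg 2 = min w n ∧ σ'.reg 3 = 1 ∧ σ'.reg 17 = 0 ∧
    ∀ a < 20, a ≠ 2 → a ≠ 3 → a ≠ 17 → σ'.reg a = σ.reg a)
    (HT.ifLt (fun h => HT.add ?_ ?_) fun h => HT.skip ?_) ?_))
  · simp [hreg]; omega
  · simp [hreg] at h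
    refine ⟨rfl, by simp [hreg, h.le], by simp, by simp, fun a _ h2 h3 h17 => by simp [h2, h3, h17]⟩
  · simp [hreg] at h
    refine ⟨rfl, by simp [hreg, h], by simp, by simp, fun a _ h2 h3 h17 => by simp [h3, h17]⟩
  rintro σ₁ ⟨hm₁, h2₁, h3₁, h17₁, hr₁⟩
  have h0₁ : σ₁.reg 0 = n := (hr₁ 0 (by omega) (by omega) (by omega) (by omega)).trans (by simp [hreg])
  have h1₁ : σ₁.reg 1 = r := (hr₁ 1 (by omega) (by omega) (by omega) (by omega)).trans (by simp [hreg])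
  refine HT.call (timesLen_spec (n := n) (v := r) h0₁ h3₁ h1₁ (by omega) (by omega) (by omega)) ?_
  rintro σ₂ ⟨hm₂, h4₂, hr₂⟩
  have h0₂ : σ₂.reg 0 = n := by rw [hr₂ 0 (by omega) (by omega), h0₁]
  have h3₂ : σ₂.reg 3 = 1 := by rw [hr₂ 3 (by omega) (by omega), h3₁]
  refine HT.add' (by rw [h4₂, h0₂]; omega) (HT.call (timesLen_spec (n := n) (v := n) (by simp [h0₂])
    (by simp [h3₂]) (by simp [h0₂]) (by omega) (by omega) (by omega)) ?_)
  rw [h4₂, h0₂, ← hBr]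
  rintro σ₃ ⟨hm₃, h5₃, hr₃⟩
  have h0₃ : σ₃.reg 0 = n := by rw [hr₃ 0 (by omega) (by omega)]; simp [h0₂]
  have h3₃ : σ₃.reg 3 = 1 := by rw [hr₃ 3 (by omega) (by omega)]; simp [h3₂]
  have h4₃ : σ₃.reg 4 = B := by rw [hr₃ 4 (by omega) (by omega)]; simp
  have hrr : ∀ a < 20, a ≠ 2 → a ≠ 3 → a ≠ 4 → a ≠ 5 → a ≠ 17 → σ₃.reg a = σ.reg a :=
    fun a ha h2 h3 h4 h5 h17 => by
      rw [hr₃ a h5 (by omega), State.reg_setReg, if_neg h4, hr₂ a h4 (by omega), hr₁ a ha h2 h3 h17]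
  have hm : σ₃.mem = σ.mem := by rw [hm₃]; exact hm₂.trans hm₁
  have h2₃ : σ₃.reg 2 = min w n := by
    rw [hr₃ 2 (by omega) (by omega), State.reg_setReg, if_neg (by omega), hr₂ 2 (by omega) (by omega), h2₁]
  have h17₃ : σ₃.reg 17 = 0 := by
    rw [hr₃ 17 (by omega) (by omega), State.reg_setReg, if_neg (by omega), hr₂ 17 (by omega) (by omega),
      h17₁]
  refine HT.add' (by rw [h5₃, h3₃]; omega) (HT.add' (by simp [h0₃, h3₃]; omega)
    (HT.const' (by omega) ?_))
  refine HT.call (Q₁ := fun σ' => (∀ a < 20, a ≠ 5 → a ≠ 16 → σ'.reg a = σ₃.reg a) ∧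
    σ'.reg 5 = n * n + 1 ∧ σ'.reg 16 = n + 1 ∧ (∀ j < n, σ'.arr B 1 j = 2 ^ j) ∧
    (∀ p < B, σ'.mem p = σ.mem p) ∧ ∀ i, σ'.arr B 6 i = σ.arr B 6 i) (HT.forLt n 8
      (fun k σ' => (∀ a < 20, a ≠ 5 → a ≠ 16 → σ'.reg a = σ₃.reg a) ∧
        σ'.reg 5 = n * n + 1 ∧ σ'.reg 16 = n + 1 ∧ σ'.reg 21 = 2 ^ k ∧
        (∀ j < k, σ'.arr B 1 j = 2 ^ j) ∧ (∀ p < B, σ'.mem p = σ.mem p) ∧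
        ∀ i, σ'.arr B 6 i = σ.arr B 6 i) (by omega) (by simp [h0₃]) ?_ ?_ ?_) ?_
  · refine ⟨fun a ha h5 h16 => ?_, by simp [h5₃, h3₃], by simp [h0₃, h3₃], by simp,
      fun j hj => by omega, fun p _ => by simp [hm], fun i => by simp [State.arr, hm]⟩
    simp (disch := omega) only [State.reg_setReg, if_neg]
  · rintro k σ₄ hk ⟨hreg₄, h5₄, h16₄, h21₄, hpow₄, hm₄, h6₄⟩ hi hlen
    have hkn : 2 ^ (k + 1) ≤ 2 ^ n := Nat.pow_le_pow_right (by omega) (by omega)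
    rw [pow_succ] at hkn
    refine HT.weaken (N₁ := 7 + 1) (HT.aset' (x := k) (B := B) (by omega) hi
      (by rw [hreg₄ 4 (by omega) (by omega) (by omega), h4₃]) (by omega) (HT.add ?_ ?_)) (by omega)
    · simp [h21₄]; omega
    have h3₄ : σ₄.reg 3 = 1 := by rw [hreg₄ 3 (by omega) (by omega) (by omega), h3₃]
    refine ⟨by simp [hi], by simp [hlen], by simp [h3₄], fun a ha h5 h16 => ?_, by simp [h5₄],
      by simp [h16₄], by simp [h21₄]; ring, fun j hj => ?_, fun p hp => ?_, fun i => ?_⟩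
    · simp only [State.reg_setReg, State.reg_setArr]
      simp (disch := omega) only [if_neg]
      exact hreg₄ a ha h5 h16
    · simp only [State.arr_setReg]
      rw [State.arr_setArr_self _ _ (by omega)]
      split_ifs with hjk
      · rw [hjk, h21₄]
      · exact hpow₄ j (by omega)
    · simp only [State.mem_setReg]
      rw [State.mem_setArr_of_lt _ hp]
      exact hm₄ p hp
    · simp only [State.arr_setReg]
      rw [State.arr_setArr_of_ne _ _ (by omega) (by omega) (by omega)]
      exact h6₄ i
  · rintro σ' ⟨h1, h2, h3, -, h4, h5, h6⟩
    exact ⟨h1, h2, h3, h4, h5, h6⟩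
  rintro σ₄ ⟨hreg₄, h5₄, h16₄, hpow₄, hm₄, h6₄⟩
  have h1₄ : σ₄.reg 1 = r := by
    rw [hreg₄ 1 (by omega) (by omega) (by omega), hrr 1 (by omega) (by omega) (by omega) (by omega)
      (by omega) (by omega)]
    simp [hreg]
  have henv₄ : Env n B σ₄ := ⟨by rw [hreg₄ 0 (by omega) (by omega) (by omega), h0₃],
    by rw [hreg₄ 3 (by omega) (by omega) (by omega), h3₃],
    by rw [hreg₄ 4 (by omega) (by omega) (by omega), h4₃], hpow₄⟩
  refine HT.const' (by omega) (HT.forLt r _ (fun i σ' =>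
      (∀ a < 20, σ'.reg a = σ₄.reg a) ∧ σ'.reg 22 = n * i ∧
      (∀ p < B, σ'.mem p = σ.mem p) ∧ (∀ j < i, σ'.arr B 0 j = enc n (rowsOf H j)) ∧
      ∀ k < 8, k ≠ 0 → ∀ i, σ'.arr B k i = σ₄.arr B k i) (by omega) (by simp [h1₄]) ?_ ?_ ?_)
  · refine ⟨fun a ha => ?_, by simp, hm₄, fun j hj => by omega, fun k _ _ i => rfl⟩
    simp (disch := omega) only [State.reg_setReg, if_neg]
  · rintro i σ₅ hi ⟨hreg₅, h22₅, hm₅, hrow₅, harr₅⟩ hi₅ hlen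
    have hnr : n * (i + 1) ≤ r * n := by rw [mul_comm r]; exact Nat.mul_le_mul_left _ hi
    have hni : n * (i + 1) = n * i + n := by ring
    refine HT.imp (readRow_spec (u := rowsOf H i) (henv₄.of_eq (fun a ha => hreg₅ a (by omega))
      fun j _ => harr₅ 1 (by omega) (by omega) j) hroom ?_ h22₅ hi₅ hi (by omega) fun j hj => ?_) ?_
    · rw [hreg₅ 17 (by omega), hreg₄ 17 (by omega) (by omega) (by omega), h17₃]
    · rw [hm₅ _ (by omega), hσ, input_mem H w hi hj]
    rintro σ₆ ⟨h22₆, hreg₆, hm₆, hrow₆, harr₆⟩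
    refine ⟨by rw [hreg₆ 23 (by omega) (by omega) (by omega), hi₅],
      by rw [hreg₆ 1 (by omega) (by omega) (by omega), hlen],
      by rw [hreg₆ 3 (by omega) (by omega) (by omega), hreg₅ 3 (by omega), henv₄.one],
      fun a ha => ?_, by simp [h22₆], fun p hp => ?_, fun j hj => ?_, fun k hk h0 j => ?_⟩
    · simp (disch := omega) only [State.reg_setReg, if_neg]
      rw [hreg₆ a (by omega) (by omega) (by omega), hreg₅ a ha]
    · rw [State.mem_setReg, hm₆ p hp, hm₅ p hp]
    · rw [State.arr_setReg, hrow₆]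
      split_ifs with hji
      · rw [hji]
      · exact hrow₅ j (by omega)
    · rw [State.arr_setReg, harr₆ k hk h0, harr₅ k hk h0]
  · rintro σ₅ ⟨hreg₅, -, -, hrow₅, harr₅⟩
    have hr₅ : ∀ a < 20, a ≠ 2 → a ≠ 3 → a ≠ 4 → a ≠ 5 → a ≠ 16 → a ≠ 17 → σ₅.reg a = σ.reg a :=
      fun a ha h2 h3 h4 h5 h16 h17 => by
        rw [hreg₅ a ha, hreg₄ a ha h5 h16, hrr a ha h2 h3 h4 h5 h17]
    refine ⟨⟨henv₄.of_eq (fun a ha => hreg₅ a (by omega)) fun j _ => harr₅ 1 (by omega) (by omega) j,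
      by rw [hreg₅ 1 (by omega), h1₄], by rw [hreg₅ 5 (by omega), h5₄], by rw [hreg₅ 16 (by omega), h16₄],
      hrow₅⟩, ?_, ?_, ?_, fun v => ?_⟩
    · rw [hreg₅ 2 (by omega), hreg₄ 2 (by omega) (by omega) (by omega), h2₃]
    · rw [hr₅ 6 (by omega) (by omega) (by omega) (by omega) (by omega) (by omega) (by omega)]; simp [hreg]
    · rw [hr₅ 8 (by omega) (by omega) (by omega) (by omega) (by omega) (by omega) (by omega)]; simp [hreg]
    · rw [harr₅ 6 (by omega) (by omega), h6₄, State.arr, hσ, input_mem_of_le H w (by omega)]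

theorem HT.store_eq {W a b p v : ℕ} {σ : State} {Q : State → Prop} (ha : σ.reg a = p)
    (hb : σ.reg b = v) (h : Q (σ.setMem p v)) : HT W (.store a b) σ 1 Q :=
  HT.store (by rwa [ha, hb])

/-- Writes the word in register `6` to the first cells of the memory. -/
def Prog.output : Prog :=
  .const 17 0 ;; .forLt 20 0 (.sub 21 0 20 ;; .sub 21 21 3 ;; .aget 22 1 21 ;;
    .ifLt 6 22 (.store 21 17) (.sub 6 6 22 ;; .store 21 3))

theorem output_spec {W n r B : ℕ} {σ : State} {x : ℕ → ZMod 2} (henv : Env n B σ)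
    (hroom : Room W n r B) (hnB : n ≤ B) (h6 : σ.reg 6 = enc n x) :
    HT W .output σ (14 * n + 3) fun σ' => ∀ j < n, σ'.mem j = (x j).val := by
  unfold Room at hroom
  have hn2 : n < 2 ^ n := Nat.lt_two_pow_self
  refine HT.weaken (N₁ := 1 + ((12 + 2) * n + 2)) ?_ (by omega)
  refine HT.const' (by omega) (HT.forLt n 12 (fun k σ' => Env n B σ' ∧ σ'.reg 17 = 0 ∧
    σ'.reg 6 = enc (n - k) x ∧ ∀ j < n, n - k ≤ j → σ'.mem j = (x j).val) (by omega)
    (by simp [henv.len]) ?_ ?_ ?_)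
  · refine ⟨henv.of_eq (fun a ha => ?_) fun i _ => rfl, by simp, by simp [h6], fun j hj hj' => by omega⟩
    simp (disch := omega) only [State.reg_setReg, if_neg]
  · rintro k σ₁ hk ⟨henv₁, h17, h6₁, hout⟩ hi hlen
    obtain ⟨p, hp⟩ : ∃ p, n - k = p + 1 := ⟨n - k - 1, by omega⟩
    have hp' : n - (k + 1) = p := by omega
    have hlt := enc_lt p x
    have h4 := henv₁.base
    have h3 := henv₁.one
    rw [hp, enc_succ] at h6₁
    refine HT.weaken (N₁ := 1 + (1 + (7 + ((1 + 1) + 1)))) ?_ (by omega)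
    refine HT.sub' (HT.sub' (HT.aget' (x := p) (B := B) (by simp [henv₁.len, h3, hi]; omega)
      (by simp [h4]) (by omega) ?_))
    simp only [State.arr_setReg, henv₁.pow p (by omega)]
    have hmem : ∀ (τ : State) (v : ℕ), (∀ j, τ.mem j = σ₁.mem j) → v = (x p).val →
        ∀ j < n, n - (k + 1) ≤ j → ((τ.setMem p v).setReg 20 (k + 1)).mem j = (x j).val := by
      intro τ v hτ hv j hj hj'
      rw [State.mem_setReg, State.mem_setMem]
      split_ifs with hjp
      · rw [hv, hjp]
      · rw [hτ]; exact hout j hj (by omega)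
    have hpow : ∀ (τ : State) (v : ℕ), (∀ j, τ.mem j = σ₁.mem j) →
        ∀ i < n, ((τ.setMem p v).setReg 20 (k + 1)).arr B 1 i = σ₁.arr B 1 i := by
      intro τ v hτ i hi
      unfold State.arr
      rw [State.mem_setReg, State.mem_setMem, if_neg (by omega), hτ]
    have h21 : n - k - 1 = p := by omega
    rcases zmod_two_cases (x p) with h | h
    · rw [h, ZMod.val_zero, mul_zero, add_zero] at h6₁
      refine HT.ifLt (fun _ => HT.weaken (HT.store_eq (p := p) (v := 0)
        (by simp [henv₁.len, h3, hi, h21]) (by simp [h17]) ?_) (by omega)) (fun h' => ?_)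
      · refine ⟨by simp [hi], by simp [hlen], by simp [h3], henv₁.of_eq (fun a ha => ?_)
          (hpow _ _ fun _ => rfl), by simp [h17], by simp [h6₁, hp'],
          hmem _ _ (fun _ => rfl) (by rw [h, ZMod.val_zero])⟩
        simp only [State.reg_setReg, State.reg_setMem]
        simp (disch := omega) only [if_neg]
      · simp [h6₁] at h'; omega
    · rw [h, ZMod.val_one, mul_one] at h6₁
      refine HT.ifLt (fun h' => ?_) (fun h' => HT.sub' (HT.store_eq (p := p) (v := 1)
        (by simp [henv₁.len, h3, hi, h21]) (by simp [h3]) ?_))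
      · simp [h6₁] at h'
      · refine ⟨by simp [hi], by simp [hlen], by simp [h3], henv₁.of_eq (fun a ha => ?_)
          (hpow _ _ fun _ => rfl), by simp [h17], by simp [h6₁, hp'],
          hmem _ _ (fun _ => rfl) (by rw [h, ZMod.val_one])⟩
        simp only [State.reg_setReg, State.reg_setMem]
        simp (disch := omega) only [if_neg]
  · rintro σ' ⟨-, -, -, h⟩ j hj
    exact h j hj (by omega)

/-- Verifies the distance by searches for words of weight `1, 2, …`. -/
def Prog.verifier (S : Prog) : Prog :=
  .setup ;; .forLt 9 2 (.ifLt 6 3 (.add 7 9 3 ;; S) .skip) ;; .output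

/-- The number of operations of `verifier`, if the search needs `N`. -/
def verifierCost (n r N : ℕ) : ℕ := setupCost n r + (N + 4) * n + 14 * n + 5

/-- The search for weight `D + 1` starts only when all nonzero codewords are known to have weight
above `D`, so a hit has minimum weight. The hypothesis `hS` is restricted to such `D`; this is what
bounds the time by the distance when `w` is large. -/
theorem verifier_spec {W r n N : ℕ} (H : Matrix (Fin r) (Fin n) (ZMod 2)) (w : ℕ) (S : Prog)
    (I : ℕ → State → Prop) (hroom : Room W n r ((r + 1) * n))
    (hI : ∀ D σ σ', σ'.reg 8 = σ.reg 8 → σ'.mem = σ.mem → I D σ → I D σ')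
    (hI0 : ∀ σ, σ.reg 8 = 0 → (∀ v, σ.arr ((r + 1) * n) 6 v = 0) → I 0 σ)
    (hS : ∀ D < min w n, (∀ c, IsWord n r (rowsOf H) c → 0 < wt n c → D < wt n c) →
      Searches W n r ((r + 1) * n) (rowsOf H) I S D N) :
    HT W (.verifier S) (input H w) (verifierCost n r N) fun σ' =>
      ∃ x : ℕ → ZMod 2, (∀ j < n, σ'.mem j = (x j).val) ∧
        ((x = 0 ∧ ∀ c, IsWord n r (rowsOf H) c → 0 < wt n c → min w n < wt n c) ∨
        (IsWord n r (rowsOf H) x ∧ 0 < wt n x ∧ wt n x ≤ min w n ∧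
          ∀ c, IsWord n r (rowsOf H) c → 0 < wt n c → wt n x ≤ wt n c)) := by
  have hroom' := hroom
  set B := (r + 1) * n with hB
  have hnB : n ≤ B := by rw [hB]; exact Nat.le_mul_of_pos_left _ (by omega)
  unfold Room at hroom'
  have hcost : (N + 1 + 1 + 2) * min w n ≤ (N + 4) * n := Nat.mul_le_mul_left _ (min_le_right _ _)
  refine HT.weaken (N₁ := setupCost n r + (((N + 1 + 1 + 2) * min w n + 2) + (14 * n + 3))) ?_
    (by unfold verifierCost; omega)
  refine HT.call (setup_spec H w hroom) ?_
  rintro σ ⟨hσ, h2, h6, h8, h6a⟩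
  refine HT.call (Q₁ := fun σ' => Env n B σ' ∧ ∃ x : ℕ → ZMod 2, σ'.reg 6 = enc n x ∧
        ((x = 0 ∧ ∀ c, IsWord n r (rowsOf H) c → 0 < wt n c → min w n < wt n c) ∨
        (IsWord n r (rowsOf H) x ∧ 0 < wt n x ∧ wt n x ≤ min w n ∧
          ∀ c, IsWord n r (rowsOf H) c → 0 < wt n c → wt n x ≤ wt n c)))
    (HT.forLt (min w n) _ (fun D σ' => Ready n r B (rowsOf H) σ' ∧
      ((σ'.reg 6 = 0 ∧ I D σ' ∧ ∀ c, IsWord n r (rowsOf H) c → 0 < wt n c → D < wt n c) ∨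
      (∃ x, 0 < σ'.reg 6 ∧ σ'.reg 6 = enc n x ∧ IsWord n r (rowsOf H) x ∧ 0 < wt n x ∧ wt n x ≤ D ∧
        ∀ c, IsWord n r (rowsOf H) c → 0 < wt n c → wt n x ≤ wt n c))) (by omega) h2 ?_ ?_ ?_) ?_
  · refine ⟨hσ.of_eq (fun a ha => ?_) (by simp) (fun _ => rfl) fun _ => rfl,
      Or.inl ⟨by simp [h6], hI0 _ (by simp [h8]) (by simpa using h6a), fun c _ h => h⟩⟩
    simp (disch := omega) only [State.reg_setReg, if_neg]
  · rintro D σ₁ hD ⟨hσ₁, hcase⟩ hi hlen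
    have hDn : D < n := lt_of_lt_of_le hD (min_le_right _ _)
    have hn2 : n < 2 ^ n := Nat.lt_two_pow_self
    rcases hcase with ⟨h6₁, hI₁, hno⟩ | ⟨x, h6₁, hx⟩
    · refine HT.ifLt (fun _ => ?_) (fun h => absurd (by rw [h6₁, hσ₁.env.one]; omega) h)
      refine HT.weaken (N₁ := 1 + N) (HT.add' (by rw [hi, hσ₁.env.one]; omega) ?_) (by omega)
      refine HT.imp (hS D hD hno _ (hσ₁.of_eq (fun a ha => ?_) (by simp) (fun _ => rfl) fun _ => rfl)
        (hI D σ₁ _ (by simp) rfl hI₁) (by simp [h6₁]) (by simp [hi, hσ₁.env.one])) ?_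
      · simp (disch := omega) only [State.reg_setReg, if_neg]
      rintro σ₂ ⟨hσ₂, hI₂, h2₂, h9₂, hit, hnone⟩
      refine ⟨by rw [h9₂]; simp [hi], by rw [h2₂]; simp [hlen], hσ₂.env.one,
        hσ₂.of_eq (fun a ha => ?_) (by simp) (fun _ => rfl) fun _ => rfl, ?_⟩
      · simp (disch := omega) only [State.reg_setReg, if_neg]
      · rcases hit with h0 | hit
        · refine Or.inl ⟨by simp [h0], hI (D + 1) σ₂ _ (by simp) rfl hI₂, fun c hc hc0 => ?_⟩
          have h1 := hno c hc hc0
          have h2 := hnone h0 c hc hc0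
          omega
        · have hpos := hit.ne_zero
          obtain ⟨x, hx, hxw, hx0, hxD⟩ := hit
          refine Or.inr ⟨x, by simp; omega, by simp [hx], hxw, hx0, hxD, fun c hc hc0 => ?_⟩
          have h1 := hno c hc hc0
          omega
    · refine HT.ifLt (fun h => absurd h (by rw [hσ₁.env.one]; omega)) (fun _ =>
        HT.weaken (HT.skip ?_) (by omega : 1 ≤ N + 1))
      refine ⟨hi, hlen, hσ₁.env.one, hσ₁.of_eq (fun a ha => ?_) (by simp) (fun _ => rfl) fun _ => rfl,
        Or.inr ⟨x, by simpa using h6₁, by simpa using hx.1, hx.2.1, hx.2.2.1, by omega, hx.2.2.2.2⟩⟩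
      simp (disch := omega) only [State.reg_setReg, if_neg]
  · rintro σ' ⟨hσ', ⟨h0, -, hno⟩ | ⟨x, -, hx⟩⟩
    · exact ⟨hσ'.env, 0, by rw [h0, enc_zero], Or.inl ⟨rfl, hno⟩⟩
    · exact ⟨hσ'.env, x, hx.1, Or.inr hx.2⟩
  · rintro σ₁ ⟨henv, x, hx, h⟩
    exact HT.imp (output_spec henv hroom hnB hx) fun σ' h' => ⟨x, h', h⟩

/-! ### From sequences back to codes: correctness and time of the verifiers -/

theorem isWord_rowsOf {r n : ℕ} (H : Matrix (Fin r) (Fin n) (ZMod 2)) (x : ℕ → ZMod 2) :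
    IsWord n r (rowsOf H) x ↔ (fun j : Fin n => x j) ∈ code H := by
  have key : ∀ i : Fin r, dot n (rowsOf H i) x = (H *ᵥ fun j : Fin n => x j) i := fun i => by
    unfold dot
    rw [Finset.sum_range]
    refine Finset.sum_congr rfl fun j _ => ?_
    rw [rowsOf, dif_pos ⟨i.2, j.2⟩]
  rw [code, LinearMap.mem_ker, Matrix.mulVecLin_apply]
  constructor
  · intro h
    ext i
    rw [← key i]
    exact h i i.2
  · intro h i hi
    rw [key ⟨i, hi⟩, h]
    rfl

theorem wt_eq_hammingNorm {n : ℕ} (x : ℕ → ZMod 2) :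
    wt n x = hammingNorm fun j : Fin n => x j := by
  unfold wt hammingNorm
  rw [Finset.sum_range, Finset.card_filter]
  exact Finset.sum_congr rfl fun j _ => val_eq_ite _

theorem exists_extension {n : ℕ} (c : Fin n → ZMod 2) : ∃ x : ℕ → ZMod 2, (fun j : Fin n => x j) = c :=
  ⟨fun j => if h : j < n then c ⟨j, h⟩ else 0, by ext j; simp⟩

theorem forall_words_iff {r n : ℕ} (H : Matrix (Fin r) (Fin n) (ZMod 2)) (p : ℕ → Prop) :
    (∀ x, IsWord n r (rowsOf H) x → 0 < wt n x → p (wt n x)) ↔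
      ∀ c ∈ code H, c ≠ 0 → p (hammingNorm c) := by
  constructor
  · intro h c hc hc0
    obtain ⟨x, rfl⟩ := exists_extension c
    rw [← wt_eq_hammingNorm]
    exact h x ((isWord_rowsOf H x).2 hc) (by rw [wt_eq_hammingNorm]; exact hammingNorm_pos_iff.2 hc0)
  · intro h x hx hx0
    rw [wt_eq_hammingNorm] at hx0 ⊢
    exact h _ ((isWord_rowsOf H x).1 hx) (hammingNorm_pos_iff.1 hx0)

theorem bdd_input {r n W : ℕ} (H : Matrix (Fin r) (Fin n) (ZMod 2)) (w : ℕ)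
    (hroom : Room W n r ((r + 1) * n)) (hw : w < 2 ^ W) : Bdd W (input H w) := by
  unfold Room at hroom
  have hn2 : n < 2 ^ n := Nat.lt_two_pow_self
  have hr2 : r < 2 ^ r := Nat.lt_two_pow_self
  refine ⟨fun a => ?_, fun p => ?_⟩
  · simp only [input]
    split_ifs <;> omega
  · have := input_mem_le H w p
    omega

/-- A verifier is correct if its search is. -/
theorem verifiesDistance_verifier (S : Prog) (I : ℕ → ℕ → ℕ → ℕ → State → Prop)
    (hI : ∀ n r B D σ σ', σ'.reg 8 = σ.reg 8 → σ'.mem = σ.mem → I n r B D σ → I n r B D σ')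
    (hI0 : ∀ n r B σ, σ.reg 8 = 0 → (∀ v, σ.arr B 6 v = 0) → I n r B 0 σ)
    (hS : ∀ (r n : ℕ) (H : Matrix (Fin r) (Fin n) (ZMod 2)), ∃ N, ∀ W D,
      Room W n r ((r + 1) * n) → D < n →
      Searches W n r ((r + 1) * n) (rowsOf H) (I n r ((r + 1) * n)) S D N) :
    VerifiesDistance (.verifier S) := by
  intro r n H w
  obtain ⟨N, hN⟩ := hS r n H
  -- Correctness does not involve time, so any word length with enough room will do, and `E < 2^E`.
  set E := (r + 1) * n + 8 * 2 ^ n + 8 * 2 ^ r + 8 * (n * n) + 8 * n + 16 + w with hE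
  have hE2 : E < 2 ^ E := Nat.lt_two_pow_self
  have hroom : Room E n r ((r + 1) * n) := by unfold Room; omega
  obtain ⟨T, σ, hrun, -, -, x, hx, h⟩ := verifier_spec H w S (I n r ((r + 1) * n)) hroom (hI n r _)
    (hI0 n r _) (fun D hD _ => hN E D hroom (lt_of_lt_of_le hD (min_le_right _ _)))
    (bdd_input H w hroom (by omega))
  refine ⟨T, σ, fun j => x j, hrun, fun j => hx j j.2, ?_⟩
  have hle : ∀ c : Fin n → ZMod 2, hammingNorm c ≤ n := fun c => by
    simpa using hammingNorm_le_card_fintype (x := c)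
  rcases h with ⟨rfl, h⟩ | ⟨h1, h2, h3, h4⟩
  · rw [forall_words_iff H fun k => min w n < k] at h
    have hno : ¬ DistLE H w := by
      rintro ⟨c, hc, hc0, hcw⟩
      have h1 := h c hc hc0
      have h2 : hammingNorm c ≤ w := by exact_mod_cast hcw
      have := hle c
      omega
    exact ⟨fun h' => absurd h' hno, fun _ => rfl⟩
  · rw [forall_words_iff H fun k => wt n x ≤ k] at h4
    rw [isWord_rowsOf] at h1
    have h0 : (fun j : Fin n => x j) ≠ 0 := hammingNorm_pos_iff.1 (wt_eq_hammingNorm x ▸ h2)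
    refine ⟨fun _ => ⟨h1, h0, fun c hc hc0 => wt_eq_hammingNorm x ▸ h4 c hc hc0⟩, fun h' => ?_⟩
    refine absurd ⟨_, h1, h0, ?_⟩ h'
    rw [← wt_eq_hammingNorm]
    exact_mod_cast h3.trans (min_le_left _ _)

theorem sq_le_two_mul_two_pow (n : ℕ) : n * n ≤ 2 * 2 ^ n := by
  induction n with
  | zero => simp
  | succ n ih =>
    rcases Nat.lt_or_ge n 3 with h | h
    · interval_cases n <;> norm_num
    · rw [pow_succ]; nlinarith

/-- The time of a verifier in terms of the number of operations of its search. -/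
theorem fastUpTo_verifier {r n N : ℕ} (H : Matrix (Fin r) (Fin n) (ZMod 2)) (S : Prog)
    (I : ℕ → State → Prop) {E x : ℝ} (hr : r ≤ n)
    (hI : ∀ D σ σ', σ'.reg 8 = σ.reg 8 → σ'.mem = σ.mem → I D σ → I D σ')
    (hI0 : ∀ σ, σ.reg 8 = 0 → (∀ v, σ.arr ((r + 1) * n) 6 v = 0) → I 0 σ)
    (hS : ∀ W D, Room W n r ((r + 1) * n) → D < n → ((D + 1 : ℕ) : ℝ) ≤ x * n →
      Searches W n r ((r + 1) * n) (rowsOf H) I S D N)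
    (hN : ((verifierCost n r N * (2 * (n + 6) + 1) : ℕ) : ℝ) ≤ (2 : ℝ) ^ (E * n)) :
    FastUpTo (.verifier S) E x r n H := by
  intro w hw hx
  -- As `r ≤ n` and `n² ≤ 2 · 2^n`, all addresses and numbers are below `64 · 2^n`.
  have hroom : Room (n + 6) n r ((r + 1) * n) := by
    unfold Room
    have h1 := sq_le_two_mul_two_pow n
    have h2 : n < 2 ^ n := Nat.lt_two_pow_self
    have h3 : 2 ^ r ≤ 2 ^ n := Nat.pow_le_pow_right (by omega) hr
    have h4 : (r + 1) * n ≤ n * n + n := by nlinarith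
    have h5 : 2 ^ (n + 6) = 64 * 2 ^ n := by rw [pow_add]; ring
    have h6 : 0 < 2 ^ n := by positivity
    omega
  have hwW : w < 2 ^ (n + 6) := lt_of_le_of_lt hw (lt_of_lt_of_le Nat.lt_two_pow_self
    (Nat.pow_le_pow_right (by omega) (by omega)))
  obtain ⟨T, σ, hrun, hT, -⟩ := verifier_spec H w S I hroom hI hI0 (fun D hD hno => by
    refine hS _ D hroom (lt_of_lt_of_le hD (min_le_right _ _)) ?_
    rcases hx with hx | ⟨c, hc, hc0, hcx⟩
    · refine le_trans ?_ hx
      exact_mod_cast lt_of_lt_of_le hD (min_le_left _ _)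
    · rw [forall_words_iff H fun k => D < k] at hno
      refine le_trans ?_ hcx
      exact_mod_cast hno c hc hc0) (bdd_input H w hroom hwW)
  exact ⟨T, σ, hrun, le_trans (by exact_mod_cast hT) hN⟩

/-- Outside of a window with few codewords outside of it, few vectors of the basis have cost zero. -/
theorem Sparse.zeroCount_sq_le {r n a s : ℕ} {H : Matrix (Fin r) (Fin n) (ZMod 2)} (h : Sparse H a)
    (hs : s < n) {g : ℕ → ℕ → ZMod 2} {κ : ℕ → ℕ} (he : Elim n (rowsOf H) (windowCost n a s) r g κ) :
    zeroCount κ n * zeroCount κ n ≤ n := by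
  rw [← Nat.le_sqrt]
  set Z := (Finset.range n).filter fun j => κ j = 0 with hZ
  suffices 2 ^ zeroCount κ n ≤ 2 ^ Nat.sqrt n from (Nat.pow_le_pow_iff_right (by omega)).1 this
  refine le_trans ?_ (h s hs)
  have hcard : Z.powerset.card = 2 ^ zeroCount κ n := Finset.card_powerset _
  rw [← hcard]
  -- Sums of vectors of cost zero are codewords that vanish on the window. The echelon form recovers
  -- the set of summands from the entries of the sum at their own positions.
  refine Finset.card_le_card_of_injOn
    (fun S => Finset.univ.filter fun j : Fin n => (∑ i ∈ S, g i) j ≠ 0) ?_ ?_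
  · intro S hS
    rw [Finset.mem_coe, Finset.mem_powerset] at hS
    have hSn : S ⊆ Finset.range n := hS.trans (Finset.filter_subset _ _)
    have hS0 : ∀ j ∈ S, κ j = 0 := fun j hj => (Finset.mem_filter.1 (hS hj)).2
    simp only [Finset.mem_coe, wordsIn, Finset.mem_filter, Finset.mem_powerset]
    constructor
    · intro j hj
      rw [Finset.mem_filter] at hj
      simp only [offWindow, Finset.mem_filter, Finset.mem_univ, true_and]
      intro hw
      refine hj.2 ?_
      rw [Finset.sum_apply]
      refine Finset.sum_eq_zero fun i hi => he.supp i (Finset.mem_range.1 (hSn hi)) (hS0 i hi) j j.2 ?_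
      rw [windowCost, if_pos hw]
      omega
    · intro i
      have h1 : dot n (rowsOf H i) (∑ j ∈ S, g j) = 0 := by
        rw [dot_sum_right]
        exact Finset.sum_eq_zero fun j hj => he.check j (Finset.mem_range.1 (hSn hj))
          (by rw [hS0 j hj]; omega) i i.2
      refine Eq.trans ?_ h1
      rw [Finset.sum_filter]
      unfold dot
      rw [Finset.sum_range]
      refine Finset.sum_congr rfl fun j _ => ?_
      rw [rowsOf, dif_pos ⟨i.2, j.2⟩]
      rcases zmod_two_cases ((∑ i ∈ S, g i) j) with h2 | h2 <;> simp [h2]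
  · intro S hS S' hS' hSS
    rw [Finset.mem_coe, Finset.mem_powerset] at hS hS'
    have key : ∀ S ⊆ Z, ∀ k ∈ Z, (k ∈ S ↔ ∃ hk : k < n, (⟨k, hk⟩ : Fin n) ∈
        Finset.univ.filter fun j : Fin n => (∑ i ∈ S, g i) j ≠ 0) := by
      intro S hS k hk
      rw [hZ, Finset.mem_filter, Finset.mem_range] at hk
      have h1 := he.sum_injOn (hS.trans (Finset.filter_subset _ _))
        (fun j hj => by rw [(Finset.mem_filter.1 (hS hj)).2]; omega) hk.1 (by omega)
      simp only [Finset.mem_filter, Finset.mem_univ, true_and, h1]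
      constructor
      · intro h; exact ⟨hk.1, by simp [h]⟩
      · rintro ⟨-, h⟩; by_contra h'; simp [h'] at h
    simp only at hSS
    ext k
    constructor
    · intro hk
      rw [key S' hS' k (hS hk), ← hSS]
      exact (key S hS k (hS hk)).1 hk
    · intro hk
      rw [key S hS k (hS' hk)]
      have := (key S' hS' k (hS' hk)).1 hk
      rwa [← hSS] at this

/-- Only the zero word vanishes on the full circle. This makes the window search end successfully at
`a = n` at the latest, for every matrix. -/
theorem sparse_self {r n : ℕ} (H : Matrix (Fin r) (Fin n) (ZMod 2)) : Sparse H n := by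
  intro s hs
  have h1 : offWindow n n s = ∅ := by
    refine Finset.eq_empty_of_forall_notMem fun j hj => ?_
    rw [offWindow, Finset.mem_filter] at hj
    have := j.2
    apply hj.2
    unfold InWindow
    omega
  have h2 : wordsIn H (offWindow n n s) ⊆ {∅} := by
    rw [h1]
    exact (Finset.filter_subset _ _).trans (by simp)
  exact (Finset.card_le_card h2).trans (by simpa using Nat.one_le_two_pow)

theorem verifiesDistance_windowSearch : VerifiesDistance (.verifier .windowSearch) := by
  refine verifiesDistance_verifier _ (fun _ _ _ _ _ => True) (fun _ _ _ _ _ _ _ _ h => h)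
    (fun _ _ _ _ _ _ => trivial) fun r n H => ⟨windowSearchCost n r (2 ^ Nat.sqrt n * ballVol n (n * n)),
    fun W D hroom hD => ?_⟩
  refine searches_windowSearch hroom hD le_rfl
    (fun s hs g κ he => (sparse_self H).zeroCount_sq_le hs he) fun a ha => ?_
  refine Nat.mul_le_mul_left _ (ballVol_mono ha ((Nat.div_le_self _ _).trans ?_))
  exact Nat.mul_le_mul (by omega) ha

theorem stampInv_of_eq {n r B D : ℕ} {σ σ' : State} (h8 : σ'.reg 8 = σ.reg 8) (hm : σ'.mem = σ.mem)
    (h : StampInv n r B D σ) : StampInv n r B D σ' := by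
  refine ⟨by rw [h8, h.1], fun v hv => ?_⟩
  rw [h8]
  have := h.2 v hv
  unfold State.arr at this ⊢
  rwa [hm]

theorem stampInv_zero {n r B : ℕ} {σ : State} (h8 : σ.reg 8 = 0) (h6 : ∀ v, σ.arr B 6 v = 0) :
    StampInv n r B 0 σ :=
  ⟨by rw [h8, zero_mul], fun v _ => by rw [h6 v]; omega⟩

theorem verifiesDistance_collisionSearch : VerifiesDistance (.verifier .collisionSearch) := by
  refine verifiesDistance_verifier _ StampInv (fun _ _ _ _ _ _ h8 hm h => stampInv_of_eq h8 hm h)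
    (fun _ _ _ _ h8 h6 => stampInv_zero h8 h6) fun r n H =>
    ⟨collisionSearchCost n r (ballVol n n), fun W D hroom hD => ?_⟩
  exact searches_collisionSearch hroom hD (ballVol_mono (by omega) (by omega))

/-! ### Monotonicity of the statements about most codes -/

theorem MostA.mono {ℓ m : ℕ} (hm : 0 < m) (hℓm : ℓ ≤ m)
    {P Q : ∀ r n : ℕ, Matrix (Fin r) (Fin n) (ZMod 2) → Prop} (h : MostA ℓ m P) {N₀ : ℕ}
    (hPQ : ∀ r n, N₀ ≤ n → r ≤ n → ∀ H, P r n H → Q r n H) : MostA ℓ m Q := by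
  intro κ hκ
  obtain ⟨N, hN⟩ := h κ hκ
  refine ⟨max N N₀, fun n r hn hr => (hN n r (by omega) hr).trans ?_⟩
  have hrn : r ≤ n := by
    have : r * m ≤ n * m := by rw [hr, mul_comm n]; exact Nat.mul_le_mul_right _ hℓm
    exact Nat.le_of_mul_le_mul_right this hm
  have hsub : {H ∈ ensembleA ℓ m r n | P r n H} ⊆ {H ∈ ensembleA ℓ m r n | Q r n H} :=
    fun H hH => ⟨hH.1, hPQ r n (by omega) hrn H hH.2⟩
  exact_mod_cast Set.ncard_le_ncard hsub (Set.toFinite _)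

theorem MostB.mono {ℓ m : ℕ} (hm : 0 < m) (hℓm : ℓ ≤ m)
    {P Q : ∀ r n : ℕ, Matrix (Fin r) (Fin n) (ZMod 2) → Prop} (h : MostB ℓ m P) {N₀ : ℕ}
    (hPQ : ∀ r n, N₀ ≤ n → r ≤ n → ∀ H, P r n H → Q r n H) : MostB ℓ m Q := by
  intro κ hκ
  obtain ⟨N, hN⟩ := h κ hκ
  refine ⟨max N N₀, fun s hs => (hN s (by omega)).trans ?_⟩
  have hsm : s ≤ m * s := Nat.le_mul_of_pos_left _ hm
  have hsub : {π : Fin ℓ → Equiv.Perm (Fin (m * s)) | P _ _ (gallagerMatrix ℓ m s π)} ⊆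
      {π | Q _ _ (gallagerMatrix ℓ m s π)} :=
    fun π hπ => hPQ _ _ (by omega) (Nat.mul_le_mul_right _ hℓm) _ hπ
  exact_mod_cast Set.ncard_le_ncard hsub (Set.toFinite _)

/-! ### Exponents -/

/-- The parameters of the exponential bound for the volume of a ball of relative radius `δ`. -/
theorem exists_entropy_split {δ : ℝ} (h0 : 0 < δ) (h1 : δ ≤ 1 / 2) :
    ∃ A L : ℝ, 0 ≤ A ∧ 0 ≤ L ∧ (2 : ℝ) ^ A = 1 + (2 : ℝ) ^ (-L) ∧ A + δ * L = h2 δ := by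
  have h1' : 0 < 1 - δ := by linarith
  have hl2 : 0 < Real.log 2 := Real.log_pos (by norm_num)
  -- `L` is the slope and `A` the intercept of the tangent to the binary entropy at `δ`; the slope
  -- is nonnegative because `δ ≤ 1/2`.
  refine ⟨-Real.logb 2 (1 - δ), Real.logb 2 (1 - δ) - Real.logb 2 δ, ?_, ?_, ?_, ?_⟩
  · have := Real.logb_nonpos (b := 2) (by norm_num) h1'.le (by linarith)
    linarith
  · exact sub_nonneg.2 (Real.logb_le_logb_of_le (by norm_num) h0 (by linarith))
  · rw [neg_sub, Real.rpow_neg (by norm_num), Real.rpow_sub (by norm_num),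
      Real.rpow_logb (by norm_num) (by norm_num) h1', Real.rpow_logb (by norm_num) (by norm_num) h0]
    field_simp
    ring
  · rw [h2, Real.binEntropy_eq_negMulLog_add_negMulLog_one_sub, Real.negMulLog, Real.negMulLog, Real.logb, Real.logb]
    field_simp
    ring

/-- A Chernoff bound: each term with `i ≤ y` is enlarged by the factor `2^(L(y-i)) ≥ 1`, and the sum
is then at most a power of `1 + 2^(-L) = 2^A` by the binomial theorem. The exponent is linear in
both the length and the radius. -/
theorem ballVol_le_rpow {A L : ℝ} (hL : 0 ≤ L) (hA : (2 : ℝ) ^ A = 1 + (2 : ℝ) ^ (-L)) {a b : ℕ} {y : ℝ}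
    (hy : (b : ℝ) ≤ y) : (ballVol a b : ℝ) ≤ (2 : ℝ) ^ (A * a + L * y) := by
  have hterm : ∀ i ∈ Finset.range (b + 1), (a.choose i : ℝ) ≤
      (a.choose i : ℝ) * ((2 : ℝ) ^ (-L)) ^ i * (2 : ℝ) ^ (L * y) := fun i hi => by
    have hi' : (i : ℝ) ≤ b := by exact_mod_cast Nat.lt_succ_iff.1 (Finset.mem_range.1 hi)
    rw [mul_assoc, ← Real.rpow_natCast, ← Real.rpow_mul (by norm_num), ← Real.rpow_add (by norm_num)]
    refine le_mul_of_one_le_right (by positivity) (Real.one_le_rpow (by norm_num) ?_)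
    nlinarith
  have hsum : ∑ i ∈ Finset.range (b + 1), (a.choose i : ℝ) * ((2 : ℝ) ^ (-L)) ^ i ≤
      (1 + (2 : ℝ) ^ (-L)) ^ a := by
    rw [add_comm (1 : ℝ), add_pow]
    rcases Nat.le_total b a with h | h
    · refine (Finset.sum_le_sum fun i _ => ?_).trans
        (Finset.sum_le_sum_of_subset_of_nonneg (Finset.range_mono (Nat.succ_le_succ h))
          fun i _ _ => by positivity)
      rw [one_pow, mul_one, mul_comm]
    · refine le_of_eq ?_
      rw [← Finset.sum_subset (Finset.range_mono (Nat.succ_le_succ h))]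
      · exact Finset.sum_congr rfl fun i _ => by rw [one_pow, mul_one, mul_comm]
      · intro i _ hi
        rw [Nat.choose_eq_zero_of_lt (by simp only [Finset.mem_range] at hi; omega)]
        simp
  calc (ballVol a b : ℝ) = ∑ i ∈ Finset.range (b + 1), (a.choose i : ℝ) := by
        unfold ballVol; push_cast; rfl
    _ ≤ (∑ i ∈ Finset.range (b + 1), (a.choose i : ℝ) * ((2 : ℝ) ^ (-L)) ^ i) * (2 : ℝ) ^ (L * y) := by
        rw [Finset.sum_mul]; exact Finset.sum_le_sum hterm
    _ ≤ (1 + (2 : ℝ) ^ (-L)) ^ a * (2 : ℝ) ^ (L * y) := by gcongr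
    _ = (2 : ℝ) ^ (A * a + L * y) := by
        rw [← hA, Real.rpow_add (by norm_num), Real.rpow_mul_natCast (by norm_num)]

theorem verifierCost_windowSearch_le {n r M : ℕ} (hr : r ≤ n) (hM : 1 ≤ M) :
    verifierCost n r (windowSearchCost n r M) * (2 * (n + 6) + 1) ≤ 100000 * (n + 1) ^ 7 * M := by
  -- With `1 + M` for `M`, the difference of the two sides becomes a polynomial in `n` and `M` with
  -- nonnegative coefficients.
  obtain ⟨M, rfl⟩ := Nat.exists_eq_add_of_le hM
  calc verifierCost n r (windowSearchCost n r (1 + M)) * (2 * (n + 6) + 1)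
      ≤ verifierCost n n (windowSearchCost n n (1 + M)) * (2 * (n + 6) + 1) := by
        unfold verifierCost windowSearchCost stageCost windowStepCost basisCost setupCost
        gcongr
    _ ≤ _ := by
        unfold verifierCost windowSearchCost stageCost windowStepCost basisCost setupCost elimRowCost
          enumCost combCost
        zify
        rw [← sub_nonneg]
        ring_nf
        positivity

theorem verifierCost_collisionSearch_le {n r M : ℕ} (hr : r ≤ n) (hM : 1 ≤ M) :
    verifierCost n r (collisionSearchCost n r M) * (2 * (n + 6) + 1) ≤ 100000 * (n + 1) ^ 7 * M := by
  obtain ⟨M, rfl⟩ := Nat.exists_eq_add_of_le hM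
  calc verifierCost n r (collisionSearchCost n r (1 + M)) * (2 * (n + 6) + 1)
      ≤ verifierCost n n (collisionSearchCost n n (1 + M)) * (2 * (n + 6) + 1) := by
        unfold verifierCost collisionSearchCost splitStepCost fillStepCost matchStepCost synCost setupCost
        gcongr
    _ ≤ _ := by
        unfold verifierCost collisionSearchCost splitStepCost fillStepCost matchStepCost synCost setupCost
          enumCost combCost
        zify
        rw [← sub_nonneg]
        ring_nf
        positivity

/-- Polynomial factors and `2 ^ √n` do not affect exponents. -/
theorem exists_poly_mul_le_rpow (c : ℝ) {ε : ℝ} (hε : 0 < ε) : ∃ N : ℕ, ∀ n : ℕ, N ≤ n →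
    100000 * ((n : ℝ) + 1) ^ 7 * (2 : ℝ) ^ ((Nat.sqrt n : ℝ) + c) ≤ (2 : ℝ) ^ (ε * n) := by
  obtain ⟨N₁, hN₁⟩ := exists_poly_le_two_pow_sqrt 100000 (by norm_num) 7 1 one_pos
  -- From `√n ≥ k + 1` on, `2√n + c` is at most `εn`; one `√n` in the exponent absorbs the
  -- polynomial.
  obtain ⟨k, hk⟩ := exists_nat_ge ((2 + |c|) / ε)
  refine ⟨max N₁ ((k + 1) * (k + 1)), fun n hn => ?_⟩
  have h1 := hN₁ n (by omega)
  have hks : k + 1 ≤ Nat.sqrt n := Nat.le_sqrt.2 (by omega)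
  have hn1 : (1 : ℝ) ≤ n := by
    have : 1 ≤ n := by nlinarith [Nat.sqrt_le n]
    exact_mod_cast this
  have hp : 0 ≤ 100000 * ((n : ℝ) + 1) ^ 7 := by positivity
  have h2 : 100000 * ((n : ℝ) + 1) ^ 7 ≤ (2 : ℝ) ^ (Nat.sqrt n : ℝ) := by
    rw [Real.rpow_natCast]
    refine le_trans ?_ (h1.trans_eq (one_mul _))
    generalize 100000 * ((n : ℝ) + 1) ^ 7 = p at hp ⊢
    have h2 : p ≤ n * p := le_mul_of_one_le_left hp hn1
    nlinarith
  have h3 : (Nat.sqrt n : ℝ) + (Nat.sqrt n + c) ≤ ε * n := by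
    have hs : (Nat.sqrt n : ℝ) * Nat.sqrt n ≤ n := by exact_mod_cast Nat.sqrt_le n
    have hs1 : (k : ℝ) + 1 ≤ Nat.sqrt n := by exact_mod_cast hks
    have hk0 : (0 : ℝ) ≤ k := Nat.cast_nonneg k
    rw [div_le_iff₀ hε] at hk
    have h4 : 2 + |c| ≤ ε * Nat.sqrt n := by nlinarith
    have h5 : (2 + |c|) * Nat.sqrt n ≤ ε * (Nat.sqrt n * Nat.sqrt n) := by nlinarith
    have h6 := le_abs_self c
    have h7 := abs_nonneg c
    nlinarith
  calc _ ≤ (2 : ℝ) ^ (Nat.sqrt n : ℝ) * (2 : ℝ) ^ ((Nat.sqrt n : ℝ) + c) := by gcongr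
    _ = (2 : ℝ) ^ ((Nat.sqrt n : ℝ) + (Nat.sqrt n + c)) := by rw [← Real.rpow_add (by norm_num)]
    _ ≤ _ := Real.rpow_le_rpow_of_exponent_le (by norm_num) h3

/-- For weights up to `(δ+η)n` and a window of length `a` the lists have at most `2^(√n + a(A + δL +
Lη))` entries. This increases with `a`, and the search stops at `a ≤ (1-θ)n + 1`. -/
theorem fastUpTo_windowSearch {δ η θ A L ε : ℝ} (hδ : 0 < δ) (hη : 0 < η) (hθ0 : 0 < θ) (hθ1 : θ ≤ 1)
    (hA0 : 0 ≤ A) (hL : 0 ≤ L) (hA : (2 : ℝ) ^ A = 1 + (2 : ℝ) ^ (-L)) (hε : 0 < ε) (hηL : L * η ≤ ε / 4) :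
    ∃ N : ℕ, ∀ r n, N ≤ n → r ≤ n → ∀ H : Matrix (Fin r) (Fin n) (ZMod 2), Sparse H (winLen θ n) →
      FastUpTo (.verifier .windowSearch) ((1 - θ) * (A + δ * L) + ε) (δ + η) r n H := by
  set h := A + δ * L with hh
  have hh0 : 0 ≤ h := by positivity
  obtain ⟨N, hN⟩ := exists_poly_mul_le_rpow (h + L * η) (half_pos hε)
  refine ⟨max N 1, fun r n hn hr H hH => ?_⟩
  have hn0 : (0 : ℝ) < n := by exact_mod_cast (show 0 < n by omega)
  obtain ⟨ha₁, -, ha₂⟩ := winLen_spec hθ0 hθ1 n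
  set X : ℝ := (2 : ℝ) ^ ((Nat.sqrt n : ℝ) + ((1 - θ) * n + 1) * (h + L * η)) with hX
  have hLη : 0 ≤ L * η := by positivity
  have hw0 : 0 ≤ (1 - θ) * n + 1 := by nlinarith
  have hX1 : 1 ≤ X := Real.one_le_rpow (by norm_num) (by positivity)
  refine fastUpTo_verifier (N := windowSearchCost n r ⌊X⌋₊) H _ (fun _ _ => True) hr
    (fun _ _ _ _ _ h => h) (fun _ _ _ => trivial) (fun W D hroom hD hDx => ?_) ?_
  · refine searches_windowSearch hroom hD ha₁ (fun s hs g κ he => hH.zeroCount_sq_le hs he) fun a ha => ?_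
    refine Nat.le_floor ?_
    have ha' : (a : ℝ) ≤ (1 - θ) * n + 1 := le_trans (by exact_mod_cast ha) ha₂
    have hb : (((D + 1) * a / n : ℕ) : ℝ) ≤ (δ + η) * a := by
      refine Nat.cast_div_le.trans ?_
      rw [div_le_iff₀ hn0, Nat.cast_mul]
      calc ((D + 1 : ℕ) : ℝ) * a ≤ ((δ + η) * n) * a := by gcongr
        _ = _ := by ring
    push_cast
    calc (2 : ℝ) ^ Nat.sqrt n * (ballVol a ((D + 1) * a / n) : ℝ)
        ≤ (2 : ℝ) ^ (Nat.sqrt n : ℝ) * (2 : ℝ) ^ (A * a + L * ((δ + η) * a)) := by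
          rw [Real.rpow_natCast]
          gcongr
          exact ballVol_le_rpow hL hA hb
      _ = (2 : ℝ) ^ ((Nat.sqrt n : ℝ) + a * (h + L * η)) := by
          rw [← Real.rpow_add (by norm_num)]
          congr 1
          rw [hh]
          ring
      _ ≤ X := by
          refine Real.rpow_le_rpow_of_exponent_le (by norm_num) ?_
          gcongr
  · have hfl : ((⌊X⌋₊ : ℕ) : ℝ) ≤ X := Nat.floor_le (by positivity)
    have hcost := verifierCost_windowSearch_le hr (Nat.le_floor (by exact_mod_cast hX1) : 1 ≤ ⌊X⌋₊)
    calc ((verifierCost n r (windowSearchCost n r ⌊X⌋₊) * (2 * (n + 6) + 1) : ℕ) : ℝ)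
        ≤ 100000 * ((n : ℝ) + 1) ^ 7 * ⌊X⌋₊ := by exact_mod_cast hcost
      _ ≤ 100000 * ((n : ℝ) + 1) ^ 7 * X := by gcongr
      _ = (100000 * ((n : ℝ) + 1) ^ 7 * (2 : ℝ) ^ ((Nat.sqrt n : ℝ) + (h + L * η))) *
          (2 : ℝ) ^ ((1 - θ) * n * (h + L * η)) := by
          rw [mul_assoc (100000 * ((n : ℝ) + 1) ^ 7), ← Real.rpow_add (by norm_num), hX]
          congr 2
          ring
      _ ≤ (2 : ℝ) ^ (ε / 2 * n) * (2 : ℝ) ^ ((1 - θ) * n * (h + L * η)) := by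
          gcongr
          exact hN n (by omega)
      _ ≤ (2 : ℝ) ^ (((1 - θ) * h + ε) * n) := by
          rw [← Real.rpow_add (by norm_num)]
          refine Real.rpow_le_rpow_of_exponent_le (by norm_num) ?_
          have h1 : (1 - θ) * (L * η) ≤ ε / 4 := by nlinarith
          nlinarith

/-- Each list is a ball on `⌈n/2⌉` positions with radius about half the weight, so the exponent of
its volume is half of that for the whole word. The roundings contribute the constant factor
`2^((A+L)/2)`. -/
theorem fastUpTo_collisionSearch {δ η A L ε : ℝ} (hδ : 0 < δ) (hη : 0 < η)
    (hA0 : 0 ≤ A) (hL : 0 ≤ L) (hA : (2 : ℝ) ^ A = 1 + (2 : ℝ) ^ (-L)) (hε : 0 < ε) (hηL : L * η ≤ ε / 4) :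
    ∃ N : ℕ, ∀ r n, N ≤ n → r ≤ n → ∀ H : Matrix (Fin r) (Fin n) (ZMod 2),
      FastUpTo (.verifier .collisionSearch) ((A + δ * L) / 2 + ε) (δ + η) r n H := by
  obtain ⟨N, hN⟩ := exists_poly_mul_le_rpow ((A + L) / 2) (half_pos hε)
  refine ⟨N, fun r n hn hr H => ?_⟩
  have hn0 : (0 : ℝ) ≤ n := Nat.cast_nonneg n
  set X : ℝ := (2 : ℝ) ^ (A * ((n + 1) / 2) + L * (((δ + η) * n + 1) / 2)) with hX
  have hX1 : 1 ≤ X := Real.one_le_rpow (by norm_num) (by positivity)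
  refine fastUpTo_verifier (N := collisionSearchCost n r ⌊X⌋₊) H _ (StampInv n r ((r + 1) * n)) hr
    (fun _ _ _ h8 hm h => stampInv_of_eq h8 hm h) (fun _ h8 h6 => stampInv_zero h8 h6)
    (fun W D hroom hD hDx => ?_) ?_
  · refine searches_collisionSearch hroom hD (Nat.le_floor ?_)
    have ha : (((n + 1) / 2 : ℕ) : ℝ) ≤ ((n : ℝ) + 1) / 2 := by
      refine Nat.cast_div_le.trans ?_
      push_cast
      exact le_rfl
    have hb : (((D + 2) / 2 : ℕ) : ℝ) ≤ ((δ + η) * n + 1) / 2 := by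
      refine Nat.cast_div_le.trans ?_
      push_cast at hDx ⊢
      linarith
    refine (ballVol_le_rpow hL hA hb).trans (Real.rpow_le_rpow_of_exponent_le (by norm_num) ?_)
    gcongr
  · have hfl : ((⌊X⌋₊ : ℕ) : ℝ) ≤ X := Nat.floor_le (by positivity)
    have hcost := verifierCost_collisionSearch_le hr (Nat.le_floor (by exact_mod_cast hX1) : 1 ≤ ⌊X⌋₊)
    calc ((verifierCost n r (collisionSearchCost n r ⌊X⌋₊) * (2 * (n + 6) + 1) : ℕ) : ℝ)
        ≤ 100000 * ((n : ℝ) + 1) ^ 7 * ⌊X⌋₊ := by exact_mod_cast hcost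
      _ ≤ 100000 * ((n : ℝ) + 1) ^ 7 * X := by gcongr
      _ ≤ 100000 * ((n : ℝ) + 1) ^ 7 * (2 : ℝ) ^ (((Nat.sqrt n : ℝ) + (A + L) / 2) +
          n * (A + (δ + η) * L) / 2) := by
          gcongr 100000 * ((n : ℝ) + 1) ^ 7 * ?_
          refine Real.rpow_le_rpow_of_exponent_le (by norm_num) ?_
          have : (0 : ℝ) ≤ Nat.sqrt n := Nat.cast_nonneg _
          linarith
      _ = (100000 * ((n : ℝ) + 1) ^ 7 * (2 : ℝ) ^ ((Nat.sqrt n : ℝ) + (A + L) / 2)) *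
          (2 : ℝ) ^ (n * (A + (δ + η) * L) / 2) := by
          rw [Real.rpow_add (by norm_num)]
          ring
      _ ≤ (2 : ℝ) ^ (ε / 2 * n) * (2 : ℝ) ^ (n * (A + (δ + η) * L) / 2) := by
          gcongr
          exact hN n hn
      _ ≤ (2 : ℝ) ^ (((A + δ * L) / 2 + ε) * n) := by
          rw [← Real.rpow_add (by norm_num)]
          refine Real.rpow_le_rpow_of_exponent_le (by norm_num) ?_
          nlinarith

end LDPC

/-! ### The theorem -/

theorem corollary2 (ℓ m : ℕ) (hℓ : 3 ≤ ℓ) (hm : ℓ ≤ m) :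
    (∃! δ : ℝ, LDPC.IsRelativeDistance ℓ m δ) ∧
    (∃! θ : ℝ, LDPC.IsErasureRoot ℓ m θ) ∧
    ∀ δ θ : ℝ, LDPC.IsRelativeDistance ℓ m δ → LDPC.IsErasureRoot ℓ m θ →
      ∃ P : LDPC.Prog, LDPC.VerifiesDistance P ∧
        ∀ ε : ℝ, 0 < ε → ∃ η : ℝ, 0 < η ∧
          LDPC.MostA ℓ m
            (LDPC.FastUpTo P (min ((1 - θ) * LDPC.h2 δ) (LDPC.h2 δ / 2) + ε) (δ + η)) ∧
          LDPC.MostB ℓ m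
            (LDPC.FastUpTo P (min ((1 - θ) * LDPC.h2 δ) (LDPC.h2 δ / 2) + ε) (δ + η)) := by
  refine ⟨LDPC.existsUnique_isRelativeDistance hℓ hm, LDPC.existsUnique_isErasureRoot hℓ hm,
    fun δ θ hδ hθ => ?_⟩
  have hδ0 : 0 < δ := hδ.1.1
  obtain ⟨A, L, hA0, hL, hA, hh⟩ := LDPC.exists_entropy_split hδ0 (hδ.le_half hℓ hm)
  -- The slope `L` turns `η` into an increase of the exponent by `Lη`. The `+ 1` keeps `η` defined
  -- when `L = 0`, that is, at `δ = 1/2`.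
  have hη : ∀ ε : ℝ, 0 < ε → 0 < ε / (4 * (L + 1)) ∧ L * (ε / (4 * (L + 1))) ≤ ε / 4 := fun ε hε => by
    refine ⟨by positivity, ?_⟩
    rw [mul_div_assoc', div_le_div_iff₀ (by positivity) (by norm_num)]
    nlinarith
  have hsA := LDPC.mostA_sparse (by omega : 1 ≤ ℓ) (hℓ.trans hm) hθ
  have hsB := LDPC.mostB_sparse (ℓ := ℓ) (hℓ.trans hm) hθ
  -- The smaller exponent selects the program, which depends neither on `ε` nor on the matrix. The
  -- collision search achieves its time for all matrices with `r ≤ n` and large `n`; the ensemble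
  -- matters only for the window search.
  rcases le_total ((1 - θ) * LDPC.h2 δ) (LDPC.h2 δ / 2) with hle | hle
  · refine ⟨_, LDPC.verifiesDistance_windowSearch, fun ε hε => ⟨_, (hη ε hε).1, ?_⟩⟩
    rw [min_eq_left hle, ← hh]
    obtain ⟨N, hN⟩ := LDPC.fastUpTo_windowSearch hδ0 (hη ε hε).1 hθ.1 hθ.2.1 hA0 hL hA hε (hη ε hε).2
    exact ⟨hsA.mono (by omega) hm hN, hsB.mono (by omega) hm hN⟩
  · refine ⟨_, LDPC.verifiesDistance_collisionSearch, fun ε hε => ⟨_, (hη ε hε).1, ?_⟩⟩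
    rw [min_eq_right hle, ← hh]
    obtain ⟨N, hN⟩ := LDPC.fastUpTo_collisionSearch hδ0 (hη ε hε).1 hA0 hL hA hε (hη ε hε).2
    exact ⟨hsA.mono (by omega) hm fun r n hn hr H _ => hN r n hn hr H,
      hsB.mono (by omega) hm fun r n hn hr H _ => hN r n hn hr H⟩
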